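/- **Setting.** All digraphs are simple (no self-loops, no parallel arcs; $(u,v)$ and $(v,u)$ may both be present). For a digraph $G=(V,A)$ with $|V|=n$, an ordering is a bijection $\pi:V\to\{1,\dots,n\}$, and for $1\le i\le n-1$ let $\mathrm{cut}_\pi^i=\{(u,v)\in A:\pi(u)>i,\ \pi(v)\le i\}$. *Directed Optimal Linear Arrangement* asks, given $G$, for an ordering $\pi$ that minimizes $\sum_{i=1}^{n-1}|\mathrm{cut}_\pi^i|$; let $\mathrm{opt}(G)$ be this minimum. A $\rho$-approximation is a (deterministic) algorithm that, on every input $G$, outputs an ordering $\pi$ with $\sum_{i=1}^{n-1}|\mathrm{cut}_\pi^i|\le\rho\cdot\mathrm{opt}(G)$. Algorithms are programs of a random access machine with integer registers, integer memory, addition, subtraction, multiplication and integer division, and logarithmic cost (a step costs one plus the bit lengths of the integers it handles). A running time $O^*(T(n))$ is a bound $C(n+1)^c\,T(n)$ with constants $C,c$ independent of $G$ and $n$ (but depending on the algorithm). A real number $\tau$ is an *admissible* matrix-multiplication exponent if some algorithm multiplies any two $N\times N$ integer matrices ($N\ge 1$) with entries of at most $b$ bits in time at most $C\,(b+\lfloor\log_2N\rfloor+1)^{c}N^{\tau}$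 for some constants $C,c$; the matrix-multiplication exponent $\omega$ is the infimum of all admissible $\tau$. **Proposition.** Let $0<\alpha<1$ be real, and let $\tau$ be a real number such that $\tau>\omega$ or $\tau$ is admissible (so $\tau=\omega$ is allowed if the infimum is attained). Then there is a $\left(1+\frac1{1-\alpha}\right)$-approximation for Directed Optimal Linear Arrangement that runs in $$O^*\!\left(2^{\tau n/3}+2^{(1-\alpha/2)n}\right)$$ time on digraphs with $n$ vertices. -/

import Mathlib

/-! ### Random access machines with logarithmic cost

A machine has registers `0, 1, 2, …` and a random access memory whose cells are addressed by
integers; every register and every memory cell holds an integer of arbitrary size. A program is a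
fixed finite text that names finitely many registers. Each elementary step costs one plus the number
of bits of all integers (operands, addresses and contents) that it handles. -/

namespace RAM

/-- The arithmetic instructions; `div` is integer division. -/
inductive Op where
  | add
  | sub
  | mul
  | div

/-- The result of an arithmetic instruction. -/
def Op.apply : Op → ℤ → ℤ → ℤ
  | .add, a, b => a + b
  | .sub, a, b => a - b
  | .mul, a, b => a * b
  | .div, a, b => a / b

/-- Programs. The natural numbers are names of registers. -/
inductive Prog where
  /-- do nothing -/
  | skip : Prog
  /-- `const x c`: put the constant `c` into register `x` -/
  | const : ℕ → ℤ → Prog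
  /-- `arith o x y z`: put the result of `o`, applied to registers `y` and `z`, into register `x` -/
  | arith : Op → ℕ → ℕ → ℕ → Prog
  /-- `load x y`: put the memory cell with the address held by register `y` into register `x` -/
  | load : ℕ → ℕ → Prog
  /-- `store x y`: put register `y` into the memory cell with the address held by register `x` -/
  | store : ℕ → ℕ → Prog
  /-- `seq p q`: first `p`, then `q` -/
  | seq : Prog → Prog → Prog
  /-- `branch x p q`: `p` if register `x` is positive, otherwise `q` -/
  | branch : ℕ → Prog → Prog → Prog
  /-- `loop x p`: repeat `p` as long as register `x` is positive -/
  | loop : ℕ → Prog → Prog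

/-- The contents of the registers and of the memory. -/
structure State where
  reg : ℕ → ℤ
  mem : ℤ → ℤ

/-- The number of binary digits of `|x|`. -/
def bits (x : ℤ) : ℕ := x.natAbs.size

/-- Overwrite register `x`. -/
def State.setReg (s : State) (x : ℕ) (a : ℤ) : State :=
  { s with reg := Function.update s.reg x a }

/-- Overwrite the memory cell with address `a`. -/
def State.setMem (s : State) (a b : ℤ) : State :=
  { s with mem := Function.update s.mem a b }

/-- `Exec p s t s'`: the program `p`, started in `s`, halts in `s'` after steps of total cost `t`. -/
inductive Exec : Prog → State → ℕ → State → Prop where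
  | skip (s : State) : Exec .skip s 1 s
  | const (s : State) (x : ℕ) (c : ℤ) :
      Exec (.const x c) s (1 + bits c) (s.setReg x c)
  | arith (s : State) (o : Op) (x y z : ℕ) :
      Exec (.arith o x y z) s (1 + bits (s.reg y) + bits (s.reg z))
        (s.setReg x (o.apply (s.reg y) (s.reg z)))
  | load (s : State) (x y : ℕ) :
      Exec (.load x y) s (1 + bits (s.reg y) + bits (s.mem (s.reg y)))
        (s.setReg x (s.mem (s.reg y)))
  | store (s : State) (x y : ℕ) :
      Exec (.store x y) s (1 + bits (s.reg x) + bits (s.reg y))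
        (s.setMem (s.reg x) (s.reg y))
  | seq {p q : Prog} {s s' s'' : State} {t t' : ℕ} :
      Exec p s t s' → Exec q s' t' s'' → Exec (.seq p q) s (t + t') s''
  | branch_pos {x : ℕ} {p q : Prog} {s s' : State} {t : ℕ} :
      0 < s.reg x → Exec p s t s' → Exec (.branch x p q) s (1 + bits (s.reg x) + t) s'
  | branch_neg {x : ℕ} {p q : Prog} {s s' : State} {t : ℕ} :
      s.reg x ≤ 0 → Exec q s t s' → Exec (.branch x p q) s (1 + bits (s.reg x) + t) s'
  | loop_pos {x : ℕ} {p : Prog} {s s' s'' : State} {t t' : ℕ} :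
      0 < s.reg x → Exec p s t s' → Exec (.loop x p) s' t' s'' →
      Exec (.loop x p) s (1 + bits (s.reg x) + t + t') s''
  | loop_neg {x : ℕ} {p : Prog} {s : State} :
      s.reg x ≤ 0 → Exec (.loop x p) s (1 + bits (s.reg x)) s

/-- The initial state: register `0` holds the size parameter `n` of the input, all other registers
are `0`, and the memory holds `input`. -/
def State.init (n : ℕ) (input : ℤ → ℤ) : State where
  reg := fun x => if x = 0 then (n : ℤ) else 0
  mem := input

end RAM

/-! ### The exponent of matrix multiplication -/

/-- The memory that holds two `N × N` integer matrices `A` and `B` row by row: `A` in the cells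
`0, …, N² - 1`, then `B` in the cells `N², …, 2 N² - 1`, and `0` in all other cells. -/
def matrixInput {N : ℕ} (A B : Matrix (Fin N) (Fin N) ℤ) (a : ℤ) : ℤ :=
  ∑ i : Fin N, ∑ j : Fin N,
    ((if a = (i : ℤ) * N + j then A i j else 0) +
      (if a = (N : ℤ) * N + ((i : ℤ) * N + j) then B i j else 0))

/-- One program multiplies any two `N × N` integer matrices with entries of at most `b` bits in time
`O(N ^ τ)`, up to factors polynomial in `log N` and `b`. The product is left row by row in the cells
`2 N², …, 3 N² - 1`. -/
def MultipliesMatricesInTime (τ : ℝ) : Prop :=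
  ∃ (p : RAM.Prog) (C c : ℕ), ∀ (N : ℕ), 1 ≤ N → ∀ (b : ℕ) (A B : Matrix (Fin N) (Fin N) ℤ),
    (∀ i j, RAM.bits (A i j) ≤ b ∧ RAM.bits (B i j) ≤ b) →
    ∃ (t : ℕ) (s : RAM.State), RAM.Exec p (RAM.State.init N (matrixInput A B)) t s ∧
      (∀ i j : Fin N, s.mem (2 * ((N : ℤ) * N) + ((i : ℤ) * N + j)) = (A * B) i j) ∧
      (t : ℝ) ≤ C * (b + Nat.log 2 N + 1 : ℝ) ^ c * (N : ℝ) ^ τ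

/-- The exponent `ω` of matrix multiplication. -/
noncomputable def matMulExponent : ℝ := sInf {τ : ℝ | MultipliesMatricesInTime τ}

/-! ### Directed optimal linear arrangement -/

section DOLA

variable {n : ℕ}

/-- A simple digraph: no self-loops (both `(u, v)` and `(v, u)` may be arcs). -/
def Digraph.IsSimple (G : Digraph (Fin n)) : Prop := ∀ v, ¬ G.Adj v v

/-- The position, in `{1, …, n}`, of the vertex `v` in the ordering `π`. -/
def position (π : Fin n ≃ Fin n) (v : Fin n) : ℕ := (π v : ℕ) + 1

/-- The cut at position `i`: the arcs from a vertex after position `i` to a vertex at position at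
most `i`. -/
def arcCut (G : Digraph (Fin n)) (π : Fin n ≃ Fin n) (i : ℕ) : Set (Fin n × Fin n) :=
  {e | G.Adj e.1 e.2 ∧ i < position π e.1 ∧ position π e.2 ≤ i}

/-- The value of the ordering `π`: the sum of the sizes of its cuts at the positions
`1, …, n - 1`. -/
noncomputable def arrangementCost (G : Digraph (Fin n)) (π : Fin n ≃ Fin n) : ℕ :=
  ∑ i ∈ Finset.Icc 1 (n - 1), (arcCut G π i).ncard

/-- The minimum value of an ordering. -/
noncomputable def optArrangementCost (G : Digraph (Fin n)) : ℕ :=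
  sInf (Set.range (arrangementCost G))

open Classical in
/-- The memory that holds the adjacency matrix of `G` row by row in the cells `0, …, n² - 1`, and
`0` in all other cells. -/
noncomputable def digraphInput (G : Digraph (Fin n)) (a : ℤ) : ℤ :=
  if ∃ u v : Fin n, a = (u : ℤ) * n + v ∧ G.Adj u v then 1 else 0

end DOLA

/-- The program `p` is a `ρ`-approximation for Directed Optimal Linear Arrangement that runs in
`O*(T(n))` time: on every simple digraph `G` with `n` vertices it halts within time `T(n)`, up to a
factor polynomial in `n`, and leaves in the cells `0, …, n - 1` the positions of the vertices in an
ordering whose value is at most `ρ` times the minimum. -/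
def ApproximatesDOLA (p : RAM.Prog) (ρ : ℝ) (T : ℕ → ℝ) : Prop :=
  ∃ C c : ℕ, ∀ (n : ℕ) (G : Digraph (Fin n)), G.IsSimple →
    ∃ (t : ℕ) (s : RAM.State), RAM.Exec p (RAM.State.init n (digraphInput G)) t s ∧
      (t : ℝ) ≤ C * (n + 1 : ℝ) ^ c * T n ∧
      ∃ π : Fin n ≃ Fin n, (∀ v : Fin n, s.mem (v : ℤ) = position π v) ∧
        (arrangementCost G π : ℝ) ≤ ρ * optArrangementCost G

open RAM

/-! Put β = 1 - α, let cut(S) be the number of arcs that enter S, and let f be about αn/2. The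
algorithm looks at sets T with f ≤ |T| ≤ n - f. The least value cost(T) of an ordering that begins
with T comes from dynamic programming over the subsets of T and over the supersets of T, in time
O*(2^(n-f)). List T in the order of an optimal π and then the remaining vertices in the order of π.
Submodularity of cut, applied to T and every prefix of π, yields cost(T) ≤ opt + n·cut(T)
(`cost_add_le`). If m is the least cut of a set of middle size, the middle prefixes of π alone give
opt ≥ (n - 2f)m. With f = αn/2 this would be opt ≥ βnm, and a minimum cut would have ratio 1 + 1/β.

A fixed program cannot hold a general real α, so f is ⌊rn⌋ for a rational r slightly above α/2. The
time bound survives, but only opt ≥ (β - δ)nm is left, with a small δ > 0. `exists_wins` repairs the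
loss. If opt ≥ βnm, a minimum cut is still good. Otherwise almost all middle cuts of π are close to
m, and some prefix P of a size k near n/2 has cut(P) ≤ (1 + 8δ/β)m. Let L be the last k - f vertices
of π. The terms that submodularity leaves over show that a set T with |T| = k and cut(T) ≤ cut(P)
that is not good enough contains all but 9δn/β vertices of L. Now restrict the search to sets that
meet U = T in exactly |P ∩ U| vertices. P remains feasible and avoids L, so the new T ∩ U is much
smaller than U, and yet it again contains almost all of L. Iteration shrinks U by βn/16 per round,
so a good set appears within a constant number K > 16/β of rounds (`wins_of_card_sdiff_le`). The
numbers k and |P ∩ U| are found by exhaustive guessing, with polynomially many searches.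

One search asks for a minimum cut with prescribed |T| and |T ∩ U|. Split the vertices into three
blocks of about n/3 vertices. Cut, size and intersection size are packed into one integer weight, a
quadratic form in the indicator of the set. The weight of a union of parts x, y, z of the blocks is
therefore a sum of terms in two parts each (`weight_split`). With matrices of order N = 2^⌈n/3⌉
whose entries are powers of 2N with these terms as exponents, a digit of entry (x, z) of the product
tells whether some y produces a wanted weight (`hit_iff`, `pos_test_iff`). The entries have
polynomially many bits, so a search costs O*(2^(τn/3)).

The rest is the realization on the machine. Expressions and statements are compiled to programs, and
Hoare triples (`Tri`) count steps up to a power of a bit bound B. A given multiplication program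
runs on blank memories, which are interleaved with the main memory as residue classes of addresses
(`Exec.lift`, `Tri.fresh`, `Tri.run`). Every τ > ω is admissible because schoolbook multiplication
makes the set of admissible exponents nonempty. The N² steps that surround a multiplication are paid
by its own time bound, since the product has N² entries to be written. -/

/-! ### Bit lengths of results of arithmetic. -/

theorem bits_le_iff {x : ℤ} {B : ℕ} : bits x ≤ B ↔ x.natAbs < 2 ^ B := Nat.size_le

theorem bits_le_of_nonneg {x : ℤ} {B : ℕ} (h0 : 0 ≤ x) (h : x < 2 ^ B) : bits x ≤ B := by
  rw [bits_le_iff]; zify; rwa [abs_of_nonneg h0]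

theorem bits_add_le (x y : ℤ) : bits (x + y) ≤ bits x + bits y + 1 := by
  rw [bits_le_iff]
  have h1 : x.natAbs < 2 ^ bits x := bits_le_iff.1 le_rfl
  have h2 : y.natAbs < 2 ^ bits y := bits_le_iff.1 le_rfl
  have h3 := Int.natAbs_add_le x y
  have h4 : 2 ^ bits x ≤ 2 ^ (bits x + bits y) := Nat.pow_le_pow_right (by norm_num) (by omega)
  have h5 : 2 ^ bits y ≤ 2 ^ (bits x + bits y) := Nat.pow_le_pow_right (by norm_num) (by omega)
  rw [pow_succ]; omega

theorem bits_neg (x : ℤ) : bits (-x) = bits x := by simp [bits]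

theorem bits_sub_le (x y : ℤ) : bits (x - y) ≤ bits x + bits y + 1 := by
  have := bits_add_le x (-y)
  rwa [bits_neg, ← sub_eq_add_neg] at this

theorem bits_mul_le (x y : ℤ) : bits (x * y) ≤ bits x + bits y := by
  rw [bits_le_iff, Int.natAbs_mul, pow_add]
  exact Nat.mul_lt_mul'' (bits_le_iff.1 le_rfl) (bits_le_iff.1 le_rfl)

theorem bits_mono {x y : ℤ} (h : x.natAbs ≤ y.natAbs) : bits x ≤ bits y := Nat.size_le_size h

theorem bits_div_le (x y : ℤ) : bits (x / y) ≤ bits x :=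
  bits_mono (Int.natAbs_ediv_le_natAbs x y)

theorem bits_apply_le (o : Op) (x y : ℤ) : bits (o.apply x y) ≤ bits x + bits y + 1 := by
  cases o
  · exact bits_add_le x y
  · exact bits_sub_le x y
  · exact (bits_mul_le x y).trans (by omega)
  · exact (bits_div_le x y).trans (by omega)

theorem bits_natCast_le_self (c : ℕ) : bits c ≤ c := by
  rw [bits_le_iff]; simpa using Nat.lt_two_pow_self

theorem bits_zero : bits 0 = 0 := by simp [bits]

theorem bits_one : bits 1 = 1 := by simp [bits]

theorem bits_pow_le (x : ℤ) (k : ℕ) : bits (x ^ k) ≤ k * bits x + 1 := by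
  induction k with
  | zero => simp [bits_one]
  | succ k ih =>
    rw [pow_succ]
    refine (bits_mul_le _ _).trans ?_
    rw [Nat.succ_mul]; omega

/-- The growth by `k` bits instead of log k is crude but sufficient: ranges of summation are bounded
by the bit bound itself. -/
theorem bits_sum_le (f : ℕ → ℤ) (k y : ℕ) (h : ∀ i < k, bits (f i) ≤ y) :
    bits (∑ i ∈ Finset.range k, f i) ≤ y + k := by
  rw [bits_le_iff]
  have h1 : (∑ i ∈ Finset.range k, f i).natAbs ≤ ∑ i ∈ Finset.range k, (f i).natAbs :=
    Int.natAbs_sum_le _ _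
  have h2 : ∑ i ∈ Finset.range k, (f i).natAbs ≤ ∑ i ∈ Finset.range k, 2 ^ y :=
    Finset.sum_le_sum fun i hi => (bits_le_iff.1 (h i (Finset.mem_range.1 hi))).le
  rcases Nat.eq_zero_or_pos k with rfl | hk
  · simp
  have h3 : ∑ i ∈ Finset.range k, 2 ^ y = k * 2 ^ y := by simp
  have h4 : k < 2 ^ k := Nat.lt_two_pow_self
  rw [pow_add, mul_comm]
  have := Nat.mul_lt_mul_of_pos_right h4 (show 0 < 2 ^ y by positivity)
  omega

/-! ### Expressions and their compilation. -/

/-- Prepend a value to an environment. -/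
def push {A : Type} (a : A) (b : ℕ → A) : ℕ → A
  | 0 => a
  | k + 1 => b k

@[simp] theorem push_succ {A : Type} (a : A) (b : ℕ → A) (k : ℕ) : push a b (k + 1) = b k := rfl

/-- Expressions over registers, bound variables, the main memory and the external memory. -/
inductive Expr where
  | num : ℤ → Expr
  | var : ℕ → Expr
  | bv : ℕ → Expr
  | op : Op → Expr → Expr → Expr
  | load : Expr → Expr
  | xload : Expr → Expr
  /-- `sum a b`: the sum of `b` over all values `0, …, a - 1` of the bound variable `0` -/
  | sum : Expr → Expr → Expr
  | pow : Expr → Expr → Expr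

/-- States of the structured machine: registers, main memory, external memory, and the number of
blank external memories that are still available. -/
structure HState where
  reg : ℕ → ℤ
  mem : ℤ → ℤ
  ext : ℤ → ℤ
  left : ℕ

/-- The value of an expression. -/
def Expr.eval (s : HState) : Expr → (ℕ → ℤ) → ℤ
  | num c, _ => c
  | var x, _ => s.reg x
  | bv k, b => b k
  | op o e f, b => o.apply (e.eval s b) (f.eval s b)
  | load e, b => s.mem (e.eval s b)
  | xload e, b => s.ext (e.eval s b)
  | sum e f, b => ∑ i ∈ Finset.range (e.eval s b).toNat, f.eval s (push (i : ℤ) b)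
  | pow e f, b => e.eval s b ^ (f.eval s b).toNat

/-- All ranges of summation, exponents, and external cells read are within the bound `B`. -/
def Expr.Ok (B : ℕ) (s : HState) : Expr → (ℕ → ℤ) → Prop
  | num _, _ => True
  | var _, _ => True
  | bv _, _ => True
  | op _ e f, b => e.Ok B s b ∧ f.Ok B s b
  | load e, b => e.Ok B s b
  | xload e, b => e.Ok B s b ∧ bits (s.ext (e.eval s b)) ≤ B
  | sum e f, b => e.Ok B s b ∧ e.eval s b ≤ B ∧
      ∀ i : ℕ, (i : ℤ) < e.eval s b → f.Ok B s (push (i : ℤ) b)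
  | pow e f, b => e.Ok B s b ∧ f.Ok B s b ∧ f.eval s b ≤ B

/-- The exponent of the polynomial that bounds the cost and the size of an expression. -/
def Expr.wt : Expr → ℕ
  | num c => bits c + 2
  | var _ => 1
  | bv _ => 1
  | op _ e f => e.wt + f.wt + 3
  | load e => e.wt + 4
  | xload e => e.wt + 5
  | sum e f => e.wt + f.wt + 8
  | pow e f => e.wt + f.wt + 8

/-- The machine register that holds variable `x`. -/
def ur (x : ℕ) : ℕ := 2 * x

/-- The machine register for the temporary `d`. -/
def tr (d : ℕ) : ℕ := 2 * d + 1

/-- Code that puts the value of an expression into the temporary `d`. -/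
def Expr.code : Expr → (ℕ → ℕ) → ℕ → Prog
  | num c, _, d => .const (tr d) c
  | var x, _, d => .seq (.const (tr d) 0) (.arith .add (tr d) (ur x) (tr d))
  | bv k, l, d => .seq (.const (tr d) 0) (.arith .add (tr d) (l k) (tr d))
  | op o e f, l, d =>
      .seq (e.code l d) (.seq (f.code l (d + 1)) (.arith o (tr d) (tr d) (tr (d + 1))))
  | load e, l, d =>
      .seq (e.code l d) (.seq (.arith .mul (tr d) (tr d) (tr 0)) (.load (tr d) (tr d)))
  | xload e, l, d =>
      .seq (e.code l d) (.seq (.arith .mul (tr d) (tr d) (tr 0))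
        (.seq (.arith .add (tr d) (tr d) (tr 1)) (.load (tr d) (tr d))))
  | sum e f, l, d =>
      .seq (e.code l d) (.seq (.const (tr (d + 1)) 0) (.seq (.const (tr (d + 2)) 0)
        (.seq (.loop (tr d) (.seq (f.code (push (tr (d + 2)) l) (d + 3))
            (.seq (.arith .add (tr (d + 1)) (tr (d + 1)) (tr (d + 3)))
            (.seq (.const (tr (d + 3)) 1)
            (.seq (.arith .add (tr (d + 2)) (tr (d + 2)) (tr (d + 3)))
              (.arith .sub (tr d) (tr d) (tr (d + 3))))))))
          (.seq (.const (tr d) 0) (.arith .add (tr d) (tr (d + 1)) (tr d))))))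
  | pow e f, l, d =>
      .seq (e.code l d) (.seq (f.code l (d + 1)) (.seq (.const (tr (d + 2)) 1)
        (.seq (.loop (tr (d + 1)) (.seq (.arith .mul (tr (d + 2)) (tr (d + 2)) (tr d))
            (.seq (.const (tr (d + 3)) 1)
              (.arith .sub (tr (d + 1)) (tr (d + 1)) (tr (d + 3))))))
          (.seq (.const (tr d) 0) (.arith .add (tr d) (tr (d + 2)) (tr d))))))

/-- Registers that code at depth `d` leaves alone. -/
def Low (d r : ℕ) : Prop := r % 2 = 0 ∨ r < 2 * d + 1

/-- The machine state `S` represents `s` with spacing `Q` and external offset `off`. -/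
structure Sees (s : HState) (Q off : ℤ) (S : State) : Prop where
  reg : ∀ x, S.reg (ur x) = s.reg x
  regQ : S.reg (tr 0) = Q
  regOff : S.reg (tr 1) = off
  mem : ∀ a, S.mem (a * Q) = s.mem a
  ext : ∀ a, S.mem (a * Q + off) = s.ext a

/-- All registers and cells of the main memory have at most `B` bits. -/
structure Bdd (B : ℕ) (s : HState) : Prop where
  reg : ∀ x, bits (s.reg x) ≤ B
  mem : ∀ a, bits (s.mem a) ≤ B

/-- Variables sit in even registers, and the spacing and the offset in the temporaries 0 and 1. Code
that uses temporaries from `d ≥ 2` on and leaves the memory alone cannot disturb the representation.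
-/
theorem Sees.of_low {s : HState} {Q off : ℤ} {S S' : State} {d : ℕ} (hd : 2 ≤ d)
    (h : Sees s Q off S) (hm : S'.mem = S.mem) (hr : ∀ r, Low d r → S'.reg r = S.reg r) :
    Sees s Q off S' where
  reg x := by rw [hr _ (by simp [Low, ur]), h.reg]
  regQ := by rw [hr _ (by unfold Low tr; omega), h.regQ]
  regOff := by rw [hr _ (by unfold Low tr; omega), h.regOff]
  mem := by rw [hm]; exact h.mem
  ext := by rw [hm]; exact h.ext

@[simp] theorem setReg_mem (S : State) (x : ℕ) (a : ℤ) : (S.setReg x a).mem = S.mem := rfl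

theorem setReg_reg (S : State) (x r : ℕ) (a : ℤ) :
    (S.setReg x a).reg r = if r = x then a else S.reg r := by
  simp [State.setReg, Function.update_apply]

theorem low_ne {d d' r : ℕ} (h : Low d r) (hd : d ≤ d') : r ≠ tr d' := by
  unfold Low at h; unfold tr; omega

theorem low_mono {d d' r : ℕ} (h : Low d r) (hd : d ≤ d') : Low d' r := by
  unfold Low at *; omega

theorem low_tr {d d' : ℕ} (hd : d' < d) : Low d (tr d') := by
  unfold Low tr; omega

theorem tr_inj {d d' : ℕ} : tr d = tr d' ↔ d = d' := by unfold tr; omega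

/-- Costs are measured by pure powers of `L = B + 2`. As `L ≥ 2`, constant factors are paid by a
larger exponent, so that `Expr.wt` can be computed along the syntax without separate constants. -/
theorem wt_op_bound {L : ℕ} (hL2 : 2 ≤ L) (v w : ℕ) :
    2 * (L ^ v + L ^ w) + 1 ≤ L ^ (v + w + 3) := by
  have h1 : 1 ≤ L ^ v := Nat.one_le_pow _ _ (by omega)
  have h2 : 1 ≤ L ^ w := Nat.one_le_pow _ _ (by omega)
  have h3 : 2 ^ 3 ≤ L ^ 3 := Nat.pow_le_pow_left hL2 3
  have h4 := Nat.mul_le_mul h3 (Nat.mul_le_mul h1 h2)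
  rw [pow_add, pow_add]
  have h5 := Nat.mul_le_mul h3 (le_refl (L ^ v * L ^ w))
  nlinarith

theorem wt_load_bound {L : ℕ} (hL2 : 2 ≤ L) (v : ℕ) : 4 * L ^ v + 4 * L ≤ L ^ (v + 4) := by
  have h1 : 1 ≤ L ^ v := Nat.one_le_pow _ _ (by omega)
  have h3 : 2 ^ 3 ≤ L ^ 3 := Nat.pow_le_pow_left hL2 3
  have h4 := Nat.mul_le_mul h3 (Nat.mul_le_mul (show 1 ≤ L by omega) (le_refl (L ^ v)))
  have h5 := Nat.mul_le_mul h3 (Nat.mul_le_mul (le_refl L) h1)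
  have : L ^ (v + 4) = L ^ 3 * (L * L ^ v) := by ring
  rw [this]
  nlinarith

/-- One inequality serves both `sum` and `pow`: at most `B` rounds, with `B * L ^ v` for the size of
a partial power. -/
theorem wt_loop_bound {L B : ℕ} (hL : L = B + 2) (v w : ℕ) :
    3 * L ^ v + 3 * L ^ w + B * (3 * L ^ v + 3 * L ^ w + B * L ^ v + 4 * B + 8) + B + 8
      ≤ L ^ (v + w + 8) := by
  obtain ⟨x, hx⟩ : ∃ x, x = L ^ v := ⟨_, rfl⟩
  obtain ⟨y, hy⟩ : ∃ y, y = L ^ w := ⟨_, rfl⟩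
  have h1 : 1 ≤ x := hx ▸ Nat.one_le_pow _ _ (by omega)
  have h2 : 1 ≤ y := hy ▸ Nat.one_le_pow _ _ (by omega)
  have h3 : 2 ^ 5 ≤ L ^ 5 := Nat.pow_le_pow_left (by omega) 5
  have e : L ^ (v + w + 8) = L ^ 5 * (L ^ 3 * (x * y)) := by rw [hx, hy]; ring
  rw [e, ← hx, ← hy]
  have hxy : x ≤ x * y := Nat.le_mul_of_pos_right _ h2
  have hyx : y ≤ x * y := Nat.le_mul_of_pos_left _ h1
  have h1xy : 1 ≤ x * y := Nat.mul_pos h1 h2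
  generalize x * y = z at *
  refine le_trans ?_ (Nat.mul_le_mul_right _ h3)
  have a1 : B * x ≤ B * z := Nat.mul_le_mul_left _ hxy
  have a2 : B * y ≤ B * z := Nat.mul_le_mul_left _ hyx
  have a3 : B * (B * x) ≤ B * (B * z) := Nat.mul_le_mul_left _ a1
  have a4 : B * B ≤ B * B * z := Nat.le_mul_of_pos_right _ h1xy
  have a5 : B ≤ B * z := Nat.le_mul_of_pos_right _ h1xy
  have e2 : 2 ^ 5 * (L ^ 3 * z) = 32 * (B * B * B * z) + 192 * (B * B * z) + 384 * (B * z)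
      + 256 * z := by rw [hL]; ring
  rw [e2]
  have e3 : B * (3 * x + 3 * y + B * x + 4 * B + 8)
      = 3 * (B * x) + 3 * (B * y) + B * (B * x) + 4 * (B * B) + 8 * B := by ring
  have e4 : B * (B * z) = B * B * z := by ring
  rw [e3]
  omega

theorem Expr.bits_eval_le {B : ℕ} {s : HState} (hB : Bdd B s) (e : Expr) :
    ∀ b : ℕ → ℤ, (∀ k, bits (b k) ≤ B) → e.Ok B s b → bits (e.eval s b) ≤ (B + 2) ^ e.wt := by
  obtain ⟨L, hL⟩ : ∃ L, L = B + 2 := ⟨_, rfl⟩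
  rw [← hL]
  have hL2 : 2 ≤ L := by omega
  have le1 : ∀ w x, x ≤ L → x ≤ L ^ (w + 1) := fun w x h => h.trans (Nat.le_self_pow (by omega) L)
  induction e with
  | num c =>
    intro b hb _
    have h1 : bits c + 2 ≤ L ^ (bits c + 2) :=
      Nat.lt_two_pow_self.le.trans (Nat.pow_le_pow_left hL2 _)
    simp only [Expr.eval, Expr.wt]; omega
  | var x => intro b hb _; exact le1 0 _ ((hB.reg x).trans (by omega))
  | bv k => intro b hb _; exact le1 0 _ ((hb k).trans (by omega))
  | op o e f ihe ihf =>
    intro b hb hok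
    have h1 := ihe b hb hok.1
    have h2 := ihf b hb hok.2
    have h3 := wt_op_bound hL2 e.wt f.wt
    refine (bits_apply_le o _ _).trans ?_
    simp only [Expr.wt]; omega
  | load e ihe => intro b hb _; exact le1 (e.wt + 3) _ ((hB.mem _).trans (by omega))
  | xload e ihe => intro b hb hok; exact le1 (e.wt + 4) _ (hok.2.trans (by omega))
  | sum e f ihe ihf =>
    intro b hb ⟨h1, h2, h3⟩
    have h4 : ∀ i < (e.eval s b).toNat, bits (f.eval s (push (i : ℤ) b)) ≤ L ^ f.wt := by
      intro i hi
      refine ihf _ ?_ (h3 i (by omega))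
      intro k
      cases k with
      | zero => exact (bits_natCast_le_self i).trans (by omega)
      | succ k => exact hb k
    refine (bits_sum_le _ _ _ h4).trans ?_
    have h5 := wt_loop_bound hL e.wt f.wt
    simp only [Expr.wt]; omega
  | pow e f ihe ihf =>
    intro b hb ⟨h1, h2, h3⟩
    refine (bits_pow_le _ _).trans ?_
    have h4 : (f.eval s b).toNat ≤ B := by omega
    have h5 := Nat.mul_le_mul h4 (ihe b hb h1)
    have h6 := wt_loop_bound hL e.wt f.wt
    have h7 : B * L ^ e.wt ≤ B * (3 * L ^ e.wt + 3 * L ^ f.wt + B * L ^ e.wt + 4 * B + 8) := by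
      gcongr; omega
    simp only [Expr.wt]; omega

/-- The temporaries form a stack. Code at depth `d` leaves everything below intact, so pending
operands and the registers of bound variables survive the evaluation of subexpressions. -/
theorem Expr.exec_code {B : ℕ} {s : HState} {Q off : ℤ} (hB : Bdd B s) (hQ : bits Q ≤ B)
    (hoff : bits off ≤ B) (e : Expr) :
    ∀ (b : ℕ → ℤ) (l : ℕ → ℕ) (d : ℕ) (S : State), 2 ≤ d → Sees s Q off S →
      (∀ k, Low d (l k)) → (∀ k, S.reg (l k) = b k) → (∀ k, bits (b k) ≤ B) → e.Ok B s b →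
      ∃ t S', Exec (e.code l d) S t S' ∧ t ≤ (B + 2) ^ e.wt ∧ S'.mem = S.mem ∧
        S'.reg (tr d) = e.eval s b ∧ ∀ r, Low d r → S'.reg r = S.reg r := by
  have hbe := fun (e : Expr) => e.bits_eval_le hB
  obtain ⟨L, hL⟩ : ∃ L, L = B + 2 := ⟨_, rfl⟩
  rw [← hL] at hbe ⊢
  have hL2 : 2 ≤ L := by omega
  induction e with
  | num c =>
    intro b l d S hd hS hl hlb hb hok
    have h1 : bits c + 2 ≤ L ^ (bits c + 2) :=
      Nat.lt_two_pow_self.le.trans (Nat.pow_le_pow_left hL2 _)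
    refine ⟨_, _, Exec.const _ _ _, ?_, rfl, ?_, ?_⟩
    · simp only [Expr.wt]; omega
    · simp [setReg_reg, Expr.eval]
    · intro r hr; rw [setReg_reg, if_neg (low_ne hr le_rfl)]
  | var x =>
    intro b l d S hd hS hl hlb hb hok
    have h1 := hB.reg x
    have hne : ur x ≠ tr d := by unfold ur tr; omega
    refine ⟨_, _, Exec.seq (Exec.const _ _ _) (Exec.arith _ _ _ _ _), ?_, rfl, ?_, ?_⟩
    · simp only [Expr.wt, setReg_reg, if_neg hne, hS.reg, bits_zero, if_true, pow_one]; omega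
    · simp [setReg_reg, hne, Expr.eval, Op.apply, hS.reg]
    · intro r hr; simp [setReg_reg, low_ne hr le_rfl]
  | bv k =>
    intro b l d S hd hS hl hlb hb hok
    have h1 := hb k
    have hne : l k ≠ tr d := low_ne (hl k) le_rfl
    refine ⟨_, _, Exec.seq (Exec.const _ _ _) (Exec.arith _ _ _ _ _), ?_, rfl, ?_, ?_⟩
    · simp only [Expr.wt, setReg_reg, if_neg hne, hlb, bits_zero, if_true, pow_one]; omega
    · simp [setReg_reg, hne, Expr.eval, Op.apply, hlb]
    · intro r hr; simp [setReg_reg, low_ne hr le_rfl]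
  | op o e f ihe ihf =>
    intro b l d S hd hS hl hlb hb hok
    obtain ⟨t1, S1, E1, ht1, hm1, hv1, hr1⟩ := ihe b l d S hd hS hl hlb hb hok.1
    have hS1 := hS.of_low hd hm1 hr1
    obtain ⟨t2, S2, E2, ht2, hm2, hv2, hr2⟩ := ihf b l (d + 1) S1 (by omega) hS1
      (fun k => low_mono (hl k) (by omega)) (fun k => by rw [hr1 _ (hl k), hlb]) hb hok.2
    have hv12 : S2.reg (tr d) = e.eval s b := by rw [hr2 _ (low_tr (by omega)), hv1]
    have h1 := hbe e b hb hok.1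
    have h2 := hbe f b hb hok.2
    have key := wt_op_bound hL2 e.wt f.wt
    refine ⟨_, _, Exec.seq E1 (Exec.seq E2 (Exec.arith _ _ _ _ _)), ?_, ?_, ?_, ?_⟩
    · rw [hv12, hv2]; simp only [Expr.wt]; omega
    · simp [hm2, hm1]
    · simp [setReg_reg, hv12, hv2, Expr.eval]
    · intro r hr
      rw [setReg_reg, if_neg (low_ne hr le_rfl), hr2 _ (low_mono hr (by omega)), hr1 _ hr]
  | load e ihe =>
    intro b l d S hd hS hl hlb hb hok
    obtain ⟨t1, S1, E1, ht1, hm1, hv1, hr1⟩ := ihe b l d S hd hS hl hlb hb hok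
    have hS1 := hS.of_low hd hm1 hr1
    have hne : tr 0 ≠ tr d := by rw [Ne, tr_inj]; omega
    have h1 := hbe e b hb hok
    have h2 := hB.mem (e.eval s b)
    have h3 := bits_mul_le (e.eval s b) Q
    have key := wt_load_bound hL2 e.wt
    refine ⟨_, _, Exec.seq E1 (Exec.seq (Exec.arith _ _ _ _ _) (Exec.load _ _ _)), ?_, ?_,
      ?_, ?_⟩
    · simp only [setReg_reg, if_true, setReg_mem, hv1, hS1.regQ, Op.apply, hS1.mem, Expr.wt]
      omega
    · simp [hm1]
    · simp [setReg_reg, hv1, hS1.regQ, hS1.mem, Expr.eval, Op.apply]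
    · intro r hr; simp [setReg_reg, low_ne hr le_rfl, hr1 _ hr]
  | xload e ihe =>
    intro b l d S hd hS hl hlb hb hok
    obtain ⟨t1, S1, E1, ht1, hm1, hv1, hr1⟩ := ihe b l d S hd hS hl hlb hb hok.1
    have hS1 := hS.of_low hd hm1 hr1
    have hne : tr 1 ≠ tr d := by rw [Ne, tr_inj]; omega
    have h1 := hbe e b hb hok.1
    have h2 := hok.2
    have h3 := bits_mul_le (e.eval s b) Q
    have h4 := bits_add_le (e.eval s b * Q) off
    have key := wt_load_bound hL2 e.wt
    have key2 : 2 * L ^ (e.wt + 4) ≤ L ^ (e.wt + 5) := by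
      rw [pow_succ L (e.wt + 4), mul_comm]; exact Nat.mul_le_mul_left _ hL2
    refine ⟨_, _, Exec.seq E1 (Exec.seq (Exec.arith _ _ _ _ _)
      (Exec.seq (Exec.arith _ _ _ _ _) (Exec.load _ _ _))), ?_, ?_, ?_, ?_⟩
    · simp only [setReg_reg, if_true, setReg_mem, hv1, hS1.regQ, Op.apply, hS1.ext, Expr.wt,
        if_neg hne, hS1.regOff]
      omega
    · simp [hm1]
    · simp [setReg_reg, hv1, hS1.regQ, hS1.regOff, hne, hS1.ext, Expr.eval, Op.apply]
    · intro r hr; simp [setReg_reg, low_ne hr le_rfl, hr1 _ hr]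
  | sum e f ihe ihf =>
    intro b l d S hd hS hl hlb hb hok
    obtain ⟨hok1, hcB, hok2⟩ := hok
    obtain ⟨t1, S1, E1, ht1, hm1, hv1, hr1⟩ := ihe b l d S hd hS hl hlb hb hok1
    have hpb : ∀ i : ℕ, (i : ℤ) < e.eval s b → ∀ k, bits (push (i : ℤ) b k) ≤ B := by
      intro i hi k
      cases k with
      | zero => exact (bits_natCast_le_self i).trans (by omega)
      | succ k => exact hb k
    have hfb : ∀ i : ℕ, (i : ℤ) < e.eval s b → bits (f.eval s (push (i : ℤ) b)) ≤ L ^ f.wt :=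
      fun i hi => hbe f _ (hpb i hi) (hok2 i hi)
    obtain ⟨y, hy⟩ : ∃ y, y = L ^ f.wt := ⟨_, rfl⟩
    rw [← hy] at ihf hfb
    set g : ℕ → ℤ := fun i => f.eval s (push (i : ℤ) b) with hg
    -- The temporaries `d`, `d + 1`, `d + 2` hold the number of rounds left, the partial sum and the
    -- current index.
    have loop : ∀ (j i : ℕ) (S2 : State), (e.eval s b).toNat = i + j →
        S2.reg (tr d) = j → S2.reg (tr (d + 1)) = ∑ i' ∈ Finset.range i, g i' →
        S2.reg (tr (d + 2)) = i → S2.mem = S.mem → (∀ r, Low d r → S2.reg r = S.reg r) →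
        ∃ t S3, Exec (.loop (tr d) (.seq (f.code (push (tr (d + 2)) l) (d + 3))
            (.seq (.arith .add (tr (d + 1)) (tr (d + 1)) (tr (d + 3)))
            (.seq (.const (tr (d + 3)) 1)
            (.seq (.arith .add (tr (d + 2)) (tr (d + 2)) (tr (d + 3)))
              (.arith .sub (tr d) (tr d) (tr (d + 3)))))))) S2 t S3 ∧
          t ≤ j * (3 * y + 4 * B + 8) + 1 ∧ S3.mem = S.mem ∧
          S3.reg (tr (d + 1)) = ∑ i' ∈ Finset.range (i + j), g i' ∧
          ∀ r, Low d r → S3.reg r = S.reg r := by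
      intro j
      induction j with
      | zero =>
        intro i S2 hc h0 h1 h2 hm hr
        refine ⟨_, _, Exec.loop_neg (by rw [h0]; simp), ?_, hm, h1, hr⟩
        rw [h0]; simp [bits_zero]
      | succ j ih =>
        intro i S2 hc h0 h1 h2 hm hr
        have hi : (i : ℤ) < e.eval s b := by omega
        have hS2 : Sees s Q off S2 := hS.of_low hd hm hr
        obtain ⟨t3, S3, E3, ht3, hm3, hv3, hr3⟩ := ihf (push (i : ℤ) b) (push (tr (d + 2)) l)
          (d + 3) S2 (by omega) hS2
          (by
            intro k
            cases k with
            | zero => exact low_tr (by omega)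
            | succ k => exact low_mono (hl k) (by omega))
          (by
            intro k
            cases k with
            | zero => exact h2
            | succ k => rw [push_succ, hr _ (hl k), hlb]; rfl) (hpb i hi) (hok2 i hi)
        have q0 : S3.reg (tr d) = (j : ℤ) + 1 := by
          rw [hr3 _ (low_tr (by omega)), h0]; push_cast; ring
        have q1 : S3.reg (tr (d + 1)) = ∑ i' ∈ Finset.range i, g i' := by
          rw [hr3 _ (low_tr (by omega)), h1]
        have q2 : S3.reg (tr (d + 2)) = i := by
          rw [hr3 _ (low_tr (by omega)), h2]
        have hv3' : S3.reg (tr (d + 3)) = g i := hv3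
        obtain ⟨t4, S4, E4, ht4, hm4, p0, p1, p2, hr4⟩ : ∃ t S4, Exec
            (.seq (.arith .add (tr (d + 1)) (tr (d + 1)) (tr (d + 3)))
            (.seq (.const (tr (d + 3)) 1)
            (.seq (.arith .add (tr (d + 2)) (tr (d + 2)) (tr (d + 3)))
              (.arith .sub (tr d) (tr d) (tr (d + 3)))))) S3 t S4 ∧
            t ≤ 2 * y + 3 * B + 7 ∧ S4.mem = S.mem ∧ S4.reg (tr d) = j ∧
            S4.reg (tr (d + 1)) = ∑ i' ∈ Finset.range (i + 1), g i' ∧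
            S4.reg (tr (d + 2)) = (i + 1 : ℕ) ∧ ∀ r, Low d r → S4.reg r = S.reg r := by
          refine ⟨_, _, Exec.seq (Exec.arith _ _ _ _ _) (Exec.seq (Exec.const _ _ _)
            (Exec.seq (Exec.arith _ _ _ _ _) (Exec.arith _ _ _ _ _))), ?_, ?_, ?_, ?_, ?_, ?_⟩
          · have b1 : bits ((j : ℤ) + 1) ≤ B := by
              have := bits_natCast_le_self (j + 1)
              push_cast at this
              omega
            have b2 : bits (i : ℤ) ≤ B := (bits_natCast_le_self i).trans (by omega)
            have b3 : bits (g i) ≤ y := hfb i hi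
            have b4 : bits (∑ i' ∈ Finset.range i, g i') ≤ y + B :=
              (bits_sum_le g i y (fun i' hi' => hfb i' (by omega))).trans (by omega)
            simp [setReg_reg, tr_inj, q0, q1, q2, hv3', bits_one]
            omega
          · simp [hm3, hm]
          · simp [setReg_reg, tr_inj, Op.apply, q0]
          · simp [setReg_reg, tr_inj, Op.apply, q1, hv3', Finset.sum_range_succ]
          · simp [setReg_reg, tr_inj, Op.apply, q2]
          · intro r hr'
            simp [setReg_reg, low_ne hr' (show d ≤ d + 1 by omega), low_ne hr' le_rfl,
              low_ne hr' (show d ≤ d + 2 by omega), low_ne hr' (show d ≤ d + 3 by omega),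
              hr3 _ (low_mono hr' (show d ≤ d + 3 by omega)), hr _ hr']
        obtain ⟨t5, S5, E5, ht5, hm5, hv5, hr5⟩ := ih (i + 1) S4 (by omega) p0 p1 p2 hm4 hr4
        refine ⟨_, S5, Exec.loop_pos (by rw [h0]; positivity) (Exec.seq E3 E4) E5, ?_, hm5, ?_,
          hr5⟩
        · have b1 : bits (((j + 1 : ℕ) : ℤ)) ≤ B := (bits_natCast_le_self _).trans (by omega)
          have e1 : (j + 1) * (3 * y + 4 * B + 8)
              = j * (3 * y + 4 * B + 8) + (3 * y + 4 * B + 8) := by ring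
          rw [e1, h0]
          omega
        · rw [hv5]; congr 2; omega
    -- A nonpositive bound gives an empty sum, and the loop stops at its first test. The counter may
    -- then be a negative number of many bits, so its cost is bounded separately.
    rcases le_or_gt (e.eval s b) 0 with hneg | hpos
    · have hz : (e.eval s b).toNat = 0 := by omega
      refine ⟨_, _, Exec.seq E1 (Exec.seq (Exec.const _ _ _) (Exec.seq (Exec.const _ _ _)
        (Exec.seq (Exec.loop_neg (by simpa [setReg_reg, tr_inj, hv1] using hneg))
          (Exec.seq (Exec.const _ _ _) (Exec.arith _ _ _ _ _))))), ?_, ?_, ?_, ?_⟩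
      · have h1 := hbe e b hb hok1
        have key := wt_loop_bound hL e.wt f.wt
        simp [setReg_reg, tr_inj, hv1, bits_zero, Expr.wt]
        omega
      · simp [hm1]
      · simp [setReg_reg, tr_inj, Expr.eval, Op.apply, hz]
      · intro r hr'
        simp [setReg_reg, low_ne hr' (show d ≤ d + 1 by omega), low_ne hr' le_rfl,
          low_ne hr' (show d ≤ d + 2 by omega), hr1 _ hr']
    obtain ⟨t4, S4, E4, ht4, hm4, hv4, hr4⟩ := loop (e.eval s b).toNat 0
      ((S1.setReg (tr (d + 1)) 0).setReg (tr (d + 2)) 0) (by omega)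
      (by simp [setReg_reg, tr_inj, hv1]; omega)
      (by simp [setReg_reg, tr_inj]) (by simp [setReg_reg]) (by simp [hm1])
      (by
        intro r hr'
        simp [setReg_reg, low_ne hr' (show d ≤ d + 1 by omega),
          low_ne hr' (show d ≤ d + 2 by omega), hr1 _ hr'])
    rw [zero_add] at hv4
    refine ⟨_, _, Exec.seq E1 (Exec.seq (Exec.const _ _ _) (Exec.seq (Exec.const _ _ _)
        (Exec.seq E4 (Exec.seq (Exec.const _ _ _) (Exec.arith _ _ _ _ _))))), ?_, ?_, ?_, ?_⟩
    · have b4 : bits (∑ i' ∈ Finset.range (e.eval s b).toNat, g i') ≤ y + B :=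
        (bits_sum_le g _ y (fun i' hi' => hfb i' (by omega))).trans (by omega)
      have key := wt_loop_bound hL e.wt f.wt
      have h5 : (e.eval s b).toNat * (3 * y + 4 * B + 8) ≤ B * (3 * L ^ e.wt + 3 * L ^ f.wt
          + B * L ^ e.wt + 4 * B + 8) := by
        rw [← hy]
        exact Nat.mul_le_mul (by omega) (by omega)
      simp [setReg_reg, tr_inj, hv4, bits_zero, Expr.wt]
      omega
    · simp [hm4]
    · simp [setReg_reg, tr_inj, Expr.eval, Op.apply, hv4, hg]
    · intro r hr'
      simp [setReg_reg, low_ne hr' le_rfl, hr4 _ hr']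
  | pow e f ihe ihf =>
    intro b l d S hd hS hl hlb hb hok
    obtain ⟨hok1, hok2, hcB⟩ := hok
    obtain ⟨t1, S1, E1, ht1, hm1, hv1, hr1⟩ := ihe b l d S hd hS hl hlb hb hok1
    have hS1 := hS.of_low hd hm1 hr1
    obtain ⟨t2, S2, E2, ht2, hm2, hv2, hr2⟩ := ihf b l (d + 1) S1 (by omega) hS1
      (fun k => low_mono (hl k) (by omega)) (fun k => by rw [hr1 _ (hl k), hlb]) hb hok2
    have hv12 : S2.reg (tr d) = e.eval s b := by rw [hr2 _ (low_tr (by omega)), hv1]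
    have hbx := hbe e b hb hok1
    have hby := hbe f b hb hok2
    obtain ⟨x, hx⟩ : ∃ x, x = L ^ e.wt := ⟨_, rfl⟩
    rw [← hx] at hbx
    set v := e.eval s b
    set c := (f.eval s b).toNat with hc
    have hcB' : c ≤ B := by omega
    have hpw : ∀ i, i ≤ c → bits (v ^ i) ≤ B * x + 1 := fun i hi =>
      (bits_pow_le v i).trans (by gcongr; omega)
    -- The second alternative covers a negative exponent: `toNat` makes it 0, while the counter
    -- register still holds the negative number.
    have loop : ∀ (j i : ℕ) (S2 : State), c = i + j →
        (S2.reg (tr (d + 1)) = j ∨ f.eval s b < 0 ∧ S2.reg (tr (d + 1)) = f.eval s b) →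
        S2.reg (tr (d + 2)) = v ^ i → S2.reg (tr d) = v →
        S2.mem = S.mem → (∀ r, Low d r → S2.reg r = S.reg r) →
        ∃ t S3, Exec (.loop (tr (d + 1)) (.seq (.arith .mul (tr (d + 2)) (tr (d + 2)) (tr d))
            (.seq (.const (tr (d + 3)) 1)
              (.arith .sub (tr (d + 1)) (tr (d + 1)) (tr (d + 3)))))) S2 t S3 ∧
          t ≤ j * (x + B * x + 2 * B + 8) + 1 + L ^ f.wt ∧ S3.mem = S.mem ∧
          S3.reg (tr (d + 2)) = v ^ (i + j) ∧ ∀ r, Low d r → S3.reg r = S.reg r := by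
      intro j
      induction j with
      | zero =>
        intro i S2 hc' h0 h1 h2 hm hr
        have h0' : S2.reg (tr (d + 1)) ≤ 0 ∧ bits (S2.reg (tr (d + 1))) ≤ L ^ f.wt := by
          rcases h0 with h0 | ⟨hz, h0⟩
          · rw [h0]; simp [bits_zero]
          · rw [h0]; exact ⟨by omega, hby⟩
        exact ⟨_, _, Exec.loop_neg h0'.1, by omega, hm, h1, hr⟩
      | succ j ih =>
        intro i S2 hc' h0 h1 h2 hm hr
        have h0 : S2.reg (tr (d + 1)) = (j : ℤ) + 1 := by
          rcases h0 with h0 | ⟨hz, h0⟩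
          · rw [h0]; push_cast; ring
          · omega
        obtain ⟨t4, S4, E4, ht4, hm4, p0, p1, p2, hr4⟩ : ∃ t S4, Exec
            (.seq (.arith .mul (tr (d + 2)) (tr (d + 2)) (tr d))
            (.seq (.const (tr (d + 3)) 1)
              (.arith .sub (tr (d + 1)) (tr (d + 1)) (tr (d + 3))))) S2 t S4 ∧
            t ≤ x + B * x + B + 6 ∧ S4.mem = S.mem ∧ S4.reg (tr (d + 1)) = j ∧
            S4.reg (tr (d + 2)) = v ^ (i + 1) ∧
            S4.reg (tr d) = v ∧ ∀ r, Low d r → S4.reg r = S.reg r := by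
          refine ⟨_, _, Exec.seq (Exec.arith _ _ _ _ _) (Exec.seq (Exec.const _ _ _)
            (Exec.arith _ _ _ _ _)), ?_, ?_, ?_, ?_, ?_, ?_⟩
          · have b1 : bits ((j : ℤ) + 1) ≤ B := by
              have := bits_natCast_le_self (j + 1)
              push_cast at this
              omega
            have b2 := hpw i (by omega)
            simp [setReg_reg, tr_inj, h0, h1, h2, bits_one]
            omega
          · simp [hm]
          · simp [setReg_reg, tr_inj, Op.apply, h0]
          · simp [setReg_reg, tr_inj, Op.apply, h1, h2, pow_succ]
          · simp [setReg_reg, tr_inj, h2]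
          · intro r hr'
            simp [setReg_reg, low_ne hr' (show d ≤ d + 1 by omega),
              low_ne hr' (show d ≤ d + 2 by omega), low_ne hr' (show d ≤ d + 3 by omega),
              hr _ hr']
        obtain ⟨t5, S5, E5, ht5, hm5, hv5, hr5⟩ := ih (i + 1) S4 (by omega) (Or.inl p0) p1 p2 hm4
          hr4
        refine ⟨_, S5, Exec.loop_pos (by rw [h0]; positivity) E4 E5, ?_, hm5, ?_, hr5⟩
        · have b1 : bits ((j : ℤ) + 1) ≤ B := by
            have := bits_natCast_le_self (j + 1)
            push_cast at this
            omega
          have e1 : (j + 1) * (x + B * x + 2 * B + 8)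
              = j * (x + B * x + 2 * B + 8) + (x + B * x + 2 * B + 8) := by ring
          rw [e1, h0]
          omega
        · rw [hv5]; congr 1; omega
    obtain ⟨t4, S4, E4, ht4, hm4, hv4, hr4⟩ := loop c 0 (S2.setReg (tr (d + 2)) 1) (by omega)
      (by
        rcases le_or_gt 0 (f.eval s b) with h | h
        · left; simp [setReg_reg, tr_inj, hv2, hc, h]
        · right; exact ⟨h, by simp [setReg_reg, tr_inj, hv2]⟩) (by simp [setReg_reg])
      (by simp [setReg_reg, tr_inj, hv12]) (by simp [hm2, hm1])
      (by
        intro r hr'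
        simp [setReg_reg, low_ne hr' (show d ≤ d + 2 by omega),
          hr2 _ (low_mono hr' (show d ≤ d + 1 by omega)), hr1 _ hr'])
    rw [zero_add] at hv4
    refine ⟨_, _, Exec.seq E1 (Exec.seq E2 (Exec.seq (Exec.const _ _ _)
        (Exec.seq E4 (Exec.seq (Exec.const _ _ _) (Exec.arith _ _ _ _ _))))), ?_, ?_, ?_, ?_⟩
    · have b4 := hpw c le_rfl
      have key := wt_loop_bound hL e.wt f.wt
      have h5 : c * (x + B * x + 2 * B + 8) + (B * x + B * L ^ f.wt) ≤
          B * (3 * L ^ e.wt + 3 * L ^ f.wt + B * L ^ e.wt + 4 * B + 8) := by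
        have := Nat.mul_le_mul_right (x + B * x + 2 * B + 8) hcB'
        rw [← hx]
        nlinarith [Nat.zero_le (B * x), Nat.zero_le (B * B), Nat.zero_le (B * L ^ f.wt)]
      simp [setReg_reg, tr_inj, hv4, bits_zero, bits_one, Expr.wt]
      have h7 : x ≤ L ^ e.wt := hx.le
      omega
    · simp [hm4]
    · simp [setReg_reg, tr_inj, Expr.eval, Op.apply, hv4, hc, v]
    · intro r hr'
      simp [setReg_reg, low_ne hr' le_rfl, hr4 _ hr']

/-! ### Statements of the structured machine and their Hoare triples. -/

namespace HState

/-- Overwrite a register. -/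
def setR (s : HState) (x : ℕ) (v : ℤ) : HState := { s with reg := Function.update s.reg x v }

/-- Overwrite a cell of the main memory. -/
def setM (s : HState) (a v : ℤ) : HState := { s with mem := Function.update s.mem a v }

/-- Overwrite a cell of the external memory. -/
def setX (s : HState) (a v : ℤ) : HState := { s with ext := Function.update s.ext a v }

theorem setR_reg (s : HState) (x y : ℕ) (v : ℤ) :
    (s.setR x v).reg y = if y = x then v else s.reg y := by
  simp [setR, Function.update_apply]

theorem setM_mem (s : HState) (a b v : ℤ) :
    (s.setM a v).mem b = if b = a then v else s.mem b := by
  simp [setM, Function.update_apply]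

theorem setX_ext (s : HState) (a b v : ℤ) :
    (s.setX a v).ext b = if b = a then v else s.ext b := by
  simp [setX, Function.update_apply]

@[simp] theorem setR_mem (s : HState) (x : ℕ) (v : ℤ) : (s.setR x v).mem = s.mem := rfl
@[simp] theorem setR_ext (s : HState) (x : ℕ) (v : ℤ) : (s.setR x v).ext = s.ext := rfl
@[simp] theorem setR_left (s : HState) (x : ℕ) (v : ℤ) : (s.setR x v).left = s.left := rfl
@[simp] theorem setM_reg (s : HState) (a v : ℤ) : (s.setM a v).reg = s.reg := rfl
@[simp] theorem setM_ext (s : HState) (a v : ℤ) : (s.setM a v).ext = s.ext := rfl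
@[simp] theorem setM_left (s : HState) (a v : ℤ) : (s.setM a v).left = s.left := rfl
@[simp] theorem setX_reg (s : HState) (a v : ℤ) : (s.setX a v).reg = s.reg := rfl
@[simp] theorem setX_mem (s : HState) (a v : ℤ) : (s.setX a v).mem = s.mem := rfl
@[simp] theorem setX_left (s : HState) (a v : ℤ) : (s.setX a v).left = s.left := rfl

end HState

/-- The value of a closed expression. -/
def Expr.val (e : Expr) (s : HState) : ℤ := e.eval s (fun _ => s.reg 0)

/-- `Expr.Ok` for a closed expression. -/
def Expr.Safe (e : Expr) (B : ℕ) (s : HState) : Prop := e.Ok B s (fun _ => s.reg 0)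

/-- The machine state `S` represents `s`, with the current external memory and the blank ones that
are left in different residue classes modulo `Q`. -/
def Models (Q : ℤ) (s : HState) (S : State) : Prop :=
  ∃ off : ℤ, Sees s Q off S ∧ 0 < off ∧ off + s.left < Q ∧
    ∀ c : ℤ, off < c → c ≤ off + s.left → ∀ a, S.mem (a * Q + c) = 0

/-- Statements: code, with temporaries from a given depth on, and the exponent of the polynomial
in the bit bound that bounds the cost of a step. -/
structure Stm where
  code : ℕ → Prog
  wt : ℕ

/-- Started in `s`, the statement halts after at most `k` steps in a state that satisfies `Post`,
and all numbers have at most `B` bits. -/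
def Tri (Q : ℤ) (B : ℕ) (st : Stm) (s : HState) (k : ℕ) (Post : HState → Prop) : Prop :=
  ∀ d, 2 ≤ d → ∀ S, Models Q s S → Bdd B s → bits Q ≤ B →
    ∃ t S' s', Exec (st.code d) S t S' ∧ t ≤ k * (B + 2) ^ st.wt ∧
      (∀ r, 3 < r → r % 2 = 1 → r < 2 * d + 1 → S'.reg r = S.reg r) ∧
      Models Q s' S' ∧ Bdd B s' ∧ Post s'

theorem Tri.mono {Q : ℤ} {B : ℕ} {st : Stm} {s : HState} {k k' : ℕ} {P P' : HState → Prop}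
    (h : Tri Q B st s k P) (hk : k ≤ k') (hP : ∀ s', P s' → P' s') : Tri Q B st s k' P' := by
  intro d hd S h1 h2 h3
  obtain ⟨t, S', s', E, ht, hr, h4, h5, h6⟩ := h d hd S h1 h2 h3
  exact ⟨t, S', s', E, ht.trans (Nat.mul_le_mul_right _ hk), hr, h4, h5, hP _ h6⟩

theorem pow_wt_mono {B v w : ℕ} (h : v ≤ w) : (B + 2) ^ v ≤ (B + 2) ^ w :=
  Nat.pow_le_pow_right (by omega) h

/-- Sequential composition. -/
def seqS (p q : Stm) : Stm := ⟨fun d => .seq (p.code d) (q.code d), max p.wt q.wt⟩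

infixr:60 " ;; " => seqS

theorem Tri.seq {Q : ℤ} {B : ℕ} {p q : Stm} {s : HState} {k1 k2 k : ℕ} {M P : HState → Prop}
    (h1 : Tri Q B p s k1 M) (h2 : ∀ s', M s' → Tri Q B q s' k2 P) (hk : k1 + k2 ≤ k) :
    Tri Q B (p ;; q) s k P := by
  intro d hd S hR hB hQ
  obtain ⟨t1, S1, s1, E1, ht1, hr1, hR1, hB1, hM⟩ := h1 d hd S hR hB hQ
  obtain ⟨t2, S2, s2, E2, ht2, hr2, hR2, hB2, hP⟩ := h2 s1 hM d hd S1 hR1 hB1 hQ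
  refine ⟨_, S2, s2, Exec.seq E1 E2, ?_, fun r a b c => by rw [hr2 r a b c, hr1 r a b c],
    hR2, hB2, hP⟩
  calc t1 + t2 ≤ k1 * (B + 2) ^ p.wt + k2 * (B + 2) ^ q.wt := add_le_add ht1 ht2
    _ ≤ k1 * (B + 2) ^ (p ;; q).wt + k2 * (B + 2) ^ (p ;; q).wt := by
        gcongr
        · omega
        · exact le_max_left _ _
        · omega
        · exact le_max_right _ _
    _ = (k1 + k2) * (B + 2) ^ (p ;; q).wt := by ring
    _ ≤ _ := Nat.mul_le_mul_right _ hk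

/-- Main memory, current external memory and blank memories occupy different residue classes modulo
`Q`, hence never share a cell. -/
theorem cell_ne {Q : ℤ} (a b : ℤ) {c c' : ℤ} (h0 : 0 ≤ c) (h1 : c < Q) (h0' : 0 ≤ c')
    (h1' : c' < Q) (hne : c ≠ c') : a * Q + c ≠ b * Q + c' := by
  intro h
  have h2 : (a * Q + c) % Q = (b * Q + c') % Q := by rw [h]
  rw [Int.mul_add_emod_self_right, Int.mul_add_emod_self_right, Int.emod_eq_of_lt h0 h1,
    Int.emod_eq_of_lt h0' h1'] at h2
  exact hne h2

theorem bits_lt_of_lt {x Q : ℤ} {B : ℕ} (h0 : 0 ≤ x) (h : x < Q) (hQ : bits Q ≤ B) :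
    bits x ≤ B := (bits_mono (by omega)).trans hQ

/-- The code of a closed expression. -/
def Expr.put (e : Expr) (d : ℕ) : Prog := e.code (fun _ => ur 0) d

theorem Expr.exec_put {Q : ℤ} {B : ℕ} {s : HState} {off : ℤ} {S : State} {d : ℕ} (e : Expr)
    (hd : 2 ≤ d) (hS : Sees s Q off S) (hB : Bdd B s) (hQ : bits Q ≤ B) (hoff : bits off ≤ B)
    (hs : e.Safe B s) :
    bits (e.val s) ≤ (B + 2) ^ e.wt ∧
    ∃ t S', Exec (e.put d) S t S' ∧ t ≤ (B + 2) ^ e.wt ∧ S'.mem = S.mem ∧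
      S'.reg (tr d) = e.val s ∧ Sees s Q off S' ∧ ∀ r, Low d r → S'.reg r = S.reg r := by
  refine ⟨e.bits_eval_le hB _ (fun _ => hB.reg 0) hs, ?_⟩
  -- A closed expression has no use for its environment; register 0 is a dummy for every bound
  -- variable.
  obtain ⟨t, S', E, ht, hm, hv, hr⟩ := e.exec_code hB hQ hoff (fun _ => s.reg 0) (fun _ => ur 0)
    d S hd hS (fun _ => by simp [Low, ur]) (fun _ => hS.reg 0) (fun _ => hB.reg 0) hs
  exact ⟨t, S', E, ht, hm, hv, hS.of_low hd hm hr, hr⟩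

/-- `assign x e`: put the value of `e` into register `x`. -/
def assign (x : ℕ) (e : Expr) : Stm :=
  ⟨fun d => .seq (e.put d) (.seq (.const (ur x) 0) (.arith .add (ur x) (tr d) (ur x))), e.wt + 2⟩

theorem ur_ne_tr (x d : ℕ) : ur x ≠ tr d := by unfold ur tr; omega

theorem Sees.setReg_ur {s : HState} {Q off : ℤ} {S : State} (h : Sees s Q off S) (x : ℕ) (v : ℤ) :
    Sees (s.setR x v) Q off (S.setReg (ur x) v) where
  reg y := by
    rw [setReg_reg, HState.setR_reg, ← h.reg y]
    by_cases hxy : y = x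
    · simp [hxy]
    · rw [if_neg hxy, if_neg (by unfold ur; omega)]
  regQ := by rw [setReg_reg, if_neg (ur_ne_tr x 0).symm, h.regQ]
  regOff := by rw [setReg_reg, if_neg (ur_ne_tr x 1).symm, h.regOff]
  mem := h.mem
  ext := h.ext

theorem Sees.setReg_tr {s : HState} {Q off : ℤ} {S : State} (h : Sees s Q off S) {d : ℕ}
    (hd : 2 ≤ d) (v : ℤ) : Sees s Q off (S.setReg (tr d) v) :=
  h.of_low hd rfl fun r hr => by rw [setReg_reg, if_neg (low_ne hr le_rfl)]

theorem HState.setR_setR (s : HState) (x : ℕ) (v w : ℤ) : (s.setR x v).setR x w = s.setR x w := by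
  simp [HState.setR]

theorem Bdd.setR {B : ℕ} {s : HState} (h : Bdd B s) (x : ℕ) {v : ℤ} (hv : bits v ≤ B) :
    Bdd B (s.setR x v) :=
  ⟨fun y => by rw [HState.setR_reg]; split; exacts [hv, h.reg y], h.mem⟩

theorem Bdd.setM {B : ℕ} {s : HState} (h : Bdd B s) (a : ℤ) {v : ℤ} (hv : bits v ≤ B) :
    Bdd B (s.setM a v) :=
  ⟨h.reg, fun y => by rw [HState.setM_mem]; split; exacts [hv, h.mem y]⟩

theorem Tri.assign {Q : ℤ} {B : ℕ} {x : ℕ} {e : Expr} {s : HState} {P : HState → Prop}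
    (hs : e.Safe B s) (hb : bits (e.val s) ≤ B) (hP : P (s.setR x (e.val s))) :
    Tri Q B (assign x e) s 1 P := by
  rintro d hd S ⟨off, hS, h0, h1, h2⟩ hB hQ
  obtain ⟨hbe, t, S1, E, ht, hm, hv, hS1, hr⟩ := e.exec_put hd hS hB hQ
    (bits_lt_of_lt h0.le (by omega) hQ) hs
  refine ⟨_, _, s.setR x (e.val s), Exec.seq E (Exec.seq (Exec.const _ _ _)
    (Exec.arith _ _ _ _ _)), ?_, ?_, ⟨off, ?_, h0, h1, ?_⟩, hB.setR x hb, hP⟩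
  · simp only [setReg_reg, if_neg (ur_ne_tr x d).symm, hv, if_true, bits_zero, _root_.assign]
    have : 1 ≤ (B + 2) ^ e.wt := Nat.one_le_pow _ _ (by omega)
    have h4 : 4 * (B + 2) ^ e.wt ≤ (B + 2) ^ (e.wt + 2) := by
      rw [pow_add, mul_comm]; gcongr; exact Nat.pow_le_pow_left (show 2 ≤ B + 2 by omega) 2
    omega
  · intro r h3 hodd hlt
    have : r ≠ ur x := by unfold ur; omega
    simp only [setReg_reg, if_neg this]
    exact hr r (Or.inr hlt)
  · have := (hS1.setReg_ur x 0).setReg_ur x (e.val s)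
    rw [HState.setR_setR] at this
    simpa [setReg_reg, (ur_ne_tr x d).symm, hv, Op.apply] using this
  · simpa [hm] using h2

/-- `store a e`: put the value of `e` into the main memory cell `a`. -/
def store (a e : Expr) : Stm :=
  ⟨fun d => .seq (a.put d) (.seq (e.put (d + 1)) (.seq (.arith .mul (tr d) (tr d) (tr 0))
    (.store (tr d) (tr (d + 1))))), a.wt + e.wt + 5⟩

theorem store_bound {L : ℕ} (hL2 : 2 ≤ L) (v w : ℕ) :
    4 * (L ^ v + L ^ w + L) ≤ L ^ (v + w + 5) := by
  have h1 : 1 ≤ L ^ v := Nat.one_le_pow _ _ (by omega)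
  have h2 : 1 ≤ L ^ w := Nat.one_le_pow _ _ (by omega)
  have h3 : 2 ^ 4 ≤ L ^ 4 := Nat.pow_le_pow_left hL2 4
  have e : L ^ (v + w + 5) = L ^ 4 * (L * (L ^ v * L ^ w)) := by ring
  rw [e]
  generalize L ^ v = x at *
  generalize L ^ w = y at *
  have hxy : x ≤ x * y := Nat.le_mul_of_pos_right _ h2
  have hyx : y ≤ x * y := Nat.le_mul_of_pos_left _ h1
  have h4 : x * y ≤ L * (x * y) := Nat.le_mul_of_pos_left _ (by omega)
  have h5 : L ≤ L * (x * y) := Nat.le_mul_of_pos_right _ (Nat.mul_pos h1 h2)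
  have := Nat.mul_le_mul_right (L * (x * y)) h3
  omega

theorem Tri.store {Q : ℤ} {B : ℕ} {a e : Expr} {s : HState} {P : HState → Prop}
    (ha : a.Safe B s) (hs : e.Safe B s) (hb : bits (e.val s) ≤ B)
    (hP : P (s.setM (a.val s) (e.val s))) : Tri Q B (store a e) s 1 P := by
  rintro d hd S ⟨off, hS, h0, h1, h2⟩ hB hQ
  have hoff : bits off ≤ B := bits_lt_of_lt h0.le (by omega) hQ
  obtain ⟨hbe1, t1, S1, E1, ht1, hm1, hv1, hS1, hr1⟩ := a.exec_put hd hS hB hQ hoff ha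
  obtain ⟨hbe2, t2, S2, E2, ht2, hm2, hv2, hS2, hr2⟩ :=
    e.exec_put (show 2 ≤ d + 1 by omega) hS1 hB hQ hoff hs
  have hv12 : S2.reg (tr d) = a.val s := by rw [hr2 _ (low_tr (by omega)), hv1]
  have hne : tr d ≠ tr (d + 1) := by rw [Ne, tr_inj]; omega
  have hne0 : tr 0 ≠ tr d := by rw [Ne, tr_inj]; omega
  have hQ0 : 0 < Q := by omega
  refine ⟨_, _, s.setM (a.val s) (e.val s), Exec.seq E1 (Exec.seq E2 (Exec.seq
    (Exec.arith _ _ _ _ _) (Exec.store _ _ _))), ?_, ?_, ⟨off, ⟨?_, ?_, ?_, ?_, ?_⟩, h0, h1, ?_⟩,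
    hB.setM _ hb, hP⟩
  · simp only [setReg_reg, if_true, hv12, hS2.regQ, hv2, if_neg hne.symm, _root_.store, Op.apply]
    have h5 := store_bound (show 2 ≤ B + 2 by omega) a.wt e.wt
    have h6 := bits_mul_le (a.val s) Q
    omega
  · intro r h3 hodd hlt
    simp only [State.setMem, setReg_reg]
    rw [if_neg (by unfold tr; omega), hr2 r (low_mono (Or.inr hlt) (by omega)),
      hr1 r (Or.inr hlt)]
  · intro x; simp [State.setMem, setReg_reg, ur_ne_tr, hS2.reg]
  · simp [State.setMem, setReg_reg, hne0, hS2.regQ]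
  · have : tr 1 ≠ tr d := by rw [Ne, tr_inj]; omega
    simp [State.setMem, setReg_reg, this, hS2.regOff]
  · intro b
    simp only [State.setMem, setReg_reg, if_true, hv12, hS2.regQ, hv2, if_neg hne.symm, Op.apply,
      setReg_mem, Function.update_apply, HState.setM_mem, hS2.mem,
      mul_eq_mul_right_iff, hQ0.ne', or_false]
  · intro b
    have h8 : b * Q + off ≠ a.val s * Q := by
      simpa using cell_ne b (a.val s) (c := off) (c' := 0) h0.le (by omega) le_rfl hQ0 h0.ne'
    simp [State.setMem, setReg_reg, hv12, hS2.regQ, Op.apply, h8, hS2.ext]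
  · intro c hc hc' b
    change c ≤ off + s.left at hc'
    have h8 : b * Q + c ≠ a.val s * Q := by
      simpa using cell_ne b (a.val s) (c := c) (c' := 0) (by omega) (by omega) le_rfl hQ0
        (by omega)
    simp [State.setMem, setReg_reg, hv12, hS2.regQ, Op.apply, h8, hm1, hm2, h2 c hc hc']

/-- `xstore a e`: put the value of `e` into the external memory cell `a`. -/
def xstore (a e : Expr) : Stm :=
  ⟨fun d => .seq (a.put d) (.seq (e.put (d + 1)) (.seq (.arith .mul (tr d) (tr d) (tr 0))
    (.seq (.arith .add (tr d) (tr d) (tr 1)) (.store (tr d) (tr (d + 1)))))), a.wt + e.wt + 6⟩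

/-- No size bound is required of the stored number, since `Bdd` says nothing about the external
memory. This permits matrix programs to leave large numbers there; `Expr.Ok` asks for a bound only
at cells that are read. -/
theorem Tri.xstore {Q : ℤ} {B : ℕ} {a e : Expr} {s : HState} {P : HState → Prop}
    (ha : a.Safe B s) (hs : e.Safe B s)
    (hP : P (s.setX (a.val s) (e.val s))) : Tri Q B (xstore a e) s 1 P := by
  rintro d hd S ⟨off, hS, h0, h1, h2⟩ hB hQ
  have hoff : bits off ≤ B := bits_lt_of_lt h0.le (by omega) hQ
  obtain ⟨hbe1, t1, S1, E1, ht1, hm1, hv1, hS1, hr1⟩ := a.exec_put hd hS hB hQ hoff ha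
  obtain ⟨hbe2, t2, S2, E2, ht2, hm2, hv2, hS2, hr2⟩ :=
    e.exec_put (show 2 ≤ d + 1 by omega) hS1 hB hQ hoff hs
  have hv12 : S2.reg (tr d) = a.val s := by rw [hr2 _ (low_tr (by omega)), hv1]
  have hne : tr d ≠ tr (d + 1) := by rw [Ne, tr_inj]; omega
  have hne0 : tr 0 ≠ tr d := by rw [Ne, tr_inj]; omega
  have hne1 : tr 1 ≠ tr d := by rw [Ne, tr_inj]; omega
  have hQ0 : 0 < Q := by omega
  refine ⟨_, _, s.setX (a.val s) (e.val s), Exec.seq E1 (Exec.seq E2 (Exec.seq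
    (Exec.arith _ _ _ _ _) (Exec.seq (Exec.arith _ _ _ _ _) (Exec.store _ _ _)))), ?_, ?_,
    ⟨off, ⟨?_, ?_, ?_, ?_, ?_⟩, h0, h1, ?_⟩, ⟨hB.reg, hB.mem⟩, hP⟩
  · simp only [setReg_reg, if_true, hv12, hS2.regQ, hv2, if_neg hne.symm, _root_.xstore, Op.apply,
      if_neg hne1, hS2.regOff]
    have h5 := store_bound (show 2 ≤ B + 2 by omega) a.wt e.wt
    have h6 := bits_mul_le (a.val s) Q
    have h7 := bits_add_le (a.val s * Q) off
    have h8 : (B + 2) ^ (a.wt + e.wt + 6) = (B + 2) ^ (a.wt + e.wt + 5) * (B + 2) := by ring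
    have h9 := Nat.mul_le_mul_left ((B + 2) ^ (a.wt + e.wt + 5)) (show 2 ≤ B + 2 by omega)
    omega
  · intro r h3 hodd hlt
    simp only [State.setMem, setReg_reg]
    rw [if_neg (by unfold tr; omega), if_neg (by unfold tr; omega),
      hr2 r (low_mono (Or.inr hlt) (by omega)), hr1 r (Or.inr hlt)]
  · intro x; simp [State.setMem, setReg_reg, ur_ne_tr, hS2.reg]
  · simp [State.setMem, setReg_reg, hne0, hS2.regQ]
  · simp [State.setMem, setReg_reg, hne1, hS2.regOff]
  · intro b
    have h8 : b * Q ≠ a.val s * Q + off := by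
      simpa using cell_ne b (a.val s) (c' := off) (c := 0) le_rfl hQ0 h0.le (by omega) h0.ne
    simp [State.setMem, setReg_reg, hv12, hS2.regQ, Op.apply, h8, hS2.mem, hne1, hS2.regOff]
  · intro b
    simp [State.setMem, setReg_reg, hv12, hS2.regQ, Op.apply, hS2.ext, hne1, hS2.regOff,
      Function.update_apply, HState.setX_ext, hQ0.ne', hne.symm, hv2]
  · intro c hc hc' b
    change c ≤ off + s.left at hc'
    have h8 : b * Q + c ≠ a.val s * Q + off :=
      cell_ne _ _ (by omega) (by omega) (by omega) (by omega) (by omega)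
    simp [State.setMem, setReg_reg, hv12, hS2.regQ, Op.apply, h8, hm1, hm2, h2 c hc hc', hne1,
      hS2.regOff]

/-- Pass to a blank external memory. -/
def fresh : Stm := ⟨fun d => .seq (.const (tr d) 1) (.arith .add (tr 1) (tr 1) (tr d)), 3⟩

/-- Raising the offset by one enters the next residue class, which `Models` keeps filled with zeros.
A blank memory is thus obtained without any erasing. -/
theorem Tri.fresh {Q : ℤ} {B : ℕ} {s : HState} {l : ℕ} {P : HState → Prop}
    (hl : s.left = l + 1) (hP : P { s with ext := fun _ => 0, left := l }) :
    Tri Q B fresh s 1 P := by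
  rintro d hd S ⟨off, hS, h0, h1, h2⟩ hB hQ
  have hoff : bits off ≤ B := bits_lt_of_lt h0.le (by omega) hQ
  have hne1 : tr 1 ≠ tr d := by rw [Ne, tr_inj]; omega
  refine ⟨_, _, { s with ext := fun _ => 0, left := l }, Exec.seq (Exec.const _ _ _)
    (Exec.arith _ _ _ _ _), ?_, ?_, ⟨off + 1, ⟨?_, ?_, ?_, ?_, ?_⟩, ?_, ?_, ?_⟩,
    ⟨hB.reg, hB.mem⟩, hP⟩
  · simp only [setReg_reg, if_true, hS.regOff, if_neg hne1, bits_one, _root_.fresh]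
    have : (B + 2) ^ 3 = (B + 2) * ((B + 2) * (B + 2)) := by ring
    nlinarith
  · intro r h3 hodd hlt
    simp only [setReg_reg]
    rw [if_neg (by unfold tr; omega), if_neg (by unfold tr; omega)]
  · intro x; simp [setReg_reg, ur_ne_tr, hS.reg]
  · have hne0 : tr 0 ≠ tr d := by rw [Ne, tr_inj]; omega
    simp [setReg_reg, hne0, hS.regQ, tr_inj]
  · simp [setReg_reg, hne1, hS.regOff, Op.apply]
  · intro b; simp [hS.mem]
  · intro b; simp [h2 (off + 1) (by omega) (by omega) b]
  · omega
  · simp only; omega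
  · intro c hc hc' b; exact h2 c (by omega) (by simp only at hc'; omega) b

/-- `ifPos e p q`: `p` if the value of `e` is positive, otherwise `q`. -/
def ifPos (e : Expr) (p q : Stm) : Stm :=
  ⟨fun d => .seq (e.put d) (.branch (tr d) (p.code d) (q.code d)),
    max (e.wt + 2) (max p.wt q.wt)⟩

theorem Tri.ifPos {Q : ℤ} {B : ℕ} {e : Expr} {p q : Stm} {s : HState} {k : ℕ}
    {P : HState → Prop} (hs : e.Safe B s) (hp : 0 < e.val s → Tri Q B p s k P)
    (hq : e.val s ≤ 0 → Tri Q B q s k P) : Tri Q B (ifPos e p q) s (k + 1) P := by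
  rintro d hd S ⟨off, hS, h0, h1, h2⟩ hB hQ
  have hoff : bits off ≤ B := bits_lt_of_lt h0.le (by omega) hQ
  obtain ⟨hbe1, t1, S1, E1, ht1, hm1, hv1, hS1, hr1⟩ := e.exec_put hd hS hB hQ hoff hs
  have hM : Models Q s S1 := ⟨off, hS1, h0, h1, by rw [hm1]; exact h2⟩
  have h4 : 4 * (B + 2) ^ e.wt ≤ (B + 2) ^ (e.wt + 2) := by
    rw [pow_add, mul_comm]; gcongr; exact Nat.pow_le_pow_left (show 2 ≤ B + 2 by omega) 2
  have h5 : 1 ≤ (B + 2) ^ e.wt := Nat.one_le_pow _ _ (by omega)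
  have h6 : (B + 2) ^ (e.wt + 2) ≤ (B + 2) ^ (_root_.ifPos e p q).wt :=
    pow_wt_mono (le_max_left _ _)
  rw [add_mul, one_mul]
  rcases lt_or_ge 0 (e.val s) with h | h
  · obtain ⟨t2, S2, s2, E2, ht2, hr2, hR2, hB2, hP⟩ := hp h d hd S1 hM hB hQ
    refine ⟨_, S2, s2, Exec.seq E1 (Exec.branch_pos (by rw [hv1]; exact h) E2), ?_, ?_, hR2, hB2,
      hP⟩
    · have h7 : (B + 2) ^ p.wt ≤ (B + 2) ^ (_root_.ifPos e p q).wt :=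
        pow_wt_mono ((le_max_left _ _).trans (le_max_right _ _))
      have := Nat.mul_le_mul_left k h7
      rw [hv1]; omega
    · intro r a b c; rw [hr2 r a b c, hr1 r (Or.inr c)]
  · obtain ⟨t2, S2, s2, E2, ht2, hr2, hR2, hB2, hP⟩ := hq h d hd S1 hM hB hQ
    refine ⟨_, S2, s2, Exec.seq E1 (Exec.branch_neg (by rw [hv1]; exact h) E2), ?_, ?_, hR2, hB2,
      hP⟩
    · have h7 : (B + 2) ^ q.wt ≤ (B + 2) ^ (_root_.ifPos e p q).wt :=
        pow_wt_mono ((le_max_right _ _).trans (le_max_right _ _))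
      have := Nat.mul_le_mul_left k h7
      rw [hv1]; omega
    · intro r a b c; rw [hr2 r a b c, hr1 r (Or.inr c)]

/-- Do nothing. -/
def skipS : Stm := ⟨fun _ => .skip, 0⟩

theorem Tri.skip {Q : ℤ} {B : ℕ} {s : HState} {P : HState → Prop} (hP : P s) :
    Tri Q B skipS s 1 P :=
  fun _ _ S hR hB _ => ⟨_, S, s, Exec.skip S, by simp [skipS], fun _ _ _ _ => rfl, hR, hB, hP⟩

/-- `forS x e body`: run `body` for the values `0, 1, …` below the value of `e` of register `x`. -/
def forS (x : ℕ) (e : Expr) (body : Stm) : Stm :=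
  ⟨fun d => .seq (e.put d) (.seq (.const (tr (d + 1)) 0) (.loop (tr d)
    (.seq (.const (ur x) 0) (.seq (.arith .add (ur x) (tr (d + 1)) (ur x))
    (.seq (body.code (d + 2)) (.seq (.const (tr (d + 2)) 1)
    (.seq (.arith .add (tr (d + 1)) (tr (d + 1)) (tr (d + 2)))
      (.arith .sub (tr d) (tr d) (tr (d + 2)))))))))), max e.wt body.wt + 4⟩

theorem Models.setReg_tr {Q : ℤ} {s : HState} {S : State} (h : Models Q s S) {d : ℕ} (hd : 2 ≤ d)
    (v : ℤ) : Models Q s (S.setReg (tr d) v) := by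
  obtain ⟨off, hS, h0, h1, h2⟩ := h
  exact ⟨off, hS.setReg_tr hd v, h0, h1, h2⟩

theorem Models.setReg_ur {Q : ℤ} {s : HState} {S : State} (h : Models Q s S) (x : ℕ)
    (v : ℤ) : Models Q (s.setR x v) (S.setReg (ur x) v) := by
  obtain ⟨off, hS, h0, h1, h2⟩ := h
  exact ⟨off, hS.setReg_ur x v, h0, h1, h2⟩

/-- The counters live in the temporaries `d` and `d + 1`, and the body is compiled from depth `d +
2` on. The frame clause of `Tri` protects the counters, so the body is free to overwrite even `x`.
-/
theorem Tri.forS {Q : ℤ} {B : ℕ} {x : ℕ} {e : Expr} {body : Stm} {s : HState} {kb k : ℕ}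
    {P : HState → Prop} (I : ℕ → HState → Prop) (hs : e.Safe B s) (hb : bits (e.val s) ≤ B)
    (h0 : I 0 s)
    (hstep : ∀ i : ℕ, (i : ℤ) < e.val s → ∀ s', I i s' →
      Tri Q B body (s'.setR x i) kb (I (i + 1)))
    (hk : (e.val s).toNat * (kb + 1) + 1 ≤ k)
    (hpost : ∀ s', I (e.val s).toNat s' → P s') : Tri Q B (forS x e body) s k P := by
  refine Tri.mono (k := (e.val s).toNat * (kb + 1) + 1) (P := P) ?_ hk fun _ h => h
  rintro d hd S hR hB hQ
  have hR0 := hR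
  obtain ⟨off, hS, ho0, ho1, ho2⟩ := hR
  have hoff : bits off ≤ B := bits_lt_of_lt ho0.le (by omega) hQ
  obtain ⟨hbe1, t1, S1, E1, ht1, hm1, hv1, hS1, hr1⟩ := e.exec_put hd hS hB hQ hoff hs
  have hM : Models Q s S1 := ⟨off, hS1, ho0, ho1, by rw [hm1]; exact ho2⟩
  obtain ⟨w, hw⟩ : ∃ w, w = max e.wt body.wt + 4 := ⟨_, rfl⟩
  obtain ⟨W, hW⟩ : ∃ W, W = (B + 2) ^ w := ⟨_, rfl⟩
  have hWe : 16 * (B + 2) ^ e.wt ≤ W := by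
    rw [hW, hw, pow_add, mul_comm]
    exact Nat.mul_le_mul (pow_wt_mono (le_max_left _ _)) (Nat.pow_le_pow_left (show 2 ≤ B + 2 by omega) 4)
  have hWb : (B + 2) ^ body.wt ≤ W := by
    rw [hW, hw]; exact pow_wt_mono (by omega)
  have hWB : 8 * (B + 2) ≤ W := by
    have h3 : (B + 2) ^ 4 ≤ W := by rw [hW, hw]; exact pow_wt_mono (by omega)
    have h4 : 2 ^ 3 ≤ (B + 2) ^ 3 := Nat.pow_le_pow_left (show 2 ≤ B + 2 by omega) 3
    have h5 := Nat.mul_le_mul_right (B + 2) h4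
    have h6 : (B + 2) ^ 4 = (B + 2) ^ 3 * (B + 2) := by ring
    omega
  have hne : tr d ≠ tr (d + 1) := by rw [Ne, tr_inj]; omega
  have loop : ∀ (j i : ℕ) (S2 : State) (s2 : HState), (e.val s).toNat = i + j →
      (S2.reg (tr d) = j ∨ e.val s < 0 ∧ S2.reg (tr d) = e.val s) →
      S2.reg (tr (d + 1)) = i → Models Q s2 S2 → Bdd B s2 → I i s2 →
      (∀ r, 3 < r → r % 2 = 1 → r < 2 * d + 1 → S2.reg r = S.reg r) →
      ∃ t S3 s3, Exec (.loop (tr d)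
        (.seq (.const (ur x) 0) (.seq (.arith .add (ur x) (tr (d + 1)) (ur x))
        (.seq (body.code (d + 2)) (.seq (.const (tr (d + 2)) 1)
        (.seq (.arith .add (tr (d + 1)) (tr (d + 1)) (tr (d + 2)))
          (.arith .sub (tr d) (tr d) (tr (d + 2))))))))) S2 t S3 ∧
        t ≤ j * ((kb + 1) * W) + 1 + (B + 2) ^ e.wt ∧ Models Q s3 S3 ∧ Bdd B s3 ∧
        I (i + j) s3 ∧ ∀ r, 3 < r → r % 2 = 1 → r < 2 * d + 1 → S3.reg r = S.reg r := by
    intro j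
    induction j with
    | zero =>
      intro i S2 s2 hc h1 h2 hR2 hB2 hI hr2
      have h0' : S2.reg (tr d) ≤ 0 ∧ bits (S2.reg (tr d)) ≤ (B + 2) ^ e.wt := by
        rcases h1 with h1 | ⟨hz, h1⟩
        · rw [h1]; simp [bits_zero]
        · rw [h1]; exact ⟨by omega, hbe1⟩
      exact ⟨_, _, s2, Exec.loop_neg h0'.1, by omega, hR2, hB2, hI, hr2⟩
    | succ j ih =>
      intro i S2 s2 hc h1 h2 hR2 hB2 hI hr2
      have hi : (i : ℤ) < e.val s := by omega
      have h1 : S2.reg (tr d) = (j : ℤ) + 1 := by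
        rcases h1 with h1 | ⟨hz, h1⟩
        · rw [h1]; push_cast; ring
        · omega
      have bj : bits ((j : ℤ) + 1) ≤ B :=
        (bits_mono (by omega)).trans hb
      have bi : bits (i : ℤ) ≤ B := (bits_mono (by omega)).trans hb
      have bi1 : bits ((i : ℤ) + 1) ≤ B + 2 := (bits_add_le _ _).trans (by rw [bits_one]; omega)
      have hMi : Models Q (s2.setR x i) ((S2.setReg (ur x) 0).setReg (ur x) i) := by
        have := (hR2.setReg_ur x 0).setReg_ur x i
        rwa [HState.setR_setR] at this
      obtain ⟨t3, S3, s3, E3, ht3, hr3, hR3, hB3, hI3⟩ := hstep i hi s2 hI (d + 2) (by omega) _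
        hMi (hB2.setR x bi) hQ
      have q0 : S3.reg (tr d) = (j : ℤ) + 1 := by
        rw [hr3 _ (by unfold tr; omega) (by unfold tr; omega) (by unfold tr; omega), setReg_reg,
          setReg_reg, if_neg (ur_ne_tr x d).symm, if_neg (ur_ne_tr x d).symm, h1]
      have q1 : S3.reg (tr (d + 1)) = i := by
        rw [hr3 _ (by unfold tr; omega) (by unfold tr; omega) (by unfold tr; omega), setReg_reg,
          setReg_reg, if_neg (ur_ne_tr x _).symm, if_neg (ur_ne_tr x _).symm, h2]
      have hr3' : ∀ r, 3 < r → r % 2 = 1 → r < 2 * d + 1 → S3.reg r = S.reg r := by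
        intro r a b c
        have : r ≠ ur x := by unfold ur; omega
        rw [hr3 r a b (by omega), setReg_reg, setReg_reg, if_neg this, if_neg this, hr2 r a b c]
      obtain ⟨t4, S4, E4, ht4, p0, p1, hR4, hr4⟩ : ∃ t S4, Exec
          (.seq (.const (tr (d + 2)) 1)
          (.seq (.arith .add (tr (d + 1)) (tr (d + 1)) (tr (d + 2)))
            (.arith .sub (tr d) (tr d) (tr (d + 2))))) S3 t S4 ∧ t ≤ 2 * B + 6 ∧
          S4.reg (tr d) = j ∧ S4.reg (tr (d + 1)) = (i + 1 : ℕ) ∧ Models Q s3 S4 ∧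
          ∀ r, 3 < r → r % 2 = 1 → r < 2 * d + 1 → S4.reg r = S.reg r := by
        refine ⟨_, _, Exec.seq (Exec.const _ _ _) (Exec.seq (Exec.arith _ _ _ _ _)
          (Exec.arith _ _ _ _ _)), ?_, ?_, ?_, ?_, ?_⟩
        · simp [setReg_reg, tr_inj, q0, q1, bits_one]; omega
        · simp [setReg_reg, tr_inj, q0, Op.apply]
        · simp [setReg_reg, tr_inj, q1, Op.apply]
        · exact ((hR3.setReg_tr (by omega) _).setReg_tr (by omega) _).setReg_tr (by omega) _
        · intro r a b c
          simp only [setReg_reg]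
          rw [if_neg (by unfold tr; omega), if_neg (by unfold tr; omega),
            if_neg (by unfold tr; omega), hr3' r a b c]
      obtain ⟨t5, S5, s5, E5, ht5, hR5, hB5, hI5, hr5⟩ := ih (i + 1) S4 s3 (by omega) (Or.inl p0)
        p1 hR4 hB3 hI3 hr4
      have E3' : Exec (body.code (d + 2)) ((S2.setReg (ur x) 0).setReg (ur x)
          (Op.add.apply ((S2.setReg (ur x) 0).reg (tr (d + 1)))
            ((S2.setReg (ur x) 0).reg (ur x)))) t3 S3 := by
        convert E3 using 1
        simp [setReg_reg, (ur_ne_tr x _).symm, h2, Op.apply]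
      refine ⟨_, S5, s5, Exec.loop_pos (by rw [h1]; positivity) (Exec.seq (Exec.const _ _ _)
        (Exec.seq (Exec.arith _ _ _ _ _) (Exec.seq E3' E4))) E5, ?_, hR5, hB5, ?_, hr5⟩
      · have e1 : (j + 1) * ((kb + 1) * W) = j * ((kb + 1) * W) + (kb * W + W) := by ring
        have h7 := Nat.mul_le_mul_left kb hWb
        rw [e1, h1]
        simp only [setReg_reg, if_true, if_neg (ur_ne_tr x _).symm, h2, bits_zero]
        omega
      · rwa [show i + (j + 1) = i + 1 + j by ring]
  obtain ⟨t4, S4, s4, E4, ht4, hR4, hB4, hI4, hr4⟩ := loop (e.val s).toNat 0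
    (S1.setReg (tr (d + 1)) 0) s (by omega)
    (by
      rcases le_or_gt 0 (e.val s) with h | h
      · left; simp [setReg_reg, hne, hv1, h]
      · right; exact ⟨h, by simp [setReg_reg, hne, hv1]⟩)
    (by simp [setReg_reg]) (hM.setReg_tr (by omega) 0) hB h0
    (by
      intro r a b c
      rw [setReg_reg, if_neg (by unfold tr; omega), hr1 r (Or.inr c)])
  refine ⟨_, S4, s4, Exec.seq E1 (Exec.seq (Exec.const _ _ _) E4), ?_, hr4, hR4, hB4,
    hpost _ (by simpa using hI4)⟩
  have h5 : 1 ≤ (B + 2) ^ e.wt := Nat.one_le_pow _ _ (by omega)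
  have e1 : ((e.val s).toNat * (kb + 1) + 1) * (B + 2) ^ (_root_.forS x e body).wt
      = (e.val s).toNat * ((kb + 1) * W) + W := by
    rw [hW, hw]; simp only [_root_.forS]; ring
  rw [e1, bits_zero]
  omega

/-! ### Running an arbitrary program inside the external memory. -/

/-- A bound for the registers that a program names. -/
def RAM.Prog.regBound : Prog → ℕ
  | .skip => 0
  | .const x _ => x + 1
  | .arith _ x y z => max (x + 1) (max (y + 1) (z + 1))
  | .load x y => max (x + 1) (y + 1)
  | .store x y => max (x + 1) (y + 1)
  | .seq p q => max p.regBound q.regBound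
  | .branch x p q => max (x + 1) (max p.regBound q.regBound)
  | .loop x p => max (x + 1) p.regBound

/-- The program `p`, run on temporaries from `d` on and on the current external memory, with the
temporary `d + m` as scratch register. -/
def RAM.Prog.lift (d m : ℕ) : Prog → Prog
  | .skip => .skip
  | .const x c => .const (tr (d + x)) c
  | .arith o x y z => .arith o (tr (d + x)) (tr (d + y)) (tr (d + z))
  | .load x y => .seq (.arith .mul (tr (d + m)) (tr (d + y)) (tr 0))
      (.seq (.arith .add (tr (d + m)) (tr (d + m)) (tr 1)) (.load (tr (d + x)) (tr (d + m))))
  | .store x y => .seq (.arith .mul (tr (d + m)) (tr (d + x)) (tr 0))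
      (.seq (.arith .add (tr (d + m)) (tr (d + m)) (tr 1)) (.store (tr (d + m)) (tr (d + y))))
  | .seq p q => .seq (p.lift d m) (q.lift d m)
  | .branch x p q => .branch (tr (d + x)) (p.lift d m) (q.lift d m)
  | .loop x p => .loop (tr (d + x)) (p.lift d m)

/-- `S` simulates `s` on the temporaries from `d` on and on the external memory. -/
structure Simulates (Q off : ℤ) (d m : ℕ) (s S : State) : Prop where
  reg : ∀ r < m, S.reg (tr (d + r)) = s.reg r
  regQ : S.reg (tr 0) = Q
  regOff : S.reg (tr 1) = off
  mem : ∀ a, S.mem (a * Q + off) = s.mem a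

theorem Simulates.setReg {Q off : ℤ} {d m : ℕ} {s S : State} (h : Simulates Q off d m s S)
    (hd : 2 ≤ d) (x : ℕ) (v : ℤ) :
    Simulates Q off d m (s.setReg x v) (S.setReg (tr (d + x)) v) where
  reg r hr := by
    simp only [setReg_reg, tr_inj, Nat.add_left_cancel_iff, h.reg r hr]
  regQ := by rw [setReg_reg, if_neg (by rw [tr_inj]; omega), h.regQ]
  regOff := by rw [setReg_reg, if_neg (by rw [tr_inj]; omega), h.regOff]
  mem := h.mem

theorem Simulates.setScratch {Q off : ℤ} {d m : ℕ} {s S : State} (h : Simulates Q off d m s S)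
    (hd : 2 ≤ d) (v : ℤ) : Simulates Q off d m s (S.setReg (tr (d + m)) v) where
  reg r hr := by rw [setReg_reg, if_neg (by rw [tr_inj]; omega), h.reg r hr]
  regQ := by rw [setReg_reg, if_neg (by rw [tr_inj]; omega), h.regQ]
  regOff := by rw [setReg_reg, if_neg (by rw [tr_inj]; omega), h.regOff]
  mem := h.mem

theorem Simulates.setMem {Q off : ℤ} {d m : ℕ} {s S : State} (h : Simulates Q off d m s S)
    (hQ : 0 < Q) (a v : ℤ) :
    Simulates Q off d m (s.setMem a v) (S.setMem (a * Q + off) v) where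
  reg := h.reg
  regQ := h.regQ
  regOff := h.regOff
  mem b := by simp [State.setMem, Function.update_apply, hQ.ne', h.mem]

/-- The registers below the temporary `d` and the cells outside the external memory agree. -/
structure Frame (Q off : ℤ) (d : ℕ) (S S' : State) : Prop where
  reg : ∀ r, Low d r → S'.reg r = S.reg r
  mem : ∀ b, (∀ a, b ≠ a * Q + off) → S'.mem b = S.mem b

theorem Frame.trans {Q off : ℤ} {d : ℕ} {S S' S'' : State} (h : Frame Q off d S S')
    (h' : Frame Q off d S' S'') : Frame Q off d S S'' :=
  ⟨fun r hr => by rw [h'.reg r hr, h.reg r hr], fun b hb => by rw [h'.mem b hb, h.mem b hb]⟩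

theorem Frame.refl {Q off : ℤ} {d : ℕ} (S : State) : Frame Q off d S S :=
  ⟨fun _ _ => rfl, fun _ _ => rfl⟩

theorem Frame.setReg {Q off : ℤ} {d : ℕ} {S S' : State} (h : Frame Q off d S S') (x : ℕ) (v : ℤ) :
    Frame Q off d S (S'.setReg (tr (d + x)) v) :=
  ⟨fun r hr => by rw [setReg_reg, if_neg (low_ne hr (by omega)), h.reg r hr], h.mem⟩

theorem Frame.setMem {Q off : ℤ} {d : ℕ} {S S' : State} (h : Frame Q off d S S') (a v : ℤ) :
    Frame Q off d S (S'.setMem (a * Q + off) v) :=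
  ⟨h.reg, fun b hb => by simp [State.setMem, hb a, h.mem b hb]⟩

/-- Every access to cell `a` becomes an access to `a * Q + off`. The address arithmetic handles
numbers of a few times `B` bits beyond those already paid for, so each unit of cost grows by a
factor of at most `(B + 2) ^ 4`. -/
theorem RAM.Exec.lift {Q off : ℤ} {B d m : ℕ} (hQ0 : 0 < Q) (hQ : bits Q ≤ B)
    (hoff : bits off ≤ B) (hd : 2 ≤ d) {p : Prog} {s : State} {t : ℕ} {s' : State}
    (E : Exec p s t s') : p.regBound ≤ m → ∀ S, Simulates Q off d m s S →
    ∃ T S', Exec (p.lift d m) S T S' ∧ T ≤ t * (B + 2) ^ 4 ∧ Simulates Q off d m s' S' ∧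
      Frame Q off d S S' := by
  have hL : 8 * (B + 2) ≤ (B + 2) ^ 4 := by
    have h4 : 2 ^ 3 ≤ (B + 2) ^ 3 := Nat.pow_le_pow_left (show 2 ≤ B + 2 by omega) 3
    have h5 := Nat.mul_le_mul_right (B + 2) h4
    have h6 : (B + 2) ^ 4 = (B + 2) ^ 3 * (B + 2) := by ring
    omega
  have hL1 : 1 ≤ (B + 2) ^ 4 := by omega
  have acc : ∀ y w T : ℕ, T ≤ 3 * y + w + 5 * B + 4 → T ≤ (1 + y + w) * (B + 2) ^ 4 := by
    intro y w T hT
    have h1 := Nat.mul_le_mul_left (1 + y + w) hL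
    have h2 : (1 + y + w) * (8 * (B + 2)) = 8 * B + 16 + 16 * y + 16 * w + 8 * (B * y) + 8 * (B * w) := by
      ring
    omega
  induction E with
  | skip s =>
    intro hm S hS
    exact ⟨_, _, Exec.skip S, by omega, hS, Frame.refl S⟩
  | const s x c =>
    intro hm S hS
    exact ⟨_, _, Exec.const _ _ _, Nat.le_mul_of_pos_right _ hL1, hS.setReg hd x c,
      (Frame.refl S).setReg x c⟩
  | arith s o x y z =>
    intro hm S hS
    simp only [Prog.regBound, max_le_iff] at hm
    refine ⟨_, _, Exec.arith _ _ _ _ _, ?_, ?_, (Frame.refl S).setReg x _⟩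
    · rw [hS.reg y (by omega), hS.reg z (by omega)]
      exact Nat.le_mul_of_pos_right _ hL1
    · rw [hS.reg y (by omega), hS.reg z (by omega)]
      exact hS.setReg hd x _
  | load s x y =>
    intro hm S hS
    simp only [Prog.regBound, max_le_iff] at hm
    have hy := hS.reg y (by omega)
    have hne1 : tr 1 ≠ tr (d + m) := by rw [Ne, tr_inj]; omega
    have h6 := bits_mul_le (s.reg y) Q
    have h7 := bits_add_le (s.reg y * Q) off
    refine ⟨_, _, Exec.seq (Exec.arith _ _ _ _ _) (Exec.seq (Exec.arith _ _ _ _ _)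
      (Exec.load _ _ _)), ?_, ?_, ?_⟩
    · simp only [setReg_reg, if_true, hy, hS.regQ, hS.regOff, if_neg hne1, Op.apply, setReg_mem,
        hS.mem]
      apply acc
      omega
    · have := ((hS.setScratch hd (s.reg y * Q)).setScratch hd (s.reg y * Q + off)).setReg hd x
        (s.mem (s.reg y))
      simpa only [setReg_reg, if_true, hy, hS.regQ, hS.regOff, if_neg hne1, Op.apply, setReg_mem,
        hS.mem] using this
    · exact ((((Frame.refl S).setReg m _).setReg m _).setReg x _)
  | store s x y =>
    intro hm S hS
    simp only [Prog.regBound, max_le_iff] at hm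
    have hx := hS.reg x (by omega)
    have hy := hS.reg y (by omega)
    have hne1 : tr 1 ≠ tr (d + m) := by rw [Ne, tr_inj]; omega
    have hne2 : tr (d + y) ≠ tr (d + m) := by rw [Ne, tr_inj]; omega
    have h6 := bits_mul_le (s.reg x) Q
    have h7 := bits_add_le (s.reg x * Q) off
    refine ⟨_, _, Exec.seq (Exec.arith _ _ _ _ _) (Exec.seq (Exec.arith _ _ _ _ _)
      (Exec.store _ _ _)), ?_, ?_, ?_⟩
    · simp only [setReg_reg, if_true, hx, hy, hS.regQ, hS.regOff, if_neg hne1, if_neg hne2,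
        Op.apply]
      apply acc
      omega
    · have := ((hS.setScratch hd (s.reg x * Q)).setScratch hd (s.reg x * Q + off)).setMem hQ0
        (s.reg x) (s.reg y)
      simpa only [setReg_reg, if_true, hx, hy, hS.regQ, hS.regOff, if_neg hne1, if_neg hne2,
        Op.apply] using this
    · have := (((Frame.refl (Q := Q) (off := off) (d := d) S).setReg m (s.reg x * Q)).setReg m
        (s.reg x * Q + off)).setMem (s.reg x) (s.reg y)
      simpa only [setReg_reg, if_true, hx, hy, hS.regQ, hS.regOff, if_neg hne1, if_neg hne2,
        Op.apply] using this
  | seq _ _ ih1 ih2 =>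
    intro hm S hS
    simp only [Prog.regBound, max_le_iff] at hm
    obtain ⟨T1, S1, E1, hT1, hS1, hF1⟩ := ih1 hm.1 S hS
    obtain ⟨T2, S2, E2, hT2, hS2, hF2⟩ := ih2 hm.2 S1 hS1
    exact ⟨_, _, Exec.seq E1 E2, by rw [add_mul]; exact add_le_add hT1 hT2, hS2, hF1.trans hF2⟩
  | @branch_pos x p q s s' t hx _ ih =>
    intro hm S hS
    simp only [Prog.regBound, max_le_iff] at hm
    have h1 := hS.reg x (by omega)
    obtain ⟨T1, S1, E1, hT1, hS1, hF1⟩ := ih hm.2.1 S hS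
    refine ⟨_, _, Exec.branch_pos (by rw [h1]; exact hx) E1, ?_, hS1, hF1⟩
    rw [h1, add_mul]
    exact add_le_add (Nat.le_mul_of_pos_right _ hL1) hT1
  | @branch_neg x p q s s' t hx _ ih =>
    intro hm S hS
    simp only [Prog.regBound, max_le_iff] at hm
    have h1 := hS.reg x (by omega)
    obtain ⟨T1, S1, E1, hT1, hS1, hF1⟩ := ih hm.2.2 S hS
    refine ⟨_, _, Exec.branch_neg (by rw [h1]; exact hx) E1, ?_, hS1, hF1⟩
    rw [h1, add_mul]
    exact add_le_add (Nat.le_mul_of_pos_right _ hL1) hT1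
  | @loop_pos x p s s' s'' t t' hx _ _ ih1 ih2 =>
    intro hm S hS
    have hm' := hm
    simp only [Prog.regBound, max_le_iff] at hm
    have h1 := hS.reg x (by omega)
    obtain ⟨T1, S1, E1, hT1, hS1, hF1⟩ := ih1 hm.2 S hS
    obtain ⟨T2, S2, E2, hT2, hS2, hF2⟩ := ih2 hm' S1 hS1
    refine ⟨_, _, Exec.loop_pos (by rw [h1]; exact hx) E1 E2, ?_, hS2, hF1.trans hF2⟩
    rw [h1, add_mul, add_mul]
    exact add_le_add (add_le_add (Nat.le_mul_of_pos_right _ hL1) hT1) hT2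
  | @loop_neg x p s hx =>
    intro hm S hS
    simp only [Prog.regBound, max_le_iff] at hm
    have h1 := hS.reg x (by omega)
    refine ⟨_, _, Exec.loop_neg (by rw [h1]; exact hx), ?_, hS, Frame.refl S⟩
    rw [h1]
    exact Nat.le_mul_of_pos_right _ hL1

/-- Set the temporaries `d, …, d + m - 1` to `0`. -/
def zeros (d : ℕ) : ℕ → Prog
  | 0 => .skip
  | m + 1 => .seq (zeros d m) (.const (tr (d + m)) 0)

theorem exec_zeros (d m : ℕ) (S : State) : ∃ S', Exec (zeros d m) S (m + 1) S' ∧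
    S'.mem = S.mem ∧ (∀ r < m, S'.reg (tr (d + r)) = 0) ∧ ∀ r, Low d r → S'.reg r = S.reg r := by
  induction m with
  | zero => exact ⟨S, Exec.skip S, rfl, by simp, fun _ _ => rfl⟩
  | succ m ih =>
    obtain ⟨S1, E1, h1, h2, h3⟩ := ih
    refine ⟨_, Exec.seq E1 (Exec.const _ _ _), h1, ?_, ?_⟩
    · intro r hr
      rw [setReg_reg]
      split
      · rfl
      · rename_i h; rw [tr_inj] at h; exact h2 r (by omega)
    · intro r hr
      rw [setReg_reg, if_neg (low_ne hr (by omega)), h3 r hr]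

/-- Run the program `p` on the external memory, with register `x` as the size parameter. -/
def runS (p : Prog) (x : ℕ) : Stm :=
  ⟨fun d => .seq (zeros d (p.regBound + 1)) (.seq (.arith .add (tr d) (ur x) (tr d))
    (p.lift d (p.regBound + 1))), p.regBound + 5⟩

/-- The given execution starts from `State.init`, where all cells outside the input are 0. The
temporaries are therefore zeroed here, and each call needs a fresh external memory. -/
theorem Tri.run {Q : ℤ} {B : ℕ} {p : Prog} {x N t : ℕ} {s : HState} {sf : State}
    {P : HState → Prop} (hx : s.reg x = N) (E : Exec p (State.init N s.ext) t sf)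
    (hP : P { s with ext := sf.mem }) : Tri Q B (runS p x) s (t + 1) P := by
  rintro d hd S ⟨off, hS, h0, h1, h2⟩ hB hQ
  have hoff : bits off ≤ B := bits_lt_of_lt h0.le (by omega) hQ
  have hQ0 : 0 < Q := by omega
  obtain ⟨S1, E1, hm1, hz1, hr1⟩ := exec_zeros d (p.regBound + 1) S
  have hx1 : S1.reg (ur x) = N := by rw [hr1 _ (by simp [Low, ur]), hS.reg, hx]
  have hz0 : S1.reg (tr d) = 0 := hz1 0 (by omega)
  have hsim : Simulates Q off d (p.regBound + 1) (State.init N s.ext) (S1.setReg (tr d) N) := by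
    refine ⟨?_, ?_, ?_, ?_⟩
    · intro r hr
      rw [setReg_reg]
      rcases Nat.eq_zero_or_pos r with rfl | hr0
      · simp [State.init]
      · rw [if_neg (by rw [tr_inj]; omega), hz1 r hr]
        simp [State.init, hr0.ne']
    · rw [setReg_reg, if_neg (by rw [tr_inj]; omega), hr1 _ (low_tr (by omega)), hS.regQ]
    · rw [setReg_reg, if_neg (by rw [tr_inj]; omega), hr1 _ (low_tr (by omega)), hS.regOff]
    · intro a; rw [setReg_mem, hm1, hS.ext]; rfl
  obtain ⟨T, S2, E2, hT, hS2, hF⟩ := E.lift hQ0 hQ hoff hd (Nat.le_succ _) _ hsim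
  have hlow : ∀ r, Low d r → S2.reg r = S.reg r := fun r hr => by
    rw [hF.reg r hr, setReg_reg, if_neg (low_ne hr le_rfl), hr1 r hr]
  have hmem : ∀ b, (∀ a, b ≠ a * Q + off) → S2.mem b = S.mem b := fun b hb => by
    rw [hF.mem b hb, setReg_mem, hm1]
  have E2' : Exec (p.lift d (p.regBound + 1)) (S1.setReg (tr d)
      (Op.add.apply (S1.reg (ur x)) (S1.reg (tr d)))) T S2 := by
    simpa [Op.apply, hx1, hz0] using E2
  refine ⟨_, S2, { s with ext := sf.mem }, Exec.seq E1 (Exec.seq (Exec.arith _ _ _ _ _) E2'), ?_,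
    ?_, ⟨off, ⟨?_, ?_, ?_, ?_, ?_⟩, h0, h1, ?_⟩, ⟨hB.reg, hB.mem⟩, hP⟩
  · rw [hx1, hz0, bits_zero]
    have h3 : bits (N : ℤ) ≤ B := hx ▸ hB.reg x
    -- Zeroing the temporaries takes `p.regBound + 1` constants; the exponent `p.regBound` absorbs
    -- this number because it is less than `2 ^ p.regBound`.
    have h4 : p.regBound < 2 ^ p.regBound := Nat.lt_two_pow_self
    have h5 : 2 ^ p.regBound ≤ (B + 2) ^ p.regBound := Nat.pow_le_pow_left (by omega) _
    have h6 : 8 * (B + 2) ≤ (B + 2) ^ 4 := by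
      have h4 : 2 ^ 3 ≤ (B + 2) ^ 3 := Nat.pow_le_pow_left (show 2 ≤ B + 2 by omega) 3
      have h5 := Nat.mul_le_mul_right (B + 2) h4
      have h6 : (B + 2) ^ 4 = (B + 2) ^ 3 * (B + 2) := by ring
      omega
    have h7 : p.regBound + B + 8 ≤ (B + 2) ^ (p.regBound + 5) := by
      have e : (B + 2) ^ (p.regBound + 5) = (B + 2) ^ p.regBound * ((B + 2) ^ 4 * (B + 2)) := by
        ring
      rw [e]
      have h8 : 8 * (B + 2) * 2 ≤ (B + 2) ^ 4 * (B + 2) := Nat.mul_le_mul h6 (by omega)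
      have h9 : (p.regBound + 1) * (8 * (B + 2) * 2) ≤ _ := Nat.mul_le_mul (by omega :
        p.regBound + 1 ≤ (B + 2) ^ p.regBound) h8
      nlinarith
    have h8 : (B + 2) ^ 4 ≤ (B + 2) ^ (p.regBound + 5) := pow_wt_mono (by omega)
    have h9 := Nat.mul_le_mul_left t h8
    simp only [runS]
    rw [add_mul, one_mul]
    omega
  · intro r a b c; exact hlow r (Or.inr c)
  · intro y; rw [hlow _ (by simp [Low, ur]), hS.reg]
  · rw [hlow _ (low_tr (by omega)), hS.regQ]
  · rw [hlow _ (low_tr (by omega)), hS.regOff]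
  · intro a
    rw [hmem _ fun b => by
      simpa using cell_ne a b (c := 0) (c' := off) le_rfl hQ0 h0.le (by omega) h0.ne, hS.mem]
  · exact hS2.mem
  · intro c hc hc' a
    change c ≤ off + s.left at hc'
    rw [hmem _ fun b => cell_ne a b (by omega) (by omega) (by omega) (by omega) (by omega),
      h2 c hc hc']

/-- Only a store changes the memory, it changes one cell, and it costs at least 1. This makes the
size of an output a lower bound for the running time. -/
theorem RAM.Exec.card_le {p : Prog} {s : State} {t : ℕ} {s' : State} (E : Exec p s t s') :
    ∀ F : Finset ℤ, (∀ a ∈ F, s'.mem a ≠ s.mem a) → F.card ≤ t := by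
  have triv : ∀ (s : State) (F : Finset ℤ), (∀ a ∈ F, s.mem a ≠ s.mem a) → F.card = 0 := by
    intro s F h
    rw [Finset.card_eq_zero, Finset.eq_empty_iff_forall_notMem]
    exact fun a ha => h a ha rfl
  have two : ∀ (s s' s'' : State) (t t' : ℕ),
      (∀ F : Finset ℤ, (∀ a ∈ F, s'.mem a ≠ s.mem a) → F.card ≤ t) →
      (∀ F : Finset ℤ, (∀ a ∈ F, s''.mem a ≠ s'.mem a) → F.card ≤ t') →
      ∀ F : Finset ℤ, (∀ a ∈ F, s''.mem a ≠ s.mem a) → F.card ≤ t + t' := by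
    intro s s' s'' t t' h1 h2 F hF
    rw [← Finset.card_filter_add_card_filter_not (s := F) (fun a => s'.mem a ≠ s.mem a)]
    refine add_le_add (h1 _ fun a ha => (Finset.mem_filter.1 ha).2) (h2 _ fun a ha => ?_)
    rw [Finset.mem_filter, not_not] at ha
    rw [ha.2]
    exact hF a ha.1
  induction E with
  | skip s => intro F hF; rw [triv s F hF]; omega
  | const s x c => intro F hF; rw [triv s F hF]; omega
  | arith s o x y z => intro F hF; rw [triv s F hF]; omega
  | load s x y => intro F hF; rw [triv s F hF]; omega
  | store s x y =>
    intro F hF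
    have : F ⊆ {s.reg x} := by
      intro a ha
      by_contra h
      rw [Finset.mem_singleton] at h
      exact hF a ha (by simp [State.setMem, h])
    have := Finset.card_le_card this
    rw [Finset.card_singleton] at this
    omega
  | seq _ _ ih1 ih2 => exact two _ _ _ _ _ ih1 ih2
  | branch_pos _ _ ih => intro F hF; have := ih F hF; omega
  | branch_neg _ _ ih => intro F hF; have := ih F hF; omega
  | loop_pos _ _ _ ih1 ih2 =>
    intro F hF
    have := two _ _ _ _ _ ih1 ih2 F hF
    omega
  | loop_neg _ => intro F hF; rw [triv _ F hF]; omega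

/-! ### Spreading out the input and collecting the output. -/

/-- Copy the cells `(i + b₂) * m₂` to the cells `(i + b₁) * m₁`, from the last to the first. The
temporaries `2, …, 6` hold the number of cells and `m₁`, `b₁`, `m₂`, `b₂`. -/
def copyCells : Prog :=
  .loop (tr 2) (.seq (.const (tr 7) 1) (.seq (.arith .sub (tr 2) (tr 2) (tr 7))
    (.seq (.arith .add (tr 7) (tr 2) (tr 6)) (.seq (.arith .mul (tr 7) (tr 7) (tr 5))
    (.seq (.load (tr 8) (tr 7)) (.seq (.arith .add (tr 7) (tr 2) (tr 4))
    (.seq (.arith .mul (tr 7) (tr 7) (tr 3)) (.store (tr 7) (tr 8)))))))))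

/-- Copying goes from the highest index downwards, so source and target may overlap. It suffices
that the target of `i` differs from every source `j < i`, which is still to be read. -/
theorem exec_copyCells {B cnt : ℕ} {m₁ b₁ m₂ b₂ : ℤ} (hm₁ : m₁ ≠ 0) (hcnt : bits cnt ≤ B)
    (h₁ : bits m₁ ≤ B) (h₂ : bits b₁ ≤ B) (h₃ : bits m₂ ≤ B) (h₄ : bits b₂ ≤ B) :
    ∀ S : State, S.reg (tr 2) = cnt → S.reg (tr 3) = m₁ → S.reg (tr 4) = b₁ → S.reg (tr 5) = m₂ →
    S.reg (tr 6) = b₂ → (∀ i < cnt, bits (S.mem ((i + b₂) * m₂)) ≤ B) →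
    (∀ i j : ℕ, j < i → i < cnt → (i + b₁) * m₁ ≠ (j + b₂) * m₂) →
    ∃ t S', Exec copyCells S t S' ∧ t ≤ cnt * (B + 2) ^ 6 + 1 ∧
      (∀ i < cnt, S'.mem ((i + b₁) * m₁) = S.mem ((i + b₂) * m₂)) ∧
      (∀ a, (∀ i < cnt, a ≠ (i + b₁) * m₁) → S'.mem a = S.mem a) ∧
      ∀ r, r ≠ tr 2 → r ≠ tr 7 → r ≠ tr 8 → S'.reg r = S.reg r := by
  induction cnt with
  | zero =>
    intro S q2 _ _ _ _ _ _
    exact ⟨_, S, Exec.loop_neg (by rw [q2]; simp), by rw [q2]; simp [bits_zero], by simp,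
      fun _ _ => rfl, fun _ _ _ _ => rfl⟩
  | succ cnt ih =>
    intro S q2 q3 q4 q5 q6 hb hne
    have hc1 : bits ((cnt : ℤ) + 1) ≤ B := by simpa using hcnt
    have hc : bits (cnt : ℤ) ≤ B := (bits_mono (by omega)).trans hcnt
    have e1 := bits_add_le cnt b₂
    have e2 := bits_mul_le (cnt + b₂) m₂
    have e3 := bits_add_le cnt b₁
    have e4 := bits_mul_le (cnt + b₁) m₁
    have e5 := hb cnt (by omega)
    have hL : 32 * (B + 2) ≤ (B + 2) ^ 6 := by
      have h4 : 2 ^ 5 ≤ (B + 2) ^ 5 := Nat.pow_le_pow_left (show 2 ≤ B + 2 by omega) 5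
      have h5 := Nat.mul_le_mul_right (B + 2) h4
      have h6 : (B + 2) ^ 6 = (B + 2) ^ 5 * (B + 2) := by ring
      omega
    obtain ⟨t1, S1, E1, ht1, hm1, p2, hr1⟩ : ∃ t S1, Exec (.seq (.const (tr 7) 1)
        (.seq (.arith .sub (tr 2) (tr 2) (tr 7))
        (.seq (.arith .add (tr 7) (tr 2) (tr 6)) (.seq (.arith .mul (tr 7) (tr 7) (tr 5))
        (.seq (.load (tr 8) (tr 7)) (.seq (.arith .add (tr 7) (tr 2) (tr 4))
        (.seq (.arith .mul (tr 7) (tr 7) (tr 3)) (.store (tr 7) (tr 8))))))))) S t S1 ∧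
        t + 1 + B ≤ (B + 2) ^ 6 ∧
        S1.mem = Function.update S.mem ((cnt + b₁) * m₁) (S.mem ((cnt + b₂) * m₂)) ∧
        S1.reg (tr 2) = cnt ∧ ∀ r, r ≠ tr 2 → r ≠ tr 7 → r ≠ tr 8 → S1.reg r = S.reg r := by
      refine ⟨_, _, Exec.seq (Exec.const _ _ _) (Exec.seq (Exec.arith _ _ _ _ _)
        (Exec.seq (Exec.arith _ _ _ _ _) (Exec.seq (Exec.arith _ _ _ _ _)
        (Exec.seq (Exec.load _ _ _) (Exec.seq (Exec.arith _ _ _ _ _)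
        (Exec.seq (Exec.arith _ _ _ _ _) (Exec.store _ _ _))))))), ?_, ?_, ?_, ?_⟩
      · simp [setReg_reg, tr_inj, q2, q3, q4, q5, q6, Op.apply, bits_one]
        omega
      · simp [State.setMem, setReg_reg, tr_inj, q2, q3, q4, q5, q6, Op.apply]
      · simp [State.setMem, setReg_reg, tr_inj, q2, Op.apply]
      · intro r h2 h7 h8
        simp [State.setMem, setReg_reg, h2, h7, h8]
    have read : ∀ i < cnt, S1.mem ((i + b₂) * m₂) = S.mem ((i + b₂) * m₂) := by
      intro i hi
      rw [hm1, Function.update_of_ne (hne cnt i hi (by omega)).symm]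
    obtain ⟨t2, S2, E2, ht2, hw2, ho2, hr2⟩ := ih hc S1 p2
      (by rw [hr1 _ (by simp [tr_inj]) (by simp [tr_inj]) (by simp [tr_inj]), q3])
      (by rw [hr1 _ (by simp [tr_inj]) (by simp [tr_inj]) (by simp [tr_inj]), q4])
      (by rw [hr1 _ (by simp [tr_inj]) (by simp [tr_inj]) (by simp [tr_inj]), q5])
      (by rw [hr1 _ (by simp [tr_inj]) (by simp [tr_inj]) (by simp [tr_inj]), q6])
      (fun i hi => by rw [read i hi]; exact hb i (by omega))
      (fun i j hj hi => hne i j hj (by omega))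
    refine ⟨_, S2, Exec.loop_pos (by rw [q2]; positivity) E1 E2, ?_, ?_, ?_, ?_⟩
    · rw [q2, add_mul]
      have : bits ((cnt + 1 : ℕ) : ℤ) ≤ B := hcnt
      omega
    · intro i hi
      rcases Nat.lt_succ_iff_lt_or_eq.1 hi with h | rfl
      · rw [hw2 i h, read i h]
      · rw [ho2 _ fun j hj h => ?_, hm1, Function.update_self]
        have := mul_right_cancel₀ hm₁ h
        omega
    · intro a ha
      rw [ho2 a fun i hi => ha i (by omega), hm1, Function.update_of_ne (ha cnt (by omega))]
    · intro r h2 h7 h8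
      rw [hr2 r h2 h7 h8, hr1 r h2 h7 h8]

/-- The descriptions of the memory layout of a wrapped statement: the number of input cells, the
spacing and first external offset, and the number, target and source of the output cells. -/
structure Layout where
  cells : Expr
  spacing : Expr
  offset : Expr
  outCells : Expr
  target : Expr
  source : Expr

/-- Compute the layout and spread out the input. -/
def Layout.prologue (l : Layout) : Prog :=
  .seq (l.cells.put 2) (.seq (l.spacing.put 3) (.seq (l.offset.put 4)
  (.seq (.const (tr 1) 0) (.seq (.arith .add (tr 1) (tr 4) (tr 1))
  (.seq (.const (tr 4) 0) (.seq (.const (tr 5) 1) (.seq (.const (tr 6) 0) (.seq copyCells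
  (.seq (.const (tr 0) 0) (.arith .add (tr 0) (tr 3) (tr 0)))))))))))

/-- Copy the output. -/
def Layout.epilogue (l : Layout) : Prog :=
  .seq (l.outCells.put 2) (.seq (.const (tr 3) 1) (.seq (l.target.put 4)
  (.seq (.const (tr 5) 0) (.seq (.arith .add (tr 5) (tr 0) (tr 5)) (.seq (l.source.put 6)
  copyCells)))))

/-- The program that spreads out the input, runs `st`, and copies the output. -/
def Layout.wrap (l : Layout) (st : Stm) : Prog :=
  .seq l.prologue (.seq (st.code 2) l.epilogue)

/-- The exponent of the polynomial that bounds the cost of a step of a wrapped statement. -/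
def Layout.wt (l : Layout) (st : Stm) : ℕ :=
  l.cells.wt + l.spacing.wt + l.offset.wt + l.outCells.wt + l.target.wt + l.source.wt + st.wt + 12

/-- The registers at the start. -/
def initReg (n : ℕ) (x : ℕ) : ℤ := if x = 0 then n else 0

theorem wt_margin {B v w : ℕ} (hv : v + 12 ≤ w) : 4096 * (B + 2) ^ v ≤ (B + 2) ^ w := by
  refine le_trans ?_ (pow_wt_mono hv)
  rw [pow_add, mul_comm]
  exact Nat.mul_le_mul_left _ (Nat.pow_le_pow_left (show 2 ≤ B + 2 by omega) 12)

theorem wt_copy {B w : ℕ} (hv : 12 ≤ w) : (B + 1 + 2) ^ 6 ≤ (B + 2) ^ w := by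
  calc (B + 1 + 2) ^ 6 ≤ ((B + 2) ^ 2) ^ 6 := Nat.pow_le_pow_left (by nlinarith) 6
    _ = (B + 2) ^ 12 := by ring
    _ ≤ _ := pow_wt_mono hv

theorem wt_linear {B w : ℕ} (hv : 12 ≤ w) : 2048 * (B + 2) ≤ (B + 2) ^ w := by
  refine le_trans ?_ (pow_wt_mono hv)
  rw [pow_succ]
  exact Nat.mul_le_mul_right _ (Nat.pow_le_pow_left (show 2 ≤ B + 2 by omega) 11)

/-- The original input cells are not erased. They lie at addresses below `cells ≤ off`, so their
residues are smaller than that of any external memory, and the memories from `off` on are blank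
because the input vanishes from `cells` on. -/
theorem Layout.models_prologue {n cells left : ℕ} {input : ℤ → ℤ} {Q off : ℤ} {S4 S5 : State}
    (hz : ∀ a, a < 0 ∨ (cells : ℤ) ≤ a → input a = 0)
    (hoff0 : 0 < off) (hcoff : cells ≤ off) (hoffQ : off + left < Q)
    (hur4 : ∀ x, S4.reg (ur x) = initReg n x) (hoff4 : S4.reg (tr 1) = off)
    (hw5 : ∀ i < cells, S5.mem (i * Q) = input i)
    (ho5 : ∀ a, (∀ i < cells, a ≠ (i : ℤ) * Q) → S5.mem a = input a)
    (hr5 : ∀ r, r ≠ tr 2 → r ≠ tr 7 → r ≠ tr 8 → S5.reg r = S4.reg r) :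
    Models Q ⟨initReg n, input, fun _ => 0, left⟩ ((S5.setReg (tr 0) 0).setReg (tr 0) Q) := by
  have hQ0 : 0 < Q := by omega
  have far : ∀ a c : ℤ, a ≠ 0 → 0 ≤ c → c < Q → input (a * Q + c) = 0 := by
    intro a c ha h0 h1
    apply hz
    rcases lt_or_gt_of_ne ha with h | h
    · left
      have : (a + 1) * Q ≤ 0 := mul_nonpos_of_nonpos_of_nonneg (by omega) hQ0.le
      rw [add_mul, one_mul] at this
      omega
    · right
      have : 1 * Q ≤ a * Q := mul_le_mul_of_nonneg_right (by omega) hQ0.le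
      omega
  have blank : ∀ a c : ℤ, off ≤ c → c ≤ off + left → S5.mem (a * Q + c) = 0 := by
    intro a c h1 h2
    rw [ho5 _ fun i _ => by
      simpa using cell_ne a i (c := c) (c' := 0) (by omega) (by omega) le_rfl hQ0 (by omega)]
    by_cases h : a = 0
    · rw [h, zero_mul, zero_add]; exact hz _ (Or.inr (by omega))
    · exact far a c h (by omega) (by omega)
  refine ⟨off, ⟨?_, ?_, ?_, ?_, ?_⟩, hoff0, hoffQ, ?_⟩
  · intro x
    simp only [setReg_reg, if_neg (ur_ne_tr x 0)]
    rw [hr5 _ (ur_ne_tr _ _) (ur_ne_tr _ _) (ur_ne_tr _ _), hur4]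
  · simp [setReg_reg]
  · simp only [setReg_reg, tr_inj, one_ne_zero, if_false]
    rw [hr5 _ (by simp [tr_inj]) (by simp [tr_inj]) (by simp [tr_inj]), hoff4]
  · intro a
    simp only [setReg_mem]
    by_cases ha : 0 ≤ a ∧ a < cells
    · have := hw5 a.toNat (by omega)
      rwa [Int.toNat_of_nonneg ha.1] at this
    · rw [hz a (by omega), ho5 _ fun i hi h => ?_]
      · by_cases h : a = 0
        · rw [h, zero_mul]; exact hz 0 (Or.inr (by omega))
        · simpa using far a 0 h le_rfl hQ0
      · have := mul_right_cancel₀ hQ0.ne' h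
        omega
  · intro a; exact blank a off le_rfl (by omega)
  · intro c h1 h2 a; exact blank a c h1.le h2

theorem Layout.exec_prologue (l : Layout) (st : Stm) {n cells left B : ℕ} {input : ℤ → ℤ}
    {Q off : ℤ} (hn : bits n ≤ B) (hin : ∀ a, bits (input a) ≤ B)
    (hz : ∀ a, a < 0 ∨ (cells : ℤ) ≤ a → input a = 0)
    (hcells : ∀ m, l.cells.Safe B ⟨initReg n, m, m, 0⟩ ∧ l.cells.val ⟨initReg n, m, m, 0⟩ = cells)
    (hQ : ∀ m, l.spacing.Safe B ⟨initReg n, m, m, 0⟩ ∧ l.spacing.val ⟨initReg n, m, m, 0⟩ = Q)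
    (hoff : ∀ m, l.offset.Safe B ⟨initReg n, m, m, 0⟩ ∧ l.offset.val ⟨initReg n, m, m, 0⟩ = off)
    (hQB : bits Q ≤ B) (hoff0 : 0 < off) (hcoff : cells ≤ off) (hoffQ : off + left < Q) :
    ∃ t S', Exec l.prologue (State.init n input) t S' ∧ 2 * t ≤ (2 * cells + 1) * (B + 2) ^ l.wt st ∧
      Models Q ⟨initReg n, input, fun _ => 0, left⟩ S' := by
  have hQ0 : 0 < Q := by omega
  have hoffB : bits off ≤ B := bits_lt_of_lt hoff0.le (by omega) hQB
  have hcB : bits (cells : ℤ) ≤ B := bits_lt_of_lt (by omega) (show (cells : ℤ) < Q by omega) hQB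
  -- While the layout is computed, the registers for spacing and offset still hold 0. Every address
  -- then collapses to 0, and the machine represents the constant memory `input 0`.
  obtain ⟨m, hm⟩ : ∃ m : ℤ → ℤ, m = fun _ => input 0 := ⟨_, rfl⟩
  have hB0 : Bdd B ⟨initReg n, m, m, 0⟩ := by
    refine ⟨fun x => ?_, fun a => by rw [hm]; exact hin 0⟩
    simp only [initReg]
    split
    · exact hn
    · rw [bits_zero]; omega
  have hS0 : Sees ⟨initReg n, m, m, 0⟩ 0 0 (State.init n input) := by
    refine ⟨?_, rfl, rfl, ?_, ?_⟩
    · intro x; simp [State.init, initReg, ur]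
    · intro a; simp [State.init, hm]
    · intro a; simp [State.init, hm]
  have hb0 : bits 0 ≤ B := by rw [bits_zero]; omega
  obtain ⟨-, t1, S1, E1, ht1, hm1, hv1, hS1, hr1⟩ :=
    l.cells.exec_put le_rfl hS0 hB0 hb0 hb0 (hcells m).1
  obtain ⟨-, t2, S2, E2, ht2, hm2, hv2, hS2, hr2⟩ :=
    l.spacing.exec_put (d := 3) (by omega) hS1 hB0 hb0 hb0 (hQ m).1
  obtain ⟨-, t3, S3, E3, ht3, hm3, hv3, hS3, hr3⟩ :=
    l.offset.exec_put (d := 4) (by omega) hS2 hB0 hb0 hb0 (hoff m).1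
  rw [(hcells m).2] at hv1
  rw [(hQ m).2] at hv2
  rw [(hoff m).2] at hv3
  have p2 : S3.reg (tr 2) = cells := by
    rw [hr3 _ (low_tr (by omega)), hr2 _ (low_tr (by omega)), hv1]
  have p3 : S3.reg (tr 3) = Q := by rw [hr3 _ (low_tr (by omega)), hv2]
  obtain ⟨S4, hS4⟩ : ∃ S4, S4 = ((((S3.setReg (tr 1) 0).setReg (tr 1) off).setReg (tr 4) 0).setReg
    (tr 5) 1).setReg (tr 6) 0 := ⟨_, rfl⟩
  have hmem4 : S4.mem = input := by rw [hS4]; simp [hm3, hm2, hm1, State.init]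
  have hur4 : ∀ x, S4.reg (ur x) = initReg n x := by
    intro x; rw [hS4]; simp [setReg_reg, ur_ne_tr, hS3.reg]
  have hoff4 : S4.reg (tr 1) = off := by rw [hS4]; simp [setReg_reg, tr_inj]
  obtain ⟨t5, S5, E5, ht5, hw5, ho5, hr5⟩ := exec_copyCells (B := B + 1) (cnt := cells) (m₁ := Q)
    (b₁ := 0) (m₂ := 1) (b₂ := 0) hQ0.ne' (by omega) (by omega) (by omega)
    (by rw [bits_one]; omega) (by omega) S4
    (by rw [hS4]; simp [setReg_reg, tr_inj, p2]) (by rw [hS4]; simp [setReg_reg, tr_inj, p3])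
    (by rw [hS4]; simp [setReg_reg, tr_inj]) (by rw [hS4]; simp [setReg_reg, tr_inj])
    (by rw [hS4]; simp [setReg_reg])
    (fun i _ => by rw [hmem4]; exact (hin _).trans (by omega))
    (by
      intro i j hj hi h
      have h1 : 1 * Q ≤ i * Q := mul_le_mul_of_nonneg_right (by omega) hQ0.le
      simp only [add_zero, mul_one] at h
      omega)
  simp only [add_zero, mul_one] at hw5 ho5
  rw [hmem4] at hw5 ho5
  have q0 : S5.reg (tr 3) = Q := by
    rw [hr5 _ (by simp [tr_inj]) (by simp [tr_inj]) (by simp [tr_inj]), hS4]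
    simp [setReg_reg, tr_inj, p3]
  have hM := Layout.models_prologue (left := left) hz hoff0 hcoff hoffQ hur4 hoff4 hw5 ho5 hr5
  have E5' : Exec copyCells (((((S3.setReg (tr 1) 0).setReg (tr 1)
      (Op.add.apply ((S3.setReg (tr 1) 0).reg (tr 4)) ((S3.setReg (tr 1) 0).reg (tr 1)))).setReg
      (tr 4) 0).setReg (tr 5) 1).setReg (tr 6) 0) t5 S5 := by
    rw [hS4] at E5
    simpa [setReg_reg, tr_inj, hv3, Op.apply] using E5
  refine ⟨_, _, Exec.seq E1 (Exec.seq E2 (Exec.seq E3 (Exec.seq (Exec.const _ _ _)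
    (Exec.seq (Exec.arith _ _ _ _ _) (Exec.seq (Exec.const _ _ _) (Exec.seq (Exec.const _ _ _)
    (Exec.seq (Exec.const _ _ _) (Exec.seq E5' (Exec.seq (Exec.const _ _ _)
    (Exec.arith _ _ _ _ _)))))))))), ?_, ?_⟩
  · simp only [setReg_reg, tr_inj, q0, hv3, bits_zero, bits_one, if_false,
      if_true, OfNat.ofNat_ne_one, OfNat.ofNat_ne_zero]
    have a1 := wt_margin (B := B) (show l.cells.wt + 12 ≤ l.wt st by unfold Layout.wt; omega)
    have a2 := wt_margin (B := B) (show l.spacing.wt + 12 ≤ l.wt st by unfold Layout.wt; omega)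
    have a3 := wt_margin (B := B) (show l.offset.wt + 12 ≤ l.wt st by unfold Layout.wt; omega)
    have a8 := wt_copy (B := B) (show 12 ≤ l.wt st by unfold Layout.wt; omega)
    have a10 := wt_linear (B := B) (show 12 ≤ l.wt st by unfold Layout.wt; omega)
    have b1 := Nat.mul_le_mul_left cells a8
    clear hz hcells hQ hoff hw5 ho5 hr5 hM hin hur4
    rw [add_mul, mul_assoc, one_mul]
    omega
  · simpa [setReg_reg, tr_inj, q0, Op.apply] using hM

theorem Layout.exec_epilogue (l : Layout) (st : Stm) {B : ℕ} {Q off : ℤ} {s : HState} {S : State}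
    (hS : Sees s Q off S) (hB : Bdd B s) (hQB : bits Q ≤ B) (hoffB : bits off ≤ B)
    {cnt : ℕ} {g b : ℤ} (hcnt : bits cnt ≤ B) (hg : bits g ≤ B) (hb : bits b ≤ B)
    (hpost : l.outCells.Safe B s ∧ l.outCells.val s = cnt ∧ l.target.Safe B s ∧
      l.target.val s = g ∧ l.source.Safe B s ∧ l.source.val s = b)
    (hout : ∀ i j : ℕ, j < i → i < cnt → (i : ℤ) + g ≠ (j + b) * Q) :
    ∃ t S', Exec l.epilogue S t S' ∧ 2 * t ≤ (2 * cnt + 1) * (B + 2) ^ l.wt st ∧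
      ∀ i < cnt, S'.mem (i + g) = s.mem (i + b) := by
  obtain ⟨c1, c2, c3, c4, c5, c6⟩ := hpost
  obtain ⟨-, t7, S7, E7, ht7, hm7, hv7, hS7, hr7⟩ :=
    l.outCells.exec_put le_rfl hS hB hQB hoffB c1
  obtain ⟨-, t8, S8, E8, ht8, hm8, hv8, hS8, hr8⟩ :=
    l.target.exec_put (d := 4) (by omega) (hS7.setReg_tr (d := 3) (by omega) 1) hB hQB hoffB c3
  obtain ⟨-, t9, S9, E9, ht9, hm9, hv9, hS9, hr9⟩ :=
    l.source.exec_put (d := 6) (by omega) ((hS8.setReg_tr (d := 5) (by omega) 0).setReg_tr (d := 5)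
      (by omega) Q) hB hQB hoffB c5
  rw [c2] at hv7
  rw [c4] at hv8
  rw [c6] at hv9
  have w2 : S9.reg (tr 2) = cnt := by
    rw [hr9 _ (low_tr (by omega))]
    simp only [setReg_reg, tr_inj, Nat.reduceEqDiff, if_false]
    rw [hr8 _ (low_tr (by omega))]
    simp [setReg_reg, tr_inj, hv7]
  have w3 : S9.reg (tr 3) = 1 := by
    rw [hr9 _ (low_tr (by omega))]
    simp only [setReg_reg, tr_inj, Nat.reduceEqDiff, if_false]
    rw [hr8 _ (low_tr (by omega))]
    simp [setReg_reg]
  have w4 : S9.reg (tr 4) = g := by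
    rw [hr9 _ (low_tr (by omega))]
    simp [setReg_reg, tr_inj, hv8]
  have w5 : S9.reg (tr 5) = Q := by
    rw [hr9 _ (low_tr (by omega)), setReg_reg, if_pos rfl]
  have hm9' : S9.mem = S.mem := by simp [hm9, hm8, hm7]
  obtain ⟨t10, S10, E10, ht10, hw10, -, -⟩ := exec_copyCells (B := B + 1) (cnt := cnt) (m₁ := 1)
    (b₁ := g) (m₂ := Q) (b₂ := b) one_ne_zero (by omega) (by rw [bits_one]; omega) (by omega)
    (by omega) (by omega) S9 w2 w3 w4 w5 hv9
    (fun i _ => by rw [hm9', hS.mem]; exact (hB.mem _).trans (by omega))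
    (by simpa using hout)
  have E9' : Exec (l.source.put 6) ((S8.setReg (tr 5) 0).setReg (tr 5)
      (Op.add.apply ((S8.setReg (tr 5) 0).reg (tr 0)) ((S8.setReg (tr 5) 0).reg (tr 5)))) t9 S9 := by
    simpa [setReg_reg, tr_inj, hS8.regQ, Op.apply] using E9
  refine ⟨_, S10, Exec.seq E7 (Exec.seq (Exec.const _ _ _)
    (Exec.seq E8 (Exec.seq (Exec.const _ _ _) (Exec.seq (Exec.arith _ _ _ _ _)
    (Exec.seq E9' E10))))), ?_, ?_⟩
  · simp only [setReg_reg, tr_inj, hS8.regQ, bits_zero, bits_one, if_false,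
      if_true, OfNat.zero_ne_ofNat]
    have a4 := wt_margin (B := B) (show l.outCells.wt + 12 ≤ l.wt st by unfold Layout.wt; omega)
    have a5 := wt_margin (B := B) (show l.target.wt + 12 ≤ l.wt st by unfold Layout.wt; omega)
    have a6 := wt_margin (B := B) (show l.source.wt + 12 ≤ l.wt st by unfold Layout.wt; omega)
    have a8 := wt_copy (B := B) (show 12 ≤ l.wt st by unfold Layout.wt; omega)
    have a10 := wt_linear (B := B) (show 12 ≤ l.wt st by unfold Layout.wt; omega)
    have b2 := Nat.mul_le_mul_left cnt a8
    rw [add_mul, mul_assoc, one_mul]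
    omega
  · intro i hi
    have := hw10 i hi
    rwa [mul_one, hm9', hS.mem] at this

theorem Layout.exec_wrap (l : Layout) (st : Stm) {n cells left k B : ℕ} {input : ℤ → ℤ} {Q off : ℤ}
    {Post : HState → Prop}
    (hn : bits n ≤ B) (hin : ∀ a, bits (input a) ≤ B)
    (hz : ∀ a, a < 0 ∨ (cells : ℤ) ≤ a → input a = 0)
    (hcells : ∀ m, l.cells.Safe B ⟨initReg n, m, m, 0⟩ ∧ l.cells.val ⟨initReg n, m, m, 0⟩ = cells)
    (hQ : ∀ m, l.spacing.Safe B ⟨initReg n, m, m, 0⟩ ∧ l.spacing.val ⟨initReg n, m, m, 0⟩ = Q)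
    (hoff : ∀ m, l.offset.Safe B ⟨initReg n, m, m, 0⟩ ∧ l.offset.val ⟨initReg n, m, m, 0⟩ = off)
    (hQB : bits Q ≤ B) (hoff0 : 0 < off) (hcoff : cells ≤ off) (hoffQ : off + left < Q)
    (hst : Tri Q B st ⟨initReg n, input, fun _ => 0, left⟩ k Post)
    {cnt : ℕ} {g b : ℤ} (hcnt : bits cnt ≤ B) (hg : bits g ≤ B) (hb : bits b ≤ B)
    (hpost : ∀ s, Post s → l.outCells.Safe B s ∧ l.outCells.val s = cnt ∧ l.target.Safe B s ∧
      l.target.val s = g ∧ l.source.Safe B s ∧ l.source.val s = b)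
    (hout : ∀ i j : ℕ, j < i → i < cnt → (i : ℤ) + g ≠ (j + b) * Q) :
    ∃ t S', Exec (l.wrap st) (State.init n input) t S' ∧
      t ≤ (cells + k + cnt + 1) * (B + 2) ^ l.wt st ∧
      ∃ s, Post s ∧ ∀ i < cnt, S'.mem (i + g) = s.mem (i + b) := by
  obtain ⟨t1, S1, E1, ht1, hM⟩ := l.exec_prologue st hn hin hz hcells hQ hoff hQB hoff0 hcoff hoffQ
  have hB1 : Bdd B ⟨initReg n, input, fun _ => 0, left⟩ := by
    refine ⟨fun x => ?_, hin⟩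
    simp only [initReg]
    split
    · exact hn
    · rw [bits_zero]; omega
  obtain ⟨t2, S2, s2, E2, ht2, -, ⟨off2, hS2, h20, h21, -⟩, hB2, hP2⟩ := hst 2 le_rfl _ hM hB1 hQB
  obtain ⟨t3, S3, E3, ht3, h3⟩ := l.exec_epilogue st hS2 hB2 hQB
    (bits_lt_of_lt h20.le (by omega) hQB) hcnt hg hb (hpost s2 hP2) hout
  refine ⟨_, S3, Exec.seq E1 (Exec.seq E2 E3), ?_, s2, hP2, h3⟩
  have a7 : (B + 2) ^ st.wt ≤ (B + 2) ^ l.wt st := pow_wt_mono (by unfold Layout.wt; omega)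
  have b3 := Nat.mul_le_mul_left k a7
  rw [add_mul, add_mul, add_mul, one_mul]
  rw [add_mul, mul_assoc, one_mul] at ht1 ht3
  omega

/-! ### Cuts, chains of sets, and orderings through a given set. -/

section Cuts

variable {n : ℕ} (G : Digraph (Fin n))

open Classical in
/-- The number of arcs that enter `S`. -/
noncomputable def cutSize (S : Finset (Fin n)) : ℕ :=
  (Finset.univ.filter fun e : Fin n × Fin n => G.Adj e.1 e.2 ∧ e.1 ∉ S ∧ e.2 ∈ S).card

/-- Holds arc by arc, by the cases of how the two ends lie in `S` and `T`. -/
theorem cutSize_submodular (S T : Finset (Fin n)) :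
    cutSize G (S ∩ T) + cutSize G (S ∪ T) ≤ cutSize G S + cutSize G T := by
  classical
  simp only [cutSize, Finset.card_filter, ← Finset.sum_add_distrib]
  refine Finset.sum_le_sum fun e _ => ?_
  by_cases h0 : G.Adj e.1 e.2 <;> by_cases h1 : e.1 ∈ S <;> by_cases h2 : e.1 ∈ T <;>
    by_cases h3 : e.2 ∈ S <;> by_cases h4 : e.2 ∈ T <;> simp [h0, h1, h2, h3, h4]

@[simp] theorem cutSize_empty : cutSize G ∅ = 0 := by simp [cutSize]

@[simp] theorem cutSize_univ : cutSize G Finset.univ = 0 := by simp [cutSize]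

theorem cutSize_le (S : Finset (Fin n)) : cutSize G S ≤ n * n := by
  classical
  refine (Finset.card_le_univ _).trans ?_
  simp

/-- The least total cut size of a chain of `m` sets that ends at `X`, in which every set arises from
the previous one by the insertion of a vertex outside of `L`. -/
noncomputable def chainCostAux (L : Finset (Fin n)) : ℕ → Finset (Fin n) → ℕ
  | 0, _ => 0
  | m + 1, X => cutSize G X + sInf {d | ∃ v ∈ X \ L, d = chainCostAux L m (X.erase v)}

/-- The least total cut size of a maximal chain from `L` to `X`, without `L` itself. -/
noncomputable def chainCost (L X : Finset (Fin n)) : ℕ := chainCostAux G L (X \ L).card X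

@[simp] theorem chainCost_self (L : Finset (Fin n)) : chainCost G L L = 0 := by
  simp [chainCost, chainCostAux]

theorem card_erase_sdiff {L X : Finset (Fin n)} {v : Fin n} (hv : v ∈ X \ L) :
    (X \ L).card = (X.erase v \ L).card + 1 := by
  rw [Finset.erase_sdiff_comm, Finset.card_erase_add_one hv]

theorem chainCost_eq {L X : Finset (Fin n)} {v : Fin n} (hv : v ∈ X \ L) :
    chainCost G L X = cutSize G X + sInf {d | ∃ w ∈ X \ L, d = chainCost G L (X.erase w)} := by
  have h : ∀ w ∈ X \ L, (X.erase w \ L).card = (X.erase v \ L).card := fun w hw => by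
    have h1 := card_erase_sdiff hw
    have h2 := card_erase_sdiff hv
    omega
  rw [chainCost, card_erase_sdiff hv, chainCostAux]
  congr 2
  ext d
  constructor
  · rintro ⟨w, hw, rfl⟩
    exact ⟨w, hw, by rw [chainCost, h w hw]⟩
  · rintro ⟨w, hw, rfl⟩
    exact ⟨w, hw, by rw [chainCost, h w hw]⟩

theorem chainCost_le {L X : Finset (Fin n)} {v : Fin n} (hv : v ∈ X \ L) :
    chainCost G L X ≤ cutSize G X + chainCost G L (X.erase v) := by
  rw [chainCost_eq G hv]
  have h : chainCost G L (X.erase v) ∈ {d | ∃ w ∈ X \ L, d = chainCost G L (X.erase w)} :=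
    ⟨v, hv, rfl⟩
  exact Nat.add_le_add_left (Nat.sInf_le h) _

theorem exists_chainCost_eq {L X : Finset (Fin n)} (h : (X \ L).Nonempty) :
    ∃ v ∈ X \ L, chainCost G L X = cutSize G X + chainCost G L (X.erase v) := by
  obtain ⟨v, hv⟩ := h
  have hne : {d | ∃ w ∈ X \ L, d = chainCost G L (X.erase w)}.Nonempty := ⟨_, v, hv, rfl⟩
  obtain ⟨w, hw, h⟩ := Nat.sInf_mem hne
  exact ⟨w, hw, by rw [chainCost_eq G hv, h]⟩

/-- Inserting the vertices of `X \ L` by increasing `f` is one of the competing chains; the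
induction removes the vertex with the largest value of `f`. -/
theorem chainCost_le_sum {L : Finset (Fin n)} {f : Fin n → ℕ} (hf : Function.Injective f) :
    ∀ (m : ℕ) (X : Finset (Fin n)), L ⊆ X → (X \ L).card = m →
      chainCost G L X ≤ ∑ v ∈ X \ L, cutSize G (L ∪ X.filter fun w => f w ≤ f v) := by
  intro m
  induction m with
  | zero =>
    intro X hLX h
    have : X = L := (Finset.sdiff_eq_empty_iff_subset.1 (Finset.card_eq_zero.1 h)).antisymm hLX
    simp [this]
  | succ m ih =>
    intro X hLX h
    obtain ⟨v, hv, hmax⟩ := Finset.exists_max_image (X \ L) f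
      (Finset.card_pos.1 (by omega))
    have hvX := (Finset.mem_sdiff.1 hv).1
    have hvL := (Finset.mem_sdiff.1 hv).2
    have h1 := card_erase_sdiff hv
    have h2 := ih (X.erase v) (fun w hw => Finset.mem_erase.2 ⟨fun e => hvL (e ▸ hw), hLX hw⟩)
      (by omega)
    rw [← Finset.add_sum_erase _ _ hv]
    have hX : L ∪ X.filter (fun w => f w ≤ f v) = X := by
      ext w
      simp only [Finset.mem_union, Finset.mem_filter]
      constructor
      · rintro (hw | hw)
        exacts [hLX hw, hw.1]
      · intro hw
        by_cases hL : w ∈ L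
        · exact Or.inl hL
        · exact Or.inr ⟨hw, hmax w (Finset.mem_sdiff.2 ⟨hw, hL⟩)⟩
    rw [hX]
    refine (chainCost_le G hv).trans (Nat.add_le_add_left (h2.trans (le_of_eq ?_)) _)
    rw [Finset.erase_sdiff_comm]
    refine Finset.sum_congr rfl fun u hu => ?_
    congr 2
    ext w
    simp only [Finset.mem_filter, Finset.mem_erase]
    have hu' := Finset.mem_erase.1 hu
    have hlt : f u < f v := lt_of_le_of_ne (hmax u hu'.2) fun e => hu'.1 (hf e)
    constructor
    · exact fun h => ⟨h.1.2, h.2⟩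
    · exact fun h => ⟨⟨fun e => by rw [e] at h; omega, h.1⟩, h.2⟩

theorem chainCost_le_card {L : Finset (Fin n)} (X : Finset (Fin n)) (h : L ⊆ X) :
    chainCost G L X ≤ n * (n * n) := by
  refine (chainCost_le_sum G Fin.val_injective _ X h rfl).trans
    ((Finset.sum_le_sum fun v _ => cutSize_le G _).trans ?_)
  rw [Finset.sum_const, smul_eq_mul]
  refine Nat.mul_le_mul_right _ ((Finset.card_le_univ _).trans ?_)
  simp

/-- The least value of an ordering that has `T` as the set of its first vertices. -/
noncomputable def cost (T : Finset (Fin n)) : ℕ :=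
  chainCost G ∅ T + chainCost G T Finset.univ

/-- The vertices at positions at most `i`. -/
def initialSet (π : Fin n ≃ Fin n) (i : ℕ) : Finset (Fin n) :=
  Finset.univ.filter fun v => position π v ≤ i

theorem mem_initialSet {π : Fin n ≃ Fin n} {i : ℕ} {v : Fin n} :
    v ∈ initialSet π i ↔ position π v ≤ i := by simp [initialSet]

theorem position_injective (π : Fin n ≃ Fin n) : Function.Injective (position π) :=
  fun _ _ h => π.injective (Fin.ext (Nat.succ_injective h))

theorem ncard_arcCut (π : Fin n ≃ Fin n) (i : ℕ) :
    (arcCut G π i).ncard = cutSize G (initialSet π i) := by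
  classical
  rw [cutSize, ← Set.ncard_coe_finset]
  congr 1
  ext e
  simp [arcCut, mem_initialSet]

theorem initialSet_card (π : Fin n ≃ Fin n) {i : ℕ} (hi : i ≤ n) : (initialSet π i).card = i := by
  have h : initialSet π i = (Finset.univ.filter fun v : Fin n => (v : ℕ) < i).map
      π.symm.toEmbedding := by
    ext v
    simp [mem_initialSet, position]
  rw [h, Finset.card_map, Fin.card_filter_val_lt, min_eq_right hi]

theorem initialSet_self (π : Fin n ≃ Fin n) : initialSet π n = Finset.univ := by
  ext v
  simp [mem_initialSet, position]

theorem sum_position (π : Fin n ≃ Fin n) (F : ℕ → ℕ) :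
    ∑ v : Fin n, F (position π v) = ∑ i ∈ Finset.range n, F (i + 1) := by
  rw [← Fin.sum_univ_eq_sum_range (fun i => F (i + 1)) n]
  exact Equiv.sum_comp π fun j => F ((j : ℕ) + 1)

/-- Position `n` contributes the cut of the full set, which is 0. With it the sum has one term for
each vertex. -/
theorem arrangementCost_eq (π : Fin n ≃ Fin n) :
    arrangementCost G π = ∑ i ∈ Finset.range n, cutSize G (initialSet π (i + 1)) := by
  rw [arrangementCost]
  rcases n with _ | n
  · simp
  · rw [Finset.sum_range_succ, initialSet_self, cutSize_univ, add_zero, add_tsub_cancel_right,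
      Finset.range_eq_Ico, Finset.sum_Ico_add' (fun i => cutSize G (initialSet π i)) 0 n 1]
    exact Finset.sum_congr rfl fun i _ => ncard_arcCut G π i

/-- The value of an ordering through `T`, obtained from `π`, against the value of `π`. -/
theorem cost_add_le (π : Fin n ≃ Fin n) (T : Finset (Fin n)) :
    cost G T + ∑ v : Fin n, (if v ∈ T then cutSize G (T ∪ initialSet π (position π v))
      else cutSize G (T ∩ initialSet π (position π v))) ≤ arrangementCost G π + n * cutSize G T := by
  have hf := position_injective π
  have h1 := chainCost_le_sum G hf _ T (Finset.empty_subset T) rfl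
  have h2 := chainCost_le_sum G hf _ Finset.univ (Finset.subset_univ T) rfl
  have e1 : ∀ v, (∅ : Finset (Fin n)) ∪ T.filter (fun w => position π w ≤ position π v) =
      T ∩ initialSet π (position π v) := fun v => by
    ext w; simp [mem_initialSet]
  have e2 : ∀ v, T ∪ Finset.univ.filter (fun w => position π w ≤ position π v) =
      T ∪ initialSet π (position π v) := fun v => rfl
  simp only [e1, Finset.sdiff_empty] at h1
  simp only [e2, ← Finset.compl_eq_univ_sdiff] at h2
  have h3 : ∑ v : Fin n, (if v ∈ T then cutSize G (T ∪ initialSet π (position π v))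
      else cutSize G (T ∩ initialSet π (position π v))) =
      ∑ v ∈ T, cutSize G (T ∪ initialSet π (position π v)) +
        ∑ v ∈ Tᶜ, cutSize G (T ∩ initialSet π (position π v)) := by
    rw [← Finset.sum_add_sum_compl T]
    refine congrArg₂ _ (Finset.sum_congr rfl fun v hv => if_pos hv)
      (Finset.sum_congr rfl fun v hv => if_neg (Finset.mem_compl.1 hv))
  -- Of the two cuts on the left, the chain through `T` uses the intersection for `v ∈ T` and the
  -- union for `v ∉ T`. The others form the extra sum in the statement.
  have h4 : ∑ v : Fin n, (cutSize G (T ∩ initialSet π (position π v)) +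
      cutSize G (T ∪ initialSet π (position π v))) ≤
      ∑ v : Fin n, (cutSize G T + cutSize G (initialSet π (position π v))) :=
    Finset.sum_le_sum fun v _ => cutSize_submodular G _ _
  rw [Finset.sum_add_distrib, Finset.sum_add_distrib,
    sum_position π fun i => cutSize G (initialSet π i), ← arrangementCost_eq, Finset.sum_const,
    Finset.card_univ, Fintype.card_fin, smul_eq_mul, ← Finset.sum_add_sum_compl T,
    ← Finset.sum_add_sum_compl T] at h4
  rw [h3, cost]
  omega

theorem cost_le (π : Fin n ≃ Fin n) (T : Finset (Fin n)) :
    cost G T ≤ arrangementCost G π + n * cutSize G T :=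
  (Nat.le_add_right _ _).trans (cost_add_le G π T)

theorem exists_arrangementCost_eq : ∃ π, arrangementCost G π = optArrangementCost G :=
  Nat.sInf_mem (Set.range_nonempty _)

/-- `T` has the least cut among the sets with `k` vertices and `u` vertices in `U`. -/
structure IsMinCut (k u : ℕ) (U T : Finset (Fin n)) : Prop where
  card : T.card = k
  card_inter : (T ∩ U).card = u
  le : ∀ S : Finset (Fin n), S.card = k → (S ∩ U).card = u → cutSize G T ≤ cutSize G S

/-- Within `r` rounds of guessing the size of the intersection with `U`, computing a minimum cut and
replacing `U` by the intersection, a set of cost at most `b` appears. -/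
def Wins (k b : ℕ) : ℕ → Finset (Fin n) → Prop
  | 0, _ => False
  | r + 1, U => ∃ u, (∃ S : Finset (Fin n), S.card = k ∧ (S ∩ U).card = u) ∧
      ∀ T, IsMinCut G k u U T → cost G T ≤ b ∨ Wins k b r (T ∩ U)

end Cuts

/-! ### The approximation guarantee. -/

section Analysis

variable {n : ℕ} {G : Digraph (Fin n)}

/-- The right guess is `u = |P ∩ U|`, which keeps `P` feasible. Since `P` avoids `L` and `U`
contains at least `γ` vertices of `L`, the new set `T ∩ U` has at least `γ` vertices fewer than `U`,
while it misses at most `E` further vertices of `L`. After `r` failures the size of `U` would be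
negative. -/
theorem wins_of_card_sdiff_le {k b : ℕ} {P L : Finset (Fin n)} (hP : P.card = k)
    (hd : Disjoint P L) {γ E : ℝ}
    (hbad : ∀ T : Finset (Fin n), T.card = k → cutSize G T ≤ cutSize G P → b < cost G T →
      ((L \ T).card : ℝ) ≤ E) :
    ∀ (r : ℕ) (U : Finset (Fin n)), (U.card : ℝ) < r * γ →
      ((L \ U).card : ℝ) + γ + r * E ≤ L.card → 0 ≤ E → Wins G k b r U := by
  intro r
  induction r with
  | zero =>
    intro U h _ _
    rw [Nat.cast_zero, zero_mul] at h
    exact absurd (Nat.cast_nonneg U.card) (not_le.2 h)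
  | succ r ih =>
    intro U hU hL hE
    refine ⟨(P ∩ U).card, ⟨P, hP, rfl⟩, fun T hT => ?_⟩
    by_cases hb : cost G T ≤ b
    · exact Or.inl hb
    refine Or.inr (ih _ ?_ ?_ hE)
    · have h1 : (P ∩ U).card + (L ∩ U).card ≤ U.card := by
        rw [← Finset.card_union_of_disjoint
          (hd.mono Finset.inter_subset_left Finset.inter_subset_left)]
        exact Finset.card_le_card (Finset.union_subset Finset.inter_subset_right
          Finset.inter_subset_right)
      have h2 : (L \ U).card + (L ∩ U).card = L.card := Finset.card_sdiff_add_card_inter L U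
      have h3 : ((P ∩ U).card : ℝ) + (L ∩ U).card ≤ U.card := by exact_mod_cast h1
      have h4 : ((L \ U).card : ℝ) + (L ∩ U).card = L.card := by exact_mod_cast h2
      have h5 : (0 : ℝ) ≤ r * E := by positivity
      rw [hT.card_inter]
      push_cast at hU hL
      linarith
    · have h1 : (L \ (T ∩ U)).card ≤ (L \ T).card + (L \ U).card := by
        refine (Finset.card_le_card fun v hv => ?_).trans (Finset.card_union_le _ _)
        simp only [Finset.mem_union, Finset.mem_sdiff, Finset.mem_inter] at hv ⊢
        tauto
      have h2 : ((L \ (T ∩ U)).card : ℝ) ≤ (L \ T).card + (L \ U).card := by exact_mod_cast h1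
      have h3 := hbad T hT.card (hT.le P hP rfl) (not_le.1 hb)
      push_cast at hL
      linarith

/-- For a vertex outside `T` among the last `k - f` of `π`, the prefix up to it omits fewer than `k
- f` vertices, so its intersection with `T` has middle size and a cut of at least `m`. `cost_add_le`
credits this cut to `T`. -/
theorem cost_add_card_sdiff_mul_le {f k m : ℕ} (hfk : f ≤ k) (hkf : k + f ≤ n)
    (hm : ∀ S : Finset (Fin n), f ≤ S.card → S.card + f ≤ n → m ≤ cutSize G S)
    (π : Fin n ≃ Fin n) {T : Finset (Fin n)} (hT : T.card = k) :
    cost G T + ((initialSet π (n - (k - f)))ᶜ \ T).card * m ≤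
      arrangementCost G π + n * cutSize G T := by
  refine le_trans (Nat.add_le_add_left ?_ _) (cost_add_le G π T)
  rw [← smul_eq_mul, ← Finset.sum_const]
  refine le_trans (Finset.sum_le_sum fun v hv => ?_)
    (Finset.sum_le_sum_of_subset (Finset.subset_univ ((initialSet π (n - (k - f)))ᶜ \ T)))
  simp only [Finset.mem_sdiff, Finset.mem_compl, mem_initialSet] at hv
  rw [if_neg hv.2]
  have h1 : position π v ≤ n := by unfold position; omega
  have h2 := initialSet_card π h1
  have h3 : (T ∩ initialSet π (position π v)).card ≤ T.card :=
    Finset.card_le_card Finset.inter_subset_left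
  have h4 := Finset.card_union_add_card_inter T (initialSet π (position π v))
  have h5 : (T ∪ initialSet π (position π v)).card ≤ n := by
    simpa using Finset.card_le_univ (T ∪ initialSet π (position π v))
  exact hm _ (by omega) (by omega)

theorem sum_middle_le (G : Digraph (Fin n)) (π : Fin n ≃ Fin n) {f : ℕ} (hf : 0 < f) :
    ∑ i ∈ Finset.Icc f (n - f), cutSize G (initialSet π i) ≤ arrangementCost G π := by
  rw [arrangementCost_eq, Finset.range_eq_Ico,
    Finset.sum_Ico_add' (fun i => cutSize G (initialSet π i)) 0 n 1]
  refine Finset.sum_le_sum_of_subset fun i hi => ?_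
  rw [Finset.mem_Icc] at hi
  rw [Finset.mem_Ico]
  omega

/-- If the value of `π` is at most `β * n * m`, but all cuts of middle position have size at least
`m`, then some cut close to the middle is not much larger than `m`. -/
theorem exists_cutSize_initialSet_le {f w m : ℕ} {β δ : ℝ} (hβ : 0 < β) (hδ : 0 ≤ δ)
    (π : Fin n ≃ Fin n) (hf0 : 0 < f)
    (hfn : 2 * f ≤ n) (hf : (f : ℝ) ≤ (1 - (β - δ)) * n / 2) (hfw : f + w ≤ n / 2)
    (hw2 : β * n / 8 ≤ w + 1)
    (hm : ∀ S : Finset (Fin n), f ≤ S.card → S.card + f ≤ n → m ≤ cutSize G S)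
    (hA : arrangementCost G π < β * (n * m)) :
    (β - δ) * (n * m) ≤ arrangementCost G π ∧ ∃ k ∈ Finset.Icc (n / 2 - w) (n / 2),
      β * cutSize G (initialSet π k) ≤ (β + 8 * δ) * m := by
  have hm0 : (0 : ℝ) ≤ m := Nat.cast_nonneg _
  have hsum : ∀ i ∈ Finset.Icc f (n - f), m ≤ cutSize G (initialSet π i) := fun i hi => by
    rw [Finset.mem_Icc] at hi
    refine hm _ ?_ ?_ <;> rw [initialSet_card π (by omega)] <;> omega
  have hcard : ((Finset.Icc f (n - f)).card : ℝ) = n - 2 * f + 1 := by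
    rw [Nat.card_Icc, show n - f + 1 - f = n + 1 - 2 * f by omega, Nat.cast_sub (by omega)]
    push_cast
    ring
  have hmid := sum_middle_le G π hf0
  have hlow : (β - δ) * (n * m) ≤ arrangementCost G π := by
    have h1 := Finset.card_nsmul_le_sum _ _ _ hsum
    rw [smul_eq_mul] at h1
    have h2 : (((Finset.Icc f (n - f)).card * m : ℕ) : ℝ) ≤ arrangementCost G π := by
      exact_mod_cast h1.trans hmid
    rw [Nat.cast_mul, hcard] at h2
    have h3 : (β - δ) * n * m ≤ (n - 2 * f + 1) * m :=
      mul_le_mul_of_nonneg_right (by linarith) hm0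
    linarith
  refine ⟨hlow, ?_⟩
  -- The window has at least `β * n / 8` positions and lies between `f` and `n - f`. An excess above
  -- `8 * δ / β * m` at each of them would add δnm to the lower bound (β - δ)nm and so reach βnm.
  by_contra! hcon
  have h1 : ∀ i ∈ Finset.Icc f (n - f), β * m +
      (if i ∈ Finset.Icc (n / 2 - w) (n / 2) then 8 * δ * m else 0) ≤
        β * cutSize G (initialSet π i) := fun i hi => by
    split_ifs with h
    · have := hcon i h
      linarith
    · have h3 : (m : ℝ) ≤ cutSize G (initialSet π i) := by exact_mod_cast hsum i hi
      have h4 := mul_le_mul_of_nonneg_left h3 hβ.le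
      linarith
  have h2 := Finset.sum_le_sum h1
  have h3 : Finset.Icc f (n - f) ∩ Finset.Icc (n / 2 - w) (n / 2) =
      Finset.Icc (n / 2 - w) (n / 2) := by
    refine Finset.inter_eq_right.2 fun i hi => ?_
    rw [Finset.mem_Icc] at hi ⊢
    omega
  rw [Finset.sum_add_distrib, Finset.sum_const, Finset.sum_ite_mem, h3, Finset.sum_const,
    nsmul_eq_mul, nsmul_eq_mul, hcard, Nat.card_Icc, ← Finset.mul_sum,
    show n / 2 + 1 - (n / 2 - w) = w + 1 by omega] at h2
  have h4 : ((∑ i ∈ Finset.Icc f (n - f), cutSize G (initialSet π i) : ℕ) : ℝ) ≤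
      arrangementCost G π := by exact_mod_cast hmid
  rw [Nat.cast_sum] at h4
  have h5 : β * n / 8 * (8 * δ * m) ≤ (w + 1 : ℕ) * (8 * δ * m) := by
    push_cast
    exact mul_le_mul_of_nonneg_right hw2 (by positivity)
  have h6 : β * (β * (n * m)) ≤ β * arrangementCost G π := by
    have h7 : (β - δ) * n * (β * m) ≤ (n - 2 * f + 1) * (β * m) :=
      mul_le_mul_of_nonneg_right (by linarith) (by positivity)
    have h8 := mul_le_mul_of_nonneg_left h4 hβ.le
    linarith
  exact absurd (le_of_mul_le_mul_left h6 hβ) (not_le.2 hA)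

/-- `δ` is the loss caused by the rational approximation of α. If the optimum is at least βnm, the
first round succeeds. Otherwise an optimal ordering has nearly constant cuts in the middle, and its
structure forces failing sets to contain nearly all of a long final segment. -/
theorem exists_wins (G : Digraph (Fin n)) {f b K : ℕ} {β δ : ℝ} (hβ : 0 < β) (hβ1 : β ≤ 1)
    (hδ : 0 ≤ δ) (hK : 16 < K * β) (hδK : 144 * δ * K ≤ β ^ 2)
    (hf : (f : ℝ) ≤ (1 - (β - δ)) * n / 2) (hn : f = 0 ∨ 8 ≤ β * n)
    (hb : (1 + 1 / β) * optArrangementCost G < b + 1) :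
    ∃ k, f ≤ k ∧ k + f ≤ n ∧ Wins G k b K Finset.univ := by
  classical
  obtain ⟨π, hπ⟩ := exists_arrangementCost_eq G
  have hK0 : 0 < K := by
    rcases Nat.eq_zero_or_pos K with rfl | h
    · norm_num at hK
    · exact h
  have hK16 : (16 : ℝ) < K := by nlinarith
  have hδβ : 8 * δ ≤ β := by nlinarith
  have hfn : 2 * f ≤ n := by
    have : (2 * f : ℝ) ≤ n := by nlinarith [(Nat.cast_nonneg n : (0 : ℝ) ≤ n)]
    exact_mod_cast this
  obtain ⟨S, hS, hmin⟩ := Finset.exists_min_image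
    (Finset.univ.filter fun S : Finset (Fin n) => f ≤ S.card ∧ S.card + f ≤ n) (cutSize G)
    ⟨initialSet π f, by
      rw [Finset.mem_filter, initialSet_card π (by omega)]
      exact ⟨Finset.mem_univ _, le_rfl, by omega⟩⟩
  have hS' := (Finset.mem_filter.1 hS).2
  have hm : ∀ S' : Finset (Fin n), f ≤ S'.card → S'.card + f ≤ n → cutSize G S ≤ cutSize G S' :=
    fun S' h1 h2 => hmin S' (Finset.mem_filter.2 ⟨Finset.mem_univ _, h1, h2⟩)
  set m := cutSize G S
  have hopt0 : (0 : ℝ) ≤ optArrangementCost G := Nat.cast_nonneg _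
  have hm0 : (0 : ℝ) ≤ m := Nat.cast_nonneg _
  -- In the good case, guess the size of a minimum middle cut; with `U` the full set the second
  -- guess is the same number.
  by_cases hA : β * (n * m) ≤ optArrangementCost G
  · refine ⟨S.card, hS'.1, hS'.2, ?_⟩
    obtain ⟨K, rfl⟩ : ∃ K', K = K' + 1 := ⟨K - 1, by omega⟩
    refine ⟨S.card, ⟨S, rfl, by simp⟩, fun T hT => Or.inl ?_⟩
    have h1 := cost_le G π T
    have h2 : cutSize G T ≤ m := hT.le S rfl (by simp)
    have h3 : (cost G T : ℝ) ≤ optArrangementCost G + n * m := by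
      rw [← hπ]
      exact_mod_cast h1.trans (Nat.add_le_add_left (Nat.mul_le_mul_left n h2) _)
    have h4 : (n * m : ℝ) ≤ 1 / β * optArrangementCost G := by
      rw [one_div, ← div_eq_inv_mul, le_div_iff₀ hβ]
      linarith
    have h5 : (cost G T : ℝ) < (b + 1 : ℕ) := by push_cast; linarith
    exact Nat.lt_succ_iff.1 (Nat.cast_lt.1 h5)
  rw [not_le] at hA
  -- For `f = 0` the empty set is admitted, so `m = 0` and the assumption on the optimum fails.
  have hf0 : 0 < f := by
    rcases Nat.eq_zero_or_pos f with rfl | h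
    · have h1 : m ≤ 0 := by
        have := hm ∅ (by simp) (by simp)
        rwa [cutSize_empty] at this
      have : m = 0 := by omega
      rw [this] at hA
      simp only [Nat.cast_zero, mul_zero] at hA
      linarith
    · exact h
  have hn8 : 8 ≤ β * n := hn.resolve_left (by omega)
  have hnm : (0 : ℝ) < n * m := by
    by_contra h
    nlinarith
  have hn0 : (0 : ℝ) < n := by
    by_contra h
    nlinarith
  have hmp : (0 : ℝ) < m := by
    by_contra h
    nlinarith
  -- The window width is small enough to stay above position `f` and to leave `k - f` of order n,
  -- but large enough for the averaging argument.
  set w := ⌊β * n / 8⌋₊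
  have hw1 : (w : ℝ) ≤ β * n / 8 := Nat.floor_le (by positivity)
  have hw2 : β * n / 8 < w + 1 := Nat.lt_floor_add_one _
  have hh : ((n : ℝ) - 1) / 2 ≤ (n / 2 : ℕ) := by
    have : n ≤ 2 * (n / 2) + 1 := by omega
    have : (n : ℝ) ≤ 2 * (n / 2 : ℕ) + 1 := by exact_mod_cast this
    linarith
  have hfw : f + w ≤ n / 2 := by
    have : (f + w : ℝ) ≤ (n / 2 : ℕ) := by nlinarith
    exact_mod_cast this
  rw [← hπ] at hA
  obtain ⟨hlow, k, hk, hck⟩ := exists_cutSize_initialSet_le hβ hδ π hf0 hfn hf hfw hw2.le hm hA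
  rw [hπ] at hA hlow
  rw [Finset.mem_Icc] at hk
  refine ⟨k, by omega, by omega, ?_⟩
  have hP : (initialSet π k).card = k := initialSet_card π (by omega)
  set L := (initialSet π (n - (k - f)))ᶜ with hLdef
  have hLc : L.card = k - f := by
    rw [hLdef, Finset.card_compl, initialSet_card π (by omega), Fintype.card_fin]
    omega
  have hLr : β * n / 8 ≤ L.card := by
    rw [hLc, Nat.cast_sub (by omega)]
    have : n / 2 ≤ k + w := by omega
    have : ((n / 2 : ℕ) : ℝ) ≤ k + w := by exact_mod_cast this
    nlinarith
  -- All rounds together lose at most half of the guaranteed `β * n / 8` vertices of `L`; the other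
  -- half is `γ`. The 144 in the hypothesis is 16 · 9.
  have hE : K * (9 * δ / β * n) ≤ β * n / 16 := by
    have : K * (9 * δ / β * n) = (144 * δ * K) * (n / (16 * β)) := by
      field_simp
      ring
    rw [this]
    calc (144 * δ * K) * (n / (16 * β)) ≤ β ^ 2 * (n / (16 * β)) :=
          mul_le_mul_of_nonneg_right hδK (by positivity)
      _ = β * n / 16 := by field_simp
  refine wins_of_card_sdiff_le (γ := β * n / 16) (E := 9 * δ / β * n) (L := L) hP ?_ ?_ K
    Finset.univ ?_ ?_ (by positivity)
  · rw [hLdef, disjoint_compl_right_iff]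
    intro v hv
    rw [mem_initialSet] at hv ⊢
    omega
  · intro T hT hTP hbT
    have h1 := cost_add_card_sdiff_mul_le (by omega) (by omega) hm π hT
    rw [hπ] at h1
    have h2 : (cost G T : ℝ) + (L \ T).card * m ≤ optArrangementCost G +
        n * cutSize G (initialSet π k) := by
      exact_mod_cast h1.trans (Nat.add_le_add_left (Nat.mul_le_mul_left n hTP) _)
    have h3 : (b + 1 : ℝ) ≤ cost G T := by exact_mod_cast hbT
    have h4 : ((L \ T).card : ℝ) * m ≤ n * cutSize G (initialSet π k) -
        1 / β * optArrangementCost G := by linarith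
    have h5 : β * (1 / β * optArrangementCost G) = optArrangementCost G := by field_simp
    have h6 : β * (((L \ T).card : ℝ) * m) ≤ 9 * δ * n * m := by
      have h7 := mul_le_mul_of_nonneg_left h4 hβ.le
      have h8 := mul_le_mul_of_nonneg_left hck hn0.le
      rw [mul_sub, h5] at h7
      linarith
    have h9 : β * ((L \ T).card : ℝ) ≤ 9 * δ * n := by
      refine le_of_mul_le_mul_right ?_ hmp
      linarith
    rw [div_mul_eq_mul_div, le_div_iff₀ hβ]
    linarith
  · rw [Finset.card_univ, Fintype.card_fin]
    nlinarith
  · have : L \ Finset.univ = ∅ := by simp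
    rw [this, Finset.card_empty, Nat.cast_zero]
    linarith

/-- The parameters of the algorithm: it looks at sets whose size lies between `f` and `n - f`, where
`f = p * n / q`. -/
theorem exists_parameters {α : ℝ} (hα₀ : 0 < α) (hα₁ : α < 1) :
    ∃ p q n₀ K : ℕ, 0 < q ∧ ∀ (n f : ℕ), f = (if n < n₀ then 0 else p * n / q) →
      f ≤ n ∧ (2 : ℝ) ^ (n - f) ≤ 2 ^ (n₀ + 1) * (2 : ℝ) ^ ((1 - α / 2) * n) ∧
      ∀ (G : Digraph (Fin n)) (b : ℕ), (1 + 1 / (1 - α)) * optArrangementCost G < b + 1 →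
        ∃ k, f ≤ k ∧ k + f ≤ n ∧ Wins G k b K Finset.univ := by
  set β := 1 - α with hβ
  have hβ0 : 0 < β := by linarith
  obtain ⟨K, hK⟩ := exists_nat_gt (16 / β)
  have hK' : 16 < K * β := by rwa [div_lt_iff₀ hβ0] at hK
  have hKp : (0 : ℝ) < K := lt_trans (by positivity) hK
  set δ₀ := β ^ 2 / (144 * K) with hδ₀
  have hδ₀p : 0 < δ₀ := by positivity
  -- Above α/2, so that the dynamic programs are fast enough; within `δ₀ / 2` of it, so that `δ = 2
  -- * r - α` is harmless for `K` rounds.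
  obtain ⟨r, hr1, hr2⟩ := exists_rat_btwn (show α / 2 < α / 2 + δ₀ / 2 by linarith)
  -- The analysis needs `8 ≤ β * n`; smaller graphs are solved with `f = 0`.
  obtain ⟨n₀, hn₀⟩ := exists_nat_gt (8 / β)
  have hr0 : 0 < r := by
    have : (0 : ℝ) < r := by linarith
    exact_mod_cast this
  have hq : (0 : ℝ) < r.den := by exact_mod_cast r.den_pos
  have hrpq : (r : ℝ) = (r.num.toNat : ℝ) / r.den := by
    have h1 : ((r.num.toNat : ℤ) : ℝ) = r.num := by
      rw [Int.toNat_of_nonneg (Rat.num_nonneg.2 hr0.le)]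
    rw [Int.cast_natCast] at h1
    rw [h1]
    exact_mod_cast (Rat.num_div_den r).symm
  set δ := 2 * r - α with hδ
  have hδ1 : 144 * δ * K ≤ β ^ 2 := by
    have h1 : δ ≤ δ₀ := by linarith
    have h2 : 144 * δ₀ * K = β ^ 2 := by rw [hδ₀]; field_simp
    nlinarith
  refine ⟨r.num.toNat, r.den, n₀, K, r.den_pos, fun n f hf => ?_⟩
  have hn : (0 : ℝ) ≤ n := Nat.cast_nonneg n
  have hfr : (f : ℝ) ≤ r * n := by
    rw [hf]
    split_ifs
    · rw [Nat.cast_zero]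
      have : (0 : ℝ) < r := by exact_mod_cast hr0
      positivity
    · refine Nat.cast_div_le.trans (le_of_eq ?_)
      rw [hrpq, Nat.cast_mul]
      ring
  have hK16 : (16 : ℝ) < K := by nlinarith
  have hδβ : δ ≤ β := by nlinarith
  have hfn : f ≤ n := by
    have : (f : ℝ) ≤ n := by nlinarith
    exact_mod_cast this
  refine ⟨hfn, ?_, fun G b hb => ?_⟩
  · rw [← Real.rpow_natCast, ← Real.rpow_natCast, ← Real.rpow_add (by norm_num)]
    refine Real.rpow_le_rpow_of_exponent_le (by norm_num) ?_
    rw [Nat.cast_sub hfn]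
    push_cast
    -- For small `n` the exponent is at most `n₀`; for large `n` rounding `r * n` down loses at most
    -- 1. Together this explains the factor `2 ^ (n₀ + 1)`.
    rcases lt_or_ge n n₀ with h | h
    · have h1 : (n : ℝ) ≤ n₀ := by exact_mod_cast h.le
      have h2 : (0 : ℝ) ≤ f := Nat.cast_nonneg f
      nlinarith
    · rw [if_neg (by omega)] at hf
      have h1 : (r * n : ℝ) ≤ f + 1 := by
        rw [hf, hrpq]
        have h2 := Nat.lt_div_mul_add (a := r.num.toNat * n) r.den_pos
        have h3 : (r.num.toNat * n : ℝ) ≤ (r.num.toNat * n / r.den : ℕ) * r.den + r.den := by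
          exact_mod_cast h2.le
        rw [div_mul_eq_mul_div, div_le_iff₀ hq]
        linarith
      have h4 : (0 : ℝ) ≤ n₀ := Nat.cast_nonneg n₀
      nlinarith
  · refine exists_wins G hβ0 (by linarith) (by linarith) hK' hδ1 ?_ ?_ hb
    · rw [hβ, hδ]
      linarith
    · rcases lt_or_ge n n₀ with h | h
      · exact Or.inl (by rw [hf, if_pos h])
      · refine Or.inr ?_
        have h1 : (n₀ : ℝ) ≤ n := by exact_mod_cast h
        rw [div_lt_iff₀ hβ0] at hn₀
        nlinarith

/-! ### Calculus for the values of expressions. -/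

instance : Add Expr := ⟨Expr.op .add⟩
instance : Sub Expr := ⟨Expr.op .sub⟩
instance : Mul Expr := ⟨Expr.op .mul⟩
instance : Div Expr := ⟨Expr.op .div⟩
instance (k : ℕ) : OfNat Expr k := ⟨Expr.num k⟩

/-- The expression `e` has the value `z`, and all intermediate quantities are within `B`. -/
structure Ev (B : ℕ) (s : HState) (b : ℕ → ℤ) (e : Expr) (z : ℤ) : Prop where
  ok : e.Ok B s b
  eq : e.eval s b = z

/-- `Ev` for an expression without free bound variables. -/
def Den (B : ℕ) (s : HState) (e : Expr) (z : ℤ) : Prop := ∀ b, Ev B s b e z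

namespace Ev

variable {B : ℕ} {s : HState} {b : ℕ → ℤ} {e f : Expr} {z w : ℤ}

theorem congr (h : Ev B s b e z) (hz : z = w) : Ev B s b e w := hz ▸ h

theorem num (z : ℤ) : Ev B s b (.num z) z := ⟨trivial, rfl⟩

theorem one : Ev B s b (1 : Expr) 1 := ⟨trivial, rfl⟩

theorem two : Ev B s b (2 : Expr) 2 := ⟨trivial, rfl⟩

theorem var {x : ℕ} (h : s.reg x = z) : Ev B s b (.var x) z := ⟨trivial, h⟩

theorem bv0 : Ev B s (push z b) (.bv 0) z := ⟨trivial, rfl⟩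

theorem bv1 : Ev B s (push w (push z b)) (.bv 1) z := ⟨trivial, rfl⟩

theorem add (h : Ev B s b e z) (h' : Ev B s b f w) : Ev B s b (e + f) (z + w) :=
  ⟨⟨h.ok, h'.ok⟩, congrArg₂ _ h.eq h'.eq⟩

theorem sub (h : Ev B s b e z) (h' : Ev B s b f w) : Ev B s b (e - f) (z - w) :=
  ⟨⟨h.ok, h'.ok⟩, congrArg₂ _ h.eq h'.eq⟩

theorem mul (h : Ev B s b e z) (h' : Ev B s b f w) : Ev B s b (e * f) (z * w) :=
  ⟨⟨h.ok, h'.ok⟩, congrArg₂ _ h.eq h'.eq⟩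

theorem div (h : Ev B s b e z) (h' : Ev B s b f w) : Ev B s b (e / f) (z / w) :=
  ⟨⟨h.ok, h'.ok⟩, congrArg₂ _ h.eq h'.eq⟩

theorem load (h : Ev B s b e z) (hz : s.mem z = w) : Ev B s b (.load e) w :=
  ⟨h.ok, by rw [Expr.eval, h.eq, hz]⟩

theorem xload (h : Ev B s b e z) (hz : s.ext z = w) (hw : bits w ≤ B) : Ev B s b (.xload e) w :=
  ⟨⟨h.ok, by rw [h.eq, hz]; exact hw⟩, by rw [Expr.eval, h.eq, hz]⟩

theorem pow {k : ℕ} (h : Ev B s b e z) (h' : Ev B s b f k) (hk : k ≤ B) :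
    Ev B s b (.pow e f) (z ^ k) :=
  ⟨⟨h.ok, h'.ok, by rw [h'.eq]; exact_mod_cast hk⟩, by
    rw [Expr.eval, h.eq, h'.eq, Int.toNat_natCast]⟩

theorem sum {m : ℕ} {F : ℕ → ℤ} (h : Ev B s b e m) (hm : m ≤ B)
    (hF : ∀ i < m, Ev B s (push (i : ℤ) b) f (F i)) :
    Ev B s b (.sum e f) (∑ i ∈ Finset.range m, F i) := by
  refine ⟨⟨h.ok, by rw [h.eq]; exact_mod_cast hm, fun i hi => (hF i ?_).ok⟩, ?_⟩
  · rw [h.eq] at hi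
    exact_mod_cast hi
  · rw [Expr.eval, h.eq, Int.toNat_natCast]
    exact Finset.sum_congr rfl fun i hi => (hF i (Finset.mem_range.1 hi)).eq

end Ev

section Rules

variable {Q : ℤ} {B : ℕ} {s : HState} {P : HState → Prop}

theorem Tri.assign_den {x : ℕ} {e : Expr} {z : ℤ} (h : Den B s e z) (hz : bits z ≤ B)
    (hP : P (s.setR x z)) : Tri Q B (_root_.assign x e) s 1 P := by
  have h' : e.val s = z := (h _).eq
  exact Tri.assign (h _).ok (by rwa [h']) (by rwa [h'])

theorem Tri.store_den {a e : Expr} {z w : ℤ} (ha : Den B s a z) (he : Den B s e w)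
    (hw : bits w ≤ B) (hP : P (s.setM z w)) : Tri Q B (_root_.store a e) s 1 P := by
  have ha' : a.val s = z := (ha _).eq
  have he' : e.val s = w := (he _).eq
  exact Tri.store (ha _).ok (he _).ok (by rwa [he']) (by rwa [ha', he'])

theorem Tri.xstore_den {a e : Expr} {z w : ℤ} (ha : Den B s a z) (he : Den B s e w)
    (hP : P (s.setX z w)) : Tri Q B (_root_.xstore a e) s 1 P := by
  have ha' : a.val s = z := (ha _).eq
  have he' : e.val s = w := (he _).eq
  exact Tri.xstore (ha _).ok (he _).ok (by rwa [ha', he'])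

theorem Tri.ifPos_den {e : Expr} {p q : Stm} {k : ℕ} {z : ℤ} (h : Den B s e z)
    (hp : 0 < z → Tri Q B p s k P) (hq : z ≤ 0 → Tri Q B q s k P) :
    Tri Q B (_root_.ifPos e p q) s (k + 1) P := by
  have h' : e.val s = z := (h _).eq
  exact Tri.ifPos (h _).ok (by rwa [h']) (by rwa [h'])

theorem Tri.forS_den {x : ℕ} {e : Expr} {body : Stm} {kb k m : ℕ} (I : ℕ → HState → Prop)
    (h : Den B s e m) (hb : bits m ≤ B) (h0 : I 0 s)
    (hstep : ∀ i < m, ∀ s', I i s' → Tri Q B body (s'.setR x i) kb (I (i + 1)))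
    (hk : m * (kb + 1) + 1 ≤ k) (hpost : ∀ s', I m s' → P s') :
    Tri Q B (_root_.forS x e body) s k P := by
  have h' : e.val s = m := (h _).eq
  refine Tri.forS I (h _).ok (by rwa [h']) h0 (fun i hi => hstep i ?_) ?_ ?_
  · rw [h'] at hi
    exact_mod_cast hi
  · rwa [h', Int.toNat_natCast]
  · rwa [h', Int.toNat_natCast]

theorem Tri.post {st : Stm} {k : ℕ} {P' : HState → Prop} (h : Tri Q B st s k P)
    (hP : ∀ s', P s' → P' s') : Tri Q B st s k P' := h.mono le_rfl hP

end Rules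

/-! ### Sets of vertices as binary numbers. -/

section Masks

variable {n : ℕ}

/-- The digit of `X` at position `j`. -/
def digit (X j : ℕ) : ℤ := if X.testBit j then 1 else 0

theorem digit_eq (X j : ℕ) :
    digit X j = (X : ℤ) / 2 ^ j - 2 * ((X : ℤ) / 2 ^ j / 2) := by
  have h : ((X / 2 ^ j % 2 : ℕ) : ℤ) = (X : ℤ) / 2 ^ j - 2 * ((X : ℤ) / 2 ^ j / 2) := by
    push_cast
    omega
  rw [← h, digit, Nat.testBit_eq_decide_div_mod_eq]
  have h2 := Nat.mod_two_eq_zero_or_one (X / 2 ^ j)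
  rcases h2 with h2 | h2 <;> simp [h2]

/-- The number with the binary digit `1` at the positions in `S`. -/
def mask (S : Finset (Fin n)) : ℕ := ∑ v ∈ S, 2 ^ (v : ℕ)

/-- The set of positions of the digits `1`. -/
def maskSet (n X : ℕ) : Finset (Fin n) := Finset.univ.filter fun v : Fin n => X.testBit v = true

theorem mem_maskSet {X : ℕ} {v : Fin n} : v ∈ maskSet n X ↔ X.testBit v = true := by
  simp [maskSet]

theorem testBit_mask (S : Finset (Fin n)) (j : ℕ) :
    (mask S).testBit j = true ↔ ∃ v ∈ S, (v : ℕ) = j := by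
  have h : mask S = ∑ i ∈ S.map Fin.valEmbedding, 2 ^ i := by simp [mask]
  rw [← Nat.mem_bitIndices, ← List.mem_toFinset, h, Finset.toFinset_bitIndices_sum_two_pow]
  simp

theorem maskSet_mask (S : Finset (Fin n)) : maskSet n (mask S) = S := by
  ext v
  rw [mem_maskSet, testBit_mask]
  constructor
  · rintro ⟨w, hw, h⟩
    rwa [← Fin.ext h]
  · exact fun h => ⟨v, h, rfl⟩

theorem mask_injective : Function.Injective (mask : Finset (Fin n) → ℕ) :=
  fun S T h => by rw [← maskSet_mask S, h, maskSet_mask]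

theorem mask_univ : mask (Finset.univ : Finset (Fin n)) = 2 ^ n - 1 := by
  rw [mask, Fin.sum_univ_eq_sum_range (fun i => 2 ^ i) n, Nat.geomSum_eq (le_refl 2)]
  simp

theorem mask_lt (S : Finset (Fin n)) : mask S < 2 ^ n := by
  have h : mask S ≤ mask (Finset.univ : Finset (Fin n)) :=
    Finset.sum_le_sum_of_subset (Finset.subset_univ S)
  rw [mask_univ] at h
  have := Nat.two_pow_pos n
  omega

theorem mask_empty : mask (∅ : Finset (Fin n)) = 0 := rfl

theorem mask_erase {S : Finset (Fin n)} {v : Fin n} (hv : v ∈ S) :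
    (mask (S.erase v) : ℤ) = mask S - 2 ^ (v : ℕ) := by
  have := Finset.sum_erase_add S (fun v : Fin n => 2 ^ (v : ℕ)) hv
  rw [mask, mask, ← this]
  push_cast
  ring

theorem mask_eq_sum (S : Finset (Fin n)) :
    (mask S : ℤ) = ∑ v : Fin n, if v ∈ S then 2 ^ (v : ℕ) else 0 := by
  rw [mask]
  push_cast
  simp

theorem mask_maskSet {X : ℕ} (hX : X < 2 ^ n) : mask (maskSet n X) = X := by
  refine Nat.eq_of_testBit_eq fun j => ?_
  rw [Bool.eq_iff_iff, testBit_mask]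
  constructor
  · rintro ⟨v, hv, rfl⟩
    exact mem_maskSet.1 hv
  · intro h
    have hj : j < n := by
      by_contra hj
      rw [Nat.testBit_lt_two_pow (hX.trans_le (Nat.pow_le_pow_right (by omega) (not_lt.1 hj)))] at h
      cases h
    exact ⟨⟨j, hj⟩, mem_maskSet.2 h, rfl⟩

theorem maskSet_mod (X : ℕ) : maskSet n (X % 2 ^ n) = maskSet n X := by
  ext v
  simp [mem_maskSet]

theorem digit_eq_ite (X : ℕ) (v : Fin n) : digit X v = if v ∈ maskSet n X then 1 else 0 := by
  simp [digit, mem_maskSet]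

theorem digit_mask (S : Finset (Fin n)) (v : Fin n) : digit (mask S) v = if v ∈ S then 1 else 0 := by
  rw [digit_eq_ite, maskSet_mask]

theorem sum_digit (X : ℕ) :
    ∑ v ∈ Finset.range n, digit X v = (maskSet n X).card := by
  rw [← Fin.sum_univ_eq_sum_range]
  simp [digit_eq_ite]

theorem sum_digit_mul_digit (X Y : ℕ) :
    ∑ v ∈ Finset.range n, digit X v * digit Y v = (maskSet n X ∩ maskSet n Y).card := by
  rw [← Fin.sum_univ_eq_sum_range (fun v => digit X v * digit Y v)]
  simp only [digit_eq_ite, ← ite_and, mul_ite, mul_one, mul_zero]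
  rw [Finset.sum_boole]
  congr 2
  ext v
  simp [and_comm]

end Masks

/-! ### The weight of a set and its evaluation on the machine. -/

section GraphExpr

variable {n : ℕ} (G : Digraph (Fin n))

open Classical in
/-- Register `0` holds `n`, and the memory holds the adjacency matrix of `G`. -/
structure HasGraph (B : ℕ) (s : HState) : Prop where
  reg : s.reg 0 = n
  le : n ≤ B
  mem : ∀ u v : Fin n, s.mem (u * n + v) = if G.Adj u v then 1 else 0

/-- The weight of a set: its cut, its size, and the size of its intersection with `U`. -/
noncomputable def weight (U S : Finset (Fin n)) : ℕ :=
  cutSize G S + (n + 1) ^ 2 * S.card + (n + 1) ^ 3 * (S ∩ U).card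

theorem weight_le (U S : Finset (Fin n)) : weight G U S ≤ (n + 1) ^ 4 := by
  have h1 := cutSize_le G S
  have h2 : S.card ≤ n := by simpa using Finset.card_le_univ S
  have h3 : (S ∩ U).card ≤ n := by simpa using Finset.card_le_univ (S ∩ U)
  have h4 := Nat.mul_le_mul_left ((n + 1) ^ 2) h2
  have h5 := Nat.mul_le_mul_left ((n + 1) ^ 3) h3
  have h6 : (n + 1) ^ 4 = (n + 1) ^ 2 + (n + 1) ^ 2 * n + (n + 1) ^ 3 * n := by ring
  have h7 : n * n ≤ (n + 1) ^ 2 := by nlinarith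
  unfold weight
  omega

/-- Cut, size and intersection are the digits of a mixed-radix expansion: the cut is below `(n + 1)
^ 2` and the size below `n + 1`, so the packing can be undone. -/
theorem weight_inj {U S : Finset (Fin n)} {c k u : ℕ} (hc : c ≤ n * n) (hk : k ≤ n)
    (h : weight G U S = c + (n + 1) ^ 2 * k + (n + 1) ^ 3 * u) :
    cutSize G S = c ∧ S.card = k ∧ (S ∩ U).card = u := by
  have h1 := cutSize_le G S
  have h2 : S.card ≤ n := by simpa using Finset.card_le_univ S
  have h3 : ∀ a b d : ℕ, a + (n + 1) ^ 2 * b + (n + 1) ^ 3 * d =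
      a + (n + 1) ^ 2 * (b + (n + 1) * d) := fun a b d => by ring
  have h4 : n * n < (n + 1) ^ 2 := by nlinarith
  rw [weight, h3, h3] at h
  have e1 := congrArg (· % (n + 1) ^ 2) h
  have e2 := congrArg (· / (n + 1) ^ 2) h
  simp only [Nat.add_mul_mod_self_left, Nat.mod_eq_of_lt (h1.trans_lt h4),
    Nat.mod_eq_of_lt (hc.trans_lt h4)] at e1
  simp only [Nat.add_mul_div_left _ _ (show 0 < (n + 1) ^ 2 by positivity),
    Nat.div_eq_of_lt (h1.trans_lt h4), Nat.div_eq_of_lt (hc.trans_lt h4), zero_add] at e2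
  have e3 := congrArg (· % (n + 1)) e2
  have e4 := congrArg (· / (n + 1)) e2
  simp only [Nat.add_mul_mod_self_left, Nat.mod_eq_of_lt (Nat.lt_succ_of_le h2),
    Nat.mod_eq_of_lt (Nat.lt_succ_of_le hk)] at e3
  simp only [Nat.add_mul_div_left _ _ (Nat.succ_pos n), Nat.div_eq_of_lt (Nat.lt_succ_of_le h2),
    Nat.div_eq_of_lt (Nat.lt_succ_of_le hk), zero_add] at e4
  exact ⟨e1, e3, e4⟩

open Classical in
theorem cutSize_maskSet (X : ℕ) : (cutSize G (maskSet n X) : ℤ) = ∑ u : Fin n, ∑ v : Fin n,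
    (if G.Adj u v then 1 else 0) * (1 - digit X u) * digit X v := by
  rw [cutSize, Finset.card_filter, Nat.cast_sum, Fintype.sum_prod_type]
  refine Finset.sum_congr rfl fun u _ => Finset.sum_congr rfl fun v _ => ?_
  simp only [digit_eq_ite]
  by_cases h1 : G.Adj u v <;> by_cases h2 : u ∈ maskSet n X <;> by_cases h3 : v ∈ maskSet n X <;>
    simp [h1, h2, h3]

theorem weight_maskSet (X U : ℕ) : (weight G (maskSet n U) (maskSet n X) : ℤ) =
    cutSize G (maskSet n X) + (n + 1) ^ 2 * ∑ v ∈ Finset.range n, digit X v +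
      (n + 1) ^ 3 * ∑ v ∈ Finset.range n, digit X v * digit U v := by
  rw [sum_digit, sum_digit_mul_digit, weight]
  push_cast
  rfl

/-- The weight is a quadratic form in the indicator of the set. -/
theorem weight_split {x y z X xy yz xz : ℕ} (U : ℕ)
    (hX : ∀ v, digit X v = digit x v + digit y v + digit z v)
    (hxy : ∀ v, digit xy v = digit x v + digit y v)
    (hyz : ∀ v, digit yz v = digit y v + digit z v)
    (hxz : ∀ v, digit xz v = digit x v + digit z v) :
    weight G (maskSet n U) (maskSet n X) + weight G (maskSet n U) (maskSet n x) +
      weight G (maskSet n U) (maskSet n y) + weight G (maskSet n U) (maskSet n z) =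
    weight G (maskSet n U) (maskSet n xy) + weight G (maskSet n U) (maskSet n yz) +
      weight G (maskSet n U) (maskSet n xz) := by
  have h : ((weight G (maskSet n U) (maskSet n X) + weight G (maskSet n U) (maskSet n x) +
      weight G (maskSet n U) (maskSet n y) + weight G (maskSet n U) (maskSet n z) : ℕ) : ℤ) =
    (weight G (maskSet n U) (maskSet n xy) + weight G (maskSet n U) (maskSet n yz) +
      weight G (maskSet n U) (maskSet n xz) : ℕ) := by
    push_cast
    simp only [weight_maskSet, cutSize_maskSet]
    -- The size terms are linear in the digits and cancel between the two sides. What remains is an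
    -- identity for the quadratic form of the cut, valid summand by summand.
    have e1 : ∀ A₁ A₂ A₃ A₄ A₅ A₆ A₇ a b c C₁ C₂ C₃ p q r s₁ s₂ : ℤ,
        A₁ + A₂ + A₃ + A₄ = A₅ + A₆ + A₇ →
        (A₁ + s₁ * (a + b + c) + s₂ * (p + q + r)) + (A₂ + s₁ * a + s₂ * p) +
          (A₃ + s₁ * b + s₂ * q) + (A₄ + s₁ * c + s₂ * r) =
        (A₅ + s₁ * (a + b) + s₂ * (p + q)) + (A₆ + s₁ * (b + c) + s₂ * (q + r)) +
          (A₇ + s₁ * (a + c) + s₂ * (p + r)) := by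
      intros
      linarith
    simp only [hX, hxy, hyz, hxz, add_mul _ _ (digit U _), Finset.sum_add_distrib]
    refine e1 _ _ _ _ _ _ _ _ _ _ 0 0 0 _ _ _ _ _ ?_
    simp only [← Finset.sum_add_distrib]
    refine Finset.sum_congr rfl fun u _ => Finset.sum_congr rfl fun v _ => ?_
    ring
  exact_mod_cast h

/-- The digit of `x` at position `v`. -/
def digitE (x v : Expr) : Expr := x / .pow 2 v - 2 * (x / .pow 2 v / 2)

/-- The number of vertices in `x`. -/
def cardE (x : Expr) : Expr := .sum (.var 0) (digitE x (.bv 0))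

/-- The number of arcs that enter `x`. -/
def cutE (x : Expr) : Expr := .sum (.var 0) (.sum (.var 0)
  (.load (.bv 1 * .var 0 + .bv 0) * (1 - digitE x (.bv 1)) * digitE x (.bv 0)))

/-- The weight of `x` with respect to `u`. -/
def weightE (u x : Expr) : Expr := cutE x + (.var 0 + 1) * (.var 0 + 1) * cardE x +
  (.var 0 + 1) * (.var 0 + 1) * (.var 0 + 1) *
    .sum (.var 0) (digitE x (.bv 0) * digitE u (.bv 0))

variable {G} {B : ℕ} {s : HState} {b : ℕ → ℤ}

theorem Ev.digitE {x v : Expr} {X j : ℕ} (hx : Ev B s b x X) (hv : Ev B s b v j) (hj : j ≤ B) :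
    Ev B s b (digitE x v) (digit X j) :=
  ((hx.div (Ev.two.pow hv hj)).sub
    (Ev.two.mul ((hx.div (Ev.two.pow hv hj)).div Ev.two))).congr (digit_eq X j).symm

theorem HasGraph.size (h : HasGraph G B s) : Ev B s b (.var 0) n := Ev.var h.reg

theorem Den.cardE (h : HasGraph G B s) {x : Expr} {X : ℕ} (hx : Den B s x X) :
    Den B s (cardE x) (maskSet n X).card := fun b =>
  (Ev.sum h.size h.le fun i hi => (hx _).digitE Ev.bv0 (by have := h.le; omega)).congr
    (sum_digit X)

theorem Den.cutE (h : HasGraph G B s) {x : Expr} {X : ℕ} (hx : Den B s x X) :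
    Den B s (cutE x) (cutSize G (maskSet n X)) := fun b => by
  classical
  have := h.le
  refine (Ev.sum (F := fun u => ∑ v ∈ Finset.range n, s.mem (u * n + v) * (1 - digit X u) *
    digit X v) h.size h.le fun u hu => Ev.sum h.size h.le fun v hv =>
    ((Ev.load ((Ev.bv1.mul h.size).add Ev.bv0) rfl).mul
      (Ev.one.sub ((hx _).digitE Ev.bv1 (by omega)))).mul
      ((hx _).digitE Ev.bv0 (by omega))).congr ?_
  rw [cutSize_maskSet, ← Fin.sum_univ_eq_sum_range (fun u : ℕ => ∑ v ∈ Finset.range n,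
    s.mem (u * n + v) * (1 - digit X u) * digit X v)]
  refine Finset.sum_congr rfl fun u _ => ?_
  rw [← Fin.sum_univ_eq_sum_range (fun v : ℕ => s.mem (u * n + v) * (1 - digit X u) * digit X v)]
  refine Finset.sum_congr rfl fun v _ => ?_
  rw [h.mem]

theorem Den.weightE (h : HasGraph G B s) {u x : Expr} {U X : ℕ} (hu : Den B s u U)
    (hx : Den B s x X) :
    Den B s (weightE u x) (weight G (maskSet n U) (maskSet n X)) := fun b => by
  have := h.le
  have h1 : Ev B s b (.var 0 + 1) ((n : ℤ) + 1) := h.size.add Ev.one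
  refine (((Den.cutE h hx b).add ((h1.mul h1).mul (Den.cardE h hx b))).add
    (((h1.mul h1).mul h1).mul (Ev.sum (F := fun i => digit X i * digit U i) h.size h.le
      fun i hi => ((hx _).digitE Ev.bv0 (by omega)).mul ((hu _).digitE Ev.bv0 (by omega))))).congr ?_
  rw [weight_maskSet, sum_digit]
  ring

end GraphExpr

/-! ### Reading a digit of a sum of powers; row-major indexing. -/

section Digits

/-- With fewer than `Λ` summands no carries occur. The lower powers add up to less than `Λ ^ w`, the
higher ones are multiples of `Λ ^ (w + 1)`, and the digit at `w` counts the indices with exponent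
`w`. -/
theorem pos_digit_iff {ι : Type*} (s : Finset ι) (e : ι → ℕ) {Λ : ℕ} (w : ℕ) (h : s.card < Λ) :
    0 < (∑ i ∈ s, Λ ^ e i) / Λ ^ w % Λ ↔ ∃ i ∈ s, e i = w := by
  classical
  have hΛ : 0 < Λ := by omega
  have hp : 0 < Λ ^ w := by positivity
  have h1 : ∑ i ∈ s, Λ ^ e i = ∑ i ∈ s.filter (e · < w), Λ ^ e i +
      ∑ i ∈ s.filter (¬ e · < w), Λ ^ e i := (Finset.sum_filter_add_sum_filter_not _ _ _).symm
  have h2 : ∑ i ∈ s.filter (¬ e · < w), Λ ^ e i =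
      ∑ i ∈ (s.filter (¬ e · < w)).filter (e · = w), Λ ^ e i +
      ∑ i ∈ (s.filter (¬ e · < w)).filter (¬ e · = w), Λ ^ e i :=
    (Finset.sum_filter_add_sum_filter_not _ _ _).symm
  have h3 : ∑ i ∈ (s.filter (¬ e · < w)).filter (e · = w), Λ ^ e i =
      Λ ^ w * (s.filter (e · = w)).card := by
    have h4 : (s.filter (¬ e · < w)).filter (e · = w) = s.filter (e · = w) := by
      ext i
      simp only [Finset.mem_filter]
      constructor
      · exact fun h => ⟨h.1.1, h.2⟩
      · exact fun h => ⟨⟨h.1, by omega⟩, h.2⟩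
    rw [h4, Finset.sum_congr rfl fun i hi => by rw [(Finset.mem_filter.1 hi).2], Finset.sum_const,
      smul_eq_mul, mul_comm]
  obtain ⟨m, hm⟩ : Λ ^ w * Λ ∣ ∑ i ∈ (s.filter (¬ e · < w)).filter (¬ e · = w), Λ ^ e i := by
    refine Finset.dvd_sum fun i hi => ?_
    simp only [Finset.mem_filter] at hi
    rw [← pow_succ]
    exact pow_dvd_pow _ (by omega)
  have h5 : ∑ i ∈ s.filter (e · < w), Λ ^ e i < Λ ^ w := by
    refine lt_of_mul_lt_mul_left (a := Λ) ?_ (Nat.zero_le _)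
    calc Λ * ∑ i ∈ s.filter (e · < w), Λ ^ e i
        ≤ ∑ i ∈ s.filter (e · < w), Λ ^ w := by
          rw [Finset.mul_sum]
          refine Finset.sum_le_sum fun i hi => ?_
          rw [← pow_succ']
          exact Nat.pow_le_pow_right hΛ (Finset.mem_filter.1 hi).2
      _ ≤ s.card * Λ ^ w := by
          rw [Finset.sum_const, smul_eq_mul]
          exact Nat.mul_le_mul_right _ (Finset.card_filter_le _ _)
      _ < Λ * Λ ^ w := Nat.mul_lt_mul_of_pos_right h hp
  rw [h1, h2, h3, hm, mul_assoc, ← mul_add, Nat.add_mul_div_left _ _ hp, Nat.div_eq_of_lt h5,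
    zero_add, Nat.add_mul_mod_self_left,
    Nat.mod_eq_of_lt ((Finset.card_filter_le _ _).trans_lt h), Finset.card_pos]
  simp [Finset.Nonempty]

/-- The two numbers occupy disjoint blocks of digits, so no carry arises. -/
theorem digit_add {a i : ℕ} (c : ℕ) (h : a < 2 ^ i) (v : ℕ) :
    digit (a + 2 ^ i * c) v = digit a v + digit (2 ^ i * c) v := by
  rw [digit, digit, digit, add_comm a, Nat.testBit_two_pow_mul_add _ h, Nat.testBit_two_pow_mul]
  by_cases hv : v < i
  · simp [hv]
  · have := Nat.testBit_lt_two_pow (h.trans_le (Nat.pow_le_pow_right (by omega) (not_lt.1 hv)))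
    simp [hv, this, not_lt.1 hv]

theorem sum_sum_ite_eq {N : ℕ} (a z : ℤ) (F : ℤ → ℤ) :
    ∑ i : Fin N, ∑ j : Fin N, (if a = z + ((i : ℤ) * N + j) then F ((i : ℤ) * N + j) else 0) =
      if z ≤ a ∧ a < z + (N : ℤ) * N then F (a - z) else 0 := by
  have h1 : ∀ i j : Fin N, ((i : ℤ) * N + j) = ((finProdFinEquiv (i, j) : Fin (N * N)) : ℕ) := by
    intro i j
    simp [finProdFinEquiv]
    ring
  have h2 : ∑ i : Fin N, ∑ j : Fin N,
      (if a = z + ((i : ℤ) * N + j) then F ((i : ℤ) * N + j) else 0) =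
      ∑ t : Fin (N * N), if a = z + (t : ℕ) then F (t : ℕ) else 0 := by
    rw [← Equiv.sum_comp finProdFinEquiv, Fintype.sum_prod_type]
    exact Finset.sum_congr rfl fun i _ => Finset.sum_congr rfl fun j _ => by rw [h1]
  rw [h2, Fin.sum_univ_eq_sum_range (fun t : ℕ => if a = z + (t : ℤ) then F t else 0)]
  split_ifs with h
  · rw [Finset.sum_eq_single (a - z).toNat]
    · rw [if_pos (by omega), Int.toNat_of_nonneg (by omega)]
    · exact fun b _ hb => if_neg (by omega)
    · intro hb
      rw [Finset.mem_range] at hb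
      have : (((N * N : ℕ) : ℤ)) = N * N := by push_cast; rfl
      omega
  · refine Finset.sum_eq_zero fun t ht => if_neg fun e => h ?_
    rw [Finset.mem_range] at ht
    have : (((N * N : ℕ) : ℤ)) = N * N := by push_cast; rfl
    omega

theorem matrixInput_eq {N : ℕ} {A B : Matrix (Fin N) (Fin N) ℤ} (EA EB : ℤ → ℤ)
    (hA : ∀ i j, A i j = EA ((i : ℤ) * N + j)) (hB : ∀ i j, B i j = EB ((i : ℤ) * N + j)) (a : ℤ) :
    matrixInput A B a = (if 0 ≤ a ∧ a < (N : ℤ) * N then EA a else 0) +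
      if (N : ℤ) * N ≤ a ∧ a < (N : ℤ) * N + N * N then EB (a - N * N) else 0 := by
  have h := sum_sum_ite_eq (N := N) a 0 EA
  simp only [zero_add, sub_zero] at h
  rw [← h, ← sum_sum_ite_eq a (N * N) EB, matrixInput]
  simp only [hA, hB, Finset.sum_add_distrib]

end Digits

section NatExpr

variable {B : ℕ} {s : HState} {b : ℕ → ℤ} {e f : Expr} {x y : ℕ}

/-- The remainder. -/
def modE (e f : Expr) : Expr := e - f * (e / f)

namespace Ev

theorem nadd (h : Ev B s b e x) (h' : Ev B s b f y) : Ev B s b (e + f) (x + y : ℕ) :=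
  (h.add h').congr (by push_cast; rfl)

theorem nmul (h : Ev B s b e x) (h' : Ev B s b f y) : Ev B s b (e * f) (x * y : ℕ) :=
  (h.mul h').congr (by push_cast; rfl)

theorem ndiv (h : Ev B s b e x) (h' : Ev B s b f y) : Ev B s b (e / f) (x / y : ℕ) :=
  (h.div h').congr (by push_cast; rfl)

theorem nsub (h : Ev B s b e x) (h' : Ev B s b f y) (hle : y ≤ x) :
    Ev B s b (e - f) (x - y : ℕ) :=
  (h.sub h').congr (by push_cast [hle]; rfl)

theorem nmod (h : Ev B s b e x) (h' : Ev B s b f y) : Ev B s b (modE e f) (x % y : ℕ) :=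
  (h.sub (h'.mul (h.div h'))).congr (by rw [Int.natCast_mod, Int.emod_def])

theorem npow (h : Ev B s b e x) (h' : Ev B s b f y) (hy : y ≤ B) :
    Ev B s b (.pow e f) (x ^ y : ℕ) :=
  (h.pow h' hy).congr (by push_cast; rfl)

theorem none : Ev B s b (1 : Expr) (1 : ℕ) := ⟨trivial, rfl⟩

theorem ntwo : Ev B s b (2 : Expr) (2 : ℕ) := ⟨trivial, rfl⟩

theorem nthree : Ev B s b (3 : Expr) (3 : ℕ) := ⟨trivial, rfl⟩

end Ev

end NatExpr

/-! ### Minimum cuts by matrix multiplication: the encoding. -/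

section Search

/-- `n + 1` -/
def succE : Expr := .var 0 + 1

/-- `(n + 1) ^ 4` -/
def fourthE : Expr := succE * succE * (succE * succE)

/-- Exponents of the entries of the first matrix. -/
def expAE : Expr := weightE (.var 1) (.var 6 / .var 5 + .var 5 * modE (.var 6) (.var 5)) + fourthE -
  weightE (.var 1) (.var 6 / .var 5)

/-- Exponents of the entries of the second matrix. -/
def expBE : Expr := weightE (.var 1) (.var 5 * (.var 6 / .var 5) +
    .var 5 * .var 5 * modE (.var 6) (.var 5)) + fourthE -
  weightE (.var 1) (.var 5 * (.var 6 / .var 5))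

/-- The weight that candidate `r` looks for. -/
def targetE (r : Expr) : Expr := .var 0 * .var 0 - r / (.var 5 * .var 5) +
  succE * succE * .var 2 + succE * succE * succE * .var 3

/-- The low part of the sets that belong to candidate `r`. -/
def lowE (r : Expr) : Expr := modE (r / .var 5) (.var 5)

/-- The high part of the sets that belong to candidate `r`. -/
def highE (r : Expr) : Expr := .var 5 * .var 5 * modE r (.var 5)

/-- The position of the digit of the product that decides about candidate `r`. -/
def expWE (r : Expr) : Expr := targetE r + 2 * fourthE + weightE (.var 1) (highE r) -
  weightE (.var 1) (lowE r + highE r)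

/-- The digit of the product that decides about candidate `r`. -/
def testE (r : Expr) : Expr := modE (.xload (2 * (.var 5 * .var 5) +
  (lowE r * .var 5 + modE r (.var 5))) / .pow (2 * .var 5) (expWE r)) (2 * .var 5)

/-- Write the two matrices. -/
def fill : Stm := forS 6 (.var 5 * .var 5)
  (xstore (.var 6) (.pow (2 * .var 5) expAE) ;;
    xstore (.var 5 * .var 5 + .var 6) (.pow (2 * .var 5) expBE))

/-- Find the last successful candidate. -/
def scan : Stm := forS 6 ((.var 0 * .var 0 + 1) * (.var 5 * .var 5))
  (ifPos (testE (.var 6)) (assign 7 (.var 6)) skipS)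

/-- The set that belongs to the candidate in register `7` and the middle part in register `8`. -/
def setE : Expr := lowE (.var 7) + .var 5 * .var 8 + highE (.var 7)

/-- Find the set that belongs to the last successful candidate. -/
def decode : Stm := ifPos (.var 7 + 1) (forS 8 (.var 5)
  (ifPos (1 - (weightE (.var 1) setE - targetE (.var 7)) * (weightE (.var 1) setE - targetE (.var 7)))
    (assign 4 (modE setE (.pow 2 (.var 0)))) skipS)) skipS

/-- Put into register `4` a minimum cut for the sizes in the registers `2`, `3` and the set in
register `1`, with the help of the program `p` for matrix multiplication. -/
def search (p : Prog) : Stm :=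
  assign 5 (.pow 2 ((.var 0 + 2) / 3)) ;; assign 7 (0 - 1) ;; fresh ;; fill ;; runS p 5 ;; scan ;;
    decode

variable {n : ℕ} (G : Digraph (Fin n))

/-- The registers hold the parameters of a search. -/
structure Ready (B N h U k u : ℕ) (s : HState) : Prop where
  graph : HasGraph G B s
  regU : s.reg 1 = U
  regk : s.reg 2 = k
  regu : s.reg 3 = u
  regN : s.reg 5 = N
  hN : N = 2 ^ h
  hn : n ≤ 3 * h
  hh : h ≤ n
  hk : k ≤ n
  hu : u ≤ n
  hB : 8 * (n + 1) ^ 5 ≤ B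

/-- The weight of a number. -/
noncomputable def mweight (U X : ℕ) : ℕ := weight G (maskSet n U) (maskSet n X)

/-- Exponents of the entries of the first matrix. -/
noncomputable def expA (U N i : ℕ) : ℕ :=
  mweight G U (i / N + N * (i % N)) + (n + 1) ^ 4 - mweight G U (i / N)

/-- Exponents of the entries of the second matrix. -/
noncomputable def expB (U N i : ℕ) : ℕ :=
  mweight G U (N * (i / N) + N * N * (i % N)) + (n + 1) ^ 4 - mweight G U (N * (i / N))

/-- The weight that candidate `i` looks for. -/
def target (n N k u i : ℕ) : ℕ :=
  n * n - i / (N * N) + (n + 1) ^ 2 * k + (n + 1) ^ 3 * u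

/-- The position of the digit of the product that decides about candidate `i`. -/
noncomputable def expW (U N k u i : ℕ) : ℕ :=
  target n N k u i + 2 * (n + 1) ^ 4 + mweight G U (N * N * (i % N)) -
    mweight G U (i / N % N + N * N * (i % N))

/-- Candidate `i` is successful with the middle part `y`. -/
def Hit (U N k u i y : ℕ) : Prop :=
  mweight G U (i / N % N + N * y + N * N * (i % N)) = target n N k u i

/-- The entries of the product. -/
noncomputable def product (U N i : ℕ) : ℕ := ∑ y ∈ Finset.range N,
  (2 * N) ^ (expA G U N (i / N % N * N + y) + expB G U N (y * N + i % N))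

variable {G} {B N h U k u : ℕ} {s s' : HState}

theorem mweight_le (U X : ℕ) : mweight G U X ≤ (n + 1) ^ 4 := weight_le G _ _

theorem target_le {N i : ℕ} (hk : k ≤ n) (hu : u ≤ n) : target n N k u i ≤ (n + 1) ^ 4 := by
  have h4 := Nat.mul_le_mul_left ((n + 1) ^ 2) hk
  have h5 := Nat.mul_le_mul_left ((n + 1) ^ 3) hu
  have h6 : (n + 1) ^ 4 = (n + 1) ^ 2 + (n + 1) ^ 2 * n + (n + 1) ^ 3 * n := by ring
  have h7 : n * n ≤ (n + 1) ^ 2 := by nlinarith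
  have h8 : n * n - i / (N * N) ≤ n * n := Nat.sub_le _ _
  unfold target
  omega

/-- `weight_split` isolates the terms that involve `y`: those in x and y go to the first exponent,
those in y and z to the second, and the rest to `expW`. The summands `(n + 1) ^ 4` exceed every
weight and prevent truncated subtraction. -/
theorem hit_iff {N h i y : ℕ} (hN : N = 2 ^ h) (hy : y < N) :
    Hit G U N k u i y ↔ expA G U N (i / N % N * N + y) + expB G U N (y * N + i % N) =
      expW G U N k u i := by
  have hN0 : 0 < N := by rw [hN]; positivity
  have hx : i / N % N < N := Nat.mod_lt _ hN0
  have hz : i % N < N := Nat.mod_lt _ hN0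
  generalize hxe : i / N % N = x at *
  generalize hze : i % N = z at *
  have e1 : ∀ a c, c < N → (a * N + c) / N = a := fun a c hc => by
    rw [mul_comm, Nat.mul_add_div hN0, Nat.div_eq_of_lt hc, add_zero]
  have e2 : ∀ a c, c < N → (a * N + c) % N = c := fun a c hc => by
    rw [mul_comm, Nat.mul_add_mod, Nat.mod_eq_of_lt hc]
  rw [Hit, expA, expB, expW, hxe, hze, e1 x y hy, e2 x y hy, e1 y z hz, e2 y z hz]
  -- Since `N` is a power of 2, the parts `x`, `N * y` and `N * N * z` use disjoint digits.
  have hNN : N * N = 2 ^ (2 * h) := by rw [hN, two_mul, pow_add]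
  have d1 : ∀ v, digit (x + N * y) v = digit x v + digit (N * y) v := fun v => by
    rw [hN] at hx ⊢; exact digit_add y hx v
  have hxy : x + N * y < 2 ^ (2 * h) := by
    rw [← hNN]
    have := Nat.mul_le_mul_left N (Nat.succ_le_of_lt hy)
    rw [Nat.mul_succ] at this
    omega
  have d2 : ∀ v, digit (x + N * y + N * N * z) v = digit x v + digit (N * y) v +
      digit (N * N * z) v := fun v => by
    rw [← d1, hNN]; exact digit_add z hxy v
  have hxx : x < 2 ^ (2 * h) := by omega
  have hyy : N * y < 2 ^ (2 * h) := by omega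
  have d3 : ∀ v, digit (N * y + N * N * z) v = digit (N * y) v + digit (N * N * z) v := fun v => by
    rw [hNN]; exact digit_add z hyy v
  have d4 : ∀ v, digit (x + N * N * z) v = digit x v + digit (N * N * z) v := fun v => by
    rw [hNN]; exact digit_add z hxx v
  have hs := weight_split G U d2 d1 d3 d4
  change mweight G U _ + mweight G U _ + mweight G U _ + mweight G U _ =
    mweight G U _ + mweight G U _ + mweight G U _ at hs
  have b1 := mweight_le (G := G) U x
  have b2 := mweight_le (G := G) U (N * y)
  have b3 := mweight_le (G := G) U (x + N * N * z)
  omega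

theorem expA_le (U N i : ℕ) : expA G U N i ≤ 2 * (n + 1) ^ 4 := by
  have := mweight_le (G := G) U (i / N + N * (i % N))
  unfold expA
  omega

theorem expB_le (U N i : ℕ) : expB G U N i ≤ 2 * (n + 1) ^ 4 := by
  have := mweight_le (G := G) U (N * (i / N) + N * N * (i % N))
  unfold expB
  omega

theorem expW_le {N i : ℕ} (hk : k ≤ n) (hu : u ≤ n) : expW G U N k u i ≤ 4 * (n + 1) ^ 4 := by
  have h1 := mweight_le (G := G) U (N * N * (i % N))
  have h2 := target_le (N := N) (i := i) hk hu
  unfold expW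
  omega

theorem pos_test_iff {N h i : ℕ} (hN : N = 2 ^ h) :
    0 < product G U N i / (2 * N) ^ expW G U N k u i % (2 * N) ↔ ∃ y < N, Hit G U N k u i y := by
  have hN0 : 0 < N := by rw [hN]; positivity
  -- The base `2 * N` exceeds the number `N` of summands.
  rw [product, pos_digit_iff _ _ _ (by rw [Finset.card_range]; omega)]
  constructor
  · rintro ⟨y, hy, h⟩
    exact ⟨y, Finset.mem_range.1 hy, (hit_iff hN (Finset.mem_range.1 hy)).2 h⟩
  · rintro ⟨y, hy, h⟩
    exact ⟨y, Finset.mem_range.2 hy, (hit_iff hN hy).1 h⟩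

/-- This is the source of the requirement `8 * (n + 1) ^ 5 ≤ B`: matrix entries and entries of the
product fit into `B` bits. -/
theorem pow_lt_of_exponent {h e B : ℕ} (hh : h ≤ n) (he : e ≤ 4 * (n + 1) ^ 4)
    (hB : 8 * (n + 1) ^ 5 ≤ B) : 2 ^ h * (2 * 2 ^ h) ^ e < 2 ^ B := by
  rw [← pow_succ', ← pow_mul, ← pow_add]
  refine Nat.pow_lt_pow_right (by omega) ?_
  have h1 : (h + 1) * e ≤ (n + 1) * (4 * (n + 1) ^ 4) := Nat.mul_le_mul (by omega) he
  have h2 : (n + 1) * (4 * (n + 1) ^ 4) = 4 * (n + 1) ^ 5 := by ring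
  have h3 : n + 1 ≤ (n + 1) ^ 5 := Nat.le_self_pow (by omega) _
  omega

theorem product_lt {N i : ℕ} (hN : N = 2 ^ h) (hh : h ≤ n) (hB : 8 * (n + 1) ^ 5 ≤ B) :
    product G U N i < 2 ^ B := by
  refine lt_of_le_of_lt ?_ (pow_lt_of_exponent hh le_rfl hB)
  rw [← hN, product]
  refine (Finset.sum_le_card_nsmul _ _ ((2 * N) ^ (4 * (n + 1) ^ 4)) fun y _ => ?_).trans ?_
  · have h1 := expA_le (G := G) U N (i / N % N * N + y)
    have h2 := expB_le (G := G) U N (y * N + i % N)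
    exact Nat.pow_le_pow_right (by rw [hN]; positivity) (by omega)
  · rw [Finset.card_range, smul_eq_mul]

theorem bits_le_of_lt {x B : ℕ} (h : x < 2 ^ B) : bits x ≤ B :=
  bits_le_of_nonneg (Int.natCast_nonneg x) (by exact_mod_cast h)

theorem Ready.congr (R : Ready G B N h U k u s) (hm : s'.mem = s.mem)
    (hr : ∀ r, r < 4 ∨ r = 5 → s'.reg r = s.reg r) : Ready G B N h U k u s' :=
  ⟨⟨by rw [hr 0 (by omega), R.graph.reg], R.graph.le, by rw [hm]; exact R.graph.mem⟩,
    by rw [hr 1 (by omega), R.regU], by rw [hr 2 (by omega), R.regk],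
    by rw [hr 3 (by omega), R.regu], by rw [hr 5 (by omega), R.regN], R.hN, R.hn, R.hh, R.hk, R.hu, R.hB⟩

end Search

/-! ### Filling the matrices and scanning their product. -/

section SearchTriple

variable {n : ℕ} {G : Digraph (Fin n)} {B N h U k u : ℕ} {s s' : HState}

namespace Ready

variable (R : Ready G B N h U k u s)

theorem ev0 {b : ℕ → ℤ} (R : Ready G B N h U k u s) : Ev B s b (.var 0) n := .var R.graph.reg

theorem ev1 {b : ℕ → ℤ} (R : Ready G B N h U k u s) : Ev B s b (.var 1) U := .var R.regU

theorem ev5 {b : ℕ → ℤ} (R : Ready G B N h U k u s) : Ev B s b (.var 5) N := .var R.regN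

theorem succ {b : ℕ → ℤ} (R : Ready G B N h U k u s) : Ev B s b succE (n + 1 : ℕ) :=
  R.ev0.nadd .none

theorem fourth {b : ℕ → ℤ} (R : Ready G B N h U k u s) : Ev B s b fourthE ((n + 1) ^ 4 : ℕ) :=
  ((R.succ.nmul R.succ).nmul (R.succ.nmul R.succ)).congr (by push_cast; ring)

theorem weight {x : Expr} {X : ℕ} (R : Ready G B N h U k u s) (hx : Den B s x X) :
    Den B s (weightE (.var 1) x) (mweight G U X) :=
  Den.weightE R.graph (fun _ => R.ev1) hx

theorem pos (R : Ready G B N h U k u s) : 0 < N := by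
  rw [R.hN]; positivity

theorem lt (R : Ready G B N h U k u s) : N < 2 ^ B := by
  have h1 : n + 1 ≤ (n + 1) ^ 5 := Nat.le_self_pow (by omega) _
  rw [R.hN]
  exact Nat.pow_lt_pow_right (by omega) (by have := R.hB; have := R.hh; omega)

theorem four_le (R : Ready G B N h U k u s) : 4 * (n + 1) ^ 4 ≤ B := by
  have h1 : (n + 1) ^ 4 ≤ (n + 1) ^ 5 := Nat.pow_le_pow_right (by omega) (by omega)
  have := R.hB
  omega

theorem expA {i : ℕ} (R : Ready G B N h U k u s) (hi : s.reg 6 = i) :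
    Den B s expAE (expA G U N i) := fun b => by
  have h6 : ∀ {b}, Ev B s b (.var 6) i := .var hi
  refine ((R.weight (fun b => (h6.ndiv R.ev5).nadd (R.ev5.nmul (h6.nmod R.ev5))) b).nadd
    R.fourth).nsub (R.weight (fun b => h6.ndiv R.ev5) b) ?_
  exact (mweight_le _ _).trans (Nat.le_add_left _ _)

theorem expB {i : ℕ} (R : Ready G B N h U k u s) (hi : s.reg 6 = i) :
    Den B s expBE (expB G U N i) := fun b => by
  have h6 : ∀ {b}, Ev B s b (.var 6) i := .var hi
  refine ((R.weight (fun b => (R.ev5.nmul (h6.ndiv R.ev5)).nadd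
    ((R.ev5.nmul R.ev5).nmul (h6.nmod R.ev5))) b).nadd
    R.fourth).nsub (R.weight (fun b => R.ev5.nmul (h6.ndiv R.ev5)) b) ?_
  exact (mweight_le _ _).trans (Nat.le_add_left _ _)

theorem target {r i : ℕ} (R : Ready G B N h U k u s) (hi : s.reg r = i)
    (hq : i / (N * N) ≤ n * n) : Den B s (targetE (.var r)) (target n N k u i) := fun b => by
  refine ((((R.ev0.nmul R.ev0).nsub ((Ev.var hi).ndiv (R.ev5.nmul R.ev5)) hq).nadd
    ((R.succ.nmul R.succ).nmul (.var R.regk))).nadd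
    (((R.succ.nmul R.succ).nmul R.succ).nmul (.var R.regu))).congr ?_
  congr 1
  unfold _root_.target
  ring

theorem low {r i : ℕ} (R : Ready G B N h U k u s) (hi : s.reg r = i) :
    Den B s (lowE (.var r)) (i / N % N : ℕ) := fun _ => ((Ev.var hi).ndiv R.ev5).nmod R.ev5

theorem high {r i : ℕ} (R : Ready G B N h U k u s) (hi : s.reg r = i) :
    Den B s (highE (.var r)) (N * N * (i % N) : ℕ) := fun _ =>
  (R.ev5.nmul R.ev5).nmul ((Ev.var hi).nmod R.ev5)

theorem expW {r i : ℕ} (R : Ready G B N h U k u s) (hi : s.reg r = i) (hq : i / (N * N) ≤ n * n) :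
    Den B s (expWE (.var r)) (expW G U N k u i) := fun b => by
  refine ((((R.target hi hq b).nadd (Ev.ntwo.nmul R.fourth)).nadd
    (R.weight (R.high hi) b))).nsub (R.weight (fun b => (R.low hi b).nadd (R.high hi b)) b) ?_
  exact (mweight_le _ _).trans (by omega)

theorem test {r i : ℕ} (R : Ready G B N h U k u s) (hi : s.reg r = i) (hq : i / (N * N) ≤ n * n)
    (hx : s.ext (2 * ((N : ℤ) * N) + ((i / N % N : ℕ) * (N : ℤ) + (i % N : ℕ))) =
      product G U N i) :
    Den B s (testE (.var r)) (product G U N i / (2 * N) ^ _root_.expW G U N k u i % (2 * N) : ℕ) :=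
  fun b => by
  refine (Ev.ndiv (Ev.xload (z := 2 * ((N : ℤ) * N) + ((i / N % N : ℕ) * (N : ℤ) + (i % N : ℕ)))
    ?_ hx (bits_le_of_lt (product_lt R.hN R.hh R.hB))) ((Ev.ntwo.nmul R.ev5).npow (R.expW hi hq b)
      ((expW_le R.hk R.hu).trans R.four_le))).nmod (Ev.ntwo.nmul R.ev5)
  exact (Ev.two.mul (R.ev5.mul R.ev5)).add (((R.low hi b).mul R.ev5).add ((Ev.var hi).nmod R.ev5))

end Ready

/-- The first matrix, as a function on positions. -/
noncomputable def entryA (G : Digraph (Fin n)) (U N : ℕ) (a : ℤ) : ℤ :=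
  ((2 * N) ^ expA G U N a.toNat : ℕ)

/-- The second matrix, as a function on positions. -/
noncomputable def entryB (G : Digraph (Fin n)) (U N : ℕ) (a : ℤ) : ℤ :=
  ((2 * N) ^ expB G U N a.toNat : ℕ)

theorem Ready.pow_lt (R : Ready G B N h U k u s) {e : ℕ} (he : e ≤ 2 * (n + 1) ^ 4) :
    (2 * N) ^ e < 2 ^ B := by
  have h1 := pow_lt_of_exponent (e := e) R.hh (by omega) R.hB
  rw [← R.hN] at h1
  exact lt_of_le_of_lt (Nat.le_mul_of_pos_left _ R.pos) h1

theorem tri_fill {Q : ℤ} (R : Ready G B N h U k u s) (h0 : s.ext = fun _ => 0) :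
    Tri Q B fill s (3 * (N * N) + 1) fun s' => s'.mem = s.mem ∧ (∀ r, r ≠ 6 → s'.reg r = s.reg r) ∧
      s'.left = s.left ∧ s'.ext = matrixInput
        (Matrix.of fun i j : Fin N => entryA G U N ((i : ℤ) * N + j))
        (Matrix.of fun i j : Fin N => entryB G U N ((i : ℤ) * N + j)) := by
  have hNN : N * N < 2 ^ B := by
    have h1 := pow_lt_of_exponent (e := 1) R.hh (by have := Nat.one_le_pow 4 (n + 1) (by omega); omega) R.hB
    rw [← R.hN, pow_one] at h1
    nlinarith
  refine Tri.forS_den (kb := 2) (m := N * N) (fun i s' => s'.mem = s.mem ∧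
    (∀ r, r ≠ 6 → s'.reg r = s.reg r) ∧ s'.left = s.left ∧ ∀ a, s'.ext a =
      (if 0 ≤ a ∧ a < (i : ℤ) then entryA G U N a else 0) +
      if (N : ℤ) * N ≤ a ∧ a < (N : ℤ) * N + i then entryB G U N (a - N * N) else 0)
    (fun b => R.ev5.nmul R.ev5) (bits_le_of_lt hNN) ?_ ?_ (by omega) ?_
  · refine ⟨rfl, fun _ _ => rfl, rfl, fun a => ?_⟩
    rw [h0, if_neg (by omega), if_neg (by omega), add_zero]
  · rintro i hi s1 ⟨hm, hr, hl, hx⟩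
    have R1 : Ready G B N h U k u (s1.setR 6 i) := R.congr hm fun r hr' => by
      rw [HState.setR_reg, if_neg (by omega), hr r (by omega)]
    have h6 : (s1.setR 6 i).reg 6 = i := by rw [HState.setR_reg, if_pos rfl]
    have R2 : Ready G B N h U k u ((s1.setR 6 i).setX i (entryA G U N i)) :=
      R1.congr rfl fun _ _ => rfl
    have two : ∀ {s : HState} {b : ℕ → ℤ}, Ready G B N h U k u s →
      Ev B s b (2 * .var 5) (2 * N : ℕ) := fun R => Ev.ntwo.nmul R.ev5
    refine Tri.seq (k1 := 1) (k2 := 1) (Tri.xstore_den (fun b => .var h6)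
      (fun b => (two R1).npow (R1.expA h6 b)
        ((expA_le _ _ _).trans (by have := R.four_le; omega))) rfl) ?_ le_rfl
    rintro _ rfl
    refine Tri.xstore_den (z := (N : ℤ) * N + i) (w := entryB G U N i) (fun b => ?_) (fun b => ?_) ?_
    · exact (R2.ev5.mul R2.ev5).add (.var h6)
    · exact (two R2).npow (R2.expB (by exact h6) b)
        ((expB_le _ _ _).trans (by have := R.four_le; omega))
    · refine ⟨hm, fun r hr' => ?_, hl, fun a => ?_⟩
      · simp only [HState.setX_reg, HState.setR_reg, if_neg hr', hr r hr']
      · simp only [HState.setX_ext, HState.setR_ext, hx]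
        have hi' : (i : ℤ) < N * N := by exact_mod_cast hi
        push_cast
        rcases lt_trichotomy a i with h1 | rfl | h1
        · rw [if_neg (by omega), if_neg (by omega)]
          by_cases h2 : 0 ≤ a
          · rw [if_pos (by omega), if_neg (by omega), if_pos (by omega), if_neg (by omega)]
          · rw [if_neg (by omega), if_neg (by omega), if_neg (by omega), if_neg (by omega)]
        · rw [if_neg (by omega), if_pos rfl, if_pos (by omega), if_neg (by omega)]
          simp [entryA]
        · rw [if_neg (show ¬ (0 ≤ a ∧ a < (i : ℤ)) by omega),
            if_neg (show ¬ (0 ≤ a ∧ a < (i : ℤ) + 1) by omega), if_neg (show ¬ a = i by omega)]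
          rcases eq_or_ne a (N * N + i) with rfl | h2
          · rw [if_pos rfl, if_pos (by omega), add_sub_cancel_left]
            simp
          · rw [if_neg h2]
            by_cases h3 : (N : ℤ) * N ≤ a ∧ a < (N : ℤ) * N + i
            · rw [if_pos h3, if_pos (by omega)]
            · rw [if_neg h3, if_neg (by omega)]
  · rintro s1 ⟨hm, hr, hl, hx⟩
    refine ⟨hm, hr, hl, funext fun a => ?_⟩
    refine (hx a).trans ((matrixInput_eq (entryA G U N) (entryB G U N) (fun _ _ => rfl)
      (fun _ _ => rfl) a).trans ?_).symm
    push_cast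
    rfl

/-- Each success overwrites register 7, so the largest successful candidate survives; the value -1
stands for none. -/
theorem tri_scan {Q : ℤ} (R : Ready G B N h U k u s) (h7 : s.reg 7 = -1)
    (hx : ∀ i : ℕ, s.ext (2 * ((N : ℤ) * N) + ((i / N % N : ℕ) * (N : ℤ) + (i % N : ℕ))) =
      product G U N i) :
    Tri Q B scan s (3 * ((n * n + 1) * (N * N)) + 1) fun s' => s'.mem = s.mem ∧
      (∀ r, r ≠ 6 → r ≠ 7 → s'.reg r = s.reg r) ∧ s'.left = s.left ∧
      ((s'.reg 7 = -1 ∧ ∀ i < (n * n + 1) * (N * N), ¬ ∃ y < N, Hit G U N k u i y) ∨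
      ∃ j : ℕ, s'.reg 7 = j ∧ j < (n * n + 1) * (N * N) ∧ (∃ y < N, Hit G U N k u j y) ∧
        ∀ i < (n * n + 1) * (N * N), j < i → ¬ ∃ y < N, Hit G U N k u i y) := by
  have hbd : (n * n + 1) * (N * N) < 2 ^ B := by
    have h1 : n * n + 1 < 2 ^ (n * n + 1) := Nat.lt_two_pow_self
    have h2 : N * N = 2 ^ (2 * h) := by rw [R.hN, two_mul, pow_add]
    have h3 : (n * n + 1) * (N * N) < 2 ^ (n * n + 1 + 2 * h) := by
      rw [pow_add, h2]
      exact Nat.mul_lt_mul_of_pos_right h1 (by positivity)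
    refine h3.trans_le (Nat.pow_le_pow_right (by omega) ?_)
    have h4 : (n + 1) * (n + 1) ≤ (n + 1) ^ 5 := by
      rw [← pow_two]
      exact Nat.pow_le_pow_right (by omega) (by omega)
    have := R.hB
    have := R.hh
    nlinarith
  refine Tri.forS_den (kb := 2) (m := (n * n + 1) * (N * N)) (fun m s' => s'.mem = s.mem ∧
      (∀ r, r ≠ 6 → r ≠ 7 → s'.reg r = s.reg r) ∧ s'.left = s.left ∧ s'.ext = s.ext ∧
      ((s'.reg 7 = -1 ∧ ∀ i < m, ¬ ∃ y < N, Hit G U N k u i y) ∨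
      ∃ j : ℕ, s'.reg 7 = j ∧ j < m ∧ (∃ y < N, Hit G U N k u j y) ∧
        ∀ i < m, j < i → ¬ ∃ y < N, Hit G U N k u i y))
    (fun b => ((R.ev0.nmul R.ev0).nadd .none).nmul (R.ev5.nmul R.ev5)) (bits_le_of_lt hbd)
    ⟨rfl, fun _ _ _ => rfl, rfl, rfl, Or.inl ⟨h7, fun i hi => absurd hi (Nat.not_lt_zero i)⟩⟩
    ?_ (by omega) fun s' hs' => ⟨hs'.1, hs'.2.1, hs'.2.2.1, hs'.2.2.2.2⟩
  rintro i hi s1 ⟨hm, hr, hl, he, hc⟩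
  have R1 : Ready G B N h U k u (s1.setR 6 i) := R.congr hm fun r hr' => by
    rw [HState.setR_reg, if_neg (by omega), hr r (by omega) (by omega)]
  have h6 : (s1.setR 6 i).reg 6 = i := by rw [HState.setR_reg, if_pos rfl]
  have hNN : 0 < N * N := Nat.mul_pos R.pos R.pos
  have hq : i / (N * N) ≤ n * n := by
    rw [← Nat.lt_succ_iff, Nat.div_lt_iff_lt_mul hNN]
    exact hi
  have hiB : bits i ≤ B := bits_le_of_lt (hi.trans hbd)
  refine Tri.ifPos_den (R1.test h6 hq (by rw [HState.setR_ext, he, hx])) ?_ ?_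
  · intro hpos
    have hhit : ∃ y < N, Hit G U N k u i y := (pos_test_iff R.hN).1 (by exact_mod_cast hpos)
    refine Tri.assign_den (fun b => .var h6) hiB ⟨hm, fun r h6' h7' => ?_, hl, he, Or.inr ⟨i, ?_,
      by omega, hhit, fun i' h1 h2 => by omega⟩⟩
    · rw [HState.setR_reg, if_neg h7', HState.setR_reg, if_neg h6', hr r h6' h7']
    · rw [HState.setR_reg, if_pos rfl]
  · intro hneg
    have hhit : ¬ ∃ y < N, Hit G U N k u i y := fun h => by
      have h1 := (pos_test_iff R.hN).2 h
      have h2 : product G U N i / (2 * N) ^ _root_.expW G U N k u i % (2 * N) ≤ 0 := by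
        exact_mod_cast hneg
      omega
    refine Tri.skip ⟨hm, fun r h6' h7' => ?_, hl, he, ?_⟩
    · rw [HState.setR_reg, if_neg h6', hr r h6' h7']
    · rw [HState.setR_reg, if_neg (by omega)]
      rcases hc with ⟨hc1, hc2⟩ | ⟨j, hc1, hc2, hc3, hc4⟩
      · refine Or.inl ⟨hc1, fun i' hi' => ?_⟩
        rcases Nat.lt_succ_iff_lt_or_eq.1 hi' with h | rfl
        exacts [hc2 i' h, hhit]
      · refine Or.inr ⟨j, hc1, by omega, hc3, fun i' hi' hj => ?_⟩
        rcases Nat.lt_succ_iff_lt_or_eq.1 hi' with h | rfl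
        exacts [hc4 i' h hj, hhit]

end SearchTriple

/-! ### Correctness of one search. -/

section SearchResult

variable {n : ℕ} {G : Digraph (Fin n)} {B N h U k u : ℕ} {s s' : HState}

/-- A candidate packs the number `n * n - cutSize G S` above the first and the last block of the
mask; the middle block is the witness `y`. -/
theorem exists_hit {S : Finset (Fin n)} (hN : N = 2 ^ h) (hn : n ≤ 3 * h) (hk : S.card = k)
    (hu : (S ∩ maskSet n U).card = u) :
    ∃ i < (n * n + 1) * (N * N), i / (N * N) = n * n - cutSize G S ∧
      ∃ y < N, Hit G U N k u i y := by
  have hN0 : 0 < N := by rw [hN]; positivity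
  have hNN : 0 < N * N := Nat.mul_pos hN0 hN0
  set X := mask S with hX
  have hXlt : X < N * N * N := by
    refine (mask_lt S).trans_le ?_
    rw [hN, ← pow_add, ← pow_add]
    exact Nat.pow_le_pow_right (by omega) (by omega)
  have hc := cutSize_le G S
  have hx : X % N < N := Nat.mod_lt _ hN0
  have hz : X / (N * N) < N := by rwa [Nat.div_lt_iff_lt_mul hNN, mul_comm]
  have hr : X % N * N + X / (N * N) < N * N := by
    have := Nat.mul_le_mul_right N (Nat.succ_le_of_lt hx)
    rw [Nat.succ_mul] at this
    omega
  have h1 : ((n * n - cutSize G S) * (N * N) + (X % N * N + X / (N * N))) / (N * N) =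
      n * n - cutSize G S := by
    rw [mul_comm _ (N * N), Nat.mul_add_div hNN, Nat.div_eq_of_lt hr, add_zero]
  have h0 : (n * n - cutSize G S) * (N * N) + (X % N * N + X / (N * N)) =
      N * ((n * n - cutSize G S) * N + X % N) + X / (N * N) := by ring
  have h2 : ((n * n - cutSize G S) * (N * N) + (X % N * N + X / (N * N))) / N % N = X % N := by
    rw [h0, Nat.mul_add_div hN0, Nat.div_eq_of_lt hz, add_zero, mul_comm, Nat.mul_add_mod,
      Nat.mod_mod]
  have h3 : ((n * n - cutSize G S) * (N * N) + (X % N * N + X / (N * N))) % N = X / (N * N) := by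
    rw [h0, Nat.mul_add_mod, Nat.mod_eq_of_lt hz]
  refine ⟨(n * n - cutSize G S) * (N * N) + (X % N * N + X / (N * N)), ?_, h1, X / N % N,
    Nat.mod_lt _ hN0, ?_⟩
  · have := Nat.mul_le_mul_right (N * N) (Nat.sub_le (n * n) (cutSize G S))
    rw [add_mul, one_mul]
    omega
  · rw [Hit, target, h1, h2, h3]
    have hsum : X % N + N * (X / N % N) + N * N * (X / (N * N)) = X := by
      have e1 := Nat.mod_add_div X N
      have e2 := Nat.mod_add_div (X / N) N
      have e3 := congrArg (N * ·) e2
      simp only [mul_add, Nat.div_div_eq_div_mul] at e3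
      rw [← mul_assoc] at e3
      omega
    rw [hsum, mweight, hX, maskSet_mask, weight, hk, hu]
    omega

/-- A larger candidate number means a smaller cut, because its quotient by `N * N` is `n * n` minus
the cut. The last success is therefore a minimum. -/
theorem isMinCut_of_hit {j y : ℕ} (hN : N = 2 ^ h) (hn : n ≤ 3 * h) (hk : k ≤ n)
    (hit : Hit G U N k u j y)
    (hlast : ∀ i < (n * n + 1) * (N * N), j < i → ¬ ∃ y < N, Hit G U N k u i y) :
    IsMinCut G k u (maskSet n U)
      (maskSet n (j / N % N + N * y + N * N * (j % N))) := by
  obtain ⟨h1, h2, h3⟩ := weight_inj G (Nat.sub_le (n * n) (j / (N * N))) hk hit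
  refine ⟨h2, h3, fun S hS hSU => ?_⟩
  obtain ⟨i, hi, hic, hy⟩ := exists_hit (G := G) hN hn hS hSU
  have h4 : i ≤ j := by
    by_contra hlt
    exact hlast i hi (not_le.1 hlt) hy
  have h5 := Nat.div_le_div_right (c := N * N) h4
  have h6 := cutSize_le G S
  rw [h1]
  omega

theorem Ready.set {j y : ℕ} (R : Ready G B N h U k u s) (h7 : s.reg 7 = j) (h8 : s.reg 8 = y) :
    Den B s setE (j / N % N + N * y + N * N * (j % N) : ℕ) := fun b =>
  ((R.low h7 b).nadd (R.ev5.nmul (.var h8))).nadd (R.high h7 b)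

/-- The product only reveals that a middle part exists. Trying all `N` of them recovers it within
the time already spent. -/
theorem tri_decode {Q : ℤ} {j : ℕ} (R : Ready G B N h U k u s) (h7 : s.reg 7 = j)
    (hj : j < (n * n + 1) * (N * N)) (hit : ∃ y < N, Hit G U N k u j y) :
    Tri Q B decode s (3 * N + 2) fun s' => s'.mem = s.mem ∧
      (∀ r, r ≠ 4 → r ≠ 8 → s'.reg r = s.reg r) ∧ s'.left = s.left ∧
      ∃ y, Hit G U N k u j y ∧
        s'.reg 4 = ((j / N % N + N * y + N * N * (j % N)) % 2 ^ n : ℕ) := by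
  have hq : j / (N * N) ≤ n * n := by
    rw [← Nat.lt_succ_iff, Nat.div_lt_iff_lt_mul (Nat.mul_pos R.pos R.pos)]
    exact hj
  refine Tri.ifPos_den (z := (j : ℤ) + 1) (k := 3 * N + 1) (fun b => (Ev.var h7).add .one) (fun _ => ?_)
    (fun hneg => by omega)
  refine Tri.forS_den (kb := 2) (m := N) (fun m s' => s'.mem = s.mem ∧
      (∀ r, r ≠ 4 → r ≠ 8 → s'.reg r = s.reg r) ∧ s'.left = s.left ∧
      ((∃ y < m, Hit G U N k u j y) → ∃ y, Hit G U N k u j y ∧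
        s'.reg 4 = ((j / N % N + N * y + N * N * (j % N)) % 2 ^ n : ℕ)))
    (fun b => R.ev5) (bits_le_of_lt R.lt) ⟨rfl, fun _ _ _ => rfl, rfl, fun ⟨y, hy, _⟩ =>
      absurd hy (Nat.not_lt_zero y)⟩ ?_ (by omega) fun s' hs' =>
      ⟨hs'.1, hs'.2.1, hs'.2.2.1, hs'.2.2.2 hit⟩
  rintro y hy s1 ⟨hm, hr, hl, hc⟩
  have R1 : Ready G B N h U k u (s1.setR 8 y) := R.congr hm fun r hr' => by
    rw [HState.setR_reg, if_neg (by omega), hr r (by omega) (by omega)]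
  have h7' : (s1.setR 8 y).reg 7 = j := by
    rw [HState.setR_reg, if_neg (by omega), hr 7 (by omega) (by omega), h7]
  have h8' : (s1.setR 8 y).reg 8 = y := by rw [HState.setR_reg, if_pos rfl]
  have hS := R1.set h7' h8'
  have hd : Den B (s1.setR 8 y) (weightE (.var 1) setE - targetE (.var 7))
      ((mweight G U (j / N % N + N * y + N * N * (j % N)) : ℤ) - target n N k u j) := fun b =>
    (R1.weight hS b).sub (R1.target h7' hq b)
  -- For an integer d, `1 - d * d` is positive exactly when d = 0; this is the test for equality.
  refine Tri.ifPos_den (fun b => Ev.one.sub ((hd b).mul (hd b))) (fun hpos => ?_) (fun hneg => ?_)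
  · have hyit : Hit G U N k u j y := by
      have h1 : ((mweight G U (j / N % N + N * y + N * N * (j % N)) : ℤ) - target n N k u j) = 0 := by
        nlinarith
      have h2 : (mweight G U (j / N % N + N * y + N * N * (j % N)) : ℤ) = target n N k u j := by
        linarith
      exact_mod_cast h2
    have hn2 : n ≤ B := R.graph.le
    refine Tri.assign_den (z := ((j / N % N + N * y + N * N * (j % N)) % 2 ^ n : ℕ))
      (fun b => (hS b).nmod (Ev.ntwo.npow R1.ev0 hn2)) (bits_le_of_lt ?_) ⟨hm, fun r h4 h8 => ?_, hl,
        fun _ => ⟨y, hyit, by rw [HState.setR_reg, if_pos rfl]⟩⟩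
    · exact (Nat.mod_lt _ (by positivity)).trans_le (Nat.pow_le_pow_right (by omega) hn2)
    · rw [HState.setR_reg, if_neg h4, HState.setR_reg, if_neg h8, hr r h4 h8]
  · refine Tri.skip ⟨hm, fun r h4 h8 => ?_, hl, ?_⟩
    · rw [HState.setR_reg, if_neg h8, hr r h4 h8]
    · rintro ⟨y', hy', hyit⟩
      rw [HState.setR_reg, if_neg (by omega)]
      rcases Nat.lt_succ_iff_lt_or_eq.1 hy' with h | rfl
      · exact hc ⟨y', h, hyit⟩
      · rw [Hit] at hyit
        rw [hyit] at hneg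
        simp at hneg

theorem product_eq (x z : Fin N) {i : ℕ} (hx : i / N % N = x) (hz : i % N = z) :
    ((Matrix.of fun i j : Fin N => entryA G U N ((i : ℤ) * N + j)) *
      (Matrix.of fun i j : Fin N => entryB G U N ((i : ℤ) * N + j))) x z = product G U N i := by
  rw [Matrix.mul_apply, product, Nat.cast_sum, ← Fin.sum_univ_eq_sum_range (fun y : ℕ =>
    (((2 * N) ^ (expA G U N (i / N % N * N + y) + expB G U N (y * N + i % N)) : ℕ) : ℤ))]
  refine Finset.sum_congr rfl fun y _ => ?_
  have h1 : ((x : ℤ) * N + y).toNat = x * N + y := by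
    rw [← Nat.cast_mul, ← Nat.cast_add, Int.toNat_natCast]
  have h2 : ((y : ℤ) * N + z).toNat = y * N + z := by
    rw [← Nat.cast_mul, ← Nat.cast_add, Int.toNat_natCast]
  rw [Matrix.of_apply, Matrix.of_apply, entryA, entryB, h1, h2, hx, hz, pow_add]
  push_cast
  rfl

/-- The program `p` multiplies `N × N` matrices with entries of at most `B` bits in time `μ`. -/
def Multiplies (p : Prog) (N B μ : ℕ) : Prop :=
  ∀ A A' : Matrix (Fin N) (Fin N) ℤ, (∀ i j, bits (A i j) ≤ B ∧ bits (A' i j) ≤ B) →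
    ∃ t S, t ≤ μ ∧ Exec p (State.init N (matrixInput A A')) t S ∧
      ∀ i j : Fin N, S.mem (2 * ((N : ℤ) * N) + ((i : ℤ) * N + j)) = (A * A') i j

theorem tri_search {Q : ℤ} {p : Prog} {μ l : ℕ} (hg : HasGraph G B s) (h1 : s.reg 1 = U)
    (h2 : s.reg 2 = k) (h3 : s.reg 3 = u) (hk : k ≤ n) (hu : u ≤ n) (hB : 8 * (n + 1) ^ 5 ≤ B)
    (hl : s.left = l + 1) (hN : N = 2 ^ ((n + 2) / 3)) (hp : Multiplies p N B μ) :
    Tri Q B (search p) s (μ + 3 * ((n * n + 3) * (N * N)) + 10) fun s' => s'.mem = s.mem ∧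
      (∀ r, r < 4 ∨ 8 < r → s'.reg r = s.reg r) ∧ s'.left = l ∧
      ((s'.reg 4 = s.reg 4 ∧ ¬ ∃ S : Finset (Fin n), S.card = k ∧ (S ∩ maskSet n U).card = u) ∨
        ∃ T : Finset (Fin n), s'.reg 4 = mask T ∧ IsMinCut G k u (maskSet n U) T) := by
  have hn1 : (n + 2) / 3 ≤ n := by omega
  have hnB : n ≤ B := hg.le
  have hN0 : 0 < N := by rw [hN]; positivity
  refine Tri.seq (k1 := 1) (k2 := μ + 3 * ((n * n + 3) * (N * N)) + 9) (Tri.assign_den (z := N)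
    (fun b => ?_) ?_ rfl) ?_ (by omega)
  · rw [hN]
    exact Ev.ntwo.npow ((hg.size.nadd .ntwo).ndiv .nthree) (by omega)
  · rw [hN]
    refine bits_le_of_lt (Nat.pow_lt_pow_right (by omega) ?_)
    have := Nat.le_self_pow (show 5 ≠ 0 by omega) (n + 1)
    omega
  rintro _ rfl
  refine Tri.seq (k1 := 1) (k2 := μ + 3 * ((n * n + 3) * (N * N)) + 8) (Tri.assign_den (z := -1)
    (fun b => (Ev.num 0).sub .one) ?_ rfl) ?_ (by omega)
  · have := Nat.one_le_pow 5 (n + 1) (by omega)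
    rw [show (-1 : ℤ) = -(1 : ℤ) from rfl, bits_neg, bits_one]
    omega
  rintro _ rfl
  refine Tri.seq (k1 := 1) (k2 := μ + 3 * ((n * n + 3) * (N * N)) + 7) (Tri.fresh hl rfl) ?_
    (by omega)
  rintro _ rfl
  set s1 : HState := { (s.setR 5 N).setR 7 (-1) with ext := fun _ => 0, left := l } with hs1
  have r1 : ∀ r, s1.reg r = if r = 7 then -1 else if r = 5 then (N : ℤ) else s.reg r := fun r => by
    rw [hs1, HState.setR_reg, HState.setR_reg]
  have R1 : Ready G B N ((n + 2) / 3) U k u s1 := by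
    refine ⟨⟨by rw [r1]; simpa using hg.reg, hg.le, hg.mem⟩, ?_, ?_, ?_, ?_, hN, by omega, hn1, hk, hu,
      hB⟩ <;> rw [r1] <;> simpa
  have hNN : N ≤ N * N := Nat.le_mul_self N
  refine Tri.seq (k1 := 3 * (N * N) + 1) (k2 := μ + 3 * ((n * n + 2) * (N * N)) + 6)
    (tri_fill R1 rfl) ?_ (by
      rw [show n * n + 3 = n * n + 2 + 1 from rfl, add_mul _ 1, one_mul]; omega)
  rintro s2 ⟨m2, r2, l2, x2⟩
  have R2 : Ready G B N ((n + 2) / 3) U k u s2 := R1.congr m2 fun r hr => r2 r (by omega)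
  obtain ⟨t, S, ht, E, hS⟩ := hp (Matrix.of fun i j : Fin N => entryA G U N ((i : ℤ) * N + j))
    (Matrix.of fun i j : Fin N => entryB G U N ((i : ℤ) * N + j)) fun i j =>
      ⟨bits_le_of_lt (R1.pow_lt (expA_le _ _ _)), bits_le_of_lt (R1.pow_lt (expB_le _ _ _))⟩
  rw [← x2] at E
  refine Tri.seq (k1 := t + 1) (k2 := 3 * ((n * n + 2) * (N * N)) + 5) (Tri.run R2.regN E rfl) ?_
    (by omega)
  rintro _ rfl
  have R3 : Ready G B N ((n + 2) / 3) U k u { s2 with ext := S.mem } := R2.congr rfl fun _ _ => rfl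
  refine Tri.seq (k1 := 3 * ((n * n + 1) * (N * N)) + 1) (k2 := 3 * N + 2) (tri_scan R3 ?_ ?_) ?_ (by
      have : (n * n + 2) * (N * N) = (n * n + 1) * (N * N) + N * N := by ring
      omega)
  · change s2.reg 7 = -1
    rw [r2 7 (by omega), r1, if_pos rfl]
  · intro i
    have := hS ⟨i / N % N, Nat.mod_lt _ hN0⟩ ⟨i % N, Nat.mod_lt _ hN0⟩
    rw [product_eq (i := i) _ _ rfl rfl] at this
    exact_mod_cast this
  rintro s4 ⟨m4, r4, l4, c4⟩
  have R4 : Ready G B N ((n + 2) / 3) U k u s4 := R3.congr m4 fun r hr => r4 r (by omega) (by omega)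
  have hm4 : s4.mem = s.mem := m4.trans m2
  have hr4 : ∀ r, r < 5 ∨ 8 ≤ r → s4.reg r = s.reg r := fun r hr => by
    rw [r4 r (by omega) (by omega)]
    change s2.reg r = _
    rw [r2 r (by omega), r1, if_neg (by omega), if_neg (by omega)]
  have hl4 : s4.left = l := l4.trans l2
  rcases c4 with ⟨h7, hno⟩ | ⟨j, h7, hj, hit, hlast⟩
  · refine Tri.ifPos_den (z := (-1 : ℤ) + 1) (k := 3 * N + 1) (fun b => (Ev.var h7).add .one)
      (fun h => by omega) fun _ => (Tri.skip (P := _) ?_).mono (by omega) fun _ h => h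
    refine ⟨hm4, fun r hr => hr4 r (by omega), hl4, Or.inl ⟨hr4 4 (by omega), ?_⟩⟩
    rintro ⟨S, hSk, hSu⟩
    obtain ⟨i, hi, -, hy⟩ := exists_hit (G := G) hN (by omega) hSk hSu
    exact hno i hi hy
  · refine (tri_decode R4 h7 hj hit).post ?_
    rintro s5 ⟨m5, r5, l5, y, hy, h5⟩
    refine ⟨m5.trans hm4, fun r hr => by rw [r5 r (by omega) (by omega), hr4 r (by omega)],
      l5.trans hl4, Or.inr ⟨_, ?_, isMinCut_of_hit hN (by omega) hk hy hlast⟩⟩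
    -- Three blocks may have more than `n` digits in all. The surplus digits belong to no vertex and
    -- are removed by the reduction modulo `2 ^ n`.
    rw [h5, ← maskSet_mod, mask_maskSet (Nat.mod_lt _ (by positivity))]

end SearchResult

/-! ### Numbering the sets of an interval; tables and partial orderings. -/

section Tables

variable {n : ℕ} {G : Digraph (Fin n)}

/-- The rank of `v` among the elements of `D`. -/
def rank (D : Finset (Fin n)) (v : Fin n) : ℕ := (D.filter (· < v)).card

theorem rank_lt {D : Finset (Fin n)} {v : Fin n} (hv : v ∈ D) : rank D v < D.card :=
  Finset.card_lt_card (Finset.filter_ssubset.2 ⟨v, hv, lt_irrefl v⟩)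

theorem rank_injOn {D : Finset (Fin n)} : Set.InjOn (rank D) D := by
  have h : ∀ v ∈ D, ∀ w, v < w → rank D v < rank D w := fun v hv w hvw => by
    refine Finset.card_lt_card ⟨fun x hx => ?_, fun hsub => ?_⟩
    · rw [Finset.mem_filter] at hx ⊢
      exact ⟨hx.1, hx.2.trans hvw⟩
    · exact lt_irrefl v (Finset.mem_filter.1 (hsub (Finset.mem_filter.2 ⟨hv, hvw⟩))).2
  intro v hv w hw hvw
  rcases lt_trichotomy v w with h1 | h1 | h1
  · have := h v hv w h1
    omega
  · exact h1
  · have := h w hw v h1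
    omega

/-- The set between `L` and `L ∪ D` whose new elements are given by the digits of `j`. -/
def expand (L D : Finset (Fin n)) (j : ℕ) : Finset (Fin n) :=
  L ∪ D.filter fun v => j.testBit (rank D v) = true

/-- Ranks within `D` make the digits dense, so the interval above `L` is traversed in `2 ^ D.card`
steps instead of `2 ^ n`. This is where the dynamic programs gain their speed. -/
theorem exists_expand {L D S : Finset (Fin n)} (hL : L ⊆ S) (hD : S ⊆ L ∪ D) :
    ∃ j < 2 ^ D.card, expand L D j = S := by
  classical
  have hbit : ∀ i, (∑ i ∈ (S ∩ D).image (rank D), 2 ^ i).testBit i = true ↔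
      ∃ v ∈ S ∩ D, rank D v = i := fun i => by
    rw [← Nat.mem_bitIndices, ← List.mem_toFinset, Finset.toFinset_bitIndices_sum_two_pow,
      Finset.mem_image]
  refine ⟨∑ i ∈ (S ∩ D).image (rank D), 2 ^ i, ?_, ?_⟩
  · refine Nat.lt_pow_two_of_testBit _ fun i hi => ?_
    rw [← Bool.not_eq_true, hbit]
    rintro ⟨v, hv, rfl⟩
    exact absurd (rank_lt (Finset.mem_inter.1 hv).2) (not_lt.2 hi)
  · ext v
    rw [expand, Finset.mem_union, Finset.mem_filter, hbit]
    constructor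
    · rintro (h | ⟨h, w, hw, he⟩)
      · exact hL h
      · rw [Finset.mem_inter] at hw
        rw [← rank_injOn hw.2 h he]
        exact hw.1
    · intro h
      rcases Finset.mem_union.1 (hD h) with h1 | h1
      · exact Or.inl h1
      · exact Or.inr ⟨h1, v, Finset.mem_inter.2 ⟨h, h1⟩, rfl⟩

variable (G) in
/-- For the sets `S` between `L` and `H` with the property `P`, the memory holds the cost of the best
chain from `L` to `S` and the last vertex in such a chain. -/
def TableOn (L H : Finset (Fin n)) (P : Finset (Fin n) → Prop) (mem : ℤ → ℤ) : Prop :=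
  ∀ S, L ⊆ S → S ⊆ H → P S → mem (-1 - 2 * mask S) = chainCost G L S ∧
    (S ≠ L → ∃ v ∈ S \ L, mem (-2 - 2 * mask S) = (v : ℕ) ∧
      chainCost G L S = cutSize G S + chainCost G L (S.erase v))

variable (G) in
/-- The numbers `pos` put the vertices outside of `X` behind those of `X`, with total cut size
`d`. -/
structure Arranged (X : Finset (Fin n)) (pos : Fin n → ℕ) (d : ℕ) : Prop where
  inj : ∀ v ∉ X, ∀ w ∉ X, pos v = pos w → v = w
  lt : ∀ v ∉ X, X.card < pos v
  le : ∀ v ∉ X, pos v ≤ n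
  sum : ∑ i ∈ Finset.Ioc X.card n, cutSize G (X ∪ Finset.univ.filter fun v => v ∉ X ∧ pos v ≤ i) = d

theorem Arranged.univ (pos : Fin n → ℕ) : Arranged G Finset.univ pos 0 :=
  ⟨by simp, by simp, by simp, by simp⟩

/-- Orderings are built from the last position downwards: the removed vertex takes position
`X.card`, and the only new prefix is `X` itself. -/
theorem Arranged.erase {X : Finset (Fin n)} {pos pos' : Fin n → ℕ} {d : ℕ} (h : Arranged G X pos d)
    {v : Fin n} (hv : v ∈ X) (hpos : pos' v = X.card) (hne : ∀ w ∉ X, pos' w = pos w) :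
    Arranged G (X.erase v) pos' (d + cutSize G X) := by
  have hcard := Finset.card_erase_add_one hv
  have hX : X.card ≤ n := by simpa using Finset.card_le_univ X
  have hout : ∀ w, w ∉ X.erase v → w = v ∨ w ∉ X := fun w hw => by
    by_contra! hcon
    exact hw (Finset.mem_erase.2 hcon)
  have hset : ∀ i, X.card ≤ i →
      (X.erase v ∪ Finset.univ.filter fun w => w ∉ X.erase v ∧ pos' w ≤ i) =
        X ∪ Finset.univ.filter fun w => w ∉ X ∧ pos w ≤ i := fun i hi => by
    ext w
    simp only [Finset.mem_union, Finset.mem_filter, Finset.mem_univ, true_and, Finset.mem_erase]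
    by_cases hw : w ∈ X
    · by_cases hwv : w = v
      · subst hwv
        simp [hw, hpos, hi]
      · simp [hw, hwv]
    · have hwv : w ≠ v := fun e => hw (e ▸ hv)
      simp [hw, hne w hw]
  refine ⟨fun a ha b hb hab => ?_, fun a ha => ?_, fun a ha => ?_, ?_⟩
  · rcases hout a ha with rfl | ha' <;> rcases hout b hb with rfl | hb'
    · rfl
    · have := h.lt b hb'
      rw [hpos, hne b hb'] at hab
      omega
    · have := h.lt a ha'
      rw [hpos, hne a ha'] at hab
      omega
    · rw [hne a ha', hne b hb'] at hab
      exact h.inj a ha' b hb' hab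
  · rcases hout a ha with rfl | ha'
    · omega
    · have := h.lt a ha'
      rw [hne a ha']
      omega
  · rcases hout a ha with rfl | ha'
    · omega
    · rw [hne a ha']
      exact h.le a ha'
  · have hIoc : Finset.Ioc (X.erase v).card n = insert X.card (Finset.Ioc X.card n) := by
      ext i
      simp only [Finset.mem_Ioc, Finset.mem_insert]
      omega
    rw [hIoc, Finset.sum_insert (by simp), ← h.sum, hset _ le_rfl, add_comm]
    congr 1
    · exact Finset.sum_congr rfl fun i hi => by rw [hset i (Finset.mem_Ioc.1 hi).1.le]
    · congr 1
      ext w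
      simp only [Finset.mem_union, Finset.mem_filter, Finset.mem_univ, true_and]
      constructor
      · rintro (hw | ⟨hw, hle⟩)
        · exact hw
        · have := h.lt w hw
          omega
      · exact Or.inl

theorem Arranged.exists_equiv {pos : Fin n → ℕ} {d : ℕ} (h : Arranged G ∅ pos d) :
    ∃ π : Fin n ≃ Fin n, (∀ v, position π v = pos v) ∧ arrangementCost G π = d := by
  have hlt : ∀ v, 0 < pos v := fun v => by simpa using h.lt v (Finset.notMem_empty v)
  have hle : ∀ v, pos v ≤ n := fun v => h.le v (Finset.notMem_empty v)
  let f : Fin n → Fin n := fun v => ⟨pos v - 1, by have := hlt v; have := hle v; omega⟩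
  have hf : Function.Injective f := fun v w hvw => by
    have h1 : pos v - 1 = pos w - 1 := congrArg Fin.val hvw
    have := hlt v
    have := hlt w
    exact h.inj v (Finset.notMem_empty v) w (Finset.notMem_empty w) (by omega)
  refine ⟨Equiv.ofBijective f (Finite.injective_iff_bijective.1 hf), fun v => ?_, ?_⟩
  · have := hlt v
    change pos v - 1 + 1 = pos v
    omega
  · rw [arrangementCost_eq, ← h.sum, Finset.card_empty, Finset.range_eq_Ico,
      Finset.sum_Ico_add' (fun i => cutSize G (initialSet _ i)) 0 n 1]
    refine Finset.sum_congr (by ext i; simp; omega) fun i _ => ?_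
    congr 1
    ext v
    have := hlt v
    have e : position (Equiv.ofBijective f (Finite.injective_iff_bijective.1 hf)) v = pos v := by
      change pos v - 1 + 1 = pos v
      omega
    simp [mem_initialSet, e]

end Tables

/-! ### What a statement leaves unchanged. -/

section Frames

/-- The registers outside of `A` and the number of blank memories are unchanged. -/
structure Keeps (A : List ℕ) (s s' : HState) : Prop where
  reg : ∀ r, r ∉ A → s'.reg r = s.reg r
  left : s'.left = s.left

theorem Keeps.refl (A : List ℕ) (s : HState) : Keeps A s s := ⟨fun _ _ => rfl, rfl⟩

theorem Keeps.trans {A : List ℕ} {s s' s'' : HState} (h : Keeps A s s') (h' : Keeps A s' s'') :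
    Keeps A s s'' :=
  ⟨fun r hr => (h'.reg r hr).trans (h.reg r hr), h'.left.trans h.left⟩

theorem Keeps.mono {A A' : List ℕ} {s s' : HState} (h : Keeps A s s') (hA : A ⊆ A') :
    Keeps A' s s' := ⟨fun r hr => h.reg r fun h => hr (hA h), h.left⟩

theorem Keeps.setR {A : List ℕ} {s s' : HState} (h : Keeps A s s') {r : ℕ} (hr : r ∈ A) (v : ℤ) :
    Keeps A s (s'.setR r v) :=
  ⟨fun q hq => by
    rw [HState.setR_reg, if_neg (fun e : q = r => hq (e ▸ hr)), h.reg q hq], h.left⟩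

theorem Keeps.setM {A : List ℕ} {s s' : HState} (h : Keeps A s s') (a v : ℤ) :
    Keeps A s (s'.setM a v) := ⟨h.reg, h.left⟩

theorem HasGraph.of_keeps {n : ℕ} {G : Digraph (Fin n)} {B : ℕ} {A : List ℕ} {s s' : HState}
    (h : HasGraph G B s) (hA : 0 ∉ A) (hk : Keeps A s s')
    (hm : ∀ a : ℤ, 0 ≤ a → a < n * n → s'.mem a = s.mem a) : HasGraph G B s' := by
  refine ⟨by rw [hk.reg 0 hA, h.reg], h.le, fun u v => ?_⟩
  have h1 : ((u : ℕ) : ℤ) + 1 ≤ n := by exact_mod_cast u.isLt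
  have h2 : ((v : ℕ) : ℤ) + 1 ≤ n := by exact_mod_cast v.isLt
  rw [hm _ (by positivity) (by nlinarith), h.mem]

end Frames

/-! ### Dynamic programming between two sets. -/

section Dynamic

/-- Digit `v` of the difference of the sets in the registers `12` and `11`. -/
def diffE (v : Expr) : Expr := digitE (.var 12) v - digitE (.var 11) v

/-- The size of the difference of the sets in the registers `12` and `11`. -/
def countE : Expr := .sum (.var 0) (diffE (.bv 0))

/-- The set between those in the registers `11` and `12` with the number in register `13`. -/
def expandE : Expr := .var 11 + .sum (.var 0)
  (diffE (.bv 0) * digitE (.var 13) (.sum (.bv 0) (diffE (.bv 0))) * .pow 2 (.bv 0))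

/-- The table entry of the set in register `18` without the vertex in register `14`. -/
def prevE : Expr := .load (.num (-1) - 2 * (.var 18 - .pow 2 (.var 14)))

/-- Find the best last vertex of the set in register `18`. -/
def bestLast : Stm := forS 14 (.var 0)
  (ifPos (diffE (.var 14) * digitE (.var 18) (.var 14) * (.var 15 - prevE))
    (assign 15 prevE ;; assign 16 (.var 14)) skipS)

/-- Enter the set in register `18` into the table. -/
def enter : Stm := ifPos (.var 9)
  (store (.num (-1) - 2 * .var 18) (cutE (.var 18) + .var 15) ;;
    store (.num (-2) - 2 * .var 18) (.var 16)) (store (.num (-1) - 2 * .var 18) (.num 0))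

/-- Treat the set with the number in register `13` if it has the size in register `9`. -/
def treat : Stm := assign 18 expandE ;;
  ifPos (1 - (cardE (.var 18) - cardE (.var 11) - .var 9) *
      (cardE (.var 18) - cardE (.var 11) - .var 9))
    (assign 15 (succE * succE * succE) ;; bestLast ;; enter) skipS

/-- Compute the table of the best chains between the sets in the registers `11` and `12`. -/
def dynamic : Stm := forS 9 (countE + 1) (forS 13 (.pow 2 countE) treat)

variable {n : ℕ} {G : Digraph (Fin n)} {B : ℕ} {L H : Finset (Fin n)} {s s' : HState}

variable (G) in
/-- The registers `11` and `12` hold `L` and `H`. -/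
structure Span (B : ℕ) (L H : Finset (Fin n)) (s : HState) : Prop where
  graph : HasGraph G B s
  regL : s.reg 11 = mask L
  regH : s.reg 12 = mask H
  sub : L ⊆ H
  hB : 8 * (n + 1) ^ 5 ≤ B

namespace Span

theorem of_keeps {A : List ℕ} (R : Span G B L H s) (h0 : 0 ∉ A) (h11 : 11 ∉ A) (h12 : 12 ∉ A)
    (hk : Keeps A s s') (hm : ∀ a : ℤ, 0 ≤ a → a < n * n → s'.mem a = s.mem a) :
    Span G B L H s' :=
  ⟨R.graph.of_keeps h0 hk hm, by rw [hk.reg 11 h11, R.regL], by rw [hk.reg 12 h12, R.regH], R.sub,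
    R.hB⟩

theorem diff {b : ℕ → ℤ} {v : Expr} {j : ℕ} (R : Span G B L H s) (hv : Ev B s b v j) (hj : j ≤ B) :
    Ev B s b (diffE v) (digit (mask H) j - digit (mask L) j) :=
  (Ev.digitE (.var R.regH) hv hj).sub (Ev.digitE (.var R.regL) hv hj)

theorem digit_sub (hsub : L ⊆ H) (v : Fin n) : digit (mask H) v - digit (mask L) v =
    if v ∈ H \ L then 1 else 0 := by
  rw [digit_mask, digit_mask]
  by_cases h1 : v ∈ L
  · simp [h1, hsub h1]
  · by_cases h2 : v ∈ H <;> simp [h1, h2]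

theorem count (R : Span G B L H s) : Den B s countE (H \ L).card := fun b => by
  have := R.graph.le
  refine (Ev.sum (F := fun v => digit (mask H) v - digit (mask L) v) R.graph.size R.graph.le
    fun i hi => R.diff .bv0 (by omega)).congr ?_
  rw [← Fin.sum_univ_eq_sum_range (fun v => digit (mask H) v - digit (mask L) v)]
  simp only [digit_sub R.sub, Finset.sum_boole, Finset.filter_univ_mem]

theorem sum_rank (hsub : L ⊆ H) (v : Fin n) :
    ∑ i ∈ Finset.range v, (digit (mask H) i - digit (mask L) i) = rank (H \ L) v := by
  have h : ∑ i ∈ Finset.range v, (digit (mask H) i - digit (mask L) i) =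
      ∑ i ∈ Finset.range n, if i < v then digit (mask H) i - digit (mask L) i else 0 := by
    rw [← Finset.sum_filter]
    refine Finset.sum_congr (Finset.ext fun i => ?_) fun _ _ => rfl
    rw [Finset.mem_filter, Finset.mem_range, Finset.mem_range]
    have := v.isLt
    omega
  rw [h, ← Fin.sum_univ_eq_sum_range
    (fun i => if i < (v : ℕ) then digit (mask H) i - digit (mask L) i else 0), rank,
    Finset.card_filter, Nat.cast_sum, ← Finset.sum_filter_add_sum_filter_not Finset.univ (· ∈ H \ L)]
  have h2 : ∑ i with i ∉ H \ L, (if (i : ℕ) < (v : ℕ) then digit (mask H) i - digit (mask L) i else 0)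
      = 0 := Finset.sum_eq_zero fun i hi => by
    rw [digit_sub hsub, if_neg (Finset.mem_filter.1 hi).2, ite_self]
  rw [h2, add_zero]
  refine Finset.sum_congr (by ext; simp) fun i hi => ?_
  rw [digit_sub hsub, if_pos hi]
  simp only [Fin.val_fin_lt, Nat.cast_ite, Nat.cast_one, Nat.cast_zero]

theorem mask_expand (j : ℕ) : (mask (expand L (H \ L) j) : ℤ) = mask L + ∑ v : Fin n,
    (if v ∈ H \ L then 1 else 0) * digit j (rank (H \ L) v) * 2 ^ (v : ℕ) := by
  rw [mask_eq_sum, mask_eq_sum, ← Finset.sum_add_distrib]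
  refine Finset.sum_congr rfl fun v _ => ?_
  simp only [expand, Finset.mem_union, Finset.mem_filter, digit, Finset.mem_sdiff]
  by_cases h1 : v ∈ L <;> by_cases h2 : v ∈ H <;>
    by_cases h3 : j.testBit (rank (H \ L) v) = true <;> simp [h1, h2, h3]

theorem expand {j : ℕ} (R : Span G B L H s) (hj : s.reg 13 = j) :
    Den B s expandE (mask (expand L (H \ L) j)) := fun b => by
  have hn := R.graph.le
  have hrank : ∀ v : Fin n, rank (H \ L) v ≤ n := fun v => by
    refine (Finset.card_le_univ ((H \ L).filter (· < v))).trans ?_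
    simp
  refine (Ev.add (.var R.regL) (Ev.sum (F := fun v => (digit (mask H) v - digit (mask L) v) *
    digit j (∑ i ∈ Finset.range v, (digit (mask H) i - digit (mask L) i)).toNat * 2 ^ v)
    R.graph.size R.graph.le fun v hv => ?_)).congr ?_
  · refine ((R.diff .bv0 (by omega)).mul (Ev.digitE (.var hj) ?_ ?_)).mul
      (Ev.two.pow .bv0 (by omega))
    · refine (Ev.sum (F := fun i => digit (mask H) i - digit (mask L) i) .bv0 (by omega)
        fun i hi => R.diff .bv0 (by omega)).congr ?_
      rw [sum_rank R.sub ⟨v, hv⟩, Int.toNat_natCast]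
    · rw [sum_rank R.sub ⟨v, hv⟩, Int.toNat_natCast]
      exact (hrank _).trans hn
  · rw [mask_expand, ← Fin.sum_univ_eq_sum_range (fun v => (digit (mask H) v - digit (mask L) v) *
      digit j (∑ i ∈ Finset.range v, (digit (mask H) i - digit (mask L) i)).toNat * 2 ^ v)]
    congr 1
    refine Finset.sum_congr rfl fun v _ => ?_
    rw [digit_sub R.sub, sum_rank R.sub, Int.toNat_natCast]

theorem prev {X : Finset (Fin n)} {v : Fin n} (R : Span G B L H s) (hX : s.reg 18 = mask X)
    (hv : s.reg 14 = (v : ℕ)) :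
    Den B s prevE (s.mem (-1 - 2 * (mask X - 2 ^ (v : ℕ)))) := fun b => by
  have hn := R.graph.le
  exact Ev.load ((Ev.num (-1)).sub (Ev.two.mul ((Ev.var hX).sub
    (Ev.two.pow (.var hv) (by have := v.isLt; omega))))) rfl

end Span

theorem chainCost_le_cube {S : Finset (Fin n)} (hS : L ⊆ S) : chainCost G L S < (n + 1) ^ 3 := by
  have := chainCost_le_card G S hS
  have h : (n + 1) ^ 3 = n * (n * n) + 3 * (n * n) + 3 * n + 1 := by ring
  omega

theorem cube_le (hB : 8 * (n + 1) ^ 5 ≤ B) : (n + 1) ^ 3 ≤ B := by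
  have : (n + 1) ^ 3 ≤ (n + 1) ^ 5 := Nat.pow_le_pow_right (by omega) (by omega)
  omega

theorem bits_le_of_le {x B : ℕ} (h : x ≤ B) : bits x ≤ B := (bits_natCast_le_self x).trans h

/-- The initial value `(n + 1) ^ 3` exceeds every chain cost and acts as infinity, so it survives
only if there is no vertex to remove. -/
theorem tri_bestLast {Q : ℤ} {X : Finset (Fin n)} (R : Span G B L H s) (hLX : L ⊆ X) (hXH : X ⊆ H)
    (hX : s.reg 18 = mask X) (hbig : s.reg 15 = ((n + 1) ^ 3 : ℕ))
    (hmem : ∀ v ∈ X \ L, s.mem (-1 - 2 * mask (X.erase v)) = chainCost G L (X.erase v)) :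
    Tri Q B bestLast s (4 * n + 1) fun s' => Keeps [14, 15, 16] s s' ∧ s'.mem = s.mem ∧
      (∀ v ∈ X \ L, s'.reg 15 ≤ chainCost G L (X.erase v)) ∧
      (s'.reg 15 = ((n + 1) ^ 3 : ℕ) ∨ ∃ v ∈ X \ L, s'.reg 16 = (v : ℕ) ∧
        s'.reg 15 = chainCost G L (X.erase v)) := by
  have hn := R.graph.le
  refine Tri.forS_den (kb := 3) (m := n) (fun i s' => Keeps [14, 15, 16] s s' ∧ s'.mem = s.mem ∧
      (∀ v ∈ X \ L, (v : ℕ) < i → s'.reg 15 ≤ chainCost G L (X.erase v)) ∧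
      (s'.reg 15 = ((n + 1) ^ 3 : ℕ) ∨ ∃ v ∈ X \ L, s'.reg 16 = (v : ℕ) ∧
        s'.reg 15 = chainCost G L (X.erase v))) (fun _ => R.graph.size) (bits_le_of_le hn)
    ⟨Keeps.refl _ _, rfl, fun v _ h => absurd h (Nat.not_lt_zero _), Or.inl hbig⟩ ?_ (by omega) ?_
  · rintro i hi s1 ⟨hk, hm, hle, hor⟩
    obtain ⟨v, rfl⟩ : ∃ v : Fin n, (v : ℕ) = i := ⟨⟨i, hi⟩, rfl⟩
    have hk2 : Keeps [14, 15, 16] s (s1.setR 14 (v : ℕ)) := hk.setR (by simp) _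
    have R2 : Span G B L H (s1.setR 14 (v : ℕ)) :=
      R.of_keeps (by simp) (by simp) (by simp) hk2 fun a _ _ => by rw [HState.setR_mem, hm]
    have h14 : (s1.setR 14 (v : ℕ)).reg 14 = (v : ℕ) := by rw [HState.setR_reg, if_pos rfl]
    have h18 : (s1.setR 14 (v : ℕ)).reg 18 = mask X := by rw [hk2.reg 18 (by simp), hX]
    have h15 : (s1.setR 14 (v : ℕ)).reg 15 = s1.reg 15 := by rw [HState.setR_reg, if_neg (by omega)]
    have h16 : (s1.setR 14 (v : ℕ)).reg 16 = s1.reg 16 := by rw [HState.setR_reg, if_neg (by omega)]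
    have hprev := R2.prev h18 h14
    have hprev' : v ∈ X \ L → (s1.setR 14 (v : ℕ)).mem (-1 - 2 * (mask X - 2 ^ (v : ℕ))) =
        chainCost G L (X.erase v) := fun hv => by
      rw [HState.setR_mem, hm, ← mask_erase (Finset.mem_sdiff.1 hv).1, hmem v hv]
    have hsub : ∀ v ∈ X \ L, L ⊆ X.erase v := fun v hv w hw => by
      rw [Finset.mem_sdiff] at hv
      exact Finset.mem_erase.2 ⟨fun e => hv.2 (e ▸ hw), hLX hw⟩
    have hcond : Den B (s1.setR 14 (v : ℕ))
        (diffE (.var 14) * digitE (.var 18) (.var 14) * (.var 15 - prevE))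
        (if v ∈ X \ L then s1.reg 15 - chainCost G L (X.erase v) else 0) := fun b => by
      refine (((R2.diff (.var h14) (by omega)).mul (Ev.digitE (.var h18) (.var h14) (by omega))).mul
        ((Ev.var h15).sub (hprev b))).congr ?_
      rw [Span.digit_sub R.sub, digit_mask]
      by_cases h1 : v ∈ X
      · by_cases h2 : v ∈ L
        · simp [h1, h2]
        · have h3 : v ∈ X \ L := Finset.mem_sdiff.2 ⟨h1, h2⟩
          rw [hprev' h3, if_pos (Finset.mem_sdiff.2 ⟨hXH h1, h2⟩), if_pos h1, if_pos h3]
          ring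
      · simp [h1]
    refine Tri.ifPos_den (k := 2) hcond (fun hpos => ?_) (fun hneg => ?_)
    · have hv : v ∈ X \ L := by
        by_contra h
        rw [if_neg h] at hpos
        exact lt_irrefl _ hpos
      rw [if_pos hv] at hpos
      rw [hprev' hv] at hprev
      refine Tri.seq (k1 := 1) (k2 := 1) (Tri.assign_den hprev
        (bits_le_of_le ((chainCost_le_cube (hsub v hv)).le.trans (cube_le R.hB))) rfl) ?_ le_rfl
      rintro _ rfl
      refine Tri.assign_den (z := ((v : ℕ) : ℤ)) (fun b => .var ?_) (bits_le_of_le (by omega))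
        ⟨(hk2.setR (by simp) _).setR (by simp) _, hm, fun w hw hwv => ?_, Or.inr ⟨v, hv, ?_, ?_⟩⟩
      · rw [HState.setR_reg, if_neg (by omega), h14]
      · rw [HState.setR_reg, if_neg (by omega), HState.setR_reg, if_pos rfl]
        rcases Nat.lt_succ_iff_lt_or_eq.1 hwv with h | h
        · have := hle w hw h
          linarith
        · rw [Fin.ext h]
      · rw [HState.setR_reg, if_pos rfl]
      · rw [HState.setR_reg, if_neg (by omega), HState.setR_reg, if_pos rfl]
    · refine (Tri.skip (P := _) ⟨hk2, hm, fun w hw hwv => ?_, ?_⟩).mono (by omega) fun _ h => h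
      · rw [h15]
        rcases Nat.lt_succ_iff_lt_or_eq.1 hwv with h | h
        · exact hle w hw h
        · obtain rfl := Fin.ext h
          rw [if_pos hw] at hneg
          linarith
      · rw [h15, h16]
        exact hor
  · rintro s' ⟨h1, h2, h3, h4⟩
    exact ⟨h1, h2, fun v hv => h3 v hv v.isLt, h4⟩

theorem tri_enter {Q : ℤ} {X : Finset (Fin n)} (R : Span G B L H s) (hLX : L ⊆ X)
    (h9 : s.reg 9 = (X \ L).card) (hX : s.reg 18 = mask X)
    (hle : ∀ v ∈ X \ L, s.reg 15 ≤ chainCost G L (X.erase v))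
    (hor : s.reg 15 = ((n + 1) ^ 3 : ℕ) ∨ ∃ v ∈ X \ L, s.reg 16 = (v : ℕ) ∧
        s.reg 15 = chainCost G L (X.erase v)) :
    Tri Q B enter s 3 fun s' => Keeps [] s s' ∧
      (∀ a, a ≠ -1 - 2 * (mask X : ℤ) → a ≠ -2 - 2 * (mask X : ℤ) → s'.mem a = s.mem a) ∧
      TableOn G L H (· = X) s'.mem := by
  have hn := R.graph.le
  have ha1 : Den B s (.num (-1) - 2 * .var 18) (-1 - 2 * (mask X : ℤ)) := fun b =>
    (Ev.num _).sub (Ev.two.mul (.var hX))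
  refine Tri.ifPos_den (k := 2) (fun b => .var h9) (fun hpos => ?_) (fun hneg => ?_)
  · have hne : (X \ L).Nonempty := Finset.card_pos.1 (by exact_mod_cast hpos)
    obtain ⟨w, hw, hwc⟩ := exists_chainCost_eq G hne
    have hsub : ∀ v ∈ X \ L, L ⊆ X.erase v := fun v hv w hw => by
      rw [Finset.mem_sdiff] at hv
      exact Finset.mem_erase.2 ⟨fun e => hv.2 (e ▸ hw), hLX hw⟩
    obtain ⟨v, hv, h16, h15⟩ := hor.resolve_left fun h => by
      have h1 := hle w hw
      have h2 := chainCost_le_cube (G := G) (hsub w hw)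
      rw [h] at h1
      exact absurd h2 (not_lt.2 (by exact_mod_cast h1))
    have hval : chainCost G L X = cutSize G X + chainCost G L (X.erase v) := by
      refine le_antisymm (chainCost_le G hv) ?_
      have h1 := hle w hw
      rw [h15] at h1
      have h2 : chainCost G L (X.erase v) ≤ chainCost G L (X.erase w) := by exact_mod_cast h1
      omega
    refine Tri.seq (k1 := 1) (k2 := 1) (Tri.store_den (w := (chainCost G L X : ℕ)) ha1 (fun b => ?_)
      (bits_le_of_le ((chainCost_le_cube hLX).le.trans (cube_le R.hB))) rfl) ?_ le_rfl
    · refine ((Den.cutE R.graph (fun b => .var hX) b).add (.var h15)).congr ?_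
      rw [maskSet_mask, hval]
      push_cast
      rfl
    rintro _ rfl
    refine Tri.store_den (z := -2 - 2 * (mask X : ℤ)) (w := ((v : ℕ) : ℤ))
      (fun b => (Ev.num _).sub (Ev.two.mul (.var hX))) (fun b => .var h16)
      (bits_le_of_le (by have := v.isLt; omega))
      ⟨((Keeps.refl _ _).setM _ _).setM _ _, fun a h1 h2 => ?_, ?_⟩
    · rw [HState.setM_mem, if_neg h2, HState.setM_mem, if_neg h1]
    · rintro _ _ _ rfl
      refine ⟨?_, fun _ => ⟨v, hv, ?_, hval⟩⟩
      · rw [HState.setM_mem, if_neg (by omega), HState.setM_mem, if_pos rfl]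
      · rw [HState.setM_mem, if_pos rfl]
  · have hXL : X = L := by
      have h1 : (X \ L).card = 0 := by omega
      exact (Finset.sdiff_eq_empty_iff_subset.1 (Finset.card_eq_zero.1 h1)).antisymm hLX
    refine (Tri.store_den (w := 0) ha1 (fun b => Ev.num 0) (by rw [bits_zero]; omega)
      ⟨(Keeps.refl _ _).setM _ _, fun a h1 h2 => ?_, ?_⟩).mono (by omega) fun _ h => h
    · rw [HState.setM_mem, if_neg h1]
    · rintro _ _ _ rfl
      refine ⟨?_, fun h => absurd hXL h⟩
      rw [HState.setM_mem, if_pos rfl, hXL, chainCost_self]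
      rfl

/-- The property `P` stays arbitrary so that each call extends whatever part of the table is already
correct by one set. Table cells have negative addresses, which keeps graph and positions intact. -/
theorem tri_treat {Q : ℤ} {t j : ℕ} (R : Span G B L H s) (h9 : s.reg 9 = t) (h13 : s.reg 13 = j)
    (hT : TableOn G L H (fun S => (S \ L).card < t) s.mem) :
    Tri Q B treat s (4 * n + 7) fun s' => Keeps [14, 15, 16, 18] s s' ∧
      (∀ a, 0 ≤ a → s'.mem a = s.mem a) ∧
      ∀ P, TableOn G L H P s.mem → TableOn G L H
        (fun S => P S ∨ (S \ L).card = t ∧ expand L (H \ L) j = S) s'.mem := by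
  have hn := R.graph.le
  set X := expand L (H \ L) j with hX
  have hLX : L ⊆ X := Finset.subset_union_left
  have hXH : X ⊆ H := Finset.union_subset R.sub
    ((Finset.filter_subset _ _).trans Finset.sdiff_subset)
  refine Tri.seq (k1 := 1) (k2 := 4 * n + 6) (Tri.assign_den (R.expand h13) (bits_le_of_lt
    ((mask_lt _).trans_le (Nat.pow_le_pow_right (by omega) hn))) rfl) ?_ (by omega)
  rintro _ rfl
  have hk1 : Keeps [14, 15, 16, 18] s (s.setR 18 (mask X)) := (Keeps.refl _ _).setR (by simp) _
  have R1 : Span G B L H (s.setR 18 (mask X)) :=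
    R.of_keeps (by simp) (by simp) (by simp) hk1 fun _ _ _ => rfl
  have h18 : (s.setR 18 (mask X)).reg 18 = mask X := by rw [HState.setR_reg, if_pos rfl]
  have hd : Den B (s.setR 18 (mask X)) (cardE (.var 18) - cardE (.var 11) - .var 9)
      (((X \ L).card : ℤ) - t) := fun b => by
    refine ((((Den.cardE R1.graph fun b => .var h18) b).sub ((Den.cardE R1.graph
      fun b => .var R1.regL) b)).sub (.var ((hk1.reg 9 (by simp)).trans h9))).congr ?_
    rw [maskSet_mask, maskSet_mask, Finset.card_sdiff_of_subset hLX,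
      Nat.cast_sub (Finset.card_le_card hLX)]
  refine Tri.ifPos_den (k := 4 * n + 5) (fun b => Ev.one.sub ((hd b).mul (hd b)))
    (fun hpos => ?_) (fun hneg => ?_)
  · have hcard : (X \ L).card = t := by
      have : ((X \ L).card : ℤ) - t = 0 := by nlinarith
      omega
    refine Tri.seq (k1 := 1) (k2 := 4 * n + 4) (Tri.assign_den (z := ((n + 1) ^ 3 : ℕ)) (fun b => ?_)
      (bits_le_of_le (cube_le R.hB)) rfl) ?_ (by omega)
    · have h1 : Ev B (s.setR 18 (mask X)) b succE (n + 1 : ℕ) := R1.graph.size.nadd .none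
      exact ((h1.nmul h1).nmul h1).congr (by push_cast; ring)
    rintro _ rfl
    have hk2 : Keeps [14, 15, 16, 18] s ((s.setR 18 (mask X)).setR 15 ((n + 1) ^ 3 : ℕ)) :=
      hk1.setR (by simp) _
    have R2 := R.of_keeps (by simp) (by simp) (by simp) hk2 fun _ _ _ => rfl
    refine Tri.seq (k1 := 4 * n + 1) (k2 := 3) (tri_bestLast R2 hLX hXH ?_ ?_ ?_) ?_ (by omega)
    · rw [HState.setR_reg, if_neg (by omega), h18]
    · rw [HState.setR_reg, if_pos rfl]
    · intro v hv
      refine (hT (X.erase v) (fun w hw => ?_) ((Finset.erase_subset v X).trans hXH) ?_).1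
      · rw [Finset.mem_sdiff] at hv
        exact Finset.mem_erase.2 ⟨fun e => hv.2 (e ▸ hw), hLX hw⟩
      · have := card_erase_sdiff hv
        omega
    rintro s3 ⟨hk3, hm3, hle, hor⟩
    have hk3' := hk2.trans (hk3.mono (by simp))
    have R3 := R.of_keeps (by simp) (by simp) (by simp) hk3' fun a _ _ => by rw [hm3]; rfl
    refine (tri_enter R3 hLX ?_ ?_ hle hor).post ?_
    · rw [hk3'.reg 9 (by simp), h9, hcard]
    · rw [hk3.reg 18 (by simp), HState.setR_reg, if_neg (by omega), h18]
    rintro s4 ⟨hk4, hm4, hT4⟩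
    have hm : ∀ a, a ≠ -1 - 2 * (mask X : ℤ) → a ≠ -2 - 2 * (mask X : ℤ) →
        s4.mem a = s.mem a := fun a h1 h2 => by
      rw [hm4 a h1 h2, hm3]
      rfl
    refine ⟨hk3'.trans (hk4.mono (by simp)), fun a ha => hm a (by omega) (by omega),
      fun P hP S hS1 hS2 hS3 => ?_⟩
    by_cases hSX : S = X
    · exact hT4 S hS1 hS2 hSX
    -- Different sets have different masks, and parity separates costs from last vertices; the new
    -- entry overwrites nothing else.
    · have hne : mask S ≠ mask X := fun e => hSX (mask_injective e)
      rw [hm _ (by omega) (by omega), hm _ (by omega) (by omega)]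
      exact hP S hS1 hS2 (hS3.resolve_right fun h => hSX h.2.symm)
  · have hcard : (X \ L).card ≠ t := fun e => by
      rw [e] at hneg
      simp at hneg
    refine (Tri.skip (P := _) ⟨hk1, fun _ _ => rfl, fun P hP S hS1 hS2 hS3 => ?_⟩).mono (by omega)
      fun _ h => h
    refine hP S hS1 hS2 (hS3.resolve_right fun h => hcard ?_)
    rw [h.2]
    exact h.1

/-- The outer loop goes through the sizes, so all sets with one vertex less are finished when
needed. Re-enumerating the interval for each size costs only the factor `(H \ L).card + 1`. -/
theorem tri_dynamic {Q : ℤ} (R : Span G B L H s) :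
    Tri Q B dynamic s (((H \ L).card + 1) * (2 ^ (H \ L).card * (4 * n + 8) + 2) + 1) fun s' =>
      Keeps [9, 13, 14, 15, 16, 18] s s' ∧ (∀ a, 0 ≤ a → s'.mem a = s.mem a) ∧
      TableOn G L H (fun _ => True) s'.mem := by
  have hn := R.graph.le
  have hD : (H \ L).card ≤ n := by simpa using Finset.card_le_univ (H \ L)
  have hDB : (H \ L).card + 1 ≤ B := by
    have := Nat.le_self_pow (show 5 ≠ 0 by omega) (n + 1)
    have := R.hB
    omega
  refine Tri.forS_den (kb := 2 ^ (H \ L).card * (4 * n + 8) + 1) (m := (H \ L).card + 1)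
    (fun t s' => Keeps [9, 13, 14, 15, 16, 18] s s' ∧ (∀ a, 0 ≤ a → s'.mem a = s.mem a) ∧
      TableOn G L H (fun S => (S \ L).card < t) s'.mem)
    (fun b => (R.count b).nadd .none) (bits_le_of_le hDB)
    ⟨Keeps.refl _ _, fun _ _ => rfl, fun S _ _ h => absurd h (Nat.not_lt_zero _)⟩ ?_ le_rfl ?_
  · rintro t ht s1 ⟨hk1, hm1, hT1⟩
    have hk2 : Keeps [9, 13, 14, 15, 16, 18] s (s1.setR 9 t) := hk1.setR (by simp) _
    have R2 := R.of_keeps (by simp) (by simp) (by simp) hk2 fun a h _ => hm1 a h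
    refine Tri.forS_den (kb := 4 * n + 7) (m := 2 ^ (H \ L).card)
      (fun j s' => Keeps [13, 14, 15, 16, 18] (s1.setR 9 t) s' ∧
        (∀ a, 0 ≤ a → s'.mem a = s.mem a) ∧ TableOn G L H (fun S => (S \ L).card < t ∨
          (S \ L).card = t ∧ ∃ j' < j, expand L (H \ L) j' = S) s'.mem)
      (fun b => Ev.ntwo.npow (R2.count b) (by omega))
      (bits_le_of_lt (Nat.pow_lt_pow_right (by omega) (by omega)))
      ⟨Keeps.refl _ _, hm1, fun S h1 h2 h3 => hT1 S h1 h2 (h3.resolve_right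
        fun ⟨_, j, hj, _⟩ => Nat.not_lt_zero j hj)⟩ ?_ le_rfl ?_
    · rintro j hj s3 ⟨hk3, hm3, hT3⟩
      have hk4 : Keeps [13, 14, 15, 16, 18] (s1.setR 9 t) (s3.setR 13 j) := hk3.setR (by simp) _
      have R4 := R2.of_keeps (by simp) (by simp) (by simp) hk4 fun a h _ => by
        rw [HState.setR_mem, HState.setR_mem, hm3 a h, hm1 a h]
      refine (tri_treat R4 (t := t) (j := j) ?_ ?_ fun S h1 h2 h3 => hT3 S h1 h2 (Or.inl h3)).post ?_
      · rw [hk4.reg 9 (by simp), HState.setR_reg, if_pos rfl]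
      · rw [HState.setR_reg, if_pos rfl]
      rintro s5 ⟨hk5, hm5, hT5⟩
      refine ⟨hk4.trans (hk5.mono (by simp)), fun a ha => (hm5 a ha).trans (hm3 a ha),
        fun S h1 h2 h3 => hT5 _ hT3 S h1 h2 ?_⟩
      rcases h3 with h3 | ⟨h3, j', hj', h4⟩
      · exact Or.inl (Or.inl h3)
      · rcases Nat.lt_succ_iff_lt_or_eq.1 hj' with h5 | rfl
        · exact Or.inl (Or.inr ⟨h3, j', h5, h4⟩)
        · exact Or.inr ⟨h3, h4⟩
    · rintro s6 ⟨hk6, hm6, hT6⟩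
      refine ⟨hk2.trans (hk6.mono (by simp)), hm6, fun S h1 h2 h3 => hT6 S h1 h2 ?_⟩
      rcases Nat.lt_succ_iff_lt_or_eq.1 h3 with h4 | h4
      · exact Or.inl h4
      · refine Or.inr ⟨h4, exists_expand h1 ?_⟩
        rwa [Finset.union_sdiff_of_subset R.sub]
  · rintro s' ⟨h1, h2, h3⟩
    exact ⟨h1, h2, fun S hS1 hS2 _ => h3 S hS1 hS2
      (Nat.lt_succ_of_le (Finset.card_le_card (Finset.sdiff_subset_sdiff hS2 (Finset.Subset.refl L))))⟩

end Dynamic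

/-! ### Reading off an optimal chain and evaluating a set. -/

section Walk

/-- Read an optimal chain between the sets in the registers `11` and `12` from the table, and write
the positions of its vertices. -/
def walk : Stm := assign 18 (.var 12) ;; forS 10 countE
  (assign 14 (.load (.num (-2) - 2 * .var 18)) ;;
    store (.var 0 * .var 0 + .var 14) (cardE (.var 18)) ;;
    assign 18 (.var 18 - .pow 2 (.var 14)))

/-- Compute the cost of the set in register `4`, and keep it in register `20` and the set in
register `21` if the cost is less than that in register `20`. -/
def evaluate : Stm :=
  assign 11 (.num 0) ;; assign 12 (.var 4) ;; dynamic ;;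
  assign 19 (.load (.num (-1) - 2 * .var 12)) ;;
  assign 11 (.var 4) ;; assign 12 (.pow 2 (.var 0) - 1) ;; dynamic ;;
  assign 19 (.var 19 + .load (.num (-1) - 2 * .var 12)) ;;
  ifPos (.var 20 - .var 19) (assign 20 (.var 19) ;; assign 21 (.var 4)) skipS

variable {n : ℕ} {G : Digraph (Fin n)} {B : ℕ} {L H : Finset (Fin n)} {s s' : HState}

/-- From `H` downwards, the recorded last vertex is removed and receives the current size as its
position. The invariant balances the cuts already accounted for against the cost of the remaining
chain. -/
theorem tri_walk {Q : ℤ} {pos : Fin n → ℕ} {d : ℕ} (R : Span G B L H s)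
    (hT : TableOn G L H (fun _ => True) s.mem) (hA : Arranged G H pos d)
    (hpos : ∀ v ∉ H, s.mem (n * n + (v : ℕ)) = pos v) :
    Tri Q B walk s (4 * n + 2) fun s' => Keeps [10, 14, 18] s s' ∧
      (∀ a : ℤ, 0 ≤ a → a < n * n → s'.mem a = s.mem a) ∧
      ∃ pos', Arranged G L pos' (d + chainCost G L H) ∧
        ∀ v ∉ L, s'.mem (n * n + (v : ℕ)) = pos' v := by
  have hn := R.graph.le
  have hD : (H \ L).card ≤ n := by simpa using Finset.card_le_univ (H \ L)
  have hmask : ∀ S : Finset (Fin n), bits (mask S) ≤ B := fun S =>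
    bits_le_of_lt ((mask_lt S).trans_le (Nat.pow_le_pow_right (by omega) hn))
  refine Tri.seq (k1 := 1) (k2 := 4 * n + 1) (Tri.assign_den (fun b => .var R.regH) (hmask H) rfl)
    ?_ (by omega)
  rintro _ rfl
  have hk1 : Keeps [10, 14, 18] s (s.setR 18 (mask H)) := (Keeps.refl _ _).setR (by simp) _
  have R1 := R.of_keeps (by simp) (by simp) (by simp) hk1 fun _ _ _ => rfl
  refine Tri.forS_den (kb := 3) (m := (H \ L).card) (fun i s' => Keeps [10, 14, 18] s s' ∧
      (∀ a : ℤ, a < n * n → s'.mem a = s.mem a) ∧ ∃ S pos' d', L ⊆ S ∧ S ⊆ H ∧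
        (S \ L).card + i = (H \ L).card ∧ s'.reg 18 = mask S ∧ Arranged G S pos' d' ∧
        d' + chainCost G L S = d + chainCost G L H ∧
        ∀ v ∉ S, s'.mem (n * n + (v : ℕ)) = pos' v)
    (fun b => R1.count b) (bits_le_of_le (hD.trans hn)) ⟨hk1, fun _ _ => rfl, H, pos, d, R.sub,
      Finset.Subset.refl H, rfl, by rw [HState.setR_reg, if_pos rfl], hA, rfl, hpos⟩ ?_ (by omega) ?_
  · rintro i hi s2 ⟨hk2, hm2, S, pos', d', hLS, hSH, hcard, h18, hA', hd', hpos'⟩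
    obtain ⟨-, h2⟩ := hT S hLS hSH trivial
    obtain ⟨v, hv, hch, hval⟩ := h2 fun e => by
      rw [e, Finset.sdiff_self, Finset.card_empty] at hcard
      omega
    have hvS := (Finset.mem_sdiff.1 hv).1
    have hvn := v.isLt
    set s3 := s2.setR 10 i with hs3
    have hk3 : Keeps [10, 14, 18] s s3 := hk2.setR (by simp) _
    have h18' : s3.reg 18 = mask S := by rw [hs3, HState.setR_reg, if_neg (by omega), h18]
    have hmem : s3.mem (-2 - 2 * mask S) = ((v : ℕ) : ℤ) := by
      rw [hs3, HState.setR_mem, hm2 _ (by nlinarith), hch]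
    refine Tri.seq (k1 := 1) (k2 := 2) (Tri.assign_den (z := ((v : ℕ) : ℤ))
      (fun b => Ev.load ((Ev.num _).sub (Ev.two.mul (.var h18'))) hmem) (bits_le_of_le (by omega))
      rfl) ?_ le_rfl
    rintro _ rfl
    have hk4 : Keeps [10, 14, 18] s (s3.setR 14 (v : ℕ)) := hk3.setR (by simp) _
    have R4 := R.of_keeps (by simp) (by simp) (by simp) hk4 fun a _ ha => hm2 a ha
    have h14 : (s3.setR 14 (v : ℕ)).reg 14 = (v : ℕ) := by rw [HState.setR_reg, if_pos rfl]
    have h18'' : (s3.setR 14 (v : ℕ)).reg 18 = mask S := by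
      rw [HState.setR_reg, if_neg (by omega), h18']
    have hSn : S.card ≤ n := by simpa using Finset.card_le_univ S
    refine Tri.seq (k1 := 1) (k2 := 1) (Tri.store_den (z := n * n + (v : ℕ)) (w := (S.card : ℕ))
      (fun b => (R4.graph.size.mul R4.graph.size).add (.var h14))
      (fun b => ((Den.cardE R4.graph fun b => .var h18'') b).congr (by rw [maskSet_mask]))
      (bits_le_of_le (hSn.trans hn)) rfl) ?_ le_rfl
    rintro _ rfl
    refine Tri.assign_den (z := (mask (S.erase v) : ℕ)) (fun b => ?_) (hmask _) ⟨?_, ?_, S.erase v,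
      Function.update pos' v S.card, d' + cutSize G S, fun w hw => ?_, ?_, ?_, ?_,
      hA'.erase hvS (Function.update_self ..) (fun w hw => Function.update_of_ne
        (fun e : w = v => hw (e ▸ hvS)) _ _), ?_, fun w hw => ?_⟩
    · rw [mask_erase hvS]
      have hvB : (v : ℕ) ≤ B := by omega
      exact Ev.sub (Ev.var (by exact h18'')) (Ev.two.pow (Ev.var (by exact h14)) hvB)
    · exact (hk4.setM _ _).setR (by simp) _
    · intro a ha
      rw [HState.setR_mem, HState.setM_mem, if_neg (by omega), HState.setR_mem, hs3,
        HState.setR_mem, hm2 a ha]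
    · exact Finset.mem_erase.2 ⟨fun e => (Finset.mem_sdiff.1 hv).2 (e ▸ hw), hLS hw⟩
    · exact (Finset.erase_subset v S).trans hSH
    · have := card_erase_sdiff hv
      omega
    · rw [HState.setR_reg, if_pos rfl]
    · rw [← hd', hval, add_assoc]
    · rw [HState.setR_mem, HState.setM_mem]
      rcases eq_or_ne w v with rfl | hwv
      · rw [if_pos rfl, Function.update_self]
      · have hne : (w : ℕ) ≠ v := fun e => hwv (Fin.ext e)
        rw [if_neg (by omega), Function.update_of_ne hwv, HState.setR_mem, hs3, HState.setR_mem,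
          hpos' w fun h => hw (Finset.mem_erase.2 ⟨hwv, h⟩)]
  · rintro s' ⟨hk', hm', S, pos', d', hLS, hSH, hcard, -, hA', hd', hpos'⟩
    have hSL : S = L := (Finset.sdiff_eq_empty_iff_subset.1
      (Finset.card_eq_zero.1 (by omega : (S \ L).card = 0))).antisymm hLS
    subst hSL
    rw [chainCost_self, add_zero] at hd'
    exact ⟨hk', fun a _ ha => hm' a ha, pos', hd' ▸ hA', hpos'⟩

theorem cost_le_cube (T : Finset (Fin n)) : cost G T < 2 * (n + 1) ^ 3 := by
  have h1 := chainCost_le_cube (G := G) (Finset.empty_subset T)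
  have h2 := chainCost_le_cube (G := G) (Finset.subset_univ T)
  unfold cost
  omega

theorem dynamic_time_le {f : ℕ} (h : (H \ L).card + f ≤ n) :
    ((H \ L).card + 1) * (2 ^ (H \ L).card * (4 * n + 8) + 2) + 1 ≤
      (n + 1) * (2 ^ (n - f) * (4 * n + 8) + 2) + 1 := by
  have h1 : 2 ^ (H \ L).card ≤ 2 ^ (n - f) := Nat.pow_le_pow_right (by omega) (by omega)
  gcongr
  omega

/-- Both intervals, from the empty set to `T` and from `T` to all vertices, have at most `n - f`
free elements. That is the only use of the bounds on the size of `T`. -/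
theorem tri_evaluate {Q : ℤ} {T : Finset (Fin n)} {f : ℕ} (hg : HasGraph G B s)
    (hB : 8 * (n + 1) ^ 5 ≤ B) (h4 : s.reg 4 = mask T) (hf1 : f ≤ T.card) (hf2 : T.card + f ≤ n) :
    Tri Q B evaluate s (2 * ((n + 1) * (2 ^ (n - f) * (4 * n + 8) + 2) + 1) + 9) fun s' =>
      (∀ r, r < 9 ∨ 21 < r → s'.reg r = s.reg r) ∧ s'.left = s.left ∧
      (∀ a, 0 ≤ a → s'.mem a = s.mem a) ∧
      ((s.reg 20 ≤ cost G T ∧ s'.reg 20 = s.reg 20 ∧ s'.reg 21 = s.reg 21) ∨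
        (cost G T ≤ s.reg 20 ∧ s'.reg 20 = cost G T ∧ s'.reg 21 = mask T)) := by
  have hn := hg.le
  have hcube := cube_le hB
  have hB2 : 2 * (n + 1) ^ 3 ≤ B := by
    have : (n + 1) ^ 3 ≤ (n + 1) ^ 5 := Nat.pow_le_pow_right (by omega) (by omega)
    omega
  have hmask : ∀ S : Finset (Fin n), bits (mask S) ≤ B := fun S =>
    bits_le_of_lt ((mask_lt S).trans_le (Nat.pow_le_pow_right (by omega) hn))
  set A := [9, 11, 12, 13, 14, 15, 16, 18, 19] with hAdef
  generalize hk : (n + 1) * (2 ^ (n - f) * (4 * n + 8) + 2) + 1 = kd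
  have hcT : (∅ : Finset (Fin n)) ⊆ T := Finset.empty_subset T
  refine Tri.seq (k1 := 1) (k2 := 2 * kd + 8) (Tri.assign_den (z := 0) (fun b => Ev.num 0)
    (by rw [bits_zero]; omega) rfl) ?_ (by omega)
  rintro _ rfl
  have k1 : Keeps A s (s.setR 11 0) := (Keeps.refl _ _).setR (by simp [A]) _
  refine Tri.seq (k1 := 1) (k2 := 2 * kd + 7) (Tri.assign_den (z := mask T)
    (fun b => .var ((k1.reg 4 (by simp [A])).trans h4)) (hmask T) rfl) ?_ (by omega)
  rintro _ rfl
  have k2 : Keeps A s ((s.setR 11 0).setR 12 (mask T)) := k1.setR (by simp [A]) _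
  have R2 : Span G B ∅ T ((s.setR 11 0).setR 12 (mask T)) :=
    ⟨hg.of_keeps (by simp [A]) k2 fun _ _ _ => rfl, by
      rw [HState.setR_reg, if_neg (by omega), HState.setR_reg, if_pos rfl, mask_empty]; rfl, by
      rw [HState.setR_reg, if_pos rfl], hcT, hB⟩
  refine Tri.seq (k1 := kd) (k2 := kd + 7) ((tri_dynamic R2).mono (hk ▸ dynamic_time_le (f := f) ?_)
    fun _ h => h) ?_ (by omega)
  · rwa [Finset.sdiff_empty]
  rintro s3 ⟨k3', m3, t3⟩
  have k3 : Keeps A s s3 := k2.trans (k3'.mono (by simp [A]))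
  have m3' : ∀ a, 0 ≤ a → s3.mem a = s.mem a := m3
  have c3 := (t3 T hcT (Finset.Subset.refl T) trivial).1
  have r3 : s3.reg 12 = mask T := by
    rw [k3'.reg 12 (by simp), HState.setR_reg, if_pos rfl]
  refine Tri.seq (k1 := 1) (k2 := kd + 6) (Tri.assign_den (z := (chainCost G ∅ T : ℕ))
    (fun b => Ev.load ((Ev.num _).sub (Ev.two.mul (.var r3))) c3)
    (bits_le_of_le ((chainCost_le_cube hcT).le.trans hcube)) rfl) ?_ (by omega)
  rintro _ rfl
  have k4 : Keeps A s (s3.setR 19 (chainCost G ∅ T : ℕ)) := k3.setR (by simp [A]) _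
  refine Tri.seq (k1 := 1) (k2 := kd + 5) (Tri.assign_den (z := mask T)
    (fun b => .var ((k4.reg 4 (by simp [A])).trans h4)) (hmask T) rfl) ?_ (by omega)
  rintro _ rfl
  have k5 : Keeps A s ((s3.setR 19 (chainCost G ∅ T : ℕ)).setR 11 (mask T)) :=
    k4.setR (by simp [A]) _
  have h0 := (k5.reg 0 (by simp [A])).trans hg.reg
  refine Tri.seq (k1 := 1) (k2 := kd + 4) (Tri.assign_den
    (z := (mask (Finset.univ : Finset (Fin n)) : ℕ)) (fun b => ?_) (hmask _) rfl) ?_ (by omega)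
  · rw [mask_univ]
    exact (Ev.ntwo.npow (.var h0) hn).nsub .none Nat.one_le_two_pow
  rintro _ rfl
  set s6 := ((s3.setR 19 (chainCost G ∅ T : ℕ)).setR 11 (mask T)).setR 12
    (mask (Finset.univ : Finset (Fin n)) : ℕ) with hs6
  have k6 : Keeps A s s6 := k5.setR (by simp [A]) _
  have R6 : Span G B T Finset.univ s6 :=
    ⟨hg.of_keeps (by simp [A]) k6 fun a ha _ => m3' a ha, by
      rw [hs6, HState.setR_reg, if_neg (by omega), HState.setR_reg, if_pos rfl], by
      rw [hs6, HState.setR_reg, if_pos rfl], Finset.subset_univ T, hB⟩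
  refine Tri.seq (k1 := kd) (k2 := 4) ((tri_dynamic R6).mono (hk ▸ dynamic_time_le (f := f) ?_)
    fun _ h => h) ?_ (by omega)
  · rw [← Finset.compl_eq_univ_sdiff, Finset.card_compl, Fintype.card_fin]
    omega
  rintro s7 ⟨k7', m7, t7⟩
  have k7 : Keeps A s s7 := k6.trans (k7'.mono (by simp [A]))
  have m7' : ∀ a, 0 ≤ a → s7.mem a = s.mem a := fun a ha => (m7 a ha).trans (m3' a ha)
  have c7 := (t7 _ (Finset.subset_univ T) (Finset.Subset.refl _) trivial).1
  have r7 : s7.reg 12 = mask (Finset.univ : Finset (Fin n)) := by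
    rw [k7'.reg 12 (by simp), hs6, HState.setR_reg, if_pos rfl]
  have r7' : s7.reg 19 = chainCost G ∅ T := by
    rw [k7'.reg 19 (by simp), hs6, HState.setR_reg, if_neg (by omega), HState.setR_reg,
      if_neg (by omega), HState.setR_reg, if_pos rfl]
  refine Tri.seq (k1 := 1) (k2 := 3) (Tri.assign_den (z := (cost G T : ℕ)) (fun b => ?_)
    (bits_le_of_le ((cost_le_cube T).le.trans hB2)) rfl) ?_ (by omega)
  · refine ((Ev.var r7').add (Ev.load ((Ev.num _).sub (Ev.two.mul (.var r7))) c7)).congr ?_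
    rw [cost]
    push_cast
    rfl
  rintro _ rfl
  have k8 : Keeps A s (s7.setR 19 (cost G T : ℕ)) := k7.setR (by simp [A]) _
  have h19 : (s7.setR 19 (cost G T : ℕ)).reg 19 = cost G T := by rw [HState.setR_reg, if_pos rfl]
  have h20 := k8.reg 20 (by simp [A])
  have hfr : ∀ r, r < 9 ∨ 21 < r → (s7.setR 19 (cost G T : ℕ)).reg r = s.reg r := fun r hr =>
    k8.reg r (by simp [A]; omega)
  refine Tri.ifPos_den (z := s.reg 20 - cost G T) (k := 2) (fun b => (Ev.var h20).sub (.var h19))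
    (fun hpos => ?_) (fun hneg => ?_)
  · refine Tri.seq (k1 := 1) (k2 := 1) (Tri.assign_den (z := (cost G T : ℕ)) (fun b => .var h19)
      (bits_le_of_le ((cost_le_cube T).le.trans hB2)) rfl) ?_ le_rfl
    rintro _ rfl
    refine Tri.assign_den (z := mask T) (fun b => .var ?_) (hmask T) ⟨fun r hr => ?_, k8.left, m7',
      Or.inr ⟨by omega, ?_, ?_⟩⟩
    · rw [HState.setR_reg, if_neg (by omega), k8.reg 4 (by simp [A]), h4]
    · rw [HState.setR_reg, if_neg (by omega), HState.setR_reg, if_neg (by omega), hfr r hr]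
    · rw [HState.setR_reg, if_neg (by omega), HState.setR_reg, if_pos rfl]
    · rw [HState.setR_reg, if_pos rfl]
  · exact (Tri.skip (P := _) ⟨hfr, k8.left, m7', Or.inl ⟨by omega, h20, k8.reg 21 (by simp [A])⟩⟩).mono
      (by omega) fun _ h => h

end Walk

/-! ### Exhaustive guessing over several rounds. -/

section Nest

/-- The intersection of the sets in the registers `4` and `33 + 2 * r`. -/
def interE (r : ℕ) : Expr := .sum (.var 0)
  (digitE (.var 4) (.bv 0) * digitE (.var (33 + 2 * r)) (.bv 0) * .pow 2 (.bv 0))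

/-- The nested search of depth `r`, for the set in register `31 + 2 * r`. -/
def nest (p : Prog) : ℕ → Stm
  | 0 => skipS
  | r + 1 => forS (32 + 2 * r) succE (assign 3 (.var (32 + 2 * r)) ;; assign 1 (.var (33 + 2 * r)) ;;
      search p ;; evaluate ;; assign (31 + 2 * r) (interE r) ;; nest p r)

/-- The number of searches. -/
def calls (n : ℕ) : ℕ → ℕ
  | 0 => 0
  | r + 1 => (n + 1) * (1 + calls n r)

/-- The number of steps, if a search with evaluation takes `D` steps. -/
def nestTime (n D : ℕ) : ℕ → ℕ
  | 0 => 1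
  | r + 1 => (n + 1) * (D + nestTime n D r + 1) + 1

variable {n : ℕ} (G : Digraph (Fin n)) {B : ℕ} {s s' : HState}

/-- The invariant of the nested search. -/
structure Loop (B f k : ℕ) (s : HState) : Prop where
  graph : HasGraph G B s
  hB : 8 * (n + 1) ^ 5 ≤ B
  regk : s.reg 2 = k
  f_le : f ≤ k
  le : k + f ≤ n
  cur : ∃ T : Finset (Fin n), s.reg 4 = mask T ∧ f ≤ T.card ∧ T.card + f ≤ n
  best : ∃ T : Finset (Fin n), s.reg 21 = mask T ∧ f ≤ T.card ∧ T.card + f ≤ n ∧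
    cost G T ≤ s.reg 20

/-- The number of steps of a search. -/
def searchTime (n N μ : ℕ) : ℕ := μ + 3 * ((n * n + 3) * (N * N)) + 10

/-- The number of steps of an evaluation. -/
def evalTime (n f : ℕ) : ℕ := 2 * ((n + 1) * (2 ^ (n - f) * (4 * n + 8) + 2) + 1) + 9

variable {G}

theorem HasGraph.of_regs {s s' : HState} (h : HasGraph G B s) (hr : s'.reg 0 = s.reg 0)
    (hm : ∀ a : ℤ, 0 ≤ a → s'.mem a = s.mem a) : HasGraph G B s' := by
  refine ⟨by rw [hr, h.reg], h.le, fun u v => ?_⟩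
  rw [hm _ (by positivity), h.mem]

theorem Den.inter {r : ℕ} {T U : Finset (Fin n)} (hg : HasGraph G B s) (h4 : s.reg 4 = mask T)
    (hU : s.reg (33 + 2 * r) = mask U) : Den B s (interE r) (mask (T ∩ U) : ℕ) := fun b => by
  have hn := hg.le
  refine (Ev.sum (F := fun v => digit (mask T) v * digit (mask U) v * 2 ^ v) hg.size hg.le
    fun v hv => ((Ev.digitE (.var h4) .bv0 (by omega)).mul
      (Ev.digitE (.var hU) .bv0 (by omega))).mul (Ev.two.pow .bv0 (by omega))).congr ?_
  rw [← Fin.sum_univ_eq_sum_range (fun v => digit (mask T) v * digit (mask U) v * 2 ^ v),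
    mask_eq_sum]
  refine Finset.sum_congr rfl fun v _ => ?_
  rw [digit_mask, digit_mask]
  by_cases h1 : v ∈ T <;> by_cases h2 : v ∈ U <;> simp [h1, h2]

/-- The loop tries every intersection size, so it meets the guess promised by `Wins`; the conclusion
holds for all `b` at once. Registers from `31 + 2 * r` on are reserved for outer levels, and each
search consumes one blank memory. -/
theorem tri_nest {Q : ℤ} {p : Prog} {N μ f k D : ℕ} (hN : N = 2 ^ ((n + 2) / 3))
    (hp : Multiplies p N B μ) (hD : searchTime n N μ + evalTime n f + 3 ≤ D) :
    ∀ (r : ℕ) (U : Finset (Fin n)) (s : HState), Loop G B f k s → s.reg (31 + 2 * r) = mask U →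
      calls n r ≤ s.left → Tri Q B (nest p r) s (nestTime n D r) fun s' => Loop G B f k s' ∧
        (∀ x, x = 22 ∨ x = 23 ∨ 30 + 2 * r < x → s'.reg x = s.reg x) ∧
        s.left ≤ s'.left + calls n r ∧ s'.reg 20 ≤ s.reg 20 ∧
        ∀ b : ℕ, Wins G k b r U → s'.reg 20 ≤ b := by
  intro r
  induction r with
  | zero =>
    intro U s hs _ _
    exact Tri.skip ⟨hs, fun _ _ => rfl, by omega, le_rfl, fun b h => h.elim⟩
  | succ r ih =>
    intro U s hs hU hl
    have hn := hs.graph.le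
    have hnB : n + 1 ≤ B := by
      have := Nat.le_self_pow (show 5 ≠ 0 by omega) (n + 1)
      have := hs.hB
      omega
    have hmask : ∀ S : Finset (Fin n), bits (mask S) ≤ B := fun S =>
      bits_le_of_lt ((mask_lt S).trans_le (Nat.pow_le_pow_right (by omega) hn))
    rw [show 31 + 2 * (r + 1) = 33 + 2 * r by ring] at hU
    rw [calls] at hl
    refine Tri.forS_den (kb := D + nestTime n D r) (m := n + 1) (fun i s' => Loop G B f k s' ∧
        (∀ x, x = 22 ∨ x = 23 ∨ 32 + 2 * r < x → s'.reg x = s.reg x) ∧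
        s.left ≤ s'.left + i * (1 + calls n r) ∧ s'.reg 20 ≤ s.reg 20 ∧
        ∀ u < i, ∀ b : ℕ, ((∃ S : Finset (Fin n), S.card = k ∧ (S ∩ U).card = u) ∧
          ∀ T, IsMinCut G k u U T → cost G T ≤ b ∨ Wins G k b r (T ∩ U)) → s'.reg 20 ≤ b)
      (fun b => hs.graph.size.nadd .none) (bits_le_of_le hnB)
      ⟨hs, fun _ _ => rfl, by omega, le_rfl, fun u h => absurd h (Nat.not_lt_zero u)⟩ ?_ le_rfl ?_
    · rintro u hu s1 ⟨hs1, hr1, hl1, h201, hw1⟩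
      obtain ⟨T₀, hT₀, hT₀f, hT₀n⟩ := hs1.cur
      obtain ⟨l, hl'⟩ : ∃ l, s1.left = l + 1 := by
        refine ⟨s1.left - 1, ?_⟩
        have := Nat.mul_le_mul_right (1 + calls n r) (Nat.succ_le_of_lt hu)
        rw [Nat.succ_mul] at this
        omega
      refine Tri.seq (k1 := 1) (k2 := D - 1 + nestTime n D r) (Tri.assign_den (z := (u : ℕ))
        (fun b => .var (by rw [HState.setR_reg, if_pos rfl])) (bits_le_of_le (by omega)) rfl) ?_
        (by omega)
      rintro _ rfl
      refine Tri.seq (k1 := 1) (k2 := D - 2 + nestTime n D r) (Tri.assign_den (z := mask U)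
        (fun b => .var ?_) (hmask U) rfl) ?_ (by omega)
      · rw [HState.setR_reg, if_neg (by omega), HState.setR_reg, if_neg (by omega),
          hr1 _ (by omega), hU]
      rintro _ rfl
      set s3 := ((s1.setR (32 + 2 * r) u).setR 3 u).setR 1 (mask U) with hs3
      have hr3 : ∀ x, x ≠ 1 → x ≠ 3 → x ≠ 32 + 2 * r → s3.reg x = s1.reg x := fun x h1 h2 h3 => by
        rw [hs3, HState.setR_reg, if_neg h1, HState.setR_reg, if_neg h2, HState.setR_reg, if_neg h3]
      have hg3 : HasGraph G B s3 := hs1.graph.of_regs (hr3 0 (by omega) (by omega) (by omega))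
        fun _ _ => rfl
      have hk := hs1.f_le
      have hkn := hs1.le
      refine Tri.seq (k1 := searchTime n N μ) (k2 := D - 2 - searchTime n N μ + nestTime n D r)
        (tri_search (u := u) (k := k) hg3 (by rw [hs3, HState.setR_reg, if_pos rfl])
          (by rw [hr3 2 (by omega) (by omega) (by omega), hs1.regk])
          (by rw [hs3, HState.setR_reg, if_neg (by omega), HState.setR_reg, if_pos rfl])
          (by omega) (by omega) hs1.hB (l := l) hl' hN hp) ?_ (by omega)
      rintro s4 ⟨m4, r4, l4, c4⟩
      rw [maskSet_mask] at c4
      -- For an impossible guess the search leaves register 4 alone. The old set is then evaluated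
      -- again; its middle size, kept by `Loop.cur`, bounds the time.
      obtain ⟨T, hT4, hTf, hTn, hTmin⟩ : ∃ T : Finset (Fin n), s4.reg 4 = mask T ∧ f ≤ T.card ∧
          T.card + f ≤ n ∧ ((∃ S : Finset (Fin n), S.card = k ∧ (S ∩ U).card = u) →
            IsMinCut G k u U T) := by
        rcases c4 with ⟨h4, hno⟩ | ⟨T, h4, hT⟩
        · refine ⟨T₀, ?_, hT₀f, hT₀n, fun h => absurd h hno⟩
          rw [h4, hr3 4 (by omega) (by omega) (by omega), hT₀]
        · exact ⟨T, h4, by rw [hT.card]; exact hk, by rw [hT.card]; exact hkn, fun _ => hT⟩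
      have hr4 : ∀ x, x = 0 ∨ x = 2 ∨ 8 < x → x ≠ 32 + 2 * r → s4.reg x = s1.reg x :=
        fun x h1 h2 => by rw [r4 x (by omega), hr3 x (by omega) (by omega) h2]
      have hm4 : s4.mem = s1.mem := m4
      have hg4 : HasGraph G B s4 := hs1.graph.of_regs (hr4 0 (by omega) (by omega))
        fun _ _ => by rw [hm4]
      refine Tri.seq (k1 := evalTime n f) (k2 := 1 + nestTime n D r)
        (tri_evaluate (f := f) hg4 hs1.hB hT4 hTf hTn) ?_ (by omega)
      rintro s5 ⟨r5, l5, m5, c5⟩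
      have hr5 : ∀ x, x = 0 ∨ x = 2 ∨ 21 < x → x ≠ 32 + 2 * r → s5.reg x = s1.reg x :=
        fun x h1 h2 => by rw [r5 x (by omega), hr4 x (by omega) h2]
      have hg5 : HasGraph G B s5 := hg4.of_regs (r5 0 (by omega)) m5
      have hT5 : s5.reg 4 = mask T := by rw [r5 4 (by omega), hT4]
      have hU5 : s5.reg (33 + 2 * r) = mask U := by
        rw [hr5 _ (by omega) (by omega), hr1 _ (by omega), hU]
      have h20 : s5.reg 20 ≤ s1.reg 20 ∧ s5.reg 20 ≤ cost G T ∧ ∃ T : Finset (Fin n),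
          s5.reg 21 = mask T ∧ f ≤ T.card ∧ T.card + f ≤ n ∧ cost G T ≤ s5.reg 20 := by
        have h1 := hr4 20 (by omega) (by omega)
        have h2 := hr4 21 (by omega) (by omega)
        rcases c5 with ⟨h3, h4, h5⟩ | ⟨h3, h4, h5⟩
        · refine ⟨by rw [h4, h1], by rw [h4]; exact h3, ?_⟩
          obtain ⟨T', hT1, hT2, hT3, hT4⟩ := hs1.best
          exact ⟨T', by rw [h5, h2, hT1], hT2, hT3, by rw [h4, h1]; exact hT4⟩
        · exact ⟨by rw [h4, ← h1]; exact h3, by rw [h4], T, h5, hTf, hTn, by rw [h4]⟩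
      refine Tri.seq (k1 := 1) (k2 := nestTime n D r) (Tri.assign_den (Den.inter hg5 hT5 hU5)
        (hmask _) rfl) ?_ (by omega)
      rintro _ rfl
      set s6 := s5.setR (31 + 2 * r) (mask (T ∩ U) : ℕ) with hs6
      have hr6 : ∀ x, x ≠ 31 + 2 * r → s6.reg x = s5.reg x := fun x hx => by
        rw [hs6, HState.setR_reg, if_neg hx]
      have hloop : Loop G B f k s6 := by
        refine ⟨hg5.of_regs (hr6 0 (by omega)) fun _ _ => rfl, hs1.hB, ?_, hk, hkn,
          ⟨T, by rw [hr6 4 (by omega), hT5], hTf, hTn⟩, ?_⟩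
        · rw [hr6 2 (by omega), hr5 2 (by omega) (by omega), hs1.regk]
        · rw [hr6 21 (by omega), hr6 20 (by omega)]
          exact h20.2.2
      have hl6 : s6.left = l := l5.trans l4
      refine (ih (T ∩ U) s6 hloop (by rw [hs6, HState.setR_reg, if_pos rfl]) ?_).post ?_
      · have := Nat.mul_le_mul_right (1 + calls n r) (Nat.succ_le_of_lt hu)
        rw [Nat.succ_mul] at this
        omega
      rintro s7 ⟨hs7, hr7, hl7, h207, hw7⟩
      have h206 := hr6 20 (by omega)
      refine ⟨hs7, fun x hx => ?_, ?_, ?_, fun u' hu' b hb => ?_⟩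
      · rw [hr7 x (by omega), hr6 x (by omega), hr5 x (by omega) (by omega), hr1 x hx]
      · rw [Nat.succ_mul]
        omega
      · linarith [h20.1]
      · rcases Nat.lt_succ_iff_lt_or_eq.1 hu' with h | rfl
        · have := hw1 u' h b hb
          linarith [h20.1]
        · rcases hb.2 T (hTmin hb.1) with h | h
          · have h' : (cost G T : ℤ) ≤ b := by exact_mod_cast h
            linarith [h20.2.1]
          · exact hw7 b h
    · rintro s' ⟨h1, h2, h3, h4, h5⟩
      refine ⟨h1, fun x hx => h2 x (by omega), h3, h4, fun b hb => ?_⟩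
      obtain ⟨u, ⟨S, hS1, hS2⟩, hb⟩ := hb
      refine h5 u ?_ b ⟨⟨S, hS1, hS2⟩, hb⟩
      have h6 : (S ∩ U).card ≤ n := by simpa using Finset.card_le_univ (S ∩ U)
      omega

end Nest

/-! ### The complete algorithm on the structured machine. -/

section Main

/-- Write the positions of the vertices in the best ordering through the set in register `21`. -/
def arrange : Stm :=
  assign 11 (.var 21) ;; assign 12 (.pow 2 (.var 0) - 1) ;; dynamic ;; walk ;;
    assign 12 (.var 21) ;; assign 11 (.num 0) ;; dynamic ;; walk

/-- Find a good set. -/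
def choose (p : Prog) (K : ℕ) : Stm :=
  assign 4 (.pow 2 (.var 22) - 1) ;; assign 21 (.var 4) ;; assign 20 (2 * (succE * succE * succE)) ;;
    forS 23 (.var 0 - 2 * .var 22 + 1) (assign 2 (.var 22 + .var 23) ;;
      assign (31 + 2 * K) (.pow 2 (.var 0) - 1) ;; nest p K)

/-- Put the least set size into register `22`. -/
def setSize (num den n₀ : ℕ) : Stm := ifPos (.num n₀ - .var 0) (assign 22 (.num 0))
  (assign 22 (.num num * .var 0 / .num den))

/-- The whole algorithm. -/
def algorithm (p : Prog) (num den n₀ K : ℕ) : Stm := setSize num den n₀ ;; choose p K ;; arrange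

variable {n : ℕ} {G : Digraph (Fin n)} {B : ℕ} {s s' : HState}

/-- The part behind `T` comes first, because positions are assigned from the end. The second dynamic
program may overwrite the table since the first chain has already been read off. -/
theorem tri_arrange {Q : ℤ} {T : Finset (Fin n)} {f : ℕ} (hg : HasGraph G B s)
    (hB : 8 * (n + 1) ^ 5 ≤ B) (h21 : s.reg 21 = mask T) (hf1 : f ≤ T.card) (hf2 : T.card + f ≤ n) :
    Tri Q B arrange s (evalTime n f + 8 * n) fun s' => s'.reg 0 = n ∧
      ∃ π : Fin n ≃ Fin n, (∀ v : Fin n, s'.mem (n * n + (v : ℕ)) = position π v) ∧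
        arrangementCost G π = cost G T := by
  have hn := hg.le
  have hmask : ∀ S : Finset (Fin n), bits (mask S) ≤ B := fun S =>
    bits_le_of_lt ((mask_lt S).trans_le (Nat.pow_le_pow_right (by omega) hn))
  set A := [9, 10, 11, 12, 13, 14, 15, 16, 18] with hA
  rw [evalTime]
  generalize hk : (n + 1) * (2 ^ (n - f) * (4 * n + 8) + 2) + 1 = kd
  refine Tri.seq (k1 := 1) (k2 := 2 * kd + 8 * n + 8) (Tri.assign_den (z := mask T)
    (fun b => .var h21) (hmask T) rfl) ?_ (by omega)
  rintro _ rfl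
  have k1 : Keeps A s (s.setR 11 (mask T)) := (Keeps.refl _ _).setR (by simp [A]) _
  refine Tri.seq (k1 := 1) (k2 := 2 * kd + 8 * n + 7) (Tri.assign_den
    (z := (mask (Finset.univ : Finset (Fin n)) : ℕ)) (fun b => ?_) (hmask _) rfl) ?_ (by omega)
  · rw [mask_univ]
    exact (Ev.ntwo.npow (.var ((k1.reg 0 (by simp [A])).trans hg.reg)) hn).nsub .none
      Nat.one_le_two_pow
  rintro _ rfl
  set s2 := (s.setR 11 (mask T)).setR 12 (mask (Finset.univ : Finset (Fin n)) : ℕ) with hs2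
  have k2 : Keeps A s s2 := k1.setR (by simp [A]) _
  have R2 : Span G B T Finset.univ s2 :=
    ⟨hg.of_keeps (by simp [A]) k2 fun _ _ _ => rfl, by
      rw [hs2, HState.setR_reg, if_neg (by omega), HState.setR_reg, if_pos rfl], by
      rw [hs2, HState.setR_reg, if_pos rfl], Finset.subset_univ T, hB⟩
  refine Tri.seq (k1 := kd) (k2 := kd + 8 * n + 7) ((tri_dynamic R2).mono
    (hk ▸ dynamic_time_le (f := f) ?_) fun _ h => h) ?_ (by omega)
  · rw [← Finset.compl_eq_univ_sdiff, Finset.card_compl, Fintype.card_fin]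
    omega
  rintro s3 ⟨k3', m3, t3⟩
  have R3 := R2.of_keeps (by simp) (by simp) (by simp) k3' fun a h _ => m3 a h
  refine Tri.seq (k1 := 4 * n + 2) (k2 := kd + 4 * n + 5) (tri_walk R3 t3 (Arranged.univ fun _ => 0)
    fun v hv => absurd (Finset.mem_univ v) hv) ?_ (by omega)
  rintro s4 ⟨k4', m4, pos, hpos, hlink⟩
  have k4 : Keeps A s s4 := (k2.trans (k3'.mono (by simp [A]))).trans (k4'.mono (by simp [A]))
  have hg4 : HasGraph G B s4 := hg.of_keeps (by simp [A]) k4 fun a h1 h2 =>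
    (m4 a h1 h2).trans (m3 a h1)
  refine Tri.seq (k1 := 1) (k2 := kd + 4 * n + 4) (Tri.assign_den (z := mask T)
    (fun b => .var ((k4.reg 21 (by simp [A])).trans h21)) (hmask T) rfl) ?_ (by omega)
  rintro _ rfl
  refine Tri.seq (k1 := 1) (k2 := kd + 4 * n + 3) (Tri.assign_den (z := 0) (fun b => Ev.num 0)
    (by rw [bits_zero]; omega) rfl) ?_ (by omega)
  rintro _ rfl
  have k6 : Keeps A s4 ((s4.setR 12 (mask T)).setR 11 0) :=
    ((Keeps.refl _ _).setR (by simp [A]) _).setR (by simp [A]) _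
  have R6 : Span G B ∅ T ((s4.setR 12 (mask T)).setR 11 0) :=
    ⟨hg4.of_keeps (by simp [A]) k6 fun _ _ _ => rfl, by
      rw [HState.setR_reg, if_pos rfl, mask_empty]; rfl, by
      rw [HState.setR_reg, if_neg (by omega), HState.setR_reg, if_pos rfl],
      Finset.empty_subset T, hB⟩
  refine Tri.seq (k1 := kd) (k2 := 4 * n + 3) ((tri_dynamic R6).mono
    (hk ▸ dynamic_time_le (f := f) ?_) fun _ h => h) ?_ (by omega)
  · rwa [Finset.sdiff_empty]
  rintro s7 ⟨k7', m7, t7⟩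
  have R7 := R6.of_keeps (by simp) (by simp) (by simp) k7' fun a h _ => m7 a h
  refine ((tri_walk R7 t7 hpos fun v hv => ?_).mono (by omega) fun _ h => h).post ?_
  · rw [m7 _ (by positivity)]
    exact hlink v hv
  rintro s8 ⟨k8, -, pos', hpos', hlink'⟩
  obtain ⟨π, hπ, hcost⟩ := hpos'.exists_equiv
  refine ⟨by rw [k8.reg 0 (by simp), R7.graph.reg], π, fun v => ?_, ?_⟩
  · rw [hlink' v (Finset.notMem_empty v), hπ]
  · rw [hcost, cost]
    ring

theorem mask_prefix {f : ℕ} (hf : f ≤ n) :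
    mask (maskSet n (2 ^ f - 1)) = 2 ^ f - 1 ∧ (maskSet n (2 ^ f - 1)).card = f := by
  constructor
  · have h1 : 2 ^ f ≤ 2 ^ n := Nat.pow_le_pow_right (by omega) hf
    have h2 := Nat.two_pow_pos f
    exact mask_maskSet (by omega)
  · have h : maskSet n (2 ^ f - 1) = Finset.univ.filter fun v : Fin n => (v : ℕ) < f := by
      ext v
      simp [mem_maskSet, Nat.testBit_two_pow_sub_one]
    rw [h, Fin.card_filter_val_lt, min_eq_right hf]

/-- The initial set consists of the first `f` vertices, and the initial record `2 * (n + 1) ^ 3`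
exceeds every cost, so a valid set is available from the start. -/
theorem tri_choose {Q : ℤ} {p : Prog} {N μ f D K : ℕ} (hg : HasGraph G B s)
    (hB : 8 * (n + 1) ^ 5 ≤ B) (h22 : s.reg 22 = f) (hf : 2 * f ≤ n)
    (hN : N = 2 ^ ((n + 2) / 3)) (hp : Multiplies p N B μ)
    (hD : searchTime n N μ + evalTime n f + 3 ≤ D) (hl : (n + 1) * calls n K ≤ s.left) :
    Tri Q B (choose p K) s ((n + 1) * (nestTime n D K + 3) + 4) fun s' => HasGraph G B s' ∧
      ∃ T : Finset (Fin n), s'.reg 21 = mask T ∧ f ≤ T.card ∧ T.card + f ≤ n ∧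
        ∀ k b, f ≤ k → k + f ≤ n → Wins G k b K Finset.univ → cost G T ≤ b := by
  have hn := hg.le
  have hB2 : 2 * (n + 1) ^ 3 ≤ B := by
    have : (n + 1) ^ 3 ≤ (n + 1) ^ 5 := Nat.pow_le_pow_right (by omega) (by omega)
    omega
  have hnB : n + 1 ≤ B := by
    have := Nat.le_self_pow (show 5 ≠ 0 by omega) (n + 1)
    omega
  have hmask : ∀ S : Finset (Fin n), bits (mask S) ≤ B := fun S =>
    bits_le_of_lt ((mask_lt S).trans_le (Nat.pow_le_pow_right (by omega) hn))
  obtain ⟨hm, hc⟩ := mask_prefix (n := n) (f := f) (by omega)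
  set T := maskSet n (2 ^ f - 1)
  refine Tri.seq (k1 := 1) (k2 := (n + 1) * (nestTime n D K + 3) + 3) (Tri.assign_den
    (z := mask T) (fun b => ?_) (hmask T) rfl) ?_ (by omega)
  · rw [hm]
    exact (Ev.ntwo.npow (.var h22) (by omega)).nsub .none Nat.one_le_two_pow
  rintro _ rfl
  refine Tri.seq (k1 := 1) (k2 := (n + 1) * (nestTime n D K + 3) + 2) (Tri.assign_den
    (z := mask T) (fun b => .var ?_) (hmask T) rfl) ?_ (by omega)
  · rw [HState.setR_reg, if_pos rfl]
  rintro _ rfl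
  have h0 : ((s.setR 4 (mask T)).setR 21 (mask T)).reg 0 = n := by
    rw [HState.setR_reg, if_neg (by omega), HState.setR_reg, if_neg (by omega), hg.reg]
  refine Tri.seq (k1 := 1) (k2 := (n + 1) * (nestTime n D K + 3) + 1) (Tri.assign_den
    (z := (2 * (n + 1) ^ 3 : ℕ)) (fun b => ?_) (bits_le_of_le hB2) rfl) ?_ (by omega)
  · have h1 : Ev B ((s.setR 4 (mask T)).setR 21 (mask T)) b succE (n + 1 : ℕ) :=
      (Ev.var h0).nadd .none
    exact (Ev.ntwo.nmul ((h1.nmul h1).nmul h1)).congr (by push_cast; ring)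
  rintro _ rfl
  set s3 := ((s.setR 4 (mask T)).setR 21 (mask T)).setR 20 (2 * (n + 1) ^ 3 : ℕ) with hs3
  have h03 : s3.reg 0 = n := by rw [hs3, HState.setR_reg, if_neg (by omega), h0]
  have h223 : s3.reg 22 = f := by
    rw [hs3, HState.setR_reg, if_neg (by omega), HState.setR_reg, if_neg (by omega),
      HState.setR_reg, if_neg (by omega), h22]
  have hg3 : HasGraph G B s3 := hg.of_regs (h03.trans hg.reg.symm) fun _ _ => rfl
  refine Tri.forS_den (kb := nestTime n D K + 2) (m := n - 2 * f + 1) (fun i s' => HasGraph G B s' ∧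
      s'.reg 22 = f ∧ s.left ≤ s'.left + i * calls n K ∧
      (∃ T : Finset (Fin n), s'.reg 4 = mask T ∧ f ≤ T.card ∧ T.card + f ≤ n) ∧
      (∃ T : Finset (Fin n), s'.reg 21 = mask T ∧ f ≤ T.card ∧ T.card + f ≤ n ∧
        cost G T ≤ s'.reg 20) ∧
      ∀ k (b : ℕ), f ≤ k → k < f + i → Wins G k b K Finset.univ → s'.reg 20 ≤ b)
    (fun b => ((Ev.var h03).nsub (Ev.ntwo.nmul (.var h223)) hf).nadd .none)
    (bits_le_of_le (by omega)) ⟨hg3, h223, ?_, ⟨T, ?_, by omega, by omega⟩,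
      ⟨T, ?_, by omega, by omega, ?_⟩, fun k b h1 h2 => by omega⟩ ?_ ?_ ?_
  · rw [Nat.zero_mul]
    exact le_rfl
  · rw [hs3, HState.setR_reg, if_neg (by omega), HState.setR_reg, if_neg (by omega),
      HState.setR_reg, if_pos rfl]
  · rw [hs3, HState.setR_reg, if_neg (by omega), HState.setR_reg, if_pos rfl]
  · rw [hs3, HState.setR_reg, if_pos rfl]
    exact_mod_cast (cost_le_cube T).le
  · rintro i hi s4 ⟨hg4, h224, hl4, ⟨T₁, hT₁⟩, ⟨T₂, hT₂⟩, hw4⟩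
    have hr5 : ∀ x, x ≠ 23 → (s4.setR 23 i).reg x = s4.reg x := fun x hx => by
      rw [HState.setR_reg, if_neg hx]
    refine Tri.seq (k1 := 1) (k2 := nestTime n D K + 1) (Tri.assign_den (z := (f + i : ℕ))
      (fun b => Ev.nadd (.var (by rw [hr5 22 (by omega), h224])) (.var (by
        rw [HState.setR_reg, if_pos rfl]))) (bits_le_of_le (by omega)) rfl) ?_ (by omega)
    rintro _ rfl
    have h06 : ((s4.setR 23 i).setR 2 (f + i : ℕ)).reg 0 = n := by
      rw [HState.setR_reg, if_neg (by omega), hr5 0 (by omega), hg4.reg]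
    refine Tri.seq (k1 := 1) (k2 := nestTime n D K) (Tri.assign_den
      (z := (mask (Finset.univ : Finset (Fin n)) : ℕ)) (fun b => ?_) (hmask _) rfl) ?_ (by omega)
    · rw [mask_univ]
      exact (Ev.ntwo.npow (.var h06) hn).nsub .none Nat.one_le_two_pow
    rintro _ rfl
    set s7 := ((s4.setR 23 i).setR 2 (f + i : ℕ)).setR (31 + 2 * K)
      (mask (Finset.univ : Finset (Fin n)) : ℕ) with hs7
    have hr7 : ∀ x, x ≠ 2 → x < 23 → s7.reg x = s4.reg x := fun x h1 h2 => by
      rw [hs7, HState.setR_reg, if_neg (by omega), HState.setR_reg, if_neg h1, hr5 x (by omega)]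
    have hloop : Loop G B f (f + i) s7 := by
      refine ⟨hg4.of_regs (hr7 0 (by omega) (by omega)) fun _ _ => rfl, hB, ?_, by omega, by omega,
        ⟨T₁, ?_, hT₁.2⟩, ⟨T₂, ?_, hT₂.2.1, hT₂.2.2.1, ?_⟩⟩
      · rw [hs7, HState.setR_reg, if_neg (by omega), HState.setR_reg, if_pos rfl]
      · rw [hr7 4 (by omega) (by omega), hT₁.1]
      · rw [hr7 21 (by omega) (by omega), hT₂.1]
      · rw [hr7 20 (by omega) (by omega)]
        exact hT₂.2.2.2
    have hcalls : (i + 1) * calls n K ≤ (n + 1) * calls n K := Nat.mul_le_mul_right _ (by omega)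
    rw [Nat.succ_mul] at hcalls
    have hl7 : s7.left = s4.left := rfl
    refine (tri_nest hN hp hD K Finset.univ s7 hloop
      (by rw [hs7, HState.setR_reg, if_pos rfl]) (by omega)).post ?_
    rintro s8 ⟨hs8, hr8, hl8, h208, hw8⟩
    have h207 := hr7 20 (by omega) (by omega)
    refine ⟨hs8.graph, ?_, ?_, hs8.cur, hs8.best, fun k b h1 h2 h3 => ?_⟩
    · rw [hr8 22 (by omega), hr7 22 (by omega) (by omega), h224]
    · rw [Nat.succ_mul]
      omega
    · rcases Nat.lt_succ_iff_lt_or_eq.1 h2 with h | rfl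
      · have := hw4 k b h1 h h3
        linarith
      · exact hw8 b h3
  · have : (n - 2 * f + 1) * (nestTime n D K + 2 + 1) ≤ (n + 1) * (nestTime n D K + 2 + 1) :=
      Nat.mul_le_mul_right _ (by omega)
    exact Nat.add_le_add_right this 1
  · rintro s9 ⟨hg9, -, -, -, ⟨T', hT1, hT2, hT3, hT4⟩, hw⟩
    refine ⟨hg9, T', hT1, hT2, hT3, fun k b h1 h2 h3 => ?_⟩
    have := hw k b h1 (by omega) h3
    exact_mod_cast hT4.trans this

theorem tri_algorithm {Q : ℤ} {p : Prog} {num den n₀ N μ f D K : ℕ} (hg : HasGraph G B s)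
    (hB : 8 * (n + 1) ^ 5 ≤ B) (hf : f = if n < n₀ then 0 else num * n / den) (hfn : 2 * f ≤ n)
    (hN : N = 2 ^ ((n + 2) / 3)) (hp : Multiplies p N B μ)
    (hD : searchTime n N μ + evalTime n f + 3 ≤ D) (hl : (n + 1) * calls n K ≤ s.left) :
    Tri Q B (algorithm p num den n₀ K) s
      ((n + 1) * (nestTime n D K + 3) + evalTime n f + 8 * n + 6) fun s' => s'.reg 0 = n ∧
      ∃ π : Fin n ≃ Fin n, (∀ v : Fin n, s'.mem (n * n + (v : ℕ)) = position π v) ∧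
        ∀ k b, f ≤ k → k + f ≤ n → Wins G k b K Finset.univ → arrangementCost G π ≤ b := by
  have hn := hg.le
  have hset : Tri Q B (setSize num den n₀) s 2 fun s' => s' = s.setR 22 f := by
    refine Tri.ifPos_den (z := (n₀ : ℤ) - n) (k := 1) (fun b => (Ev.num _).sub hg.size)
      (fun hpos => ?_) (fun hneg => ?_)
    · rw [if_pos (by omega)] at hf
      exact Tri.assign_den (z := 0) (fun b => Ev.num 0) (by rw [bits_zero]; omega) (by rw [hf]; rfl)
    · rw [if_neg (by omega)] at hf
      refine Tri.assign_den (z := (f : ℕ)) (fun b => ?_) (bits_le_of_le (by omega)) rfl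
      rw [hf]
      exact Ev.ndiv (Ev.nmul (x := num) (Ev.num _) hg.size) (Ev.num _)
  refine Tri.seq (k1 := 2) (k2 := (n + 1) * (nestTime n D K + 3) + evalTime n f + 8 * n + 4) hset ?_
    (by omega)
  rintro _ rfl
  have hg1 : HasGraph G B (s.setR 22 f) := hg.of_regs
    (by rw [HState.setR_reg, if_neg (by omega)]) fun _ _ => rfl
  refine Tri.seq (k1 := (n + 1) * (nestTime n D K + 3) + 4) (k2 := evalTime n f + 8 * n)
    (tri_choose hg1 hB (by rw [HState.setR_reg, if_pos rfl]) hfn hN hp hD hl) ?_ (by omega)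
  rintro s2 ⟨hg2, T, h21, hT1, hT2, hw⟩
  refine (tri_arrange hg2 hB h21 hT1 hT2).post ?_
  rintro s3 ⟨h0, π, hπ, hc⟩
  exact ⟨h0, π, hπ, fun k b h1 h2 h3 => hc ▸ hw k b h1 h2 h3⟩

end Main

/-! ### Schoolbook matrix multiplication. -/

section Schoolbook

/-- The number `n * n`. -/
def sqE : Expr := .var 0 * .var 0

/-- One entry of the product of two matrices. -/
def entryE : Expr := .sum (.var 0) (.load (.var 1 / .var 0 * .var 0 + .bv 0) *
  .load (sqE + (.bv 0 * .var 0 + modE (.var 1) (.var 0))))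

/-- Matrix multiplication, entry by entry. -/
def schoolbook : Stm := forS 1 sqE (store (2 * sqE + .var 1) entryE)

/-- The layout of the input and the output of a matrix multiplication. -/
def matrixLayout : Layout where
  cells := 2 * sqE
  spacing := 2 * sqE + 2
  offset := 2 * sqE + 1
  outCells := sqE
  target := 2 * sqE
  source := 2 * sqE

variable {N : ℕ}

/-- The entries of a matrix, row by row. -/
def rowMajor (hN : 0 < N) (A : Matrix (Fin N) (Fin N) ℤ) (a : ℤ) : ℤ :=
  A ⟨a.toNat / N % N, Nat.mod_lt _ hN⟩ ⟨a.toNat % N, Nat.mod_lt _ hN⟩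

theorem rowMajor_eq (hN : 0 < N) (A : Matrix (Fin N) (Fin N) ℤ) (i j : Fin N) :
    rowMajor hN A ((i : ℤ) * N + j) = A i j := by
  have h1 : ((i : ℤ) * N + j).toNat = N * i + j := by
    rw [mul_comm, ← Nat.cast_mul, ← Nat.cast_add, Int.toNat_natCast]
  rw [rowMajor]
  congr 1
  · refine Fin.ext ?_
    simp only [h1]
    rw [Nat.mul_add_div hN, Nat.div_eq_of_lt j.isLt, add_zero, Nat.mod_eq_of_lt i.isLt]
  · refine Fin.ext ?_
    simp only [h1]
    rw [Nat.mul_add_mod, Nat.mod_eq_of_lt j.isLt]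

theorem matrixInput_rowMajor (hN : 0 < N) (A B : Matrix (Fin N) (Fin N) ℤ) (a : ℤ) :
    matrixInput A B a = (if 0 ≤ a ∧ a < (N : ℤ) * N then rowMajor hN A a else 0) +
      if (N : ℤ) * N ≤ a ∧ a < (N : ℤ) * N + N * N then rowMajor hN B (a - N * N) else 0 :=
  matrixInput_eq _ _ (fun i j => (rowMajor_eq hN A i j).symm) (fun i j => (rowMajor_eq hN B i j).symm)
    a

theorem matrixInput_zero (A B : Matrix (Fin N) (Fin N) ℤ) {a : ℤ}
    (ha : a < 0 ∨ (N : ℤ) * N + N * N ≤ a) : matrixInput A B a = 0 := by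
  refine Finset.sum_eq_zero fun i _ => Finset.sum_eq_zero fun j _ => ?_
  have h1 : (i : ℤ) + 1 ≤ N := by exact_mod_cast i.isLt
  have h2 : (j : ℤ) + 1 ≤ N := by exact_mod_cast j.isLt
  have h3 : (i : ℤ) * N + j < N * N := by nlinarith
  have h4 : 0 ≤ (i : ℤ) * N + j := by positivity
  have h5 : (0 : ℤ) ≤ N * N := by positivity
  rw [if_neg (by omega), if_neg (by omega), add_zero]

theorem row_lt (i j : Fin N) : (i : ℤ) * N + j < N * N := by
  have h1 : (i : ℤ) + 1 ≤ N := by exact_mod_cast i.isLt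
  have h2 : (j : ℤ) + 1 ≤ N := by exact_mod_cast j.isLt
  nlinarith

theorem matrixInput_left (A B : Matrix (Fin N) (Fin N) ℤ) (i j : Fin N) :
    matrixInput A B ((i : ℤ) * N + j) = A i j := by
  have h1 := row_lt i j
  rw [matrixInput_rowMajor i.pos, if_pos ⟨by positivity, h1⟩, if_neg (by omega), add_zero,
    rowMajor_eq]

theorem matrixInput_right (A B : Matrix (Fin N) (Fin N) ℤ) (i j : Fin N) :
    matrixInput A B ((N : ℤ) * N + ((i : ℤ) * N + j)) = B i j := by
  have h1 := row_lt i j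
  have h2 : (0 : ℤ) ≤ (i : ℤ) * N + j := by positivity
  rw [matrixInput_rowMajor i.pos, if_neg (by omega), if_pos (by omega), zero_add,
    add_sub_cancel_left, rowMajor_eq]

theorem bits_matrixInput_le {b : ℕ} {A B : Matrix (Fin N) (Fin N) ℤ}
    (h : ∀ i j, bits (A i j) ≤ b ∧ bits (B i j) ≤ b) (a : ℤ) : bits (matrixInput A B a) ≤ b := by
  rcases Nat.eq_zero_or_pos N with rfl | hN
  · simp [matrixInput, bits_zero]
  rw [matrixInput_rowMajor hN]
  split_ifs
  · omega
  · rw [add_zero]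
    exact (h _ _).1
  · rw [zero_add]
    exact (h _ _).2
  · simp [bits_zero]

theorem tri_schoolbook {Q : ℤ} {b B : ℕ} {A A' : Matrix (Fin N) (Fin N) ℤ} {s : HState}
    (hb : ∀ i j, bits (A i j) ≤ b ∧ bits (A' i j) ≤ b) (h0 : s.reg 0 = N)
    (hm : s.mem = matrixInput A A') (hB : 2 * N + 2 * b + 10 ≤ B) :
    Tri Q B schoolbook s (2 * (N * N) + 1) fun s' => s'.reg 0 = N ∧
      ∀ i j : Fin N, s'.mem (2 * ((N : ℤ) * N) + ((i : ℤ) * N + j)) = (A * A') i j := by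
  have hNN : N * N < 2 ^ B := by
    have h1 : N < 2 ^ N := Nat.lt_two_pow_self
    have h2 : N * N < 2 ^ N * 2 ^ N := Nat.mul_lt_mul'' h1 h1
    rw [← pow_add] at h2
    exact h2.trans_le (Nat.pow_le_pow_right (by omega) (by omega))
  have sq : ∀ {s : HState} {b : ℕ → ℤ}, s.reg 0 = N → Ev B s b sqE (N * N : ℕ) := fun h =>
    (Ev.var h).nmul (.var h)
  refine Tri.forS_den (kb := 1) (m := N * N) (fun m s' => s'.reg 0 = N ∧
    (∀ a : ℤ, a < 2 * ((N : ℤ) * N) → s'.mem a = matrixInput A A' a) ∧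
    ∀ i j : Fin N, ((i : ℤ) * N + j) < m →
      s'.mem (2 * ((N : ℤ) * N) + ((i : ℤ) * N + j)) = (A * A') i j)
    (fun b => sq h0) (bits_le_of_lt hNN) ⟨h0, fun a _ => by rw [hm], fun i j h => ?_⟩ ?_ (by omega) ?_
  · have h2 : (0 : ℤ) ≤ (i : ℤ) * N + j := by positivity
    omega
  · rintro m hmN s1 ⟨h01, hm1, hr1⟩
    have hN : 0 < N := by
      rcases Nat.eq_zero_or_pos N with rfl | h
      · omega
      · exact h
    have h02 : (s1.setR 1 m).reg 0 = N := by rw [HState.setR_reg, if_neg (by omega), h01]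
    have h12 : (s1.setR 1 m).reg 1 = m := by rw [HState.setR_reg, if_pos rfl]
    set x : Fin N := ⟨m / N, by rwa [Nat.div_lt_iff_lt_mul hN]⟩ with hx
    set z : Fin N := ⟨m % N, Nat.mod_lt _ hN⟩ with hz
    have hm' : ((x : ℕ) : ℤ) * N + (z : ℕ) = m := by
      have := Nat.div_add_mod m N
      simp only [hx, hz]
      rw [mul_comm]
      exact_mod_cast this
    refine Tri.store_den (z := 2 * ((N : ℤ) * N) + m) (w := (A * A') x z) (fun b => ?_) (fun b => ?_)
      ?_ ⟨h02, fun a ha => ?_, fun i j hij => ?_⟩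
    · refine Ev.add (Ev.mul Ev.two ((sq h02).congr (by push_cast; rfl))) (.var h12)
    · refine (Ev.sum (F := fun y => s1.mem ((x : ℕ) * N + y) * s1.mem (N * N + (y * N + (z : ℕ))))
        (.var h02) (by omega) fun y hy => ?_).congr ?_
      · exact (Ev.load ((((Ev.var h12).ndiv (.var h02)).mul (.var h02)).add .bv0) rfl).mul
          (Ev.load (((sq h02).congr (by push_cast; rfl)).add ((Ev.bv0.mul (.var h02)).add
            ((Ev.var h12).nmod (.var h02)))) rfl)
      · rw [Matrix.mul_apply, ← Fin.sum_univ_eq_sum_range (fun y : ℕ =>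
          s1.mem ((x : ℕ) * N + y) * s1.mem (N * N + (y * N + (z : ℕ))))]
        refine Finset.sum_congr rfl fun y _ => ?_
        have h3 := row_lt x y
        have h4 := row_lt y z
        have h5 : (0 : ℤ) ≤ (N : ℤ) * N := by positivity
        rw [hm1 _ (by omega), hm1 _ (by omega), matrixInput_left, matrixInput_right]
    · rw [Matrix.mul_apply]
      have h6 : ∀ y : Fin N, bits (A x y * A' y z) ≤ b + b := fun y =>
        (bits_mul_le _ _).trans (add_le_add (hb x y).1 (hb y z).2)
      have h7 := bits_sum_le (fun y => if h : y < N then A x ⟨y, h⟩ * A' ⟨y, h⟩ z else 0) N (b + b)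
        fun y hy => by
          rw [dif_pos hy]
          exact h6 _
      rw [← Fin.sum_univ_eq_sum_range (fun y => if h : y < N then A x ⟨y, h⟩ * A' ⟨y, h⟩ z else 0)]
        at h7
      simp only [Fin.is_lt, dif_pos] at h7
      exact h7.trans (by omega)
    · rw [HState.setM_mem, if_neg (by omega)]
      exact hm1 a ha
    · rw [HState.setM_mem]
      by_cases hc : (i : ℤ) * N + j = m
      · rw [if_pos (by rw [hc])]
        have e1 := rowMajor_eq hN (A * A') i j
        have e2 := rowMajor_eq hN (A * A') x z
        rw [hc] at e1
        rw [hm'] at e2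
        rw [← e1, ← e2]
      · rw [if_neg (by omega)]
        push_cast at hij
        exact hr1 i j (by omega)
  · rintro s' ⟨h1, -, h3⟩
    exact ⟨h1, fun i j => h3 i j (by push_cast; exact row_lt i j)⟩

theorem exec_schoolbook {b : ℕ} {A A' : Matrix (Fin N) (Fin N) ℤ} (hN : 1 ≤ N)
    (hb : ∀ i j, bits (A i j) ≤ b ∧ bits (A' i j) ≤ b) :
    ∃ t S, Exec (matrixLayout.wrap schoolbook) (State.init N (matrixInput A A')) t S ∧
      t ≤ 7 * (N * N) * (2 * N + 2 * b + 12) ^ matrixLayout.wt schoolbook ∧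
      ∀ i j : Fin N, S.mem (2 * ((N : ℤ) * N) + ((i : ℤ) * N + j)) = (A * A') i j := by
  -- The bound is linear in `N` because a range of summation may not exceed it. The resulting
  -- polynomial overhead in `N` spoils the exponent but does no harm.
  set B := 2 * N + 2 * b + 10 with hBdef
  have hNN : 8 * (N * N) < 2 ^ B := by
    have h1 : N < 2 ^ N := Nat.lt_two_pow_self
    have h2 : N * N < 2 ^ N * 2 ^ N := Nat.mul_lt_mul'' h1 h1
    calc 8 * (N * N) < 2 ^ 3 * (2 ^ N * 2 ^ N) := by omega
      _ = 2 ^ (2 * N + 3) := by ring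
      _ ≤ 2 ^ B := Nat.pow_le_pow_right (by omega) (by omega)
  have hN1 : 1 ≤ N * N := Nat.mul_pos hN hN
  have sq : ∀ {s : HState} {b : ℕ → ℤ}, s.reg 0 = N → Ev B s b sqE (N * N : ℕ) := fun h =>
    (Ev.var h).nmul (.var h)
  have h0 : ∀ m, (⟨initReg N, m, m, 0⟩ : HState).reg 0 = N := fun m => by simp [initReg]
  have e1 : ∀ {s : HState} {b : ℕ → ℤ}, s.reg 0 = N → Ev B s b (2 * sqE) (2 * (N * N) : ℕ) :=
    fun h => Ev.ntwo.nmul (sq h)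
  have conv : ∀ {e : Expr} {s : HState} {z : ℤ}, Den B s e z → e.Safe B s ∧ e.val s = z :=
    fun h => ⟨(h _).ok, (h _).eq⟩
  obtain ⟨t, S, E, ht, s, ⟨hs0, hs⟩, hS⟩ := matrixLayout.exec_wrap schoolbook (n := N)
    (cells := 2 * (N * N)) (left := 0) (B := B) (k := 2 * (N * N) + 1) (input := matrixInput A A')
    (Q := (2 * (N * N) + 2 : ℕ)) (off := (2 * (N * N) + 1 : ℕ)) (cnt := N * N)
    (g := (2 * (N * N) : ℕ)) (b := (2 * (N * N) : ℕ)) (bits_le_of_le (by omega))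
    (fun a => (bits_matrixInput_le hb a).trans (by omega))
    (fun a ha => matrixInput_zero _ _ (by push_cast at ha; omega))
    (fun m => conv fun b => e1 (h0 m)) (fun m => conv fun b => (e1 (h0 m)).nadd .ntwo)
    (fun m => conv fun b => (e1 (h0 m)).nadd .none) (bits_le_of_lt (by omega)) (by omega) (by omega)
    (by omega) (tri_schoolbook (s := ⟨initReg N, matrixInput A A', fun _ => 0, 0⟩) hb (by simp [initReg])
      rfl le_rfl) (bits_le_of_lt (by omega))
    (bits_le_of_lt (by omega)) (bits_le_of_lt (by omega))
    (fun s ⟨hs0, _⟩ => by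
      obtain ⟨h1, h2⟩ := conv (e := sqE) (s := s) (z := (N * N : ℕ)) fun b => sq hs0
      obtain ⟨h3, h4⟩ := conv (e := 2 * sqE) (s := s) (z := (2 * (N * N) : ℕ)) fun b => e1 hs0
      exact ⟨h1, h2, h3, h4, h3, h4⟩) (fun i j _ hi h => by
      have h1 : ((i : ℤ) + (2 * (N * N) : ℕ)) < 3 * (N * N : ℕ) := by push_cast; omega
      have h2 : ((2 * (N * N) : ℕ) : ℤ) * (2 * (N * N) + 2 : ℕ) ≤
          (j + (2 * (N * N) : ℕ)) * (2 * (N * N) + 2 : ℕ) :=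
        mul_le_mul_of_nonneg_right (by omega) (by positivity)
      have h3 : (1 : ℤ) ≤ ((N * N : ℕ) : ℤ) := by exact_mod_cast hN1
      push_cast at h h1 h2 h3
      nlinarith)
  refine ⟨t, S, E, ht.trans ?_, fun i j => ?_⟩
  · exact Nat.mul_le_mul_right _ (by omega)
  · have h1 := row_lt i j
    have h2 := hS (i * N + j) (by exact_mod_cast h1)
    rw [← hs i j]
    convert h2 using 2 <;> push_cast <;> ring

end Schoolbook

/-! ### Admissible exponents. -/

section Exponent

/-- The value of the exponent is irrelevant. It only shows that the set in `matMulExponent` is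
nonempty, so that its infimum can be approached by members. -/
theorem multipliesMatrices_schoolbook :
    MultipliesMatricesInTime ((matrixLayout.wt schoolbook + 2 : ℕ) : ℝ) := by
  have key := @exec_schoolbook
  generalize matrixLayout.wt schoolbook = w at key ⊢
  refine ⟨matrixLayout.wrap schoolbook, 7 * 14 ^ w, w, fun N hN b A B hb => ?_⟩
  obtain ⟨t, S, E, ht, hS⟩ := key hN hb
  refine ⟨t, S, E, hS, ?_⟩
  have h1 : 2 * N + 2 * b + 12 ≤ 14 * ((b + 1) * N) := by nlinarith
  have h2 : t ≤ 7 * 14 ^ w * (b + 1) ^ w * N ^ (w + 2) := by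
    refine (ht.trans (Nat.mul_le_mul_left _ (Nat.pow_le_pow_left h1 w))).trans (le_of_eq ?_)
    rw [mul_pow, mul_pow]
    ring
  have h3 : (t : ℝ) ≤ (7 * 14 ^ w : ℕ) * (b + 1 : ℝ) ^ w * (N : ℝ) ^ (w + 2) := by
    have : (t : ℝ) ≤ ((7 * 14 ^ w * (b + 1) ^ w * N ^ (w + 2) : ℕ) : ℝ) := by exact_mod_cast h2
    push_cast at this ⊢
    exact this
  rw [Real.rpow_natCast]
  refine h3.trans ?_
  have h4 : (0 : ℝ) ≤ Nat.log 2 N := Nat.cast_nonneg _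
  gcongr
  linarith

theorem MultipliesMatricesInTime.mono {τ τ' : ℝ} (h : MultipliesMatricesInTime τ) (hle : τ ≤ τ') :
    MultipliesMatricesInTime τ' := by
  obtain ⟨p, C, c, h⟩ := h
  refine ⟨p, C, c, fun N hN b A B hb => ?_⟩
  obtain ⟨t, s, E, hs, ht⟩ := h N hN b A B hb
  refine ⟨t, s, E, hs, ht.trans ?_⟩
  have h1 : (1 : ℝ) ≤ N := by exact_mod_cast hN
  exact mul_le_mul_of_nonneg_left (Real.rpow_le_rpow_of_exponent_le h1 hle) (by positivity)

theorem multipliesMatrices_of_lt {τ : ℝ} (h : matMulExponent < τ) : MultipliesMatricesInTime τ := by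
  obtain ⟨τ', h1, h2⟩ := exists_lt_of_csInf_lt
    (s := {τ | MultipliesMatricesInTime τ}) ⟨_, multipliesMatrices_schoolbook⟩ h
  exact MultipliesMatricesInTime.mono h1 h2.le

/-- A program for matrix multiplication writes all entries of the product. -/
theorem sq_le_time {p : Prog} {N t : ℕ} {s : State} {A : Matrix (Fin N) (Fin N) ℤ}
    (E : Exec p (State.init N (matrixInput A A)) t s) (hA : ∀ i j, (A * A) i j ≠ 0)
    (hs : ∀ i j : Fin N, s.mem (2 * ((N : ℤ) * N) + ((i : ℤ) * N + j)) = (A * A) i j) :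
    N * N ≤ t := by
  have hinj : Function.Injective fun x : Fin (N * N) => (2 * ((N : ℤ) * N) + (x : ℕ)) :=
    fun x y h => Fin.ext (by simpa using h)
  have h := E.card_le (Finset.univ.map ⟨_, hinj⟩) fun a ha => ?_
  · simpa using h
  · obtain ⟨x, -, rfl⟩ := Finset.mem_map.1 ha
    simp only [Function.Embedding.coeFn_mk]
    have hN : 0 < N := by
      by_contra h
      have := x.isLt
      simp [Nat.le_zero.1 (not_lt.1 h)] at this
    have hx : (((x : ℕ) / N : ℕ) : ℤ) * N + ((x : ℕ) % N : ℕ) = (x : ℕ) := by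
      exact_mod_cast Nat.div_add_mod' (x : ℕ) N
    have h1 := hs ⟨x / N, by rw [Nat.div_lt_iff_lt_mul hN]; exact x.isLt⟩ ⟨x % N, Nat.mod_lt _ hN⟩
    simp only at h1
    rw [hx] at h1
    rw [h1, State.init]
    simp only
    rw [matrixInput_zero _ _ (Or.inr (by omega))]
    exact hA _ _

end Exponent

/-! ### Counting the steps. -/

section Time

theorem calls_le (n r : ℕ) : calls n r + 1 ≤ (n + 2) ^ r := by
  induction r with
  | zero => simp [calls]
  | succ r ih =>
    have h := Nat.mul_le_mul_right (n + 2) ih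
    rw [pow_succ, calls]
    nlinarith

/-- The summand `D + 2` on the left strengthens the claim so that the induction closes with a factor
`n + 2` per level. -/
theorem nestTime_le (n D r : ℕ) : nestTime n D r + D + 2 ≤ (n + 2) ^ r * (D + 3) := by
  induction r with
  | zero =>
    rw [nestTime, pow_zero]
    omega
  | succ r ih =>
    have h := Nat.mul_le_mul_right (n + 2) ih
    rw [pow_succ, nestTime]
    nlinarith

theorem searchTime_add_evalTime_le (n N μ f : ℕ) : searchTime n N μ + evalTime n f + 6 ≤
    30 * (n + 2) ^ 2 * (N * N + μ + 2 ^ (n - f)) := by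
  rw [searchTime, evalTime]
  have h : 1 ≤ 2 ^ (n - f) := Nat.one_le_two_pow
  generalize 2 ^ (n - f) = Y at h ⊢
  generalize N * N = M
  nlinarith [Nat.mul_le_mul_left (n * n) h, Nat.mul_le_mul_left n h, Nat.zero_le (n * n * M),
    Nat.zero_le (n * M), Nat.zero_le (n * n * μ), Nat.zero_le (n * μ)]

theorem algorithm_time_le (n N μ f K : ℕ) :
    n * n + ((n + 1) * (nestTime n (searchTime n N μ + evalTime n f + 3) K + 3) + evalTime n f +
      8 * n + 6) + n + 1 ≤ 70 * (n + 2) ^ (K + 3) * (N * N + μ + 2 ^ (n - f)) := by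
  have h1 := searchTime_add_evalTime_le n N μ f
  have h2 := nestTime_le n (searchTime n N μ + evalTime n f + 3) K
  have hX : 1 ≤ N * N + μ + 2 ^ (n - f) := Nat.one_le_two_pow.trans (Nat.le_add_left _ _)
  generalize hD : searchTime n N μ + evalTime n f + 3 = D at h1 h2 ⊢
  have h3 : evalTime n f ≤ D := by omega
  generalize N * N + μ + 2 ^ (n - f) = X at h1 hX ⊢
  have hP : 1 ≤ (n + 2) ^ K := Nat.one_le_pow _ _ (by omega)
  have h4 : (n + 2) ^ (K + 3) = (n + 2) ^ K * (n + 2) ^ 3 := pow_add _ _ _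
  rw [h4]
  generalize (n + 2) ^ K = P at h2 hP ⊢
  have h5 : nestTime n D K + 3 ≤ P * (30 * (n + 2) ^ 2 * X) := by
    have := Nat.mul_le_mul_left P (show D + 3 ≤ 30 * (n + 2) ^ 2 * X by omega)
    omega
  have h6 := Nat.mul_le_mul_left (n + 1) h5
  have h7 : 1 ≤ P * X := Nat.mul_pos hP hX
  have h8 : 30 * (n + 2) ^ 2 * X ≤ 30 * (n + 2) ^ 2 * (P * X) :=
    Nat.mul_le_mul_left _ (Nat.le_mul_of_pos_left _ hP)
  have h9 : (n + 2) ^ 3 * 1 ≤ (n + 2) ^ 3 * (P * X) := Nat.mul_le_mul_left _ h7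
  have h10 : P * (n + 2) ^ 3 * X = (n + 2) ^ 3 * (P * X) := by ring
  have h11 : (n + 1) * (P * (30 * (n + 2) ^ 2 * X)) = 30 * (n + 1) * (n + 2) ^ 2 * (P * X) := by
    ring
  have h12 : n * n + 9 * n + 7 ≤ 7 * (n + 2) ^ 3 := by nlinarith [Nat.zero_le (n ^ 3)]
  have h13 : 30 * (n + 1) * (n + 2) ^ 2 * (P * X) + 30 * (n + 2) ^ 2 * (P * X) =
      30 * (n + 2) ^ 3 * (P * X) := by ring
  nlinarith

end Time

/-! ### Assembly on the original machine and the final estimate. -/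

section Final

variable {n : ℕ}

open Classical in
theorem digraphInput_apply (G : Digraph (Fin n)) (u v : Fin n) :
    digraphInput G ((u : ℤ) * n + v) = if G.Adj u v then 1 else 0 := by
  rw [digraphInput]
  refine if_congr ⟨?_, fun h => ⟨u, v, rfl, h⟩⟩ rfl rfl
  rintro ⟨u', v', h, ha⟩
  have h1 := rowMajor_eq u.pos (fun x y => if G.Adj x y then (1 : ℤ) else 0) u v
  have h2 := rowMajor_eq u.pos (fun x y => if G.Adj x y then (1 : ℤ) else 0) u' v'
  rw [h, h2, if_pos ha] at h1
  by_contra hc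
  rw [if_neg hc] at h1
  exact one_ne_zero h1

theorem digraphInput_zero (G : Digraph (Fin n)) {a : ℤ} (ha : a < 0 ∨ ((n * n : ℕ) : ℤ) ≤ a) :
    digraphInput G a = 0 := by
  refine if_neg ?_
  rintro ⟨u, v, rfl, -⟩
  have h1 := row_lt u v
  have h2 : (0 : ℤ) ≤ (u : ℤ) * n + v := by positivity
  push_cast at ha
  omega

theorem bits_digraphInput_le (G : Digraph (Fin n)) (a : ℤ) : bits (digraphInput G a) ≤ 1 := by
  rw [digraphInput]
  split_ifs
  · exact bits_one.le
  · rw [bits_zero]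
    omega

/-- The layout of the input and the output of the algorithm. -/
def arrangementLayout (K : ℕ) : Layout where
  cells := sqE
  spacing := .pow (.var 0 + 2) (.num (K + 5 : ℕ))
  offset := sqE + 1
  outCells := .var 0
  target := .num 0
  source := sqE

/-- All numbers have at most `B` bits, polynomially many in `n` for fixed `K`, so the factor `(B +
2) ^ wt` per step is polynomial. -/
theorem exec_algorithm {p : Prog} {num den n₀ N μ f K B : ℕ} (G : Digraph (Fin n))
    (hB : B = (K + 8) * (n + 2) ^ 5) (hf : f = if n < n₀ then 0 else num * n / den)
    (hfn : 2 * f ≤ n) (hN : N = 2 ^ ((n + 2) / 3)) (hp : Multiplies p N B μ) :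
    ∃ t S, Exec ((arrangementLayout K).wrap (algorithm p num den n₀ K))
      (State.init n (digraphInput G)) t S ∧
      t ≤ 70 * (n + 2) ^ (K + 3) * (N * N + μ + 2 ^ (n - f)) *
        (B + 2) ^ (arrangementLayout K).wt (algorithm p num den n₀ K) ∧
      ∃ π : Fin n ≃ Fin n, (∀ v : Fin n, S.mem (v : ℤ) = position π v) ∧
        ∀ k b, f ≤ k → k + f ≤ n → Wins G k b K Finset.univ → arrangementCost G π ≤ b := by
  have hm : ∀ i, 1 ≤ (n + 2) ^ i := fun i => Nat.one_le_pow _ _ (by omega)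
  have hB5 : 8 * (n + 2) ^ 5 + K * (n + 2) ^ 5 = B := by rw [hB]; ring
  have hm5 : (n + 2) * (n + 2) ≤ (n + 2) ^ 5 := by
    rw [← pow_two]
    exact Nat.pow_le_pow_right (by omega) (by omega)
  have hK5 : K * ((n + 2) * (n + 2)) ≤ K * (n + 2) ^ 5 := Nat.mul_le_mul_left _ hm5
  have hnB : n * n + n + K + 9 ≤ B := by nlinarith
  have hn5 : 8 * (n + 1) ^ 5 ≤ B := by
    have := Nat.pow_le_pow_left (show n + 1 ≤ n + 2 by omega) 5
    omega
  have hQB : bits (((n + 2) ^ (K + 5) : ℕ) : ℤ) ≤ B := by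
    have h1 := bits_pow_le (n + 2 : ℕ) (K + 5)
    have h2 := Nat.mul_le_mul_left (K + 5) (bits_natCast_le_self (n + 2))
    rw [← Nat.cast_pow] at h1
    nlinarith
  have sq : ∀ {s : HState} {b : ℕ → ℤ}, s.reg 0 = n → Ev B s b sqE (n * n : ℕ) := fun h =>
    (Ev.var h).nmul (.var h)
  have h0 : ∀ m, (⟨initReg n, m, m, 0⟩ : HState).reg 0 = n := fun m => by simp [initReg]
  have conv : ∀ {e : Expr} {s : HState} {z : ℤ}, Den B s e z → e.Safe B s ∧ e.val s = z :=
    fun h => ⟨(h _).ok, (h _).eq⟩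
  -- The spacing must leave a residue class for every search: at most `calls n K` for each of at
  -- most `n + 1` sizes.
  have hleft : n * n + 1 + (n + 1) * calls n K < (n + 2) ^ (K + 5) := by
    have h1 := calls_le n K
    have h2 := hm K
    have h3 : (n + 2) ^ (K + 5) = (n + 2) ^ K * (n + 2) ^ 5 := pow_add _ _ _
    have h4 := Nat.mul_le_mul_left ((n + 2) ^ K) hm5
    rw [h3]
    generalize (n + 2) ^ K = P at h1 h2 h4 ⊢
    nlinarith [Nat.mul_le_mul_left ((n + 2) * (n + 2)) h2, Nat.mul_le_mul_left (n + 1) h1]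
  have hg : HasGraph G B ⟨initReg n, digraphInput G, fun _ => 0, (n + 1) * calls n K⟩ :=
    ⟨by simp [initReg], by omega, fun u v => digraphInput_apply G u v⟩
  -- The positions are stored from cell `n * n` of the spread-out memory on, beyond the output cells
  -- `0, …, n - 1` of the machine.
  have hlow : ∀ j : ℕ, (n : ℤ) < (j + ((n * n : ℕ) : ℤ)) * ((n + 2) ^ (K + 5) : ℕ) ∨ n = 0 := by
    intro j
    rcases Nat.eq_zero_or_pos n with h | h
    · exact Or.inr h
    · left
      have h1 : 1 ≤ j + n * n := by nlinarith
      have h2 : n < (n + 2) ^ (K + 5) := by nlinarith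
      have h3 := Nat.mul_le_mul_right ((n + 2) ^ (K + 5)) h1
      exact_mod_cast (by omega : n < (j + n * n) * (n + 2) ^ (K + 5))
  obtain ⟨t, S, E, ht, s, ⟨hs0, π, hπ, hw⟩, hS⟩ := (arrangementLayout K).exec_wrap
    (algorithm p num den n₀ K) (n := n) (cells := n * n) (left := (n + 1) * calls n K) (B := B)
    (input := digraphInput G) (Q := ((n + 2) ^ (K + 5) : ℕ)) (off := (n * n + 1 : ℕ)) (cnt := n)
    (g := 0) (b := (n * n : ℕ)) (bits_le_of_le (by omega))
    (fun a => (bits_digraphInput_le G a).trans (by omega)) (fun a ha => digraphInput_zero G ha)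
    (fun m => conv fun b => sq (h0 m))
    (fun m => conv fun b => ((Ev.var (h0 m)).nadd .ntwo).npow (.num _) (by omega))
    (fun m => conv fun b => (sq (h0 m)).nadd .none) hQB (by omega) (by omega)
    (by exact_mod_cast hleft) (tri_algorithm hg hn5 hf hfn hN hp le_rfl le_rfl)
    (bits_le_of_le (by omega)) (by rw [bits_zero]; omega) (bits_le_of_le (by omega))
    (fun s ⟨hs0, _⟩ => by
      obtain ⟨h1, h2⟩ := conv (e := .var 0) (s := s) (z := n) fun b => .var hs0
      obtain ⟨h3, h4⟩ := conv (e := .num 0) (s := s) (z := 0) fun b => .num 0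
      obtain ⟨h5, h6⟩ := conv (e := sqE) (s := s) (z := (n * n : ℕ)) fun b => sq hs0
      exact ⟨h1, h2, h3, h4, h5, h6⟩)
    (fun i j _ hi h => by
      rcases hlow j with h1 | h1
      · omega
      · omega)
  refine ⟨t, S, E, ht.trans (Nat.mul_le_mul_right _ (algorithm_time_le n N μ f K)), π,
    fun v => ?_, hw⟩
  have h1 := hS v v.isLt
  rw [add_zero] at h1
  rw [h1, ← hπ v]
  congr 1
  push_cast
  ring

/-- Rounding n/3 up changes the exponent by at most `|τ|`. The absolute value avoids any assumption
on the sign of `τ`. -/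
theorem pow_third_le (τ : ℝ) (n : ℕ) :
    ((2 ^ ((n + 2) / 3) : ℕ) : ℝ) ^ τ ≤ (2 ^ ⌈|τ|⌉₊ : ℕ) * (2 : ℝ) ^ (τ * n / 3) := by
  have h1 : (((n + 2) / 3 : ℕ) : ℝ) ≤ n / 3 + 1 := by
    have : 3 * ((n + 2) / 3) ≤ n + 3 := by omega
    have : (3 : ℝ) * ((n + 2) / 3 : ℕ) ≤ n + 3 := by exact_mod_cast this
    linarith
  have h2 : (n : ℝ) / 3 ≤ ((n + 2) / 3 : ℕ) := by
    have : n ≤ 3 * ((n + 2) / 3) := by omega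
    have : (n : ℝ) ≤ 3 * ((n + 2) / 3 : ℕ) := by exact_mod_cast this
    linarith
  generalize (n + 2) / 3 = h at h1 h2 ⊢
  rw [Nat.cast_pow, Nat.cast_pow, Nat.cast_ofNat, ← Real.rpow_natCast, ← Real.rpow_natCast,
    ← Real.rpow_mul (by norm_num), ← Real.rpow_add (by norm_num)]
  refine Real.rpow_le_rpow_of_exponent_le (by norm_num) ?_
  have h3 : |τ * (h - n / 3)| ≤ |τ| * 1 := by
    rw [abs_mul]
    exact mul_le_mul_of_nonneg_left (abs_le.2 ⟨by linarith, by linarith⟩) (abs_nonneg _)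
  have h4 := Nat.le_ceil |τ|
  have h5 := le_abs_self (τ * (h - n / 3))
  have h6 : τ * (h - n / 3) = h * τ - τ * n / 3 := by ring
  linarith

/-- Besides the multiplication itself, `N * N` is put under the same bound; this covers writing the
matrices and scanning the product. -/
theorem MultipliesMatricesInTime.exists_multiplies {τ : ℝ} (h : MultipliesMatricesInTime τ) :
    ∃ (p : Prog) (C c : ℕ), ∀ N B : ℕ, 1 ≤ N → 1 ≤ B → ∃ μ, Multiplies p N B μ ∧
      ((N * N + μ : ℕ) : ℝ) ≤ C * (B + Nat.log 2 N + 1 : ℝ) ^ c * (N : ℝ) ^ τ := by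
  obtain ⟨p, C, c, hp⟩ := h
  refine ⟨p, 2 * C, c, fun N B hN hB => ⟨⌊C * (B + Nat.log 2 N + 1 : ℝ) ^ c * (N : ℝ) ^ τ⌋₊,
    fun A A' hA => ?_, ?_⟩⟩
  · obtain ⟨t, S, E, hS, ht⟩ := hp N hN B A A' hA
    exact ⟨t, S, Nat.le_floor ht, E, hS⟩
  -- The square of the all-ones matrix has all entries equal to `N`, so every output cell changes
  -- from 0 to a nonzero value.
  · obtain ⟨t, S, E, hS, ht⟩ := hp N hN B (.of fun _ _ => 1) (.of fun _ _ => 1) fun _ _ => by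
      rw [Matrix.of_apply, bits_one]
      exact ⟨hB, hB⟩
    have h1 := sq_le_time E (fun i j => by
      rw [Matrix.mul_apply]
      simp
      omega) hS
    have h2 : ((N * N : ℕ) : ℝ) ≤ t := by exact_mod_cast h1
    have h3 := Nat.floor_le (show 0 ≤ C * (B + Nat.log 2 N + 1 : ℝ) ^ c * (N : ℝ) ^ τ by positivity)
    rw [Nat.cast_add]
    push_cast at h2 ⊢
    linarith

end Final

theorem mainTheorem6 (α : ℝ) (hα₀ : 0 < α) (hα₁ : α < 1)
    (τ : ℝ) (hτ : matMulExponent < τ ∨ MultipliesMatricesInTime τ) :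
    ∃ p : RAM.Prog, ApproximatesDOLA p (1 + 1 / (1 - α))
      (fun n => (2 : ℝ) ^ (τ * n / 3) + (2 : ℝ) ^ ((1 - α / 2) * n)) := by
  obtain ⟨p, C, c, hp⟩ := (hτ.elim multipliesMatrices_of_lt id).exists_multiplies
  obtain ⟨num, den, n₀, K, -, hpar⟩ := exists_parameters hα₀ hα₁
  obtain ⟨w, hw⟩ : ∃ w, w = (arrangementLayout K).wt (algorithm p num den n₀ K) := ⟨_, rfl⟩
  -- The first summand collects the constants of the matrix multiplication, the second those of the
  -- dynamic programs.
  set M := C * (K + 10) ^ c * 2 ^ ⌈|τ|⌉₊ + 2 ^ (n₀ + 1) with hM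
  refine ⟨(arrangementLayout K).wrap (algorithm p num den n₀ K),
    70 * (K + 9) ^ w * M * 2 ^ (K + 3 + 5 * w + 5 * c), K + 3 + 5 * w + 5 * c, fun n G _ => ?_⟩
  obtain ⟨f, hf⟩ : ∃ f, f = if n < n₀ then 0 else num * n / den := ⟨_, rfl⟩
  obtain ⟨B, hB⟩ : ∃ B, B = (K + 8) * (n + 2) ^ 5 := ⟨_, rfl⟩
  obtain ⟨-, hfe, hwin⟩ := hpar n f hf
  have hρ : 0 ≤ (1 + 1 / (1 - α)) * optArrangementCost G := by
    have : 0 < 1 - α := by linarith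
    positivity
  -- Costs are integers, so `b` is the floor of the allowed value. The bounds on `k` also give `2 *
  -- f ≤ n`.
  obtain ⟨k, hk1, hk2, hk3⟩ := hwin G _ (Nat.lt_floor_add_one _)
  have hm5 : n + 2 ≤ (n + 2) ^ 5 := Nat.le_self_pow (by omega) _
  have hB1 : 8 * (n + 2) ^ 5 + K * (n + 2) ^ 5 = B := by rw [hB]; ring
  obtain ⟨μ, hμ, hle⟩ := hp (2 ^ ((n + 2) / 3)) B Nat.one_le_two_pow (by omega)
  obtain ⟨t, S, E, ht, π, hS, hπ⟩ := exec_algorithm (num := num) G hB hf (by omega) rfl hμ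
  refine ⟨t, S, E, ?_, π, hS, ?_⟩
  · rw [← hw] at ht
    set X := 2 ^ ((n + 2) / 3) * 2 ^ ((n + 2) / 3) + μ with hX
    rw [Nat.log_pow (by omega)] at hle
    have hτ0 : 0 < (2 : ℝ) ^ (τ * n / 3) := by positivity
    have hα0 : 0 < (2 : ℝ) ^ ((1 - α / 2) * n) := by positivity
    set T₁ := (2 : ℝ) ^ (τ * n / 3)
    set T₂ := (2 : ℝ) ^ ((1 - α / 2) * n)
    have h1 : (B + ((n + 2) / 3 : ℕ) + 1 : ℝ) ≤ (K + 10) * (n + 2) ^ 5 := by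
      have : B + (n + 2) / 3 + 1 ≤ (K + 10) * (n + 2) ^ 5 := by
        have : (K + 10) * (n + 2) ^ 5 = B + 2 * (n + 2) ^ 5 := by rw [hB]; ring
        omega
      exact_mod_cast this
    have h2 : (X : ℝ) ≤ C * ((K + 10) * (n + 2) ^ 5) ^ c * ((2 ^ ⌈|τ|⌉₊ : ℕ) * T₁) := by
      refine hle.trans (mul_le_mul (mul_le_mul_of_nonneg_left
        (pow_le_pow_left₀ (by positivity) h1 c) (by positivity)) (pow_third_le τ n) (by positivity)
        (by positivity))
    have h3 : ((X + 2 ^ (n - f) : ℕ) : ℝ) ≤ M * (n + 2) ^ (5 * c) * (T₁ + T₂) := by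
      have h4 : (1 : ℝ) ≤ (n + 2) ^ (5 * c) := one_le_pow₀ (by linarith [Nat.cast_nonneg (α := ℝ) n])
      have h5 : 2 ^ (n₀ + 1) * T₂ ≤ 2 ^ (n₀ + 1) * T₂ * (n + 2) ^ (5 * c) :=
        le_mul_of_one_le_right (by positivity) h4
      have h6 : C * ((K + 10) * (n + 2) ^ 5) ^ c * ((2 ^ ⌈|τ|⌉₊ : ℕ) * T₁) =
          C * (K + 10) ^ c * 2 ^ ⌈|τ|⌉₊ * (n + 2) ^ (5 * c) * T₁ := by
        rw [mul_pow, ← pow_mul]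
        push_cast
        ring
      have h7 : 0 ≤ C * (K + 10 : ℝ) ^ c * 2 ^ ⌈|τ|⌉₊ * (n + 2) ^ (5 * c) * T₂ := by positivity
      have h8 : 0 ≤ (2 : ℝ) ^ (n₀ + 1) * (n + 2) ^ (5 * c) * T₁ := by positivity
      rw [h6] at h2
      rw [hM]
      push_cast
      linarith
    have h9 : (B + 2 : ℝ) ≤ (K + 9) * (n + 2) ^ 5 := by
      have : B + 2 ≤ (K + 9) * (n + 2) ^ 5 := by
        have : (K + 9) * (n + 2) ^ 5 = B + (n + 2) ^ 5 := by rw [hB]; ring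
        omega
      exact_mod_cast this
    have h10 : (t : ℝ) ≤ 70 * (n + 2) ^ (K + 3) * (X + 2 ^ (n - f) : ℕ) * (B + 2) ^ w := by
      exact_mod_cast ht
    -- Passing from `n + 2` to `n + 1` uses n + 2 ≤ 2(n + 1) and explains the power of 2 in the
    -- constant.
    have h11 : (n + 2 : ℝ) ^ (K + 3 + 5 * w + 5 * c) ≤
        2 ^ (K + 3 + 5 * w + 5 * c) * (n + 1) ^ (K + 3 + 5 * w + 5 * c) := by
      rw [← mul_pow]
      exact pow_le_pow_left₀ (by positivity) (by linarith [Nat.cast_nonneg (α := ℝ) n]) _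
    calc (t : ℝ) ≤ 70 * (n + 2) ^ (K + 3) * (M * (n + 2) ^ (5 * c) * (T₁ + T₂)) *
          ((K + 9) * (n + 2) ^ 5) ^ w := h10.trans (mul_le_mul
            (mul_le_mul_of_nonneg_left h3 (by positivity))
            (pow_le_pow_left₀ (by positivity) h9 w) (by positivity) (by positivity))
      _ = 70 * (K + 9) ^ w * M * (n + 2) ^ (K + 3 + 5 * w + 5 * c) * (T₁ + T₂) := by
        rw [mul_pow, ← pow_mul, pow_add _ (K + 3 + 5 * w), pow_add _ (K + 3)]
        ring
      _ ≤ 70 * (K + 9) ^ w * M * (2 ^ (K + 3 + 5 * w + 5 * c) *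
          (n + 1) ^ (K + 3 + 5 * w + 5 * c)) * (T₁ + T₂) :=
        mul_le_mul_of_nonneg_right (mul_le_mul_of_nonneg_left h11 (by positivity)) (by positivity)
      _ = _ := by
        push_cast
        ring
  · exact (Nat.cast_le.2 (hπ k _ hk1 hk2 hk3)).trans (Nat.floor_le hρ)
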